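/- Let $l/k$ be a finite separable field extension, $L/k$ a finite Galois extension containing $l$, $G=\mathrm{Gal}(L/k)$, and $H\subseteq G$ the subgroup with $L^H=l$. For a dg $l$-algebra $A$ put $A_L:=A\otimes_l L$, and for $\sigma\in G$ let ${}^{\sigma}A_L$ be the dg $L$-algebra obtained from $A_L$ by restriction of scalars along $\sigma^{-1}\colon L\to L$; up to canonical isomorphism it depends only on the coset $\sigma H$. The group $G$ acts skew-linearly on the dg $L$-algebra $\bigotimes_{\sigma\in G/H}{}^{\sigma}A_L$ (tensor product over $L$) by permutation of the tensor factors, $\rho(\otimes_\sigma v_\sigma)=\pm\otimes_\sigma v_{\rho^{-1}\sigma}$ with the Koszul sign, and the noncommutative Weil restriction of $A$ is the dg $k$-algebra of invariants $$\mathcal R^{\mathrm{NC}}_{l/k}(A):=\Bigl(\bigotimes_{\sigma\in G/H}{}^{\sigma}A_L\Bigr)^{G}.$$ A dg algebra $B$ over a field $F$ is called smooth if $B$, regarded as a dg $B$-$B$-bimodule, is a compact object of the derived category $\mathcal D(B^{\mathrm{op}}\otimes_F B)$ of dg $B$-$B$-bimodules, and proper if $\sum_i\dim_F H^i(B)<\infty$.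 Theorem. Let $A$ be a dg $l$-algebra. If $A$ is smooth, then the dg $k$-algebra $\mathcal R^{\mathrm{NC}}_{l/k}(A)$ is smooth. If $A$ is proper, then $\mathcal R^{\mathrm{NC}}_{l/k}(A)$ is proper. -/

import Mathlib

open CategoryTheory Limits TensorProduct

universe u w

set_option linter.unusedSectionVars false

namespace NCWeil

section Graded

variable {K M N Γ : Type*} [CommRing K] [AddCommGroup M] [Module K M] [AddCommGroup N] [Module K N]
  [DecidableEq Γ] {gr : Γ → Submodule K M}

/-- The linear map out of an internally graded module given by its restrictions to the pieces. -/
noncomputable def gradedLift (h : DirectSum.IsInternal gr) (φ : ∀ g, gr g →ₗ[K] N) : M →ₗ[K] N :=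
  DirectSum.toModule K Γ N φ ∘ₗ
    (LinearEquiv.ofBijective (DirectSum.coeLinearMap gr)
      (show Function.Bijective (DirectSum.coeLinearMap gr) from h)).symm.toLinearMap

theorem gradedLift_of_mem (h : DirectSum.IsInternal gr) (φ : ∀ g, gr g →ₗ[K] N) {g : Γ} {x : M}
    (hx : x ∈ gr g) : gradedLift h φ x = φ g ⟨x, hx⟩ := by
  have h' : Function.Bijective (DirectSum.coeLinearMap gr) := h
  have : (LinearEquiv.ofBijective (DirectSum.coeLinearMap gr) h').symm x
      = DirectSum.lof K Γ (fun g => gr g) g ⟨x, hx⟩ := by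
    rw [LinearEquiv.symm_apply_eq, LinearEquiv.ofBijective_apply, DirectSum.coeLinearMap_lof]
  change DirectSum.toModule K Γ N φ
    ((LinearEquiv.ofBijective (DirectSum.coeLinearMap gr) h').symm x) = _
  rw [this, DirectSum.toModule_lof]

/-- The projection onto a graded piece, as an endomorphism of the whole module. -/
noncomputable def gproj (h : DirectSum.IsInternal gr) (g : Γ) : M →ₗ[K] M :=
  gradedLift h fun g' => if g' = g then (gr g').subtype else 0

theorem gproj_of_mem (h : DirectSum.IsInternal gr) {g : Γ} {x : M} (hx : x ∈ gr g) :
    gproj h g x = x := by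
  simp [gproj, gradedLift_of_mem h _ hx]

theorem gproj_of_mem_ne (h : DirectSum.IsInternal gr) {g g' : Γ} {x : M} (hx : x ∈ gr g')
    (hg : g' ≠ g) : gproj h g x = 0 := by
  simp [gproj, gradedLift_of_mem h _ hx, hg]

/-- The endomorphism acting on the piece of degree `g` by the sign `s g`. -/
noncomputable def signOp (h : DirectSum.IsInternal gr) (s : Γ → ℤˣ) : M →ₗ[K] M :=
  gradedLift h fun g => s g • (gr g).subtype

theorem signOp_of_mem (h : DirectSum.IsInternal gr) (s : Γ → ℤˣ) {g : Γ} {x : M} (hx : x ∈ gr g) :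
    signOp h s x = s g • x := by
  simp [signOp, gradedLift_of_mem h _ hx]

theorem graded_induction (h : DirectSum.IsInternal gr) {P : M → Prop} (x : M) (h0 : P 0)
    (hm : ∀ g, ∀ x ∈ gr g, P x) (ha : ∀ x y, P x → P y → P (x + y)) : P x := by
  have hx : x ∈ ⨆ g, gr g := by rw [h.submodule_iSup_eq_top]; trivial
  exact Submodule.iSup_induction gr (motive := P) hx hm h0 ha

theorem gproj_mem (h : DirectSum.IsInternal gr) (g : Γ) (x : M) : gproj h g x ∈ gr g := by
  induction x using graded_induction h with
  | h0 => simp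
  | hm g' x hx =>
    by_cases e : g' = g
    · subst e; rwa [gproj_of_mem h hx]
    · rw [gproj_of_mem_ne h hx e]; exact zero_mem _
  | ha x y hx hy => rw [map_add]; exact add_mem hx hy

theorem mem_iSup_gproj (h : DirectSum.IsInternal gr) (x : M) :
    ∃ s : Finset Γ, x = ∑ g ∈ s, gproj h g x := by
  have hz : ∀ x : M, ∃ s : Finset Γ, ∀ g ∉ s, gproj h g x = 0 := by
    intro x
    induction x using graded_induction h with
    | h0 => exact ⟨∅, by simp⟩
    | hm g' x hx =>
      exact ⟨{g'}, fun g hg => gproj_of_mem_ne h hx (by simpa [eq_comm] using hg)⟩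
    | ha x y hx hy =>
      obtain ⟨s, hs⟩ := hx
      obtain ⟨t, ht⟩ := hy
      refine ⟨s ∪ t, fun g hg => ?_⟩
      simp only [Finset.mem_union, not_or] at hg
      simp [hs g hg.1, ht g hg.2]
  have hS : ∀ x : M, ∀ s : Finset Γ, (∀ g ∉ s, gproj h g x = 0) → x = ∑ g ∈ s, gproj h g x := by
    intro x
    induction x using graded_induction h with
    | h0 => simp
    | hm g' x hx =>
      intro s hs
      by_cases e : g' ∈ s
      · rw [Finset.sum_eq_single g' (fun g _ hg => gproj_of_mem_ne h hx hg.symm)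
          (fun hg => absurd e hg), gproj_of_mem h hx]
      · have : x = 0 := by rw [← gproj_of_mem h hx]; exact hs _ e
        simp [this]
    | ha x y hx hy =>
      intro s hs
      obtain ⟨s1, h1⟩ := hz x
      obtain ⟨s2, h2⟩ := hz y
      have hx' := hx (s ∪ s1) (fun g hg => h1 g (fun hh => hg (by simp [hh])))
      have hy' := hy (s ∪ s2) (fun g hg => h2 g (fun hh => hg (by simp [hh])))
      have hx'' := hx (s ∪ s1 ∪ s2) (fun g hg => h1 g (fun hh => hg (by simp [hh])))
      have hy'' := hy (s ∪ s1 ∪ s2) (fun g hg => h2 g (fun hh => hg (by simp [hh])))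
      have : ∑ g ∈ s, gproj h g (x + y) = ∑ g ∈ s ∪ s1 ∪ s2, gproj h g (x + y) := by
        apply Finset.sum_subset
        · intro g hg; simp [hg]
        · intro g _ hg; exact hs g hg
      rw [this]
      simp only [map_add, Finset.sum_add_distrib]
      rw [← hx'', ← hy'']
  obtain ⟨s, hs⟩ := hz x
  exact ⟨s, hS x s hs⟩

/-- A criterion for a family of submodules to be a grading. -/
theorem isInternal_of_proj (gr : Γ → Submodule K M) (P : Γ → M →ₗ[K] M)
    (h1 : ∀ g, ∀ x ∈ gr g, P g x = x) (h2 : ∀ g g', g' ≠ g → ∀ x ∈ gr g', P g x = 0)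
    (htop : ⨆ g, gr g = ⊤) : DirectSum.IsInternal gr := by
  refine DirectSum.isInternal_submodule_of_iSupIndep_of_iSup_eq_top ?_ htop
  intro g
  rw [Submodule.disjoint_def]
  intro x hx hx'
  have hle : (⨆ g', ⨆ (_ : g' ≠ g), gr g') ≤ LinearMap.ker (P g) :=
    iSup₂_le fun g' hg x hx => h2 g g' hg x hx
  rw [← h1 g x hx]
  exact hle hx'

end Graded

/-- A dg algebra over the field `k`: a `k`-algebra with a grading `A = ⨁ₙ Aⁿ` and a differential of
degree `1` which satisfies the graded Leibniz rule. -/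
structure DGAlgebra (k : Type u) [Field k] where
  /-- the total space `⨁ₙ Aⁿ` -/
  carrier : Type u
  [ring : Ring carrier]
  [algebra : Algebra k carrier]
  /-- the homogeneous elements of degree `n` -/
  gr : ℤ → Submodule k carrier
  isInternal : DirectSum.IsInternal gr
  one_mem : (1 : carrier) ∈ gr 0
  mul_mem : ∀ {m n : ℤ} {a b : carrier}, a ∈ gr m → b ∈ gr n → a * b ∈ gr (m + n)
  /-- the differential -/
  d : carrier →ₗ[k] carrier
  d_mem : ∀ {n : ℤ} {a : carrier}, a ∈ gr n → d a ∈ gr (n + 1)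
  d_d : ∀ a, d (d a) = 0
  leibniz : ∀ {m : ℤ} {a : carrier} (b : carrier), a ∈ gr m →
    d (a * b) = d a * b + m.negOnePow • (a * d b)

namespace DGAlgebra

instance (k : Type u) [Field k] : CoeSort (DGAlgebra k) (Type u) := ⟨carrier⟩

attribute [instance] DGAlgebra.ring DGAlgebra.algebra

variable {k : Type u} [Field k]

/-- Morphisms of dg algebras which are semilinear with respect to `ρ`. -/
structure SemiHom {k K : Type u} [Field k] [Field K] (ρ : k →+* K) (A : DGAlgebra k)
    (B : DGAlgebra K) where
  toRingHom : A.carrier →+* B.carrier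
  map_smul : ∀ (c : k) (a : A.carrier), toRingHom (c • a) = ρ c • toRingHom a
  map_gr : ∀ {n : ℤ} {a : A.carrier}, a ∈ A.gr n → toRingHom a ∈ B.gr n
  map_d : ∀ a : A.carrier, toRingHom (A.d a) = B.d (toRingHom a)

/-- Morphisms of dg `k`-algebras. -/
abbrev Hom (A B : DGAlgebra k) := SemiHom (RingHom.id k) A B

/-- Restriction of scalars of a dg algebra along a homomorphism of fields. -/
def restrictScalars {K : Type u} [Field K] (f : k →+* K) (A : DGAlgebra K) : DGAlgebra k :=
  letI : Algebra k A.carrier := Algebra.compHom A.carrier f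
  { carrier := A.carrier
    ring := A.ring
    algebra := Algebra.compHom A.carrier f
    gr := fun n =>
      { carrier := A.gr n
        add_mem' := fun ha hb => add_mem ha hb
        zero_mem' := zero_mem _
        smul_mem' := fun c _ ha => (A.gr n).smul_mem (f c) ha }
    isInternal := A.isInternal
    one_mem := A.one_mem
    mul_mem := fun ha hb => A.mul_mem ha hb
    d :=
      { toFun := A.d
        map_add' := fun a b => map_add A.d a b
        map_smul' := fun c a => map_smul A.d (f c) a }
    d_mem := fun ha => A.d_mem ha
    d_d := A.d_d
    leibniz := fun b ha => A.leibniz b ha }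

/-- The extension of scalars `K ⊗ₖ A` of a dg algebra; `K` sits in degree `0`. -/
noncomputable def baseChange (K : Type u) [Field K] [Algebra k K] (A : DGAlgebra k) :
    DGAlgebra K where
  carrier := K ⊗[k] A.carrier
  gr n := (A.gr n).baseChange K
  isInternal := A.isInternal.baseChange
  one_mem := Submodule.tmul_mem_baseChange_of_mem _ A.one_mem
  mul_mem {m n a b} ha hb := by
    rw [Submodule.baseChange_eq_span] at ha
    induction ha using Submodule.span_induction with
    | zero => simp
    | add x y _ _ hx hy => rw [add_mul]; exact add_mem hx hy
    | smul c x _ hx => rw [smul_mul_assoc]; exact Submodule.smul_mem _ _ hx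
    | mem x hx =>
      obtain ⟨x, hx, rfl⟩ := hx
      rw [Submodule.baseChange_eq_span] at hb
      induction hb using Submodule.span_induction with
      | zero => simp
      | add x y _ _ hx hy => rw [mul_add]; exact add_mem hx hy
      | smul c x _ hx => rw [mul_smul_comm]; exact Submodule.smul_mem _ _ hx
      | mem y hy =>
        obtain ⟨y, hy, rfl⟩ := hy
        simpa using Submodule.tmul_mem_baseChange_of_mem _ (A.mul_mem hx hy)
  d := A.d.baseChange K
  d_mem {n a} ha := by
    rw [Submodule.baseChange_eq_span] at ha
    induction ha using Submodule.span_induction with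
    | zero => simp
    | add x y _ _ hx hy => rw [map_add]; exact add_mem hx hy
    | smul c x _ hx => rw [map_smul]; exact Submodule.smul_mem _ _ hx
    | mem x hx =>
      obtain ⟨x, hx, rfl⟩ := hx
      simpa using Submodule.tmul_mem_baseChange_of_mem _ (A.d_mem hx)
  d_d a := by
    induction a using TensorProduct.induction_on with
    | zero => simp
    | tmul c a => simp [A.d_d]
    | add x y hx hy => simp [hx, hy]
  leibniz {m a} b ha := by
    rw [Submodule.baseChange_eq_span] at ha
    induction ha using Submodule.span_induction with
    | zero => simp
    | add x y _ _ hx hy => simp only [add_mul, map_add, hx, hy, smul_add]; abel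
    | smul c x _ hx =>
      simp only [smul_mul_assoc, map_smul, hx, smul_add]
      rw [smul_comm c]
    | mem x hx =>
      obtain ⟨x, hx, rfl⟩ := hx
      induction b using TensorProduct.induction_on with
      | zero => simp
      | add x y hx hy => simp only [mul_add, map_add, hx, hy, smul_add]; abel
      | tmul c b =>
        rcases Int.units_eq_one_or m.negOnePow with h | h <;>
          simp [A.leibniz b hx, TensorProduct.tmul_add, TensorProduct.tmul_neg, h]

/-- The dg subalgebra of elements fixed by a family of dg endomorphisms. -/
def fixed (A : DGAlgebra k) {G : Type u} (act : G → Hom A A) : DGAlgebra k :=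
  let S : Subalgebra k A.carrier :=
    { carrier := {a | ∀ g, (act g).toRingHom a = a}
      mul_mem' := fun {a b} ha hb g => by rw [map_mul, ha g, hb g]
      add_mem' := fun {a b} ha hb g => by rw [map_add, ha g, hb g]
      algebraMap_mem' := fun c g => by
        rw [Algebra.algebraMap_eq_smul_one, (act g).map_smul, map_one, RingHom.id_apply] }
  have hproj : ∀ (n : ℤ) (a : A.carrier) (g : G),
      (act g).toRingHom (gproj A.isInternal n a) = gproj A.isInternal n ((act g).toRingHom a) := by
    intro n a g
    induction a using graded_induction A.isInternal with
    | h0 => simp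
    | hm m a ha =>
      have ha' : (act g).toRingHom a ∈ A.gr m := (act g).map_gr ha
      by_cases e : m = n
      · subst e; rw [gproj_of_mem _ ha, gproj_of_mem _ ha']
      · rw [gproj_of_mem_ne _ ha e, gproj_of_mem_ne _ ha' e, map_zero]
    | ha a b ha hb => simp only [map_add, ha, hb]
  have hd : ∀ a ∈ S, A.d a ∈ S := fun a ha g => by
    have := (act g).map_d a
    exact this.trans (congrArg A.d (ha g))
  have hS : ∀ a ∈ S, ∀ n, gproj A.isInternal n a ∈ S := fun a ha n g => by
    rw [hproj, ha g]
  { carrier := S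
    gr := fun n => (A.gr n).comap S.val.toLinearMap
    isInternal := by
      refine isInternal_of_proj _
        (fun n => ((gproj A.isInternal n).comp S.val.toLinearMap).codRestrict
          (Subalgebra.toSubmodule S) (fun a => hS a.1 a.2 n)) ?_ ?_ ?_
      · intro n x hx
        exact Subtype.ext (gproj_of_mem A.isInternal hx)
      · intro n m hm x hx
        exact Subtype.ext (gproj_of_mem_ne A.isInternal hx hm)
      · rw [eq_top_iff]
        rintro x -
        obtain ⟨s, hs⟩ := mem_iSup_gproj A.isInternal x.1
        have : x = ∑ n ∈ s, (⟨gproj A.isInternal n x.1, hS _ x.2 n⟩ : S) := by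
          apply Subtype.ext
          rw [AddSubmonoidClass.coe_finsetSum]
          exact hs
        rw [this]
        refine sum_mem fun n _ => Submodule.mem_iSup_of_mem n ?_
        exact gproj_mem A.isInternal n x.1
    one_mem := A.one_mem
    mul_mem := fun ha hb => A.mul_mem ha hb
    d := (A.d.comp S.val.toLinearMap).codRestrict (Subalgebra.toSubmodule S)
      (fun a => hd a.1 a.2)
    d_mem := fun ha => A.d_mem ha
    d_d := fun a => Subtype.ext (A.d_d a.1)
    leibniz := fun {m a} b ha => Subtype.ext (by
      have := A.leibniz b.1 ha
      rw [Units.smul_def] at this ⊢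
      exact this) }

end DGAlgebra

section Koszul

variable {K : Type u} [Field K] {ι : Type u} [Fintype ι] [LinearOrder ι]

/-- The Koszul sign of `(⊗ᵢ xᵢ) (⊗ᵢ yᵢ) = ± ⊗ᵢ xᵢ yᵢ` for `|xᵢ| = f i` and `|yᵢ| = g i`: every `xᵢ`
moves past all the `yⱼ` with `j < i`. -/
def mulSign (f g : ι → ℤ) : ℤˣ := (∑ i, ∑ j, if j < i then f i * g j else 0).negOnePow

/-- The Koszul sign of applying a differential to the `i`-th factor of `⊗ⱼ xⱼ`, for `|xⱼ| = f j`. -/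
def dSign (i : ι) (f : ι → ℤ) : ℤˣ := (∑ j, if j < i then f j else 0).negOnePow

/-- The Koszul sign of permuting the factors of `⊗ⱼ xⱼ` by `p`, for `|xⱼ| = f j`: the product of
`(-1)^(|xᵢ| |xⱼ|)` over all the pairs `i < j` whose order is reversed by `p`. -/
def permSign (p : Equiv.Perm ι) (f : ι → ℤ) : ℤˣ :=
  (∑ i, ∑ j, if i < j ∧ p j < p i then f i * f j else 0).negOnePow

theorem mulSign_add_left (f f' g : ι → ℤ) :
    mulSign (f + f') g = mulSign f g * mulSign f' g := by
  rw [mulSign, mulSign, mulSign, ← Int.negOnePow_add]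
  congr 1
  simp only [← Finset.sum_add_distrib]
  refine Finset.sum_congr rfl fun i _ => Finset.sum_congr rfl fun j _ => ?_
  split_ifs
  · simp [add_mul]
  · simp

theorem mulSign_add_right (f g g' : ι → ℤ) :
    mulSign f (g + g') = mulSign f g * mulSign f g' := by
  rw [mulSign, mulSign, mulSign, ← Int.negOnePow_add]
  congr 1
  simp only [← Finset.sum_add_distrib]
  refine Finset.sum_congr rfl fun i _ => Finset.sum_congr rfl fun j _ => ?_
  split_ifs
  · simp [mul_add]
  · simp

theorem mulSign_zero_left (g : ι → ℤ) : mulSign 0 g = 1 := by simp [mulSign]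

theorem mulSign_zero_right (f : ι → ℤ) : mulSign f 0 = 1 := by simp [mulSign]

theorem dSign_add (i : ι) (f g : ι → ℤ) : dSign i (f + g) = dSign i f * dSign i g := by
  rw [dSign, dSign, dSign, ← Int.negOnePow_add, ← Finset.sum_add_distrib]
  congr 1
  refine Finset.sum_congr rfl fun j _ => ?_
  split_ifs <;> simp

theorem mulSign_single_left (i : ι) (g : ι → ℤ) : mulSign (Pi.single i 1) g = dSign i g := by
  rw [mulSign, dSign]
  congr 1
  rw [Finset.sum_eq_single i]
  · simp
  · intro j _ hj
    simp [hj]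
  · simp

theorem mulSign_single_right (i : ι) (f : ι → ℤ) :
    (∑ j, f j).negOnePow * mulSign f (Pi.single i 1) = dSign i f * (f i).negOnePow := by
  rw [mulSign, dSign, ← Int.negOnePow_add, ← Int.negOnePow_add, Int.negOnePow_eq_iff]
  have h : (∑ j, f j) = (∑ j, if j < i then f j else 0) + f i + ∑ j, if i < j then f j else 0 := by
    have : f i = ∑ j, if j = i then f j else 0 := by simp
    rw [this, ← Finset.sum_add_distrib, ← Finset.sum_add_distrib]
    refine Finset.sum_congr rfl fun j _ => ?_
    rcases lt_trichotomy j i with h | h | h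
    · simp [h, h.ne, h.not_gt]
    · simp [h]
    · simp [h, h.ne', h.not_gt]
  have h' : (∑ a, ∑ j, if j < a then f a * (Pi.single i 1 : ι → ℤ) j else 0)
      = ∑ j, if i < j then f j else 0 := by
    refine Finset.sum_congr rfl fun a _ => ?_
    rw [Finset.sum_eq_single i]
    · simp
    · intro j _ hj
      simp [hj]
    · simp
  rw [h, h']
  exact ⟨∑ j, if i < j then f j else 0, by ring⟩

theorem dSign_single_of_lt {i j : ι} (h : j < i) : dSign i (Pi.single j 1) = -1 := by
  rw [dSign, Finset.sum_eq_single j]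
  · simp [h]
  · intro a _ ha
    simp [ha]
  · simp

theorem dSign_single_of_not_lt {i j : ι} (h : ¬ j < i) : dSign i (Pi.single j 1) = 1 := by
  rw [dSign, Finset.sum_eq_zero]
  · simp
  · intro a _
    by_cases ha : a = j
    · subst ha; simp [h]
    · simp [ha]

theorem permSign_add (p : Equiv.Perm ι) (f g : ι → ℤ) :
    permSign p (f + g) * mulSign f g =
      mulSign (fun i => f (p.symm i)) (fun i => g (p.symm i)) * (permSign p f * permSign p g) := by
  have e : mulSign (fun i => f (p.symm i)) (fun i => g (p.symm i)) =
      (∑ i, ∑ j, if p j < p i then f i * g j else 0).negOnePow := by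
    rw [mulSign, ← Equiv.sum_comp p]
    congr 1
    refine Finset.sum_congr rfl fun i _ => ?_
    rw [← Equiv.sum_comp p]
    simp
  rw [e, permSign, permSign, permSign, mulSign]
  simp only [← Int.negOnePow_add]
  rw [Int.negOnePow_eq_iff]
  have h1 : (∑ i, ∑ j, if i < j ∧ p j < p i then (f + g) i * (f + g) j else 0) =
      (∑ i, ∑ j, if i < j ∧ p j < p i then f i * f j else 0) +
      (∑ i, ∑ j, if i < j ∧ p j < p i then g i * g j else 0) +
      (∑ i, ∑ j, if i < j ∧ p j < p i then f i * g j else 0) +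
      (∑ i, ∑ j, if j < i ∧ p i < p j then f i * g j else 0) := by
    rw [Finset.sum_comm (f := fun i j => if j < i ∧ p i < p j then f i * g j else 0)]
    simp only [← Finset.sum_add_distrib]
    refine Finset.sum_congr rfl fun i _ => Finset.sum_congr rfl fun j _ => ?_
    split_ifs
    · simp only [Pi.add_apply]; ring
    · simp
  have h2 : (∑ i, ∑ j, if j < i then f i * g j else 0) +
      (∑ i, ∑ j, if i < j ∧ p j < p i then f i * g j else 0) =
      (∑ i, ∑ j, if p j < p i then f i * g j else 0) +
      (∑ i, ∑ j, if j < i ∧ p i < p j then f i * g j else 0) := by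
    simp only [← Finset.sum_add_distrib]
    refine Finset.sum_congr rfl fun i _ => Finset.sum_congr rfl fun j _ => ?_
    rcases lt_trichotomy j i with h | h | h
    · rcases lt_or_gt_of_ne (p.injective.ne h.ne) with h' | h'
      · simp [h, h', h.not_gt, h'.not_gt]
      · simp [h, h', h.not_gt, h'.not_gt]
    · simp [h]
    · rcases lt_or_gt_of_ne (p.injective.ne h.ne) with h' | h'
      · simp [h, h', h.not_gt, h'.not_gt]
      · simp [h, h', h.not_gt, h'.not_gt]
  exact ⟨∑ i, ∑ j, if j < i ∧ p i < p j then f i * g j else 0, by linear_combination h1 + h2⟩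

theorem permSign_single_add (p : Equiv.Perm ι) (i : ι) (f : ι → ℤ) :
    permSign p (f + Pi.single i 1) * dSign i f =
      dSign (p i) (fun j => f (p.symm j)) * permSign p f := by
  have h := permSign_add p (Pi.single i 1) f
  have e : (fun j => (Pi.single i 1 : ι → ℤ) (p.symm j)) = Pi.single (p i) 1 := by
    funext j
    simp only [Pi.single_apply, Equiv.symm_apply_eq]
  have e' : permSign p (Pi.single i 1) = 1 := by
    rw [permSign, Finset.sum_eq_zero, Int.negOnePow_zero]
    intro a _
    refine Finset.sum_eq_zero fun b _ => ?_
    split_ifs with hab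
    · by_cases ha : a = i
      · have : b ≠ i := by rintro rfl; exact hab.1.ne ha
        simp [this]
      · simp [ha]
    · rfl
  rw [e, mulSign_single_left, mulSign_single_left, e', one_mul, add_comm] at h
  exact h

variable (B : ι → DGAlgebra K)

/-- The underlying space of the tensor product over `K` of a finite family of dg `K`-algebras. -/
def KTensor : Type u := ⨂[K] i, (B i).carrier

namespace KTensor

noncomputable instance : AddCommGroup (KTensor B) :=
  inferInstanceAs (AddCommGroup (⨂[K] i, (B i).carrier))

noncomputable instance : Module K (KTensor B) :=
  inferInstanceAs (Module K (⨂[K] i, (B i).carrier))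

/-- The pure tensor `⊗ᵢ xᵢ`. -/
noncomputable def pure (x : ∀ i, (B i).carrier) : KTensor B := PiTensorProduct.tprod K x

/-- The part of multidegree `f`. -/
noncomputable def multiGr (f : ι → ℤ) : Submodule K (KTensor B) :=
  Submodule.span K {t | ∃ x : ∀ i, (B i).carrier, (∀ i, x i ∈ (B i).gr (f i)) ∧ t = pure B x}

/-- The part of total degree `n`. -/
noncomputable def gr (n : ℤ) : Submodule K (KTensor B) :=
  Submodule.span K {t | ∃ (f : ι → ℤ) (x : ∀ i, (B i).carrier),
    (∀ i, x i ∈ (B i).gr (f i)) ∧ ∑ i, f i = n ∧ t = pure B x}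

variable {B}

theorem pure_mem_multiGr {f : ι → ℤ} {x : ∀ i, (B i).carrier} (hx : ∀ i, x i ∈ (B i).gr (f i)) :
    pure B x ∈ multiGr B f := Submodule.subset_span ⟨x, hx, rfl⟩

theorem pure_mem_gr {f : ι → ℤ} {x : ∀ i, (B i).carrier} (hx : ∀ i, x i ∈ (B i).gr (f i)) :
    pure B x ∈ gr B (∑ i, f i) := Submodule.subset_span ⟨f, x, hx, rfl, rfl⟩

theorem pure_update_add (x : ∀ i, (B i).carrier) (i : ι) (a b : (B i).carrier) :
    pure B (Function.update x i (a + b)) =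
      pure B (Function.update x i a) + pure B (Function.update x i b) :=
  (PiTensorProduct.tprod K).map_update_add x i a b

theorem pure_update_units_smul (x : ∀ i, (B i).carrier) (i : ι) (c : ℤˣ) (a : (B i).carrier) :
    pure B (Function.update x i (c • a)) = c • pure B (Function.update x i a) := by
  rcases Int.units_eq_one_or c with rfl | rfl
  · simp
  · simp only [Units.neg_smul, one_smul]
    exact (PiTensorProduct.tprod K).map_update_neg x i a

/-- A linear map between the tensor products, given by linear maps of the factors. -/
noncomputable def mapₗ (φ : ∀ i, (B i).carrier →ₗ[K] (B i).carrier) : KTensor B →ₗ[K] KTensor B :=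
  PiTensorProduct.map φ

theorem mapₗ_pure (φ : ∀ i, (B i).carrier →ₗ[K] (B i).carrier) (x : ∀ i, (B i).carrier) :
    mapₗ φ (pure B x) = pure B (fun i => φ i (x i)) :=
  PiTensorProduct.map_tprod _ _

theorem iSup_multiGr : ⨆ f, multiGr B f = ⊤ := by
  rw [eq_top_iff]
  rintro t -
  induction t using PiTensorProduct.induction_on with
  | add x y hx hy => exact add_mem hx hy
  | smul_tprod r x =>
    refine Submodule.smul_mem _ _ ?_
    choose s hs using fun i => mem_iSup_gproj (B i).isInternal (x i)
    have : x = fun i => ∑ n ∈ s i, gproj (B i).isInternal n (x i) := funext hs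
    rw [this]
    have e := (PiTensorProduct.tprod K (s := fun i => (B i).carrier)).map_sum_finset
      (fun i n => gproj (B i).isInternal n (x i)) s
    rw [e]
    refine sum_mem fun f _ => Submodule.mem_iSup_of_mem f ?_
    exact pure_mem_multiGr fun i => gproj_mem _ _ _

theorem isInternal_multiGr : DirectSum.IsInternal (multiGr B) := by
  refine isInternal_of_proj _ (fun f => mapₗ fun i => gproj (B i).isInternal (f i)) ?_ ?_
    iSup_multiGr
  · intro f x hx
    induction hx using Submodule.span_induction with
    | zero => simp
    | add x y _ _ hx hy => rw [map_add, hx, hy]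
    | smul c x _ hx => rw [map_smul, hx]
    | mem x hx =>
      obtain ⟨x, hx, rfl⟩ := hx
      rw [mapₗ_pure]
      congr 1
      funext i
      exact gproj_of_mem _ (hx i)
  · intro f g hg x hx
    induction hx using Submodule.span_induction with
    | zero => simp
    | add x y _ _ hx hy => rw [map_add, hx, hy, add_zero]
    | smul c x _ hx => rw [map_smul, hx, smul_zero]
    | mem x hx =>
      obtain ⟨x, hx, rfl⟩ := hx
      rw [mapₗ_pure]
      obtain ⟨i, hi⟩ := Function.ne_iff.mp hg
      exact (PiTensorProduct.tprod K).map_coord_zero i (gproj_of_mem_ne _ (hx i) hi)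

theorem hom_induction {P : KTensor B → Prop} (t : KTensor B)
    (hp : ∀ (f : ι → ℤ) (x : ∀ i, (B i).carrier), (∀ i, x i ∈ (B i).gr (f i)) → P (pure B x))
    (ha : ∀ x y, P x → P y → P (x + y)) (hs : ∀ (c : K) x, P x → P (c • x)) : P t := by
  have h0 : P 0 := by
    have := hs 0 _ (hp 0 (fun _ => 0) (fun _ => zero_mem _))
    simpa using this
  refine graded_induction isInternal_multiGr t h0 (fun f x hx => ?_) ha
  induction hx using Submodule.span_induction with
  | zero => exact h0
  | add x y _ _ hx hy => exact ha _ _ hx hy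
  | smul c x _ hx => exact hs _ _ hx
  | mem x hx =>
    obtain ⟨x, hx, rfl⟩ := hx
    exact hp f x hx

/-- A linear map which multiplies every part of multidegree `f` by the sign `s f`. -/
noncomputable def sOp (s : (ι → ℤ) → ℤˣ) : KTensor B →ₗ[K] KTensor B :=
  signOp isInternal_multiGr s

theorem sOp_pure (s : (ι → ℤ) → ℤˣ) {f : ι → ℤ} {x : ∀ i, (B i).carrier}
    (hx : ∀ i, x i ∈ (B i).gr (f i)) : sOp s (pure B x) = s f • pure B x :=
  signOp_of_mem _ _ (pure_mem_multiGr hx)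

theorem isInternal_gr : DirectSum.IsInternal (gr B) := by
  refine isInternal_of_proj _ (fun n => gradedLift isInternal_multiGr fun f =>
    if ∑ i, f i = n then (multiGr B f).subtype else 0) ?_ ?_ ?_
  · intro n x hx
    induction hx using Submodule.span_induction with
    | zero => simp
    | add x y _ _ hx hy => rw [map_add, hx, hy]
    | smul c x _ hx => rw [map_smul, hx]
    | mem x hx =>
      obtain ⟨f, x, hx, hf, rfl⟩ := hx
      rw [gradedLift_of_mem _ _ (pure_mem_multiGr hx), if_pos hf]
      rfl
  · intro n m hm x hx
    induction hx using Submodule.span_induction with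
    | zero => simp
    | add x y _ _ hx hy => rw [map_add, hx, hy, add_zero]
    | smul c x _ hx => rw [map_smul, hx, smul_zero]
    | mem x hx =>
      obtain ⟨f, x, hx, hf, rfl⟩ := hx
      rw [gradedLift_of_mem _ _ (pure_mem_multiGr hx), if_neg (by rw [hf]; exact hm)]
      rfl
  · rw [eq_top_iff]
    rintro t -
    induction t using hom_induction with
    | hp f x hx => exact Submodule.mem_iSup_of_mem _ (pure_mem_gr hx)
    | ha x y hx hy => exact add_mem hx hy
    | hs c x hx => exact Submodule.smul_mem _ _ hx

/-- The factorwise multiplication `(⊗ᵢ xᵢ) (⊗ᵢ yᵢ) = ⊗ᵢ xᵢ yᵢ`, without signs. -/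
noncomputable def mul₀ : KTensor B →ₗ[K] KTensor B →ₗ[K] KTensor B := PiTensorProduct.mul

theorem mul₀_pure (x y : ∀ i, (B i).carrier) : mul₀ (pure B x) (pure B y) = pure B (x * y) :=
  PiTensorProduct.mul_tprod_tprod x y

/-- The multiplication of the tensor product, `(⊗ᵢ xᵢ) (⊗ᵢ yᵢ) = ± ⊗ᵢ xᵢ yᵢ` with the Koszul sign. -/
noncomputable def mulₗ : KTensor B →ₗ[K] KTensor B →ₗ[K] KTensor B :=
  gradedLift isInternal_multiGr fun f =>
    (mul₀.compl₂ (sOp (mulSign f))) ∘ₗ (multiGr B f).subtype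

theorem mulₗ_pure {f g : ι → ℤ} {x y : ∀ i, (B i).carrier} (hx : ∀ i, x i ∈ (B i).gr (f i))
    (hy : ∀ i, y i ∈ (B i).gr (g i)) :
    mulₗ (pure B x) (pure B y) = mulSign f g • pure B (x * y) := by
  rw [mulₗ, gradedLift_of_mem _ _ (pure_mem_multiGr hx)]
  simp only [LinearMap.comp_apply, Submodule.subtype_apply, LinearMap.compl₂_apply]
  rw [sOp_pure _ hy, Units.smul_def, map_zsmul, mul₀_pure, Units.smul_def]

theorem mulₗ_units_smul (c : ℤˣ) (x y : KTensor B) : mulₗ (c • x) y = c • mulₗ x y := by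
  rw [Units.smul_def, Units.smul_def, map_zsmul, LinearMap.smul_apply]

theorem mulₗ_smul_units (c : ℤˣ) (x y : KTensor B) : mulₗ x (c • y) = c • mulₗ x y := by
  rw [Units.smul_def, Units.smul_def, map_zsmul]

theorem map_units_smul {M : Type*} [AddCommGroup M] [Module K M] (F : KTensor B →ₗ[K] M)
    (c : ℤˣ) (x : KTensor B) : F (c • x) = c • F x := by
  rw [Units.smul_def, Units.smul_def, map_zsmul]

theorem mul_mem_gr' {f g : ι → ℤ} {x y : ∀ i, (B i).carrier} (hx : ∀ i, x i ∈ (B i).gr (f i))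
    (hy : ∀ i, y i ∈ (B i).gr (g i)) (i : ι) : (x * y) i ∈ (B i).gr ((f + g) i) :=
  (B i).mul_mem (hx i) (hy i)

theorem mulₗ_assoc (x y z : KTensor B) : mulₗ (mulₗ x y) z = mulₗ x (mulₗ y z) := by
  induction x using hom_induction with
  | ha x y hx hy => simp only [map_add, LinearMap.add_apply, hx, hy]
  | hs c x hx => simp only [map_smul, LinearMap.smul_apply, hx]
  | hp f x hx =>
    induction y using hom_induction with
    | ha x y hx hy => simp only [map_add, LinearMap.add_apply, hx, hy]
    | hs c x hx => simp only [map_smul, LinearMap.smul_apply, hx]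
    | hp g y hy =>
      induction z using hom_induction with
      | ha x y hx hy => simp only [map_add, hx, hy]
      | hs c x hx => simp only [map_smul, hx]
      | hp h z hz =>
        rw [mulₗ_pure hx hy, mulₗ_pure hy hz, mulₗ_units_smul, mulₗ_smul_units,
          mulₗ_pure (mul_mem_gr' hx hy) hz, mulₗ_pure hx (mul_mem_gr' hy hz), smul_smul, smul_smul,
          mulSign_add_left, mulSign_add_right, mul_assoc x y z]
        congr 1
        ac_rfl

theorem one_mem' (i : ι) : (1 : ∀ i, (B i).carrier) i ∈ (B i).gr ((0 : ι → ℤ) i) := (B i).one_mem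

theorem one_mulₗ (x : KTensor B) : mulₗ (pure B 1) x = x := by
  induction x using hom_induction with
  | ha x y hx hy => rw [map_add, hx, hy]
  | hs c x hx => rw [map_smul, hx]
  | hp f x hx => rw [mulₗ_pure one_mem' hx, mulSign_zero_left, one_smul, one_mul]

theorem mulₗ_one (x : KTensor B) : mulₗ x (pure B 1) = x := by
  induction x using hom_induction with
  | ha x y hx hy => rw [map_add, LinearMap.add_apply, hx, hy]
  | hs c x hx => rw [map_smul, LinearMap.smul_apply, hx]
  | hp f x hx => rw [mulₗ_pure hx one_mem', mulSign_zero_right, one_smul, mul_one]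

noncomputable instance : Ring (KTensor B) :=
  { (inferInstance : AddCommGroup (KTensor B)) with
    mul := fun x y => mulₗ x y
    one := pure B 1
    left_distrib := fun x y z => map_add (mulₗ x) y z
    right_distrib := fun x y z => by
      change mulₗ (x + y) z = mulₗ x z + mulₗ y z
      rw [map_add, LinearMap.add_apply]
    zero_mul := fun x => by
      change mulₗ 0 x = 0
      rw [map_zero, LinearMap.zero_apply]
    mul_zero := fun x => map_zero (mulₗ x)
    mul_assoc := mulₗ_assoc
    one_mul := one_mulₗ
    mul_one := mulₗ_one }

theorem mul_def (x y : KTensor B) : x * y = mulₗ x y := rfl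

theorem one_def : (1 : KTensor B) = pure B 1 := rfl

noncomputable instance : Algebra K (KTensor B) :=
  Algebra.ofModule (fun c x y => by rw [mul_def, mul_def, map_smul, LinearMap.smul_apply])
    (fun c x y => by rw [mul_def, mul_def, map_smul])

theorem pure_mul_pure {f g : ι → ℤ} {x y : ∀ i, (B i).carrier} (hx : ∀ i, x i ∈ (B i).gr (f i))
    (hy : ∀ i, y i ∈ (B i).gr (g i)) :
    pure B x * pure B y = mulSign f g • pure B (x * y) := mulₗ_pure hx hy

/-- The differential of the `i`-th factor, with its Koszul sign. -/
noncomputable def dAt (i : ι) : KTensor B →ₗ[K] KTensor B :=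
  mapₗ (Function.update (fun _ => LinearMap.id) i (B i).d) ∘ₗ sOp (dSign i)

theorem dAt_pure (i : ι) {f : ι → ℤ} {x : ∀ i, (B i).carrier} (hx : ∀ i, x i ∈ (B i).gr (f i)) :
    dAt i (pure B x) = dSign i f • pure B (Function.update x i ((B i).d (x i))) := by
  rw [dAt, LinearMap.comp_apply, sOp_pure _ hx, map_units_smul, mapₗ_pure]
  congr 2
  funext j
  by_cases h : j = i
  · subst h; simp
  · simp [h]

theorem update_d_mem (i : ι) {f : ι → ℤ} {x : ∀ i, (B i).carrier}
    (hx : ∀ i, x i ∈ (B i).gr (f i)) (j : ι) :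
    Function.update x i ((B i).d (x i)) j ∈ (B j).gr ((f + (Pi.single i 1 : ι → ℤ)) j) := by
  by_cases h : j = i
  · subst h; simpa using (B j).d_mem (hx j)
  · simpa [h] using hx j

theorem dAt_dAt (i : ι) (t : KTensor B) : dAt i (dAt i t) = 0 := by
  induction t using hom_induction with
  | ha x y hx hy => simp only [map_add, hx, hy, add_zero]
  | hs c x hx => simp only [map_smul, hx, smul_zero]
  | hp f x hx =>
    rw [dAt_pure i hx, map_units_smul, dAt_pure i (update_d_mem i hx)]
    have : pure B (Function.update (Function.update x i ((B i).d (x i))) i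
        ((B i).d (Function.update x i ((B i).d (x i)) i))) = 0 := by
      refine (PiTensorProduct.tprod K).map_coord_zero i ?_
      simp [(B i).d_d]
    rw [this, smul_zero, smul_zero]

theorem dAt_anticomm {i j : ι} (h : i < j) (t : KTensor B) :
    dAt i (dAt j t) + dAt j (dAt i t) = 0 := by
  induction t using hom_induction with
  | ha x y hx hy =>
    simp only [map_add]
    rw [add_add_add_comm, hx, hy, add_zero]
  | hs c x hx => simp only [map_smul]; rw [← smul_add, hx, smul_zero]
  | hp f x hx =>
    rw [dAt_pure i hx, dAt_pure j hx, map_units_smul, map_units_smul,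
      dAt_pure i (update_d_mem j hx), dAt_pure j (update_d_mem i hx), smul_smul, smul_smul,
      dSign_add, dSign_add, dSign_single_of_lt h, dSign_single_of_not_lt h.not_gt]
    rw [Function.update_of_ne h.ne, Function.update_of_ne h.ne', Function.update_comm h.ne]
    rw [mul_one, mul_neg, mul_one, mul_neg, Units.neg_smul, mul_comm (dSign i f), add_neg_cancel]

/-- The differential `d (⊗ⱼ xⱼ) = ∑ᵢ ± x₁ ⊗ ⋯ ⊗ d xᵢ ⊗ ⋯`, with the Koszul signs. -/
noncomputable def dₗ : KTensor B →ₗ[K] KTensor B := ∑ i, dAt i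

theorem dₗ_apply (t : KTensor B) : dₗ t = ∑ i, dAt i t := by
  rw [dₗ, LinearMap.sum_apply]

theorem dₗ_dₗ (t : KTensor B) : dₗ (dₗ t) = 0 := by
  simp only [dₗ_apply, map_sum]
  rw [← Finset.sum_product']
  refine Finset.sum_involution (fun p _ => (p.2, p.1)) ?_ ?_ (by simp) (by simp)
  · rintro ⟨i, j⟩ -
    rcases lt_trichotomy i j with h | h | h
    · rw [add_comm]; exact dAt_anticomm h t
    · subst h; simp only [dAt_dAt, add_zero]
    · exact dAt_anticomm h t
  · rintro ⟨i, j⟩ - hne h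
    simp only [Prod.mk.injEq] at h
    obtain rfl := h.1
    exact hne (dAt_dAt _ t)

theorem dAt_mul (i : ι) {f : ι → ℤ} {x : ∀ i, (B i).carrier} (hx : ∀ i, x i ∈ (B i).gr (f i))
    (b : KTensor B) : dAt i (pure B x * b) =
      dAt i (pure B x) * b + (∑ i, f i).negOnePow • (pure B x * dAt i b) := by
  simp only [mul_def]
  induction b using hom_induction with
  | ha x y hx hy => simp only [map_add, hx, hy, smul_add]; abel
  | hs c x hx => simp only [map_smul, hx, smul_add]; rw [smul_comm c]
  | hp g y hy =>
    rw [mulₗ_pure hx hy, map_units_smul, dAt_pure i (mul_mem_gr' hx hy), dAt_pure i hx,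
      dAt_pure i hy, mulₗ_units_smul, mulₗ_smul_units, mulₗ_pure (update_d_mem i hx) hy,
      mulₗ_pure hx (update_d_mem i hy), Pi.mul_apply, (B i).leibniz (y i) (hx i),
      pure_update_add, pure_update_units_smul]
    have e1 : Function.update (x * y) i ((B i).d (x i) * y i) =
        Function.update x i ((B i).d (x i)) * y := by
      funext j
      by_cases h : j = i
      · subst h; simp
      · simp [h]
    have e2 : Function.update (x * y) i (x i * (B i).d (y i)) =
        x * Function.update y i ((B i).d (y i)) := by
      funext j
      by_cases h : j = i
      · subst h; simp
      · simp [h]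
    rw [e1, e2, smul_add, smul_add]
    simp only [smul_smul]
    congr 2
    · rw [dSign_add, mulSign_add_left, mulSign_single_left]
      ac_rfl
    · rw [dSign_add, mulSign_add_right]
      have := mulSign_single_right i f
      calc _ = mulSign f g * dSign i g * (dSign i f * (f i).negOnePow) := by ac_rfl
        _ = _ := by rw [← this]; ac_rfl

end KTensor

open KTensor in
/-- The tensor product over `K` of a finite family of dg `K`-algebras, with the Koszul signs taken
with respect to a linear order of the index set. Reordering the factors (with the sign `permSign`)
is an isomorphism, so the choice of the linear order is immaterial. -/
noncomputable def DGAlgebra.piTensor : DGAlgebra K where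
  carrier := KTensor B
  gr := KTensor.gr B
  isInternal := isInternal_gr
  one_mem := by
    have := pure_mem_gr (B := B) one_mem'
    simpa [one_def] using this
  mul_mem {m n a b} ha hb := by
    induction ha using Submodule.span_induction with
    | zero => simp
    | add x y _ _ hx hy => rw [add_mul]; exact add_mem hx hy
    | smul c x _ hx => rw [smul_mul_assoc]; exact Submodule.smul_mem _ _ hx
    | mem x hx =>
      obtain ⟨f, x, hx, hf, rfl⟩ := hx
      induction hb using Submodule.span_induction with
      | zero => simp
      | add x y _ _ hx hy => rw [mul_add]; exact add_mem hx hy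
      | smul c x _ hx => rw [mul_smul_comm]; exact Submodule.smul_mem _ _ hx
      | mem y hy =>
        obtain ⟨g, y, hy, hg, rfl⟩ := hy
        rw [pure_mul_pure hx hy]
        have := pure_mem_gr (mul_mem_gr' hx hy)
        simp only [Pi.add_apply, Finset.sum_add_distrib, hf, hg] at this
        rw [Units.smul_def]
        exact zsmul_mem this _
  d := dₗ
  d_mem {n a} ha := by
    induction ha using Submodule.span_induction with
    | zero => simp
    | add x y _ _ hx hy => rw [map_add]; exact add_mem hx hy
    | smul c x _ hx => rw [map_smul]; exact Submodule.smul_mem _ _ hx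
    | mem x hx =>
      obtain ⟨f, x, hx, hf, rfl⟩ := hx
      rw [dₗ_apply]
      refine sum_mem fun i _ => ?_
      rw [dAt_pure i hx, Units.smul_def]
      refine zsmul_mem ?_ _
      have := pure_mem_gr (update_d_mem i hx)
      simpa [Finset.sum_add_distrib, hf] using this
  d_d := dₗ_dₗ
  leibniz {m a} b ha := by
    induction ha using Submodule.span_induction with
    | zero => simp
    | add x y _ _ hx hy => simp only [add_mul, map_add, hx, hy, smul_add]; abel
    | smul c x _ hx =>
      simp only [smul_mul_assoc, map_smul, hx, smul_add]
      rw [smul_comm c]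
    | mem x hx =>
      obtain ⟨f, x, hx, hf, rfl⟩ := hx
      simp only [dₗ_apply, Finset.sum_mul, Finset.mul_sum, Finset.smul_sum,
        ← Finset.sum_add_distrib]
      refine Finset.sum_congr rfl fun i _ => ?_
      rw [dAt_mul i hx, hf]

section Perm

open KTensor

variable {B} (ρ : K →+* K) (p : Equiv.Perm ι)
  (φ : ∀ i j, p i = j → DGAlgebra.SemiHom ρ (B i) (B j))

/-- The family `y` with `y (p i) = φ (x i)`. -/
def permFam (x : ∀ i, (B i).carrier) (j : ι) : (B j).carrier :=
  (φ (p.symm j) j (p.apply_symm_apply j)).toRingHom (x (p.symm j))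

theorem permFam_apply (x : ∀ i, (B i).carrier) (i : ι) :
    permFam ρ p φ x (p i) = (φ i (p i) rfl).toRingHom (x i) := by
  have : ∀ a (h : p a = p i), (φ a (p i) h).toRingHom (x a) = (φ i (p i) rfl).toRingHom (x i) := by
    intro a h
    obtain rfl := p.injective h
    rfl
  exact this _ _

theorem permFam_update (x : ∀ i, (B i).carrier) (i : ι) (a : (B i).carrier) :
    permFam ρ p φ (Function.update x i a) =
      Function.update (permFam ρ p φ x) (p i) ((φ i (p i) rfl).toRingHom a) := by
  funext j
  obtain ⟨b, rfl⟩ := p.surjective j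
  rw [permFam_apply]
  by_cases h : b = i
  · subst h; simp
  · rw [Function.update_of_ne h, Function.update_of_ne (p.injective.ne h), permFam_apply]

theorem permFam_mem {f : ι → ℤ} {x : ∀ i, (B i).carrier} (hx : ∀ i, x i ∈ (B i).gr (f i)) (j : ι) :
    permFam ρ p φ x j ∈ (B j).gr ((fun j => f (p.symm j)) j) :=
  (φ _ j (p.apply_symm_apply j)).map_gr (hx _)

theorem permFam_mul (x y : ∀ i, (B i).carrier) :
    permFam ρ p φ (x * y) = permFam ρ p φ x * permFam ρ p φ y := by
  funext j
  exact map_mul _ _ _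

theorem permFam_one : permFam ρ p φ 1 = 1 := by
  funext j
  exact map_one _

/-- Permutation of the factors, without signs. -/
noncomputable def perm₀ : KTensor B →+ KTensor B :=
  letI : Module K (KTensor B) := Module.compHom (KTensor B) ρ
  (PiTensorProduct.lift (R := K) (s := fun i => (B i).carrier) (E := KTensor B)
    (MultilinearMap.mk' (fun x => pure B (permFam ρ p φ x))
      (fun x i a b => by
        rw [permFam_update, permFam_update, permFam_update, map_add]
        exact pure_update_add _ _ _ _)
      (fun x i c a => by
        rw [permFam_update, permFam_update, DGAlgebra.SemiHom.map_smul]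
        exact (PiTensorProduct.tprod K).map_update_smul _ _ (ρ c) _))).toAddMonoidHom

theorem perm₀_pure (x : ∀ i, (B i).carrier) :
    perm₀ ρ p φ (pure B x) = pure B (permFam ρ p φ x) :=
  let _ : Module K (KTensor B) := Module.compHom (KTensor B) ρ
  PiTensorProduct.lift.tprod (R := K) (s := fun i => (B i).carrier) (E := KTensor B) x

theorem perm₀_smul (c : K) (t : KTensor B) : perm₀ ρ p φ (c • t) = ρ c • perm₀ ρ p φ t := by
  let _ : Module K (KTensor B) := Module.compHom (KTensor B) ρ
  exact (PiTensorProduct.lift (R := K) (s := fun i => (B i).carrier) (E := KTensor B) _).map_smul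
    c t

/-- Permutation of the factors, `⊗ᵢ xᵢ ↦ ± ⊗ⱼ φ (x (p⁻¹ j))`, with the Koszul sign. -/
noncomputable def permHom : KTensor B →+ KTensor B :=
  (perm₀ ρ p φ).comp (sOp (permSign p) : KTensor B →ₗ[K] KTensor B).toAddMonoidHom

theorem permHom_pure {f : ι → ℤ} {x : ∀ i, (B i).carrier} (hx : ∀ i, x i ∈ (B i).gr (f i)) :
    permHom ρ p φ (pure B x) = permSign p f • pure B (permFam ρ p φ x) := by
  change perm₀ ρ p φ (sOp (permSign p) (pure B x)) = _
  rw [sOp_pure _ hx, Units.smul_def, map_zsmul, perm₀_pure, Units.smul_def]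

theorem permHom_smul (c : K) (t : KTensor B) :
    permHom ρ p φ (c • t) = ρ c • permHom ρ p φ t := by
  change perm₀ ρ p φ (sOp (permSign p) (c • t)) = _
  rw [map_smul, perm₀_smul]
  rfl

theorem permHom_units_smul (c : ℤˣ) (t : KTensor B) :
    permHom ρ p φ (c • t) = c • permHom ρ p φ t := by
  rw [Units.smul_def, Units.smul_def, map_zsmul]

theorem permHom_one : permHom ρ p φ 1 = 1 := by
  rw [one_def, permHom_pure ρ p φ one_mem', permFam_one]
  simp [permSign]

theorem permHom_mul (x y : KTensor B) :
    permHom ρ p φ (x * y) = permHom ρ p φ x * permHom ρ p φ y := by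
  induction x using hom_induction with
  | ha x y hx hy => simp only [map_add, add_mul, hx, hy]
  | hs c x hx => rw [smul_mul_assoc, permHom_smul, hx, permHom_smul, smul_mul_assoc]
  | hp f x hx =>
    induction y using hom_induction with
    | ha x y hx hy => simp only [map_add, mul_add, hx, hy]
    | hs c x hx => rw [mul_smul_comm, permHom_smul, hx, permHom_smul, mul_smul_comm]
    | hp g y hy =>
      rw [pure_mul_pure hx hy, permHom_units_smul, permHom_pure ρ p φ (mul_mem_gr' hx hy),
        permHom_pure ρ p φ hx, permHom_pure ρ p φ hy, permFam_mul, smul_mul_smul_comm,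
        pure_mul_pure (permFam_mem ρ p φ hx) (permFam_mem ρ p φ hy), smul_smul, smul_smul]
      congr 1
      rw [mul_comm, permSign_add, mul_comm]

theorem permHom_dAt (i : ι) (t : KTensor B) :
    permHom ρ p φ (dAt i t) = dAt (p i) (permHom ρ p φ t) := by
  induction t using hom_induction with
  | ha x y hx hy => simp only [map_add, hx, hy]
  | hs c x hx => rw [map_smul, permHom_smul, hx, permHom_smul, map_smul]
  | hp f x hx =>
    rw [dAt_pure i hx, permHom_units_smul, permHom_pure ρ p φ hx, map_units_smul,
      permHom_pure ρ p φ (update_d_mem i hx), dAt_pure (p i) (permFam_mem ρ p φ hx),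
      permFam_update, permFam_apply, DGAlgebra.SemiHom.map_d, smul_smul, smul_smul]
    congr 1
    rw [mul_comm, permSign_single_add, mul_comm]

theorem permHom_gr {n : ℤ} {a : KTensor B} (ha : a ∈ KTensor.gr B n) :
    permHom ρ p φ a ∈ KTensor.gr B n := by
  induction ha using Submodule.span_induction with
  | zero => simp
  | add x y _ _ hx hy => rw [map_add]; exact add_mem hx hy
  | smul c x _ hx => rw [permHom_smul]; exact Submodule.smul_mem _ _ hx
  | mem x hx =>
    obtain ⟨f, x, hx, hf, rfl⟩ := hx
    rw [permHom_pure ρ p φ hx, Units.smul_def]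
    refine zsmul_mem ?_ _
    have := pure_mem_gr (permFam_mem ρ p φ hx)
    rwa [Equiv.sum_comp p.symm f, hf] at this

theorem permHom_d (a : KTensor B) : permHom ρ p φ (dₗ a) = dₗ (permHom ρ p φ a) := by
  rw [dₗ_apply, dₗ_apply, map_sum, ← Equiv.sum_comp p fun j => dAt j (permHom ρ p φ a)]
  exact Finset.sum_congr rfl fun i _ => permHom_dAt ρ p φ i a

theorem permSign_mul (p p' : Equiv.Perm ι) (f : ι → ℤ) :
    permSign (p' * p) f = permSign p' (fun j => f (p.symm j)) * permSign p f := by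
  have e : permSign p' (fun j => f (p.symm j)) =
      (∑ i, ∑ j, if p i < p j ∧ p' (p j) < p' (p i) then f i * f j else 0).negOnePow := by
    rw [permSign, ← Equiv.sum_comp p]
    congr 1
    refine Finset.sum_congr rfl fun i _ => ?_
    rw [← Equiv.sum_comp p]
    simp
  rw [e, permSign, permSign, ← Int.negOnePow_add, Int.negOnePow_eq_iff]
  have h1 : (∑ i, ∑ j, if p i < p j ∧ p' (p j) < p' (p i) then f i * f j else 0) =
      (∑ i, ∑ j, if i < j ∧ p i < p j ∧ p' (p j) < p' (p i) then f i * f j else 0) +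
      ∑ i, ∑ j, if i < j ∧ p j < p i ∧ p' (p i) < p' (p j) then f i * f j else 0 := by
    rw [Finset.sum_comm (f := fun i j =>
      if i < j ∧ p j < p i ∧ p' (p i) < p' (p j) then f i * f j else 0)]
    simp only [← Finset.sum_add_distrib]
    refine Finset.sum_congr rfl fun i _ => Finset.sum_congr rfl fun j _ => ?_
    rcases lt_trichotomy i j with h | h | h
    · simp [h, h.not_gt]
    · simp [h]
    · simp [h, h.not_gt, mul_comm]
  have h2 : (∑ i, ∑ j, if i < j ∧ (p' * p) j < (p' * p) i then f i * f j else 0) +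
      (∑ i, ∑ j, if i < j ∧ p j < p i ∧ p' (p i) < p' (p j) then f i * f j else 0) =
      (∑ i, ∑ j, if i < j ∧ p i < p j ∧ p' (p j) < p' (p i) then f i * f j else 0) +
      ∑ i, ∑ j, if i < j ∧ p j < p i then f i * f j else 0 := by
    simp only [← Finset.sum_add_distrib]
    refine Finset.sum_congr rfl fun i _ => Finset.sum_congr rfl fun j _ => ?_
    simp only [Equiv.Perm.mul_apply]
    by_cases h : i < j
    · rcases lt_or_gt_of_ne (p.injective.ne h.ne) with h' | h'
      · simp [h, h', h'.not_gt]
      · rcases lt_or_gt_of_ne (p'.injective.ne h'.ne) with h'' | h''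
        · simp [h, h', h'.not_gt, h'', h''.not_gt]
        · simp [h, h', h'.not_gt, h'', h''.not_gt]
    · simp [h]
  refine ⟨-∑ i, ∑ j, if i < j ∧ p j < p i ∧ p' (p i) < p' (p j) then f i * f j else 0, ?_⟩
  linear_combination h2 - h1

/-- Compatibility of the signed permutations with composition. -/
theorem permHom_permHom {ρ ρ' ρ'' : K →+* K} {p p' : Equiv.Perm ι}
    (φ : ∀ i j, p i = j → DGAlgebra.SemiHom ρ (B i) (B j))
    (φ' : ∀ i j, p' i = j → DGAlgebra.SemiHom ρ' (B i) (B j))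
    (φ'' : ∀ i j, (p' * p) i = j → DGAlgebra.SemiHom ρ'' (B i) (B j))
    (hρ : ∀ c, ρ'' c = ρ' (ρ c))
    (hφ : ∀ i x, (φ'' i (p' (p i)) rfl).toRingHom x =
      (φ' (p i) (p' (p i)) rfl).toRingHom ((φ i (p i) rfl).toRingHom x)) (t : KTensor B) :
    permHom ρ'' (p' * p) φ'' t = permHom ρ' p' φ' (permHom ρ p φ t) := by
  induction t using hom_induction with
  | ha x y hx hy => simp only [map_add, hx, hy]
  | hs c x hx => simp only [permHom_smul, hρ, hx]
  | hp f x hx =>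
    rw [permHom_pure _ _ φ'' hx, permHom_pure _ _ φ hx, permHom_units_smul,
      permHom_pure _ _ φ' (permFam_mem _ _ φ hx), smul_smul, permSign_mul, mul_comm]
    congr 2
    funext j
    obtain ⟨i, rfl⟩ := (p' * p).surjective j
    rw [permFam_apply]
    change _ = permFam ρ' p' φ' (permFam ρ p φ x) (p' (p i))
    rw [permFam_apply ρ' p' φ', permFam_apply ρ p φ]
    exact hφ i _

theorem permHom_refl {ρ : K →+* K} (φ : ∀ i j, (1 : Equiv.Perm ι) i = j →
    DGAlgebra.SemiHom ρ (B i) (B j)) (hρ : ∀ c, ρ c = c)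
    (hφ : ∀ i x, (φ i i rfl).toRingHom x = x) (t : KTensor B) : permHom ρ 1 φ t = t := by
  induction t using hom_induction with
  | ha x y hx hy => simp only [map_add, hx, hy]
  | hs c x hx => simp only [permHom_smul, hρ, hx]
  | hp f x hx =>
    have e : permSign (1 : Equiv.Perm ι) f = 1 := by
      rw [permSign, Finset.sum_eq_zero, Int.negOnePow_zero]
      intro i _
      refine Finset.sum_eq_zero fun j _ => if_neg fun h => ?_
      exact h.1.not_gt h.2
    rw [permHom_pure _ _ φ hx, e, one_smul]
    congr 1
    funext i
    exact (permFam_apply ρ 1 φ x i).trans (hφ i _)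

/-- A permutation of the factors, together with `ρ`-semilinear morphisms between the factors,
induces a `ρ`-semilinear morphism of the tensor product. -/
noncomputable def DGAlgebra.permute :
    DGAlgebra.SemiHom ρ (DGAlgebra.piTensor B) (DGAlgebra.piTensor B) where
  toRingHom :=
    { permHom ρ p φ with
      map_one' := permHom_one ρ p φ
      map_mul' := permHom_mul ρ p φ }
  map_smul := permHom_smul ρ p φ
  map_gr ha := permHom_gr ρ p φ ha
  map_d a := permHom_d ρ p φ a

end Perm

end Koszul

section Weil

variable (k l L : Type u) [Field k] [Field l] [Field L] [Algebra k l] [Algebra k L] [Algebra l L]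
  [IsScalarTower k l L]

/-- The subgroup `H` of `G = Gal(L/k)` of the automorphisms which fix (the image of) `l`; if `L/k`
is Galois, this is the subgroup with `L^H = l`. -/
def fixingSubgroup : Subgroup (L ≃ₐ[k] L) :=
  (IsScalarTower.toAlgHom k l L).fieldRange.fixingSubgroup

/-- The set `G/H` of left cosets, with its left action of `G`. -/
abbrev Cosets : Type u := (L ≃ₐ[k] L) ⧸ fixingSubgroup k l L

noncomputable instance [FiniteDimensional k L] : Fintype (Cosets k l L) := Fintype.ofFinite _

/-- An arbitrary linear order on `G/H`, used only to write down the Koszul signs. -/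
noncomputable instance : LinearOrder (Cosets k l L) := IsWellOrder.linearOrder WellOrderingRel

variable {k l L}

theorem fixingSubgroup_apply {u : L ≃ₐ[k] L} (hu : u ∈ fixingSubgroup k l L) (x : l) :
    u (algebraMap l L x) = algebraMap l L x :=
  (IntermediateField.mem_fixingSubgroup_iff _ u).mp hu _ ⟨x, rfl⟩

/-- An element of `H`, as an `l`-algebra endomorphism of `L`. -/
def fixingSubgroupHom (u : L ≃ₐ[k] L) (hu : u ∈ fixingSubgroup k l L) : L →ₐ[l] L :=
  { (u : L →+* L) with commutes' := fixingSubgroup_apply hu }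

/-- The `σ`-conjugate `^σ B` of a dg `L`-algebra: restriction of scalars along `σ⁻¹ : L → L`. -/
def DGAlgebra.conj (σ : L ≃ₐ[k] L) (B : DGAlgebra L) : DGAlgebra L :=
  B.restrictScalars ((σ⁻¹ : L ≃ₐ[k] L) : L →+* L)

/-- For `τ⁻¹ρσ ∈ H`, the `ρ`-semilinear morphism `^σ A_L → ^τ A_L` given on `A_L = L ⊗ A` by
`c ⊗ a ↦ (τ⁻¹ρσ) c ⊗ a`. In terms of `^σ A_L = L ⊗_{σ,l} A` this is `c ⊗ a ↦ ρ c ⊗ a`. -/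
noncomputable def conjHom (A : DGAlgebra l) (σ τ ρ : L ≃ₐ[k] L)
    (h : τ⁻¹ * ρ * σ ∈ fixingSubgroup k l L) :
    DGAlgebra.SemiHom (ρ : L →+* L) ((A.baseChange L).conj σ) ((A.baseChange L).conj τ) :=
  let F : L ⊗[l] A.carrier →ₐ[l] L ⊗[l] A.carrier :=
    Algebra.TensorProduct.map (fixingSubgroupHom _ h) (AlgHom.id l A.carrier)
  have hF : ∀ (c : L) (a : L ⊗[l] A.carrier), F (c • a) = (τ⁻¹ * ρ * σ) c • F a := by
    intro c a
    induction a using TensorProduct.induction_on with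
    | zero => simp
    | add x y hx hy => simp only [smul_add, map_add, hx, hy]
    | tmul b a =>
      change F ((c * b) ⊗ₜ a) = _
      simp only [F, Algebra.TensorProduct.map_tmul]
      change ((τ⁻¹ * ρ * σ) (c * b)) ⊗ₜ a = (((τ⁻¹ * ρ * σ) c) * ((τ⁻¹ * ρ * σ) b)) ⊗ₜ a
      rw [map_mul]
  have hgr : ∀ (n : ℤ) (a : L ⊗[l] A.carrier), a ∈ (A.gr n).baseChange L →
      F a ∈ (A.gr n).baseChange L := by
    intro n a ha
    rw [Submodule.baseChange_eq_span] at ha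
    induction ha using Submodule.span_induction with
    | zero => simp
    | add x y _ _ hx hy => rw [map_add]; exact add_mem hx hy
    | smul c x _ hx => rw [hF]; exact Submodule.smul_mem _ _ hx
    | mem x hx =>
      obtain ⟨x, hx, rfl⟩ := hx
      exact Submodule.tmul_mem_baseChange_of_mem _ hx
  have hd : ∀ a : L ⊗[l] A.carrier, F (A.d.baseChange L a) = A.d.baseChange L (F a) := by
    intro a
    induction a using TensorProduct.induction_on with
    | zero => simp
    | add x y hx hy => simp only [map_add, hx, hy]
    | tmul b a => simp [F]
  { toRingHom := (F : L ⊗[l] A.carrier →+* L ⊗[l] A.carrier)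
    map_smul := fun c a => by
      change F ((σ⁻¹ : L ≃ₐ[k] L) c • (show L ⊗[l] A.carrier from a)) =
        (τ⁻¹ : L ≃ₐ[k] L) (ρ c) • F a
      rw [hF]
      congr 1
      change (τ⁻¹ * ρ * σ * σ⁻¹) c = (τ⁻¹ * ρ) c
      rw [mul_inv_cancel_right]
    map_gr := fun {n a} ha => hgr n a ha
    map_d := fun a => hd a }

theorem conjHom_one (A : DGAlgebra l) (σ : L ≃ₐ[k] L) (h) (x : L ⊗[l] A.carrier) :
    (conjHom A σ σ 1 h).toRingHom x = x := by
  change Algebra.TensorProduct.map (fixingSubgroupHom _ h) (AlgHom.id l A.carrier) x = x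
  induction x using TensorProduct.induction_on with
  | zero => simp
  | add x y hx hy => rw [map_add, hx, hy]
  | tmul c a =>
    rw [Algebra.TensorProduct.map_tmul]
    change (σ⁻¹ * 1 * σ) c ⊗ₜ a = _
    rw [mul_one, inv_mul_cancel]
    rfl

theorem conjHom_conjHom (A : DGAlgebra l) (σ τ υ ρ ρ' : L ≃ₐ[k] L) (h h' h'')
    (x : L ⊗[l] A.carrier) : (conjHom A σ υ (ρ' * ρ) h'').toRingHom x =
      (conjHom A τ υ ρ' h').toRingHom ((conjHom A σ τ ρ h).toRingHom x) := by
  change Algebra.TensorProduct.map (fixingSubgroupHom _ h'') (AlgHom.id l A.carrier) x =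
    Algebra.TensorProduct.map (fixingSubgroupHom _ h') (AlgHom.id l A.carrier)
      (Algebra.TensorProduct.map (fixingSubgroupHom _ h) (AlgHom.id l A.carrier) x)
  induction x using TensorProduct.induction_on with
  | zero => simp
  | add x y hx hy => simp only [map_add, hx, hy]
  | tmul c a =>
    simp only [Algebra.TensorProduct.map_tmul]
    change (υ⁻¹ * (ρ' * ρ) * σ) c ⊗ₜ a = (υ⁻¹ * ρ' * τ * (τ⁻¹ * ρ * σ)) c ⊗ₜ a
    congr 2
    group

theorem coset_rep_mem {ρ : L ≃ₐ[k] L} {s t : Cosets k l L} (h : ρ • s = t) :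
    t.out⁻¹ * ρ * s.out ∈ fixingSubgroup k l L := by
  rw [mul_assoc, ← QuotientGroup.eq, QuotientGroup.out_eq', ← h]
  conv_lhs => rw [← QuotientGroup.out_eq' s]
  rfl

variable [FiniteDimensional k L]

variable (k l L) in
/-- The dg `L`-algebra `⊗_{σ ∈ G/H} ^σ A_L`, where every coset is represented by one of its
elements; up to the isomorphisms `conjHom` the conjugate depends on the coset only. -/
noncomputable def weilTensor (A : DGAlgebra l) : DGAlgebra L :=
  DGAlgebra.piTensor fun s : Cosets k l L => (A.baseChange L).conj s.out

/-- The skew-linear action of `ρ ∈ G` on `⊗_{σ ∈ G/H} ^σ A_L` by permutation of the factors,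
`ρ (⊗_σ v_σ) = ± ⊗_σ v_{ρ⁻¹σ}` with the Koszul sign. -/
noncomputable def weilAct (A : DGAlgebra l) (ρ : L ≃ₐ[k] L) :
    DGAlgebra.SemiHom (ρ : L →+* L) (weilTensor k l L A) (weilTensor k l L A) :=
  DGAlgebra.permute (ρ : L →+* L) (MulAction.toPerm ρ)
    fun s t h => conjHom A s.out t.out ρ (coset_rep_mem h)

theorem weilAct_one (A : DGAlgebra l) (t : (weilTensor k l L A).carrier) :
    (weilAct A (1 : L ≃ₐ[k] L)).toRingHom t = t := by
  have key : ∀ (p : Equiv.Perm (Cosets k l L)) (_ : p = 1)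
      (φ : ∀ i j, p i = j → DGAlgebra.SemiHom ((1 : L ≃ₐ[k] L) : L →+* L)
        ((A.baseChange L).conj i.out) ((A.baseChange L).conj j.out))
      (_ : ∀ i h x, (φ i i h).toRingHom x = x) (t : KTensor _), permHom _ p φ t = t := by
    rintro p rfl φ hφ t
    exact permHom_refl φ (fun _ => rfl) (fun i x => hφ i rfl x) t
  refine key _ (by ext s; simp) _ (fun s h x => ?_) t
  exact conjHom_one A s.out _ x

theorem weilAct_mul (A : DGAlgebra l) (ρ' ρ : L ≃ₐ[k] L) (t : (weilTensor k l L A).carrier) :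
    (weilAct A (ρ' * ρ)).toRingHom t = (weilAct A ρ').toRingHom ((weilAct A ρ).toRingHom t) := by
  have key : ∀ (p p' q : Equiv.Perm (Cosets k l L)) (_ : q = p' * p)
      (φ : ∀ i j, p i = j → DGAlgebra.SemiHom (ρ : L →+* L)
        ((A.baseChange L).conj i.out) ((A.baseChange L).conj j.out))
      (φ' : ∀ i j, p' i = j → DGAlgebra.SemiHom (ρ' : L →+* L)
        ((A.baseChange L).conj i.out) ((A.baseChange L).conj j.out))
      (φ'' : ∀ i j, q i = j → DGAlgebra.SemiHom ((ρ' * ρ : L ≃ₐ[k] L) : L →+* L)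
        ((A.baseChange L).conj i.out) ((A.baseChange L).conj j.out))
      (_ : ∀ i j m h h' h'' x, (φ'' i m h'').toRingHom x =
        (φ' j m h').toRingHom ((φ i j h).toRingHom x)) (t : KTensor _),
      permHom _ q φ'' t = permHom _ p' φ' (permHom _ p φ t) := by
    rintro p p' q rfl φ φ' φ'' hφ t
    exact permHom_permHom φ φ' φ'' (fun _ => rfl) (fun i x => hφ i _ _ rfl rfl rfl x) t
  refine key _ _ _ (by ext s; simp [mul_smul]) _ _ _ (fun i j m h h' h'' x => ?_) t
  exact conjHom_conjHom A i.out j.out m.out ρ ρ' _ _ _ x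

/-- The action of `ρ ∈ G`, as a morphism of dg `k`-algebras. -/
noncomputable def weilActHom (A : DGAlgebra l) (ρ : L ≃ₐ[k] L) :
    DGAlgebra.Hom ((weilTensor k l L A).restrictScalars (algebraMap k L))
      ((weilTensor k l L A).restrictScalars (algebraMap k L)) where
  toRingHom := (weilAct A ρ).toRingHom
  map_smul c a := by
    have := (weilAct A ρ).map_smul (algebraMap k L c) a
    rw [RingHom.coe_coe, AlgEquiv.commutes] at this
    exact this
  map_gr ha := (weilAct A ρ).map_gr ha
  map_d a := (weilAct A ρ).map_d a

variable (k l L) in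
/-- The noncommutative Weil restriction `(⊗_{σ ∈ G/H} ^σ A_L)^G`. -/
noncomputable def weilRestriction (A : DGAlgebra l) : DGAlgebra k :=
  ((weilTensor k l L A).restrictScalars (algebraMap k L)).fixed (weilActHom A)

end Weil

section Cohomology

variable {k : Type u} [Field k] {V W : Type u} [AddCommGroup V] [Module k V] [AddCommGroup W]
  [Module k W]

/-- The cocycles of degree `n` of a graded vector space with differential. -/
def cocycles (gr : ℤ → Submodule k V) (d : V →ₗ[k] V) (n : ℤ) : Submodule k V :=
  gr n ⊓ LinearMap.ker d

/-- The coboundaries of degree `n`, as a subspace of the cocycles. -/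
def coboundaries (gr : ℤ → Submodule k V) (d : V →ₗ[k] V) (n : ℤ) :
    Submodule k (cocycles gr d n) :=
  ((gr (n - 1)).map d).submoduleOf (cocycles gr d n)

/-- The cohomology `Hⁿ`. -/
abbrev Cohomology (gr : ℤ → Submodule k V) (d : V →ₗ[k] V) (n : ℤ) : Type u :=
  cocycles gr d n ⧸ coboundaries gr d n

/-- The map induced on `Hⁿ` by a linear map of degree `0` which commutes with the differentials. -/
def cohomologyMap {gr : ℤ → Submodule k V} {d : V →ₗ[k] V} {gr' : ℤ → Submodule k W}
    {d' : W →ₗ[k] W} (f : V →ₗ[k] W) (hgr : ∀ n, ∀ v ∈ gr n, f v ∈ gr' n)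
    (hd : ∀ v, f (d v) = d' (f v)) (n : ℤ) : Cohomology gr d n →ₗ[k] Cohomology gr' d' n :=
  Submodule.mapQ _ _
    (f.restrict (p := cocycles gr d n) (q := cocycles gr' d' n) fun v hv =>
      ⟨hgr n v hv.1, by
        have h : d v = 0 := hv.2
        change d' (f v) = 0
        rw [← hd, h, map_zero]⟩)
    (by
      rintro ⟨v, hv⟩ ⟨w, hw, hwv⟩
      exact ⟨f w, hgr _ w hw, by rw [← hd, hwv]; rfl⟩)

end Cohomology

section Bimodules

variable {k : Type u} [Field k]

/-- A dg `A`-`A`-bimodule, with `k` acting centrally. This is the same as a dg functor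
`A ⊗ Aᵒᵖ → C_dg(k)`, i.e. as a right dg module over `Aᵒᵖ ⊗ A`, via
`m · (a ⊗ b) = (-1)^(|a| |m|) a m b`. -/
structure DGBimod (A : DGAlgebra k) where
  /-- the total space `⨁ₙ Mⁿ` -/
  carrier : Type u
  [addCommGroup : AddCommGroup carrier]
  [module : Module k carrier]
  [left : Module A.carrier carrier]
  [right : Module A.carrierᵐᵒᵖ carrier]
  [comm : SMulCommClass A.carrier A.carrierᵐᵒᵖ carrier]
  [towerLeft : IsScalarTower k A.carrier carrier]
  [towerRight : IsScalarTower k A.carrierᵐᵒᵖ carrier]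
  /-- the homogeneous elements of degree `n` -/
  gr : ℤ → Submodule k carrier
  isInternal : DirectSum.IsInternal gr
  smul_mem : ∀ {i j : ℤ} {a : A.carrier} {m : carrier}, a ∈ A.gr i → m ∈ gr j →
    a • m ∈ gr (i + j)
  op_smul_mem : ∀ {i j : ℤ} {m : carrier} {a : A.carrier}, m ∈ gr i → a ∈ A.gr j →
    MulOpposite.op a • m ∈ gr (i + j)
  /-- the differential -/
  d : carrier →ₗ[k] carrier
  d_mem : ∀ {n : ℤ} {m : carrier}, m ∈ gr n → d m ∈ gr (n + 1)
  d_d : ∀ m, d (d m) = 0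
  leibniz_left : ∀ {i : ℤ} {a : A.carrier} (m : carrier), a ∈ A.gr i →
    d (a • m) = A.d a • m + i.negOnePow • (a • d m)
  leibniz_right : ∀ {i : ℤ} {m : carrier} (a : A.carrier), m ∈ gr i →
    d (MulOpposite.op a • m) =
      MulOpposite.op a • d m + i.negOnePow • (MulOpposite.op (A.d a) • m)

namespace DGBimod

attribute [instance] addCommGroup module left right comm towerLeft towerRight

variable {A : DGAlgebra k}

/-- Morphisms of dg bimodules: bilinear maps of degree `0` which commute with the differentials. -/
@[ext]
structure Hom (M N : DGBimod A) where
  toLinearMap : M.carrier →ₗ[k] N.carrier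
  map_smul : ∀ (a : A.carrier) (m : M.carrier), toLinearMap (a • m) = a • toLinearMap m
  map_op_smul : ∀ (a : A.carrier) (m : M.carrier),
    toLinearMap (MulOpposite.op a • m) = MulOpposite.op a • toLinearMap m
  map_gr : ∀ (n : ℤ), ∀ m ∈ M.gr n, toLinearMap m ∈ N.gr n
  map_d : ∀ m : M.carrier, toLinearMap (M.d m) = N.d (toLinearMap m)

instance : Category.{u} (DGBimod A) where
  Hom := Hom
  id M :=
    { toLinearMap := LinearMap.id
      map_smul := fun _ _ => rfl
      map_op_smul := fun _ _ => rfl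
      map_gr := fun _ _ h => h
      map_d := fun _ => rfl }
  comp f g :=
    { toLinearMap := g.toLinearMap ∘ₗ f.toLinearMap
      map_smul := fun a m => by simp [f.map_smul, g.map_smul]
      map_op_smul := fun a m => by simp [f.map_op_smul, g.map_op_smul]
      map_gr := fun n m h => g.map_gr n _ (f.map_gr n m h)
      map_d := fun m => by simp [f.map_d, g.map_d] }

/-- The quasi-isomorphisms: the morphisms which induce isomorphisms on all `Hⁿ`. -/
def quasiIso (A : DGAlgebra k) : MorphismProperty (DGBimod A) := fun _ _ f =>
  ∀ n, Function.Bijective (cohomologyMap f.toLinearMap f.map_gr f.map_d n)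

/-- The derived category of dg `A`-`A`-bimodules, i.e. `D(Aᵒᵖ ⊗ A)`: the localization of the
category of dg bimodules with respect to the quasi-isomorphisms. -/
abbrev Derived (A : DGAlgebra k) := (quasiIso A).Localization

/-- The algebra `A`, as a dg `A`-`A`-bimodule. -/
def diagonal (A : DGAlgebra k) : DGBimod A where
  carrier := A.carrier
  gr := A.gr
  isInternal := A.isInternal
  smul_mem := A.mul_mem
  op_smul_mem := A.mul_mem
  d := A.d
  d_mem := A.d_mem
  d_d := A.d_d
  leibniz_left := A.leibniz
  leibniz_right b hm := A.leibniz b hm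

end DGBimod

/-- Compact objects of an additive category with coproducts: `Hom(X, -)` commutes with all small
coproducts. As `⨁ᵢ Hom(X, Yᵢ) → Hom(X, ∐ᵢ Yᵢ)` is always injective (use the projections
`∐ᵢ Yᵢ → Yⱼ`), this means that every morphism `X → ∐ᵢ Yᵢ` factors through a finite
subcoproduct. -/
def IsCompactObject {C : Type*} [Category C] (X : C) : Prop :=
  ∀ ⦃I : Type u⦄ (Y : I → C) (c : Cofan Y) (_ : IsColimit c) (f : X ⟶ c.pt),
    ∃ (J : Finset I) (c' : Cofan fun j : J => Y j) (hc' : IsColimit c') (g : X ⟶ c'.pt),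
      g ≫ Cofan.IsColimit.desc hc' (fun j => c.inj j) = f

namespace DGAlgebra

/-- A dg algebra is smooth if the bimodule `A` is a compact object of `D(Aᵒᵖ ⊗ A)`. -/
def IsSmooth (A : DGAlgebra k) : Prop :=
  IsCompactObject.{u} ((DGBimod.quasiIso A).Q.obj (DGBimod.diagonal A))

/-- A dg algebra is proper if `∑ᵢ dim Hⁱ(A) < ∞`. -/
def IsProper (A : DGAlgebra k) : Prop :=
  (Cardinal.sum fun i : ℤ => Module.rank k (Cohomology A.gr A.d i)) < Cardinal.aleph0

end DGAlgebra

end Bimodules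

end NCWeil

namespace NCWeil

/-! ### Linear maps between graded vector spaces -/

section GradedMaps

variable {K M N Γ : Type*} [CommRing K] [AddCommGroup M] [Module K M] [AddCommGroup N] [Module K N]

/-! Write W for the tensor product of the conjugates of A_L and B₀ = W^G for the Weil restriction.
Two facts tie B₀ to W. By Galois descent a k-basis of B₀ is an L-basis of W
(`exists_basis_of_semilinear`). And if c ∈ L has trace 1, then w ↦ ∑_ρ ρ(c w) is a closed
B₀-bilinear retraction of the inclusion B₀ → W (`exists_trace`, `exists_transfer`). For each half of
the theorem, finiteness of A is put in a form that survives extension of scalars, conjugation and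
tensor products; this gives it for W over L, and the retraction brings it down to B₀.

Smoothness. The diagonal bimodule A has a semi-free resolution P → A, made of inductively defined
cells (`Cell.quasiIso_aug`). Semi-free bimodules are K-projective (`SemiFree.kProj`), so morphisms
out of them in the derived category are homotopy classes of bimodule maps (`KProj.exists_Q_map_eq`,
`KProj.homotopic_of_Q_map_eq`), and coproducts there are direct sums (`isColimitDsumCofan`). It
follows that P is compact exactly when its identity is homotopic to an endomorphism u whose image
lies in a finitely generated sub-bimodule (`FreeData.exists_finset_of_isCompactObject`,
`KProj.isCompactObject_of_finset`).

This criterion involves only explicit maps. The structure `Res` records P, a linear homotopy inverse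
of P → A, the map u with its homotopy, and the generators, all as linear maps of a single dg algebra
T containing A and P; initially T is the square-zero extension A ⊕ P (`IsSmooth.nonempty_res`). The
Koszul signs for tensor products of bimodules are thereby those for tensor products of dg algebras.
Such data pass to A_L, to its conjugates and to their tensor product (`Res.nonempty_baseChange`,
`Res.nonempty_restrictScalars`, `Res.nonempty_piTensor`), hence to W.

Over B₀ the resolution of W remains semi-free: by descent its generators are the products x e, for x
in a k-basis of L and e an old generator. As L/k is finite, u still has image in a finitely
generated sub-bimodule, so W is a compact B₀-bimodule (`Res.isCompactObject_algBimod`), and B₀ is a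
retract of W.

Properness. Over a field, a complex with finite-dimensional total cohomology has identity homotopic
to a chain map with finite-dimensional image (`IsProper.isHtpyFinite`). This property also passes to
W. Composing the finite-rank map with the inclusion of B₀ and the trace retraction gives a
finite-rank chain map of B₀ which is the identity on cohomology (`isProper_of_finite`). -/

theorem units_smul_mem {S : Submodule K M} (c : ℤˣ) {x : M} (hx : x ∈ S) : c • x ∈ S := by
  rw [Units.smul_def]; exact zsmul_mem hx _

theorem map_units_smul (f : M →ₗ[K] N) (c : ℤˣ) (x : M) : f (c • x) = c • f x := by
  rw [Units.smul_def, Units.smul_def, map_zsmul]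

/-- A linear map which shifts the degrees commutes with the projections on the pieces. -/
theorem gproj_comm {gr : ℤ → Submodule K M} {gr' : ℤ → Submodule K N}
    (h : DirectSum.IsInternal gr) (h' : DirectSum.IsInternal gr') {f : M →ₗ[K] N} {n : ℤ}
    (hf : ∀ i, ∀ x ∈ gr i, f x ∈ gr' (i + n)) (i : ℤ) (x : M) :
    f (gproj h i x) = gproj h' (i + n) (f x) := by
  induction x using graded_induction h with
  | h0 => simp
  | hm j x hx =>
    by_cases e : j = i
    · subst e; rw [gproj_of_mem h hx, gproj_of_mem h' (hf _ _ hx)]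
    · rw [gproj_of_mem_ne h hx e, gproj_of_mem_ne h' (hf _ _ hx) (by omega), map_zero]
  | ha x y hx hy => simp only [map_add, hx, hy]

/-- A linear map shifts the degrees if it does so on a spanning set of homogeneous elements. -/
theorem map_gr_of_span {gr : ℤ → Submodule K M} {gr' : ℤ → Submodule K N}
    (h : DirectSum.IsInternal gr) (h' : DirectSum.IsInternal gr') {f : M →ₗ[K] N} {n : ℤ}
    {X : Set M} (hX : Submodule.span K X = ⊤)
    (hf : ∀ x ∈ X, ∃ i, x ∈ gr i ∧ f x ∈ gr' (i + n)) (i : ℤ) (x : M) (hx : x ∈ gr i) :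
    f x ∈ gr' (i + n) := by
  -- Commuting with the projections is a linear condition, unlike preservation of homogeneity, so it
  -- can be tested on a spanning set.
  have key : ∀ x, f (gproj h i x) = gproj h' (i + n) (f x) := by
    intro x
    have hx : x ∈ Submodule.span K X := hX ▸ Submodule.mem_top
    induction hx using Submodule.span_induction with
    | zero => simp
    | add x y _ _ hx hy => simp only [map_add, hx, hy]
    | smul c x _ hx => simp only [map_smul, hx]
    | mem x hx =>
      obtain ⟨j, hj, hj'⟩ := hf x hx
      by_cases e : j = i
      · subst e; rw [gproj_of_mem h hj, gproj_of_mem h' hj']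
      · rw [gproj_of_mem_ne h hj e, gproj_of_mem_ne h' hj' (by omega), map_zero]
  have := key x
  rw [gproj_of_mem h hx] at this
  rw [this]
  exact gproj_mem h' _ _

/-- Coarsening a grading. -/
theorem isInternal_coarsen [DecidableEq Γ] {gr : Γ → Submodule K M} (h : DirectSum.IsInternal gr)
    (θ : Γ → ℤ) (gr' : ℤ → Submodule K M) (h1 : ∀ g, gr g ≤ gr' (θ g))
    (h2 : ∀ n, gr' n ≤ ⨆ g, ⨆ (_ : θ g = n), gr g) : DirectSum.IsInternal gr' := by
  refine isInternal_of_proj _ (fun n => gradedLift h fun g =>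
    if θ g = n then (gr g).subtype else 0) ?_ ?_ ?_
  · intro n x hx
    have : (⨆ g, ⨆ (_ : θ g = n), gr g) ≤ LinearMap.eqLocus (gradedLift h fun g =>
        if θ g = n then (gr g).subtype else 0) LinearMap.id := by
      refine iSup₂_le fun g hg x hx => ?_
      change _ = x
      rw [gradedLift_of_mem h _ hx, if_pos hg]
      rfl
    exact this (h2 n hx)
  · intro n m hm x hx
    have : (⨆ g, ⨆ (_ : θ g = m), gr g) ≤ LinearMap.ker (gradedLift h fun g =>
        if θ g = n then (gr g).subtype else 0) := by
      refine iSup₂_le fun g hg x hx => ?_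
      rw [LinearMap.mem_ker, gradedLift_of_mem h _ hx, if_neg (by rw [hg]; exact hm)]
      rfl
    exact this (h2 m hx)
  · rw [eq_top_iff, ← h.submodule_iSup_eq_top]
    exact iSup_le fun g => (h1 g).trans (le_iSup _ _)

theorem signOp_mem {gr : ℤ → Submodule K M} (h : DirectSum.IsInternal gr) (s : ℤ → ℤˣ) {i : ℤ}
    {x : M} (hx : x ∈ gr i) : signOp h s x ∈ gr i := by
  rw [signOp_of_mem h s hx]; exact units_smul_mem _ hx

end GradedMaps

/-! ### The sign automorphisms of a dg algebra -/

namespace DGAlgebra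

variable {k : Type u} [Field k] (A : DGAlgebra k)

/-- The automorphism `a ↦ (-1)^(n|a|) a`. -/
noncomputable def sgn (n : ℤ) : A.carrier →ₐ[k] A.carrier :=
  AlgHom.ofLinearMap (signOp A.isInternal fun i => (n * i).negOnePow)
    (by rw [signOp_of_mem _ _ A.one_mem]; simp)
    (by
      intro a b
      induction a using graded_induction A.isInternal with
      | h0 => simp
      | ha x y hx hy => simp only [add_mul, map_add, hx, hy]
      | hm i a ha =>
        induction b using graded_induction A.isInternal with
        | h0 => simp
        | ha x y hx hy => simp only [mul_add, map_add, hx, hy]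
        | hm j b hb =>
          rw [signOp_of_mem _ _ ha, signOp_of_mem _ _ hb, signOp_of_mem _ _ (A.mul_mem ha hb),
            smul_mul_smul_comm, mul_add, Int.negOnePow_add])

variable {A}

theorem sgn_of_mem (n : ℤ) {i : ℤ} {a : A.carrier} (ha : a ∈ A.gr i) :
    A.sgn n a = (n * i).negOnePow • a := signOp_of_mem A.isInternal _ ha

theorem sgn_mem (n : ℤ) {i : ℤ} {a : A.carrier} (ha : a ∈ A.gr i) : A.sgn n a ∈ A.gr i :=
  signOp_mem A.isInternal _ ha

theorem sgn_units_smul (n : ℤ) (c : ℤˣ) (a : A.carrier) : A.sgn n (c • a) = c • A.sgn n a :=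
  map_units_smul (A.sgn n).toLinearMap c a

@[simp] theorem sgn_zero (a : A.carrier) : A.sgn 0 a = a := by
  induction a using graded_induction A.isInternal with
  | h0 => simp
  | ha x y hx hy => rw [map_add, hx, hy]
  | hm i a ha => rw [sgn_of_mem _ ha]; simp

theorem sgn_sgn (m n : ℤ) (a : A.carrier) : A.sgn m (A.sgn n a) = A.sgn (m + n) a := by
  induction a using graded_induction A.isInternal with
  | h0 => simp
  | ha x y hx hy => simp only [map_add, hx, hy]
  | hm i a ha =>
    rw [sgn_of_mem n ha, sgn_units_smul, sgn_of_mem _ ha, sgn_of_mem _ ha, smul_smul, ← Int.negOnePow_add, add_mul, add_comm]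

theorem sgn_eq_of_even {m n : ℤ} (h : Even (m - n)) (a : A.carrier) : A.sgn m a = A.sgn n a := by
  induction a using graded_induction A.isInternal with
  | h0 => simp
  | ha x y hx hy => simp only [map_add, hx, hy]
  | hm i a ha =>
    rw [sgn_of_mem _ ha, sgn_of_mem _ ha]
    congr 1
    rw [Int.negOnePow_eq_iff, ← sub_mul]
    exact h.mul_right i

@[simp] theorem sgn_one_sgn_one (a : A.carrier) : A.sgn 1 (A.sgn 1 a) = a := by
  rw [sgn_sgn, sgn_eq_of_even (n := 0) (by decide), sgn_zero]

theorem sgn_neg_one (a : A.carrier) : A.sgn (-1) a = A.sgn 1 a := sgn_eq_of_even (by decide) a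

theorem d_one : A.d 1 = 0 := by
  have h := A.leibniz 1 A.one_mem
  simpa using h

/-- Linearity in `a` removes the homogeneity assumption once the sign of the Leibniz rule is
absorbed into `sgn 1`. Identities in a left variable can then be checked without decomposing it. -/
theorem leibniz_sgn (a b : A.carrier) : A.d (a * b) = A.d a * b + A.sgn 1 a * A.d b := by
  induction a using graded_induction A.isInternal with
  | h0 => simp
  | ha x y hx hy => simp only [map_add, add_mul, hx, hy]; abel
  | hm i a ha => rw [A.leibniz b ha, sgn_of_mem _ ha, one_mul, smul_mul_assoc]

/-- The differential shifts degrees by one, so exchanging it with the sign (-1)^(n|a|) costs (-1)^n.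
-/
theorem d_sgn (n : ℤ) (a : A.carrier) : A.d (A.sgn n a) = n.negOnePow • A.sgn n (A.d a) := by
  induction a using graded_induction A.isInternal with
  | h0 => simp
  | ha x y hx hy => simp only [map_add, smul_add, hx, hy]
  | hm i a ha =>
    rw [sgn_of_mem _ ha, sgn_of_mem _ (A.d_mem ha), map_units_smul, smul_smul,
      ← Int.negOnePow_add]
    congr 1
    rw [Int.negOnePow_eq_iff]
    exact ⟨-n, by ring⟩

end DGAlgebra

/-! ### Bimodule maps of arbitrary degree and homotopies -/

namespace DGBimod

variable {k : Type u} [Field k] {A : DGAlgebra k}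

/-- Bimodule maps of degree `n`, with the Koszul sign `φ (a m) = (-1)^(n|a|) a φ(m)`. -/
structure IsKHom (n : ℤ) {M N : DGBimod A} (φ : M.carrier →ₗ[k] N.carrier) : Prop where
  map_smul : ∀ (a : A.carrier) (m : M.carrier), φ (a • m) = A.sgn n a • φ m
  map_op_smul : ∀ (a : A.carrier) (m : M.carrier),
    φ (MulOpposite.op a • m) = MulOpposite.op a • φ m
  map_gr : ∀ i, ∀ m ∈ M.gr i, φ m ∈ N.gr (i + n)

theorem leibniz_left_sgn (M : DGBimod A) (a : A.carrier) (m : M.carrier) :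
    M.d (a • m) = A.d a • m + A.sgn 1 a • M.d m := by
  induction a using graded_induction A.isInternal with
  | h0 => simp
  | ha x y hx hy => simp only [map_add, add_smul, hx, hy]; abel
  | hm i a ha =>
    rw [M.leibniz_left m ha, DGAlgebra.sgn_of_mem _ ha, one_mul, Units.smul_def, Units.smul_def,
      smul_assoc]

theorem smul_op_smul_mem {M : DGBimod A} {i j l : ℤ} {a b : A.carrier} {m : M.carrier}
    (ha : a ∈ A.gr i) (hm : m ∈ M.gr j) (hb : b ∈ A.gr l) :
    a • MulOpposite.op b • m ∈ M.gr (i + j + l) := by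
  have := M.smul_mem ha (M.op_smul_mem hm hb)
  rwa [← add_assoc] at this

theorem units_smul_smul {M : DGBimod A} (c : ℤˣ) (a : A.carrier) (m : M.carrier) :
    (c • a) • m = c • a • m := by
  rw [Units.smul_def, Units.smul_def, smul_assoc]

theorem smul_units_smul {M : DGBimod A} (c : ℤˣ) (a : A.carrier) (m : M.carrier) :
    a • c • m = c • a • m := by
  rw [Units.smul_def, Units.smul_def, smul_comm]

theorem op_smul_units_smul {M : DGBimod A} (c : ℤˣ) (a : A.carrierᵐᵒᵖ) (m : M.carrier) :
    a • c • m = c • a • m := by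
  rw [Units.smul_def, Units.smul_def, smul_comm]

namespace IsKHom

variable {M N P : DGBimod A} {n : ℤ}

theorem add {φ ψ : M.carrier →ₗ[k] N.carrier} (hφ : IsKHom n φ) (hψ : IsKHom n ψ) :
    IsKHom n (φ + ψ) where
  map_smul a m := by simp [hφ.map_smul, hψ.map_smul]
  map_op_smul a m := by simp [hφ.map_op_smul, hψ.map_op_smul]
  map_gr i m hm := add_mem (hφ.map_gr i m hm) (hψ.map_gr i m hm)

theorem neg {φ : M.carrier →ₗ[k] N.carrier} (hφ : IsKHom n φ) : IsKHom n (-φ) where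
  map_smul a m := by simp [hφ.map_smul]
  map_op_smul a m := by simp [hφ.map_op_smul]
  map_gr i m hm := neg_mem (hφ.map_gr i m hm)

theorem sub {φ ψ : M.carrier →ₗ[k] N.carrier} (hφ : IsKHom n φ) (hψ : IsKHom n ψ) :
    IsKHom n (φ - ψ) := by
  rw [sub_eq_add_neg]; exact hφ.add hψ.neg

theorem zero : IsKHom n (0 : M.carrier →ₗ[k] N.carrier) where
  map_smul a m := by simp
  map_op_smul a m := by simp
  map_gr i m hm := zero_mem _

theorem comp {m n p : ℤ} {ψ : N.carrier →ₗ[k] P.carrier} {φ : M.carrier →ₗ[k] N.carrier}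
    (hψ : IsKHom m ψ) (hφ : IsKHom n φ) (hp : n + m = p) : IsKHom p (ψ ∘ₗ φ) where
  map_smul a x := by
    simp only [LinearMap.comp_apply, hφ.map_smul, hψ.map_smul, DGAlgebra.sgn_sgn]
    rw [← hp, add_comm]
  map_op_smul a x := by simp [hφ.map_op_smul, hψ.map_op_smul]
  map_gr i x hx := by
    have := hψ.map_gr _ _ (hφ.map_gr i x hx)
    rwa [add_assoc, hp] at this

theorem of_hom (f : M ⟶ N) : IsKHom 0 f.toLinearMap where
  map_smul a m := by simp [f.map_smul]
  map_op_smul := f.map_op_smul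
  map_gr i m hm := by simpa using f.map_gr i m hm

/-- A closed bimodule map of degree `0`, as a morphism. -/
def toHom {φ : M.carrier →ₗ[k] N.carrier} (hφ : IsKHom 0 φ) (hd : ∀ m, φ (M.d m) = N.d (φ m)) :
    M ⟶ N where
  toLinearMap := φ
  map_smul a m := by simpa using hφ.map_smul a m
  map_op_smul := hφ.map_op_smul
  map_gr i m hm := by simpa using hφ.map_gr i m hm
  map_d := hd

@[simp] theorem toHom_toLinearMap {φ : M.carrier →ₗ[k] N.carrier} (hφ : IsKHom 0 φ)
    (hd : ∀ m, φ (M.d m) = N.d (φ m)) : (toHom hφ hd).toLinearMap = φ := rfl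

/-- The general commutator `[d, h] = d h - (-1)^n h d` is a bimodule map. -/
theorem commutator' {M N : DGBimod A} {n : ℤ}
    {h : M.carrier →ₗ[k] N.carrier} (hh : IsKHom n h) :
    IsKHom (n + 1) (N.d ∘ₗ h - n.negOnePow • (h ∘ₗ M.d)) where
  map_smul a m := by
    have e : ∀ x : N.carrier, A.sgn (n + 1) a • x = A.sgn 1 (A.sgn n a) • x := fun x => by
      rw [DGAlgebra.sgn_sgn, add_comm]
    have e' : ∀ x : N.carrier, A.sgn n (A.sgn 1 a) • x = A.sgn 1 (A.sgn n a) • x := fun x => by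
      rw [DGAlgebra.sgn_sgn, DGAlgebra.sgn_sgn, add_comm]
    simp only [LinearMap.sub_apply, LinearMap.smul_apply, LinearMap.comp_apply, hh.map_smul,
      leibniz_left_sgn, map_add, smul_add, DGAlgebra.d_sgn, e, e', smul_sub, units_smul_smul,
      smul_units_smul]
    abel
  map_op_smul a m := by
    induction m using graded_induction M.isInternal with
    | h0 => simp
    | ha x y hx hy => simp only [smul_add, map_add, hx, hy]
    | hm i m hm =>
      simp only [LinearMap.sub_apply, LinearMap.smul_apply, LinearMap.comp_apply, hh.map_op_smul,
        M.leibniz_right a hm, N.leibniz_right a (hh.map_gr i m hm), map_add, map_units_smul,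
        smul_add, smul_smul, smul_sub, op_smul_units_smul, Int.negOnePow_add]
      rw [mul_comm i.negOnePow]
      abel
  map_gr i m hm := by
    have h1 := N.d_mem (hh.map_gr i m hm)
    have h2 := hh.map_gr _ _ (M.d_mem hm)
    rw [add_assoc] at h1
    rw [add_assoc, add_comm 1 n] at h2
    exact sub_mem h1 (units_smul_mem _ h2)

/-- The commutator `[d, h]` of a bimodule map of degree `-1` is a bimodule map. -/
theorem commutator {h : M.carrier →ₗ[k] N.carrier} (hh : IsKHom (-1) h) :
    IsKHom 0 (N.d ∘ₗ h + h ∘ₗ M.d) := by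
  have := hh.commutator'
  simpa using this

end IsKHom

@[simp] theorem id_toLinearMap (M : DGBimod A) : Hom.toLinearMap (𝟙 M) = LinearMap.id := rfl

@[simp] theorem comp_toLinearMap {M N P : DGBimod A} (f : M ⟶ N) (g : N ⟶ P) :
    (f ≫ g).toLinearMap = g.toLinearMap ∘ₗ f.toLinearMap := rfl

/-- Homotopy of morphisms of dg bimodules. -/
def Homotopic {M N : DGBimod A} (f g : M ⟶ N) : Prop :=
  ∃ h : M.carrier →ₗ[k] N.carrier, IsKHom (-1) h ∧
    f.toLinearMap - g.toLinearMap = N.d ∘ₗ h + h ∘ₗ M.d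

namespace Homotopic

variable {M N P : DGBimod A}

theorem refl (f : M ⟶ N) : Homotopic f f := ⟨0, .zero, by simp⟩

theorem symm {f g : M ⟶ N} : Homotopic f g → Homotopic g f := by
  rintro ⟨h, hh, e⟩
  exact ⟨-h, hh.neg, by rw [← neg_sub, e]; simp [add_comm]⟩

theorem trans {f g l : M ⟶ N} : Homotopic f g → Homotopic g l → Homotopic f l := by
  rintro ⟨h, hh, e⟩ ⟨h', hh', e'⟩
  refine ⟨h + h', hh.add hh', ?_⟩
  rw [← sub_add_sub_cancel f.toLinearMap g.toLinearMap, e, e', LinearMap.comp_add,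
    LinearMap.add_comp]
  abel

theorem comp_right {f g : M ⟶ N} (H : Homotopic f g) (l : N ⟶ P) : Homotopic (f ≫ l) (g ≫ l) := by
  obtain ⟨h, hh, e⟩ := H
  refine ⟨l.toLinearMap ∘ₗ h, (IsKHom.of_hom l).comp hh (by norm_num), ?_⟩
  ext m
  have := LinearMap.congr_fun e m
  simp only [LinearMap.sub_apply, LinearMap.add_apply, LinearMap.comp_apply] at this
  simp [← map_sub, this, l.map_d]

end Homotopic

end DGBimod

/-! ### Quasi-isomorphisms in terms of representatives -/

section QuasiIso

variable {k : Type u} [Field k] {V W : Type u} [AddCommGroup V] [Module k V] [AddCommGroup W]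
  [Module k W] {gr : ℤ → Submodule k V} {d : V →ₗ[k] V} {gr' : ℤ → Submodule k W}
  {d' : W →ₗ[k] W}

/-- Injectivity and surjectivity on the quotients, spelled out on cocycles. Later arguments about
quasi-isomorphisms use these two clauses and leave the quotient spaces aside. -/
theorem cohomologyMap_bijective_iff (f : V →ₗ[k] W) (hgr : ∀ n, ∀ v ∈ gr n, f v ∈ gr' n)
    (hd : ∀ v, f (d v) = d' (f v)) (n : ℤ) :
    Function.Bijective (cohomologyMap f hgr hd n) ↔
      (∀ v ∈ gr n, d v = 0 → (∃ w ∈ gr' (n - 1), d' w = f v) → ∃ u ∈ gr (n - 1), d u = v) ∧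
      (∀ w ∈ gr' n, d' w = 0 → ∃ v ∈ gr n, d v = 0 ∧ ∃ u ∈ gr' (n - 1), f v = w + d' u) := by
  refine and_congr ?_ ?_
  · rw [injective_iff_map_eq_zero]
    constructor
    · rintro H v hv hdv ⟨w, hw, e⟩
      have := H (Submodule.Quotient.mk ⟨v, hv, hdv⟩) (by
        rw [cohomologyMap, Submodule.mapQ_apply, Submodule.Quotient.mk_eq_zero]
        exact ⟨w, hw, e⟩)
      rw [Submodule.Quotient.mk_eq_zero] at this
      obtain ⟨u, hu, e⟩ := this
      exact ⟨u, hu, e⟩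
    · intro H x hx
      induction x using Submodule.Quotient.induction_on with
      | H x =>
      obtain ⟨v, hv⟩ := x
      rw [cohomologyMap, Submodule.mapQ_apply, Submodule.Quotient.mk_eq_zero] at hx
      obtain ⟨w, hw, e⟩ := hx
      obtain ⟨u, hu, e⟩ := H v hv.1 hv.2 ⟨w, hw, e⟩
      rw [Submodule.Quotient.mk_eq_zero]
      exact ⟨u, hu, e⟩
  · constructor
    · intro H w hw hdw
      obtain ⟨x, hx⟩ := H (Submodule.Quotient.mk ⟨w, hw, hdw⟩)
      induction x using Submodule.Quotient.induction_on with
      | H x =>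
      obtain ⟨v, hv⟩ := x
      rw [cohomologyMap, Submodule.mapQ_apply, Submodule.Quotient.eq] at hx
      obtain ⟨u, hu, e⟩ := hx
      refine ⟨v, hv.1, hv.2, u, hu, ?_⟩
      rw [e]
      change f v = w + (f v - w)
      abel
    · intro H x
      induction x using Submodule.Quotient.induction_on with
      | H x =>
      obtain ⟨w, hw⟩ := x
      obtain ⟨v, hv, hdv, u, hu, e⟩ := H w hw.1 hw.2
      refine ⟨Submodule.Quotient.mk ⟨v, hv, hdv⟩, ?_⟩
      rw [cohomologyMap, Submodule.mapQ_apply, Submodule.Quotient.eq]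
      refine ⟨u, hu, ?_⟩
      change d' u = f v - w
      rw [e]
      abel

end QuasiIso

end NCWeil

namespace NCWeil

/-! ### Homotopy fibres, K-projective bimodules and path objects -/

namespace DGBimod

variable {k : Type u} [Field k] {A : DGAlgebra k}

/-- The space underlying the desuspension of a bimodule. -/
def Tw (N : DGBimod A) : Type u := N.carrier

section Tw

variable (N : DGBimod A)

instance : AddCommGroup (Tw N) := inferInstanceAs (AddCommGroup N.carrier)

instance : Module k (Tw N) := inferInstanceAs (Module k N.carrier)

instance : Module A.carrierᵐᵒᵖ (Tw N) := inferInstanceAs (Module A.carrierᵐᵒᵖ N.carrier)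

instance : IsScalarTower k A.carrierᵐᵒᵖ (Tw N) :=
  inferInstanceAs (IsScalarTower k A.carrierᵐᵒᵖ N.carrier)

/-- Moving `a` past the shift produces the sign (-1)^|a|, hence the twist by `sgn 1`. The right
action passes nothing and keeps its form. -/
noncomputable instance : Module A.carrier (Tw N) :=
  Module.compHom N.carrier ((A.sgn 1 : A.carrier →ₐ[k] A.carrier) : A.carrier →+* A.carrier)

/-- The identity, from the bimodule to its desuspension. -/
def toTw : N.carrier ≃ₗ[k] Tw N := LinearEquiv.refl k N.carrier

variable {N}

instance : SMulCommClass A.carrier A.carrierᵐᵒᵖ (Tw N) where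
  smul_comm a b m := smul_comm (M := A.carrier) (N := A.carrierᵐᵒᵖ) (α := N.carrier) (A.sgn 1 a) b m

instance : IsScalarTower k A.carrier (Tw N) where
  smul_assoc c a m := by
    change (A.sgn 1 (c • a) • (show N.carrier from m)) = c • (A.sgn 1 a • (show N.carrier from m))
    rw [map_smul, smul_assoc]

end Tw

theorem isInternal_prod {V W : Type*} [AddCommGroup V] [Module k V] [AddCommGroup W] [Module k W]
    {g : ℤ → Submodule k V} {g' : ℤ → Submodule k W} (h : DirectSum.IsInternal g)
    (h' : DirectSum.IsInternal g') : DirectSum.IsInternal fun n => (g n).prod (g' n) := by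
  refine isInternal_of_proj _ (fun n => (gproj h n).prodMap (gproj h' n)) ?_ ?_ ?_
  · rintro n ⟨x, y⟩ ⟨hx, hy⟩
    exact Prod.ext (gproj_of_mem h hx) (gproj_of_mem h' hy)
  · rintro n m hm ⟨x, y⟩ ⟨hx, hy⟩
    exact Prod.ext (gproj_of_mem_ne h hx hm) (gproj_of_mem_ne h' hy hm)
  · rw [eq_top_iff]
    rintro ⟨x, y⟩ -
    have e : (x, y) = LinearMap.inl k V W x + LinearMap.inr k V W y := by simp
    rw [e]
    refine add_mem ?_ ?_
    · induction x using graded_induction h with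
      | h0 => rw [map_zero]; exact zero_mem _
      | ha x x' hx hx' => rw [map_add]; exact add_mem (hx (by simp)) (hx' (by simp))
      | hm i x hx => exact Submodule.mem_iSup_of_mem i ⟨hx, zero_mem _⟩
    · induction y using graded_induction h' with
      | h0 => rw [map_zero]; exact zero_mem _
      | ha x x' hx hx' => rw [map_add]; exact add_mem (hx (by simp)) (hx' (by simp))
      | hm i x hx => exact Submodule.mem_iSup_of_mem i ⟨zero_mem _, hx⟩

theorem isInternal_shift {V : Type*} [AddCommGroup V] [Module k V]
    {g : ℤ → Submodule k V} (h : DirectSum.IsInternal g) (m : ℤ) :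
    DirectSum.IsInternal fun n => g (n + m) := by
  refine isInternal_of_proj _ (fun n => gproj h (n + m)) ?_ ?_ ?_
  · intro n x hx; exact gproj_of_mem h hx
  · intro n n' hn x hx; exact gproj_of_mem_ne h hx (by omega)
  · rw [eq_top_iff, ← h.submodule_iSup_eq_top]
    refine iSup_le fun n => le_iSup_of_le (n - m) ?_
    rw [sub_add_cancel]

/-- The homotopy fibre of a closed bimodule map of degree `0`. -/
noncomputable def cocone {M N : DGBimod A} (s : M ⟶ N) : DGBimod A where
  carrier := M.carrier × Tw N
  -- The shift is written `n + -1` so that it agrees literally with the degrees occurring in `IsKHom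
  -- (-1)`.
  gr n := (M.gr n).prod ((N.gr (n + -1)).map N.toTw.toLinearMap)
  isInternal := isInternal_prod M.isInternal (by
    have h := isInternal_shift N.isInternal (-1)
    have e : (fun n => (N.gr (n + -1)).map N.toTw.toLinearMap) = fun n => N.gr (n + -1) := by
      funext n; exact Submodule.map_id _
    rw [e]; exact h)
  smul_mem {i j a m} ha hm := by
    obtain ⟨m, n⟩ := m
    obtain ⟨hm, n, hn, rfl⟩ := hm
    refine ⟨M.smul_mem ha hm, A.sgn 1 a • n, ?_, rfl⟩
    have := N.smul_mem (DGAlgebra.sgn_mem 1 ha) hn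
    rwa [← add_assoc] at this
  op_smul_mem {i j m a} hm ha := by
    obtain ⟨m, n⟩ := m
    obtain ⟨hm, n, hn, rfl⟩ := hm
    refine ⟨M.op_smul_mem hm ha, MulOpposite.op a • n, ?_, rfl⟩
    have := N.op_smul_mem hn ha
    rwa [add_right_comm] at this
  d := (M.d ∘ₗ LinearMap.fst k _ _).prod
    (N.toTw.toLinearMap ∘ₗ (s.toLinearMap ∘ₗ LinearMap.fst k _ _ -
      N.d ∘ₗ N.toTw.symm.toLinearMap ∘ₗ LinearMap.snd k _ _))
  d_mem {n m} hm := by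
    obtain ⟨m, x⟩ := m
    obtain ⟨hm, x, hx, rfl⟩ := hm
    refine ⟨M.d_mem hm, s.toLinearMap m - N.d x, ?_, rfl⟩
    have h1 := s.map_gr _ _ hm
    have h2 := N.d_mem hx
    rw [show n + -1 + 1 = n by ring] at h2
    rw [show n + 1 + -1 = n by ring]
    exact sub_mem h1 h2
  d_d := by
    rintro ⟨m, x⟩
    refine Prod.ext (M.d_d m) (congrArg N.toTw ?_)
    change s.toLinearMap (M.d m) - N.d (s.toLinearMap m - N.d (N.toTw.symm x)) = 0
    simp [s.map_d, N.d_d]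
  leibniz_left {i a} := by
    rintro ⟨m, x⟩ ha
    obtain ⟨x, rfl⟩ := N.toTw.surjective x
    refine Prod.ext (M.leibniz_left m ha) (congrArg N.toTw ?_)
    change s.toLinearMap (a • m) - N.d (A.sgn 1 a • x) = A.sgn 1 (A.d a) • x +
      i.negOnePow • (A.sgn 1 a • (s.toLinearMap m - N.d x))
    have h := DGAlgebra.d_sgn 1 a
    rw [leibniz_left_sgn, s.map_smul, DGAlgebra.sgn_one_sgn_one, h, DGAlgebra.sgn_of_mem _ ha]
    simp only [one_mul, units_smul_smul, smul_smul, smul_sub]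
    simp
    abel
  leibniz_right {i m} a hm := by
    obtain ⟨m, x⟩ := m
    obtain ⟨hm, x, hx, rfl⟩ := hm
    refine Prod.ext (M.leibniz_right a hm) (congrArg N.toTw ?_)
    change s.toLinearMap (MulOpposite.op a • m) - N.d (MulOpposite.op a • x) =
      MulOpposite.op a • (s.toLinearMap m - N.d x) + i.negOnePow • (MulOpposite.op (A.d a) • x)
    rw [N.leibniz_right a hx, s.map_op_smul, Int.negOnePow_add, smul_sub]
    simp
    abel

/-- A dg bimodule without cohomology. -/
def Acyclic (M : DGBimod A) : Prop := ∀ n, ∀ m ∈ M.gr n, M.d m = 0 → ∃ u ∈ M.gr (n - 1), M.d u = m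

/-- K-projective bimodules: closed maps to acyclic bimodules are nullhomotopic. -/
def KProj (P : DGBimod A) : Prop :=
  ∀ (Y : DGBimod A) (_ : Acyclic Y) (n : ℤ) (φ : P.carrier →ₗ[k] Y.carrier), IsKHom n φ →
    (∀ p, Y.d (φ p) = n.negOnePow • φ (P.d p)) → ∃ h : P.carrier →ₗ[k] Y.carrier,
      IsKHom (n - 1) h ∧ ∀ p, φ p = Y.d (h p) + n.negOnePow • h (P.d p)

theorem quasiIso_iff {M N : DGBimod A} (f : M ⟶ N) : quasiIso A f ↔ ∀ n,
    (∀ v ∈ M.gr n, M.d v = 0 → (∃ w ∈ N.gr (n - 1), N.d w = f.toLinearMap v) →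
      ∃ u ∈ M.gr (n - 1), M.d u = v) ∧
    (∀ w ∈ N.gr n, N.d w = 0 → ∃ v ∈ M.gr n, M.d v = 0 ∧
      ∃ u ∈ N.gr (n - 1), f.toLinearMap v = w + N.d u) :=
  forall_congr' fun n => cohomologyMap_bijective_iff f.toLinearMap f.map_gr f.map_d n

/-- A cocycle (y, y') of the fibre satisfies d y = 0 and s y = d y'. Injectivity on Hⁿ gives x with
d x = y. Then s x - y' is a cocycle, and surjectivity on Hⁿ⁻¹ gives a cocycle z such that
subtracting z from x makes both coordinates match. -/
theorem acyclic_cocone {M N : DGBimod A} {s : M ⟶ N} (hs : quasiIso A s) :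
    Acyclic (cocone s) := by
  rw [quasiIso_iff] at hs
  rintro n ⟨y, y'⟩ ⟨hy, y', hy', rfl⟩ hd
  have h1 : M.d y = 0 := congrArg Prod.fst hd
  have h2 : s.toLinearMap y - N.d y' = 0 := congrArg Prod.snd hd
  rw [sub_eq_zero] at h2
  obtain ⟨x, hx, e⟩ := (hs n).1 y hy h1 ⟨y', hy', h2.symm⟩
  obtain ⟨z, hz, hdz, w, hw, e'⟩ := (hs (n - 1)).2 (s.toLinearMap x - y')
    (sub_mem (s.map_gr _ _ hx) hy') (by rw [map_sub, ← s.map_d, e, h2, sub_self])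
  refine ⟨(x - z, N.toTw (-w)), ⟨sub_mem hx hz, -w, neg_mem hw, rfl⟩, ?_⟩
  refine Prod.ext ?_ (congrArg N.toTw ?_)
  · change M.d (x - z) = y
    rw [map_sub, e, hdz, sub_zero]
  · change s.toLinearMap (x - z) - N.d (-w) = y'
    rw [map_sub, e', map_neg]
    abel

/-- A K-projective bimodule sees quasi-isomorphisms as surjective up to homotopy. -/
theorem KProj.lift {P M N : DGBimod A} (hP : KProj P) {s : M ⟶ N} (hs : quasiIso A s)
    (f : P ⟶ N) : ∃ g : P ⟶ M, Homotopic (g ≫ s) f := by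
  -- Placed in the second factor of the fibre, `f` is closed of degree 1. The first coordinate of a
  -- nullhomotopy is the lift, the second is the homotopy from `g ≫ s` to `f`.
  obtain ⟨h, hh, e⟩ := hP (cocone s) (acyclic_cocone hs) 1
    (LinearMap.inr k _ _ ∘ₗ N.toTw.toLinearMap ∘ₗ f.toLinearMap)
    { map_smul := fun a p => by
        refine Prod.ext ?_ (congrArg N.toTw ?_)
        · change (0 : M.carrier) = A.sgn 1 a • (0 : M.carrier)
          rw [smul_zero]
        · change f.toLinearMap (a • p) = A.sgn 1 (A.sgn 1 a) • f.toLinearMap p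
          rw [DGAlgebra.sgn_one_sgn_one, f.map_smul]
      map_op_smul := fun a p => by
        refine Prod.ext ?_ (congrArg N.toTw (f.map_op_smul a p))
        change (0 : M.carrier) = MulOpposite.op a • (0 : M.carrier)
        rw [smul_zero]
      map_gr := fun i p hp => ⟨zero_mem _, f.toLinearMap p, by
        have := f.map_gr i p hp
        rw [show i = i + 1 + -1 by ring] at this
        exact this, rfl⟩ }
    (fun p => by
      refine Prod.ext ?_ (congrArg N.toTw ?_)
      · change M.d 0 = (1 : ℤ).negOnePow • (0 : M.carrier)
        simp
      · change s.toLinearMap 0 - N.d (f.toLinearMap p) =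
          (1 : ℤ).negOnePow • f.toLinearMap (P.d p)
        simp [f.map_d])
  have e1 : ∀ p, 0 = M.d (h p).1 - (h (P.d p)).1 := fun p => by
    have := congrArg Prod.fst (e p)
    simp only [Int.negOnePow_one, Units.neg_smul, one_smul] at this
    rw [sub_eq_add_neg]
    exact this
  have e2 : ∀ p, f.toLinearMap p = s.toLinearMap (h p).1 - N.d (N.toTw.symm (h p).2) -
      N.toTw.symm (h (P.d p)).2 := fun p => by
    have := congrArg Prod.snd (e p)
    simp only [Int.negOnePow_one, Units.neg_smul, one_smul] at this
    rw [sub_eq_add_neg (_ - _)]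
    exact this
  have hsm : ∀ (a : A.carrier) (p : P.carrier), h (a • p) = a • h p := fun a p => by
    have := hh.map_smul a p
    rw [sub_self, DGAlgebra.sgn_zero] at this
    exact this
  refine ⟨⟨LinearMap.fst k M.carrier (Tw N) ∘ₗ h, fun a p => congrArg Prod.fst (hsm a p),
    fun a p => congrArg Prod.fst (hh.map_op_smul a p), fun i p hp => ?_, fun p => ?_⟩,
    N.toTw.symm.toLinearMap ∘ₗ LinearMap.snd k M.carrier (Tw N) ∘ₗ h,
    ⟨fun a p => by
      rw [DGAlgebra.sgn_neg_one]
      exact congrArg Prod.snd (hsm a p), fun a p => congrArg Prod.snd (hh.map_op_smul a p),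
      fun i p hp => ?_⟩, ?_⟩
  · have := (hh.map_gr i p hp).1
    rwa [sub_self, add_zero] at this
  · exact (sub_eq_zero.mp (e1 p).symm).symm
  · obtain ⟨x, hx, ex⟩ := (hh.map_gr i p hp).2
    rw [sub_self, add_zero] at hx
    change (h p).2 ∈ _
    rw [← ex]
    exact hx
  · ext p
    change s.toLinearMap (h p).1 - f.toLinearMap p = N.d (N.toTw.symm (h p).2) +
      N.toTw.symm (h (P.d p)).2
    rw [e2]
    abel

/-- A K-projective bimodule sees quasi-isomorphisms as injective up to homotopy. -/
theorem KProj.homotopic_of_comp {P M N : DGBimod A} (hP : KProj P) {s : M ⟶ N}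
    (hs : quasiIso A s) {f g : P ⟶ M} (H : Homotopic (f ≫ s) (g ≫ s)) : Homotopic f g := by
  obtain ⟨h, hh, e⟩ := H
  have e' : ∀ p, s.toLinearMap (f.toLinearMap p - g.toLinearMap p) = N.d (h p) + h (P.d p) :=
    fun p => by
      have := LinearMap.congr_fun e p
      simpa using this
  -- The difference of `f` and `g` together with the given homotopy `h` is a closed map of degree 0
  -- into the fibre. The first coordinate of its contraction is the required homotopy.
  obtain ⟨l, hl, el⟩ := hP (cocone s) (acyclic_cocone hs) 0
    ((f.toLinearMap - g.toLinearMap).prod (N.toTw.toLinearMap ∘ₗ h))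
    { map_smul := fun a p => by
        rw [DGAlgebra.sgn_zero]
        refine Prod.ext ?_ (congrArg N.toTw ?_)
        · change f.toLinearMap (a • p) - g.toLinearMap (a • p) =
            a • (f.toLinearMap p - g.toLinearMap p)
          rw [f.map_smul, g.map_smul, smul_sub]
        · change h (a • p) = A.sgn 1 a • h p
          rw [hh.map_smul, DGAlgebra.sgn_neg_one]
      map_op_smul := fun a p => by
        refine Prod.ext ?_ (congrArg N.toTw (hh.map_op_smul a p))
        change f.toLinearMap (MulOpposite.op a • p) - g.toLinearMap (MulOpposite.op a • p) =
            MulOpposite.op a • (f.toLinearMap p - g.toLinearMap p)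
        rw [f.map_op_smul, g.map_op_smul, smul_sub]
      map_gr := fun i p hp => by
        rw [add_zero]
        exact ⟨sub_mem (f.map_gr i p hp) (g.map_gr i p hp), h p, hh.map_gr i p hp, rfl⟩ }
    (fun p => by
      rw [Int.negOnePow_zero, one_smul]
      refine Prod.ext ?_ (congrArg N.toTw ?_)
      · change M.d (f.toLinearMap p - g.toLinearMap p) =
          f.toLinearMap (P.d p) - g.toLinearMap (P.d p)
        rw [map_sub, f.map_d, g.map_d]
      · change s.toLinearMap (f.toLinearMap p - g.toLinearMap p) - N.d (h p) = h (P.d p)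
        rw [e']
        abel)
  refine ⟨LinearMap.fst k M.carrier (Tw N) ∘ₗ l,
    ⟨fun a p => congrArg Prod.fst (hl.map_smul a p),
      fun a p => congrArg Prod.fst (hl.map_op_smul a p), fun i p hp => (hl.map_gr i p hp).1⟩, ?_⟩
  ext p
  have := congrArg Prod.fst (el p)
  rw [Int.negOnePow_zero, one_smul] at this
  exact this

/-- The product of two dg bimodules. -/
def prod (M N : DGBimod A) : DGBimod A where
  carrier := M.carrier × N.carrier
  gr n := (M.gr n).prod (N.gr n)
  isInternal := isInternal_prod M.isInternal N.isInternal
  smul_mem ha hm := ⟨M.smul_mem ha hm.1, N.smul_mem ha hm.2⟩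
  op_smul_mem hm ha := ⟨M.op_smul_mem hm.1 ha, N.op_smul_mem hm.2 ha⟩
  d := M.d.prodMap N.d
  d_mem hm := ⟨M.d_mem hm.1, N.d_mem hm.2⟩
  d_d _ := Prod.ext (M.d_d _) (N.d_d _)
  leibniz_left _ ha := Prod.ext (M.leibniz_left _ ha) (N.leibniz_left _ ha)
  leibniz_right _ hm := Prod.ext (M.leibniz_right _ hm.1) (N.leibniz_right _ hm.2)

/-- The difference map `N × N ⟶ N`. -/
def prodSub (N : DGBimod A) : prod N N ⟶ N where
  toLinearMap := LinearMap.fst k _ _ - LinearMap.snd k _ _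
  map_smul a _ := (smul_sub a _ _).symm
  map_op_smul a _ := (smul_sub (MulOpposite.op a) _ _).symm
  map_gr _ _ hm := sub_mem hm.1 hm.2
  map_d _ := (map_sub N.d _ _).symm

/-- The path object of a dg bimodule. -/
noncomputable abbrev path (N : DGBimod A) : DGBimod A := cocone (prodSub N)

/-- The constant paths. -/
noncomputable def pathConst (N : DGBimod A) : N ⟶ path N where
  toLinearMap := (LinearMap.id.prod LinearMap.id).prod 0
  map_smul a _ := Prod.ext rfl (smul_zero (M := A.carrier) (A := Tw N) a).symm
  map_op_smul _ _ := Prod.ext rfl (smul_zero (M := A.carrierᵐᵒᵖ) (A := Tw N) _).symm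
  map_gr _ _ hm := ⟨⟨hm, hm⟩, zero_mem _⟩
  map_d m := Prod.ext rfl (by
    change 0 = (m - m) - N.d 0
    simp)

/-- The first end point. -/
noncomputable def pathFst (N : DGBimod A) : path N ⟶ N where
  toLinearMap := LinearMap.fst k _ _ ∘ₗ LinearMap.fst k (N.carrier × N.carrier) (Tw N)
  map_smul _ _ := rfl
  map_op_smul _ _ := rfl
  map_gr _ _ hm := hm.1.1
  map_d _ := rfl

/-- The second end point. -/
noncomputable def pathSnd (N : DGBimod A) : path N ⟶ N where
  toLinearMap := LinearMap.snd k _ _ ∘ₗ LinearMap.fst k (N.carrier × N.carrier) (Tw N)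
  map_smul _ _ := rfl
  map_op_smul _ _ := rfl
  map_gr _ _ hm := hm.1.2
  map_d _ := rfl

/-- For a cocycle ((y, y'), z) of the path object one has y - y' = d z, so the constant path at y
differs from it by the boundary of ((0, z), 0). Injectivity is read off at the first end point. -/
theorem quasiIso_pathConst (N : DGBimod A) : quasiIso A (pathConst N) := by
  rw [quasiIso_iff]
  refine fun n => ⟨?_, ?_⟩
  · rintro v hv hdv ⟨⟨w, z⟩, hw, e⟩
    exact ⟨w.1, hw.1.1, congrArg (fun x => x.1.1) e⟩
  · rintro ⟨⟨y, y'⟩, z⟩ ⟨⟨hy, hy'⟩, z, hz, rfl⟩ hd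
    have h1 : N.d y = 0 := congrArg (fun x => x.1.1) hd
    have h3 : y - y' - N.d z = 0 := congrArg Prod.snd hd
    rw [sub_eq_zero] at h3
    refine ⟨y, hy, h1, ((0, z), 0), ⟨⟨zero_mem _, hz⟩, zero_mem _⟩, ?_⟩
    refine Prod.ext (Prod.ext ?_ ?_) ?_
    · change y = y + N.d 0
      simp
    · change y = y' + N.d z
      rw [← h3]
      abel
    · change 0 = z + ((0 - z) - N.d 0)
      simp

/-- A homotopy is a morphism to the path object with end points `f` and `g`. Both end point maps are
retractions of the constant path map, which `Q` inverts, so they become equal in the derived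
category. -/
theorem Q_map_eq_of_homotopic {M N : DGBimod A} {f g : M ⟶ N} (H : Homotopic f g) :
    (quasiIso A).Q.map f = (quasiIso A).Q.map g := by
  obtain ⟨h, hh, e⟩ := H
  have e' : ∀ p, f.toLinearMap p - g.toLinearMap p = N.d (h p) + h (M.d p) := fun p => by
    simpa using LinearMap.congr_fun e p
  let F : M ⟶ path N :=
    { toLinearMap := (f.toLinearMap.prod g.toLinearMap).prod (N.toTw.toLinearMap ∘ₗ h)
      map_smul := fun a m => Prod.ext (Prod.ext (f.map_smul a m) (g.map_smul a m)) (by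
        change h (a • m) = A.sgn 1 a • h m
        rw [hh.map_smul, DGAlgebra.sgn_neg_one])
      map_op_smul := fun a m => Prod.ext (Prod.ext (f.map_op_smul a m) (g.map_op_smul a m))
        (hh.map_op_smul a m)
      map_gr := fun i m hm => ⟨⟨f.map_gr i m hm, g.map_gr i m hm⟩, h m, hh.map_gr i m hm, rfl⟩
      map_d := fun m => Prod.ext (Prod.ext (f.map_d m) (g.map_d m)) (by
        change h (M.d m) = f.toLinearMap m - g.toLinearMap m - N.d (h m)
        rw [e']
        abel) }
  have hc : IsIso ((quasiIso A).Q.map (pathConst N)) :=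
    (quasiIso A).Q_inverts _ (quasiIso_pathConst N)
  have h12 : (quasiIso A).Q.map (pathFst N) = (quasiIso A).Q.map (pathSnd N) := by
    rw [← cancel_epi ((quasiIso A).Q.map (pathConst N)), ← Functor.map_comp, ← Functor.map_comp]
    rfl
  change (quasiIso A).Q.map (F ≫ pathFst N) = (quasiIso A).Q.map (F ≫ pathSnd N)
  rw [Functor.map_comp, Functor.map_comp, h12]

end DGBimod

end NCWeil

namespace NCWeil

namespace DGBimod

variable {k : Type u} [Field k] {A : DGAlgebra k}

/-! ### Direct sums of dg bimodules -/

section DirectSum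

variable {I : Type u} (Z : I → DGBimod A)

open scoped Classical in
/-- The direct sum of a family of dg bimodules. -/
noncomputable def dsum : DGBimod A where
  carrier := Π₀ i, (Z i).carrier
  gr n :=
    { carrier := {x | ∀ i, x i ∈ (Z i).gr n}
      add_mem' := fun hx hy i => add_mem (hx i) (hy i)
      zero_mem' := fun i => zero_mem _
      smul_mem' := fun c _ hx i => Submodule.smul_mem _ c (hx i) }
  isInternal := by
    refine isInternal_of_proj _
      (fun n => DFinsupp.mapRange.linearMap fun i => gproj (Z i).isInternal n) ?_ ?_ ?_
    · intro n x hx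
      ext i
      exact gproj_of_mem (Z i).isInternal (hx i)
    · intro n m hm x hx
      ext i
      exact gproj_of_mem_ne (Z i).isInternal (hx i) hm
    · rw [eq_top_iff]
      rintro x -
      induction x using DFinsupp.induction with
      | h0 => exact zero_mem _
      | ha i z x _ hz hx =>
        refine add_mem ?_ hx
        clear hx hz
        induction z using graded_induction (Z i).isInternal with
        | h0 => rw [DFinsupp.single_zero]; exact zero_mem _
        | ha x y hx hy => rw [DFinsupp.single_add]; exact add_mem hx hy
        | hm n z hz =>
          refine Submodule.mem_iSup_of_mem n fun j => ?_
          by_cases e : i = j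
          · subst e; simpa using hz
          · rw [DFinsupp.single_eq_of_ne (Ne.symm e)]; exact zero_mem _
  smul_mem ha hm i := (Z i).smul_mem ha (hm i)
  op_smul_mem hm ha i := (Z i).op_smul_mem (hm i) ha
  d := DFinsupp.mapRange.linearMap fun i => (Z i).d
  d_mem hm i := (Z i).d_mem (hm i)
  d_d m := by ext i; exact (Z i).d_d (m i)
  leibniz_left {i a} m ha := by
    ext j
    refine ((Z j).leibniz_left (m j) ha).trans ?_
    rw [Units.smul_def, Units.smul_def]
    rfl
  leibniz_right {i m} a hm := by
    ext j
    refine ((Z j).leibniz_right a (hm j)).trans ?_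
    rw [Units.smul_def, Units.smul_def]
    rfl

variable {Z}

/-- The components of an element of a direct sum. -/
noncomputable def dsumπ (i : I) : dsum Z ⟶ Z i where
  toLinearMap := DFinsupp.lapply i
  map_smul _ _ := rfl
  map_op_smul _ _ := rfl
  map_gr _ _ hm := hm i
  map_d _ := rfl

theorem dsum_ext {x y : (dsum Z).carrier}
    (h : ∀ i, (dsumπ i).toLinearMap x = (dsumπ i).toLinearMap y) : x = y :=
  DFinsupp.ext h

open scoped Classical in
/-- The inclusion of a summand, as a linear map. -/
noncomputable def dsumSingle (i : I) : (Z i).carrier →ₗ[k] (dsum Z).carrier :=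
  DFinsupp.lsingle (M := fun i => (Z i).carrier) i

open scoped Classical in
/-- The inclusion of a summand. -/
noncomputable def dsumι (i : I) : Z i ⟶ dsum Z where
  toLinearMap := dsumSingle i
  map_smul a m := DFinsupp.single_smul (β := fun i => (Z i).carrier) a m
  map_op_smul a m := DFinsupp.single_smul (β := fun i => (Z i).carrier) (MulOpposite.op a) m
  map_gr n m hm j := by
    change (DFinsupp.single i m : Π₀ i, (Z i).carrier) j ∈ (Z j).gr n
    by_cases e : i = j
    · subst e; simpa using hm
    · rw [DFinsupp.single_eq_of_ne (Ne.symm e)]; exact zero_mem _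
  map_d m := (DFinsupp.mapRange_single (β₁ := fun i => (Z i).carrier)
    (β₂ := fun i => (Z i).carrier) (f := fun i => (Z i).d) (hf := fun i => map_zero (Z i).d)).symm

theorem dsumπ_ι (i : I) (z : (Z i).carrier) :
    (dsumπ i).toLinearMap ((dsumι (Z := Z) i).toLinearMap z) = z := by
  classical
  change (DFinsupp.single i z : Π₀ i, (Z i).carrier) i = z
  exact DFinsupp.single_eq_same (β := fun i => (Z i).carrier)

theorem dsumπ_ι_ne {i j : I} (h : j ≠ i) (z : (Z i).carrier) :
    (dsumπ j).toLinearMap ((dsumι (Z := Z) i).toLinearMap z) = 0 := by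
  classical
  change (DFinsupp.single i z : Π₀ i, (Z i).carrier) j = 0
  exact DFinsupp.single_eq_of_ne (β := fun i => (Z i).carrier) h

theorem dsum_induction {p : (dsum Z).carrier → Prop} (x : (dsum Z).carrier) (h0 : p 0)
    (ha : ∀ x y, p x → p y → p (x + y)) (hs : ∀ i z, p ((dsumι (Z := Z) i).toLinearMap z)) :
    p x := by
  classical
  exact DFinsupp.induction (β := fun i => (Z i).carrier) x h0
    fun i z x _ _ hx => ha _ _ (hs i z) hx

theorem dsum_linear_ext {V : Type*} [AddCommGroup V] [Module k V]
    {f g : (dsum Z).carrier →ₗ[k] V}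
    (h : ∀ i z, f ((dsumι (Z := Z) i).toLinearMap z) = g ((dsumι (Z := Z) i).toLinearMap z)) :
    f = g := by
  ext x
  induction x using dsum_induction with
  | h0 => simp
  | ha x y hx hy => rw [map_add, map_add, hx, hy]
  | hs i z => exact h i z

open scoped Classical in
/-- The linear map out of a direct sum given by its restrictions to the summands. -/
noncomputable def dsumLift {V : Type*} [AddCommGroup V] [Module k V]
    (φ : ∀ i, (Z i).carrier →ₗ[k] V) : (dsum Z).carrier →ₗ[k] V :=
  DFinsupp.lsum ℕ φ

theorem dsumLift_ι {V : Type*} [AddCommGroup V] [Module k V]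
    (φ : ∀ i, (Z i).carrier →ₗ[k] V) (i : I) (z : (Z i).carrier) :
    dsumLift φ ((dsumι i).toLinearMap z) = φ i z := by
  classical
  change DFinsupp.sumAddHom (β := fun i => (Z i).carrier) (fun i => (φ i).toAddMonoidHom)
    (DFinsupp.single i z) = _
  exact DFinsupp.sumAddHom_single (β := fun i => (Z i).carrier)
    (fun i => (φ i).toAddMonoidHom) i z

theorem isKHom_dsumLift {N : DGBimod A} {n : ℤ} {φ : ∀ i, (Z i).carrier →ₗ[k] N.carrier}
    (h : ∀ i, IsKHom n (φ i)) : IsKHom n (M := dsum Z) (dsumLift φ) where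
  map_smul a x := by
    induction x using dsum_induction with
    | h0 => simp
    | ha x y hx hy => simp only [smul_add, map_add, hx, hy]
    | hs i z => rw [← (dsumι i).map_smul, dsumLift_ι, dsumLift_ι, (h i).map_smul]
  map_op_smul a x := by
    induction x using dsum_induction with
    | h0 => simp
    | ha x y hx hy => simp only [smul_add, map_add, hx, hy]
    | hs i z => rw [← (dsumι i).map_op_smul, dsumLift_ι, dsumLift_ι, (h i).map_op_smul]
  map_gr i x hx := by
    classical
    refine map_gr_of_span (n := n) (dsum Z).isInternal N.isInternal
      (X := {x | ∃ j l, ∃ z ∈ (Z j).gr l, x = (dsumι (Z := Z) j).toLinearMap z}) ?_ ?_ i x hx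
    · rw [eq_top_iff]
      rintro x -
      induction x using dsum_induction with
      | h0 => exact zero_mem _
      | ha x y hx hy => exact add_mem hx hy
      | hs j z =>
        induction z using graded_induction (Z j).isInternal with
        | h0 => rw [map_zero]; exact zero_mem _
        | ha x y hx hy => rw [map_add]; exact add_mem hx hy
        | hm l z hz => exact Submodule.subset_span ⟨j, l, z, hz, rfl⟩
    · rintro _ ⟨j, l, z, hz, rfl⟩
      refine ⟨l, (dsumι j).map_gr _ _ hz, ?_⟩
      rw [dsumLift_ι]
      exact (h j).map_gr _ _ hz

/-- The morphism out of a direct sum given by its restrictions to the summands. -/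
noncomputable def dsumDesc {N : DGBimod A} (f : ∀ i, Z i ⟶ N) : dsum Z ⟶ N :=
  (isKHom_dsumLift fun i => IsKHom.of_hom (f i)).toHom fun x => by
    induction x using dsum_induction with
    | h0 => simp
    | ha x y hx hy => simp only [map_add, hx, hy]
    | hs i z => rw [← (dsumι i).map_d, dsumLift_ι, dsumLift_ι, (f i).map_d]

@[ext]
theorem hom_ext {M N : DGBimod A} {f g : M ⟶ N} (h : f.toLinearMap = g.toLinearMap) : f = g :=
  Hom.ext h

@[simp]
theorem dsumι_desc {N : DGBimod A} (f : ∀ i, Z i ⟶ N) (i : I) : dsumι i ≫ dsumDesc f = f i := by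
  ext z
  exact dsumLift_ι (fun i => (f i).toLinearMap) i z

theorem dsum_hom_ext {N : DGBimod A} {f g : dsum Z ⟶ N} (h : ∀ i, dsumι i ≫ f = dsumι i ≫ g) :
    f = g := by
  apply hom_ext
  refine dsum_linear_ext fun i z => ?_
  exact LinearMap.congr_fun (congrArg Hom.toLinearMap (h i)) z

/-- A map out of a direct sum can be contracted on each summand independently. -/
theorem KProj.dsum (h : ∀ i, KProj (Z i)) : KProj (dsum Z) := by
  intro Y hY n φ hφ hd
  choose s hs e using fun i => h i Y hY n (φ ∘ₗ (dsumι (Z := Z) i).toLinearMap)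
    (hφ.comp (IsKHom.of_hom (dsumι i)) (zero_add n))
    (fun p => by simp [hd, (dsumι i).map_d])
  refine ⟨dsumLift s, isKHom_dsumLift hs, fun p => ?_⟩
  induction p using dsum_induction with
  | h0 => simp
  | ha x y hx hy => simp only [map_add, smul_add, hx, hy]; abel
  | hs i z => rw [← (dsumι i).map_d, dsumLift_ι, dsumLift_ι, ← e i z]; rfl

theorem homotopic_of_dsumι {N : DGBimod A} {f g : DGBimod.dsum Z ⟶ N}
    (h : ∀ i, Homotopic (dsumι i ≫ f) (dsumι i ≫ g)) : Homotopic f g := by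
  choose s hs e using h
  refine ⟨dsumLift s, isKHom_dsumLift hs, dsum_linear_ext fun i z => ?_⟩
  have := LinearMap.congr_fun (e i) z
  simp only [comp_toLinearMap, LinearMap.sub_apply, LinearMap.add_apply,
    LinearMap.comp_apply] at this ⊢
  rw [this, ← (dsumι i).map_d, dsumLift_ι, dsumLift_ι]

open scoped Classical in
/-- The element of a direct sum with given components in a finite set. -/
noncomputable def dsumMk (s : Finset I) (z : ∀ i, (Z i).carrier) : (dsum Z).carrier :=
  DFinsupp.mk (β := fun i => (Z i).carrier) s fun i => z i

theorem dsumπ_mk {s : Finset I} (z : ∀ i, (Z i).carrier) {i : I} (hi : i ∈ s) :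
    (dsumπ i).toLinearMap (dsumMk s z) = z i := by
  classical
  change DFinsupp.mk (β := fun i => (Z i).carrier) s (fun i => z i) i = _
  exact (DFinsupp.mk_apply (β := fun i => (Z i).carrier)).trans (dif_pos hi)

theorem dsumπ_mk_of_notMem {s : Finset I} (z : ∀ i, (Z i).carrier) {i : I} (hi : i ∉ s) :
    (dsumπ i).toLinearMap (dsumMk s z) = 0 := by
  classical
  change DFinsupp.mk (β := fun i => (Z i).carrier) s (fun i => z i) i = _
  exact (DFinsupp.mk_apply (β := fun i => (Z i).carrier)).trans (dif_neg hi)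

theorem dsumMk_mem {s : Finset I} {z : ∀ i, (Z i).carrier} {n : ℤ} (hz : ∀ i, z i ∈ (Z i).gr n) :
    dsumMk s z ∈ (dsum Z).gr n := by
  intro i
  change (dsumπ i).toLinearMap (dsumMk s z) ∈ _
  by_cases hi : i ∈ s
  · rw [dsumπ_mk z hi]; exact hz i
  · rw [dsumπ_mk_of_notMem z hi]; exact zero_mem _

theorem exists_dsum_support (x : (dsum Z).carrier) :
    ∃ s : Finset I, ∀ i ∉ s, (dsumπ i).toLinearMap x = 0 := by
  classical
  exact ⟨DFinsupp.support (β := fun i => (Z i).carrier) x, fun i hi =>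
    DFinsupp.notMem_support_iff.mp hi⟩

/-- Direct sums preserve quasi-isomorphisms. -/
theorem quasiIso_dsumMap {Y : I → DGBimod A} (f : ∀ i, Z i ⟶ Y i) (hf : ∀ i, quasiIso A (f i)) :
    quasiIso A (dsumDesc fun i => f i ≫ dsumι (Z := Y) i) := by
  set F := dsumDesc fun i => f i ≫ dsumι (Z := Y) i with hF
  have hc : ∀ i x, (dsumπ i).toLinearMap (F.toLinearMap x) =
      (f i).toLinearMap ((dsumπ i).toLinearMap x) := by
    intro i x
    induction x using dsum_induction with
    | h0 => simp
    | ha x y hx hy => simp only [map_add, hx, hy]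
    | hs j z =>
      have : F.toLinearMap ((dsumι j).toLinearMap z) =
        (dsumι (Z := Y) j).toLinearMap ((f j).toLinearMap z) := dsumLift_ι _ j z
      rw [this]
      by_cases e : i = j
      · subst e; rw [dsumπ_ι, dsumπ_ι]
      · rw [dsumπ_ι_ne e, dsumπ_ι_ne e, map_zero]
  simp only [quasiIso_iff] at hf ⊢
  intro n
  constructor
  · rintro v hv hdv ⟨w, hw, e⟩
    have H : ∀ i, ∃ u ∈ (Z i).gr (n - 1), (Z i).d u = (dsumπ i).toLinearMap v := fun i =>
      (hf i n).1 _ (hv i) (by rw [← (dsumπ i).map_d, hdv, map_zero])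
        ⟨_, hw i, ((dsumπ i).map_d w).symm.trans (by rw [e, hc])⟩
    choose u hu hdu using H
    -- The preimages chosen index by index need not be finitely supported. Cutting them off outside
    -- the support of `v` is harmless, since 0 is a preimage of 0.
    obtain ⟨s, hs⟩ := exists_dsum_support v
    refine ⟨dsumMk s u, dsumMk_mem hu, dsum_ext fun i => ?_⟩
    rw [(dsumπ i).map_d]
    by_cases hi : i ∈ s
    · rw [dsumπ_mk u hi, hdu]
    · rw [dsumπ_mk_of_notMem u hi, hs i hi, map_zero]
  · intro w hw hdw
    have H : ∀ i, ∃ v ∈ (Z i).gr n, (Z i).d v = 0 ∧ ∃ u ∈ (Y i).gr (n - 1),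
        (f i).toLinearMap v = (dsumπ i).toLinearMap w + (Y i).d u := fun i =>
      (hf i n).2 _ (hw i) (by rw [← (dsumπ i).map_d, hdw, map_zero])
    choose v hv hdv u hu e using H
    obtain ⟨s, hs⟩ := exists_dsum_support w
    refine ⟨dsumMk s v, dsumMk_mem hv, dsum_ext fun i => ?_, dsumMk s u, dsumMk_mem hu,
      dsum_ext fun i => ?_⟩
    · rw [(dsumπ i).map_d, map_zero]
      by_cases hi : i ∈ s
      · rw [dsumπ_mk v hi, hdv]
      · rw [dsumπ_mk_of_notMem v hi, map_zero]
    · rw [hc, map_add, (dsumπ i).map_d]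
      by_cases hi : i ∈ s
      · rw [dsumπ_mk v hi, dsumπ_mk u hi, e]
      · rw [dsumπ_mk_of_notMem v hi, dsumπ_mk_of_notMem u hi, hs i hi, map_zero, map_zero,
          add_zero]

open scoped Classical in
/-- The projection of a direct sum to a finite partial sum. -/
noncomputable def dsumProj (Z : I → DGBimod A) (J : Finset I) : dsum Z ⟶ dsum Z :=
  dsumDesc fun i => if i ∈ J then dsumι i else
    IsKHom.toHom (φ := 0) IsKHom.zero (fun m => by simp)

theorem dsumι_proj {J : Finset I} {i : I} (hi : i ∈ J) :
    dsumι i ≫ dsumProj Z J = dsumι i := by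
  rw [dsumProj, dsumι_desc, if_pos hi]

theorem dsumπ_proj_of_notMem {J : Finset I} {i : I} (hi : i ∉ J) (x : (dsum Z).carrier) :
    (dsumπ i).toLinearMap ((dsumProj Z J).toLinearMap x) = 0 := by
  induction x using dsum_induction with
  | h0 => simp
  | ha x y hx hy => simp only [map_add, hx, hy, add_zero]
  | hs j z =>
    have : (dsumProj Z J).toLinearMap ((dsumι j).toLinearMap z) = _ := dsumLift_ι _ j z
    rw [this]
    dsimp only
    split_ifs with h
    · exact dsumπ_ι_ne (by rintro rfl; exact hi h) z
    · simp

theorem dsumProj_of_support {J : Finset I} {x : (dsum Z).carrier}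
    (h : ∀ i ∉ J, (dsumπ i).toLinearMap x = 0) : (dsumProj Z J).toLinearMap x = x := by
  refine dsum_ext fun i => ?_
  by_cases hi : i ∈ J
  · clear h
    induction x using dsum_induction with
    | h0 => simp
    | ha x y hx hy => simp only [map_add, hx, hy]
    | hs j z =>
      have : (dsumProj Z J).toLinearMap ((dsumι j).toLinearMap z) = _ := dsumLift_ι _ j z
      rw [this]
      dsimp only
      split_ifs with hj
      · rfl
      · rw [dsumπ_ι_ne (by rintro rfl; exact hj hi)]
        simp
  · rw [dsumπ_proj_of_notMem hi, h i hi]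

end DirectSum

end DGBimod

end NCWeil

namespace NCWeil

/-! ### The free bimodule of rank one -/

section Env

variable {k : Type u} [Field k] (A : DGAlgebra k)

/-- The space `A ⊗ A`, with the outer bimodule structure. -/
def Env : Type u := A.carrier ⊗[k] A.carrier

noncomputable instance : AddCommGroup (Env A) :=
  inferInstanceAs (AddCommGroup (A.carrier ⊗[k] A.carrier))

noncomputable instance : Module k (Env A) :=
  inferInstanceAs (Module k (A.carrier ⊗[k] A.carrier))

noncomputable instance : Module A.carrier (Env A) :=
  inferInstanceAs (Module A.carrier (A.carrier ⊗[k] A.carrier))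

instance : IsScalarTower k A.carrier (Env A) :=
  inferInstanceAs (IsScalarTower k A.carrier (A.carrier ⊗[k] A.carrier))

variable {A}

namespace Env

/-- The element `a ⊗ b`. -/
noncomputable def mk (a b : A.carrier) : Env A := a ⊗ₜ[k] b

/-- Linear maps out of `A ⊗ A`. -/
noncomputable def lift {V : Type*} [AddCommGroup V] [Module k V]
    (φ : A.carrier →ₗ[k] A.carrier →ₗ[k] V) : Env A →ₗ[k] V := TensorProduct.lift φ

@[simp] theorem lift_mk {V : Type*} [AddCommGroup V] [Module k V]
    (φ : A.carrier →ₗ[k] A.carrier →ₗ[k] V) (a b : A.carrier) : lift φ (mk a b) = φ a b :=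
  TensorProduct.lift.tmul a b

theorem induction {p : Env A → Prop} (x : Env A) (h0 : p 0) (hm : ∀ a b, p (mk a b))
    (ha : ∀ x y, p x → p y → p (x + y)) : p x :=
  TensorProduct.induction_on x h0 hm ha

theorem mk_add_left (a a' b : A.carrier) : mk (a + a') b = mk a b + mk a' b :=
  TensorProduct.add_tmul a a' b

theorem mk_add_right (a b b' : A.carrier) : mk a (b + b') = mk a b + mk a b' :=
  TensorProduct.tmul_add a b b'

theorem smul_mk (a a' b : A.carrier) : a • mk a' b = mk (a * a') b := rfl

/-- Right multiplication. -/
noncomputable def rmul (b : A.carrier) : Env A →ₗ[k] Env A :=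
  LinearMap.lTensor A.carrier (LinearMap.mulRight k b)

@[simp] theorem rmul_mk (b a a' : A.carrier) : rmul b (mk a a') = mk a (a' * b) := rfl

noncomputable instance : Module A.carrierᵐᵒᵖ (Env A) where
  smul b x := rmul b.unop x
  one_smul x := by
    change rmul 1 x = x
    induction x using induction with
    | h0 => simp
    | ha x y hx hy => rw [map_add, hx, hy]
    | hm a b => simp
  mul_smul b c x := by
    change rmul (c.unop * b.unop) x = rmul b.unop (rmul c.unop x)
    induction x using induction with
    | h0 => simp
    | ha x y hx hy => simp only [map_add, hx, hy]
    | hm a b => simp [mul_assoc]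
  smul_zero b := map_zero (rmul b.unop)
  smul_add b x y := map_add (rmul b.unop) x y
  add_smul b c x := by
    change rmul (b.unop + c.unop) x = rmul b.unop x + rmul c.unop x
    induction x using induction with
    | h0 => simp
    | ha x y hx hy => simp only [map_add, hx, hy]; abel
    | hm a b => simp [mul_add, mk_add_right]
  zero_smul x := by
    change rmul 0 x = 0
    induction x using induction with
    | h0 => simp
    | ha x y hx hy => rw [map_add, hx, hy, add_zero]
    | hm a b =>
      change mk a (b * 0) = 0
      rw [mul_zero]
      exact TensorProduct.tmul_zero _ _

theorem op_smul_mk (a a' b : A.carrier) : MulOpposite.op b • mk a a' = mk a (a' * b) := rfl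

instance : SMulCommClass A.carrier A.carrierᵐᵒᵖ (Env A) where
  smul_comm a b x := by
    induction x using induction with
    | h0 => simp
    | ha x y hx hy => simp only [smul_add, hx, hy]
    | hm x y => rfl

instance : IsScalarTower k A.carrierᵐᵒᵖ (Env A) where
  smul_assoc c b x := by
    change rmul (c • b.unop) x = c • rmul b.unop x
    induction x using induction with
    | h0 => simp
    | ha x y hx hy => simp only [map_add, smul_add, hx, hy]
    | hm x y =>
      change mk x (y * (c • b.unop)) = c • mk x (y * b.unop)
      rw [mul_smul_comm]
      exact TensorProduct.tmul_smul _ _ _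

end Env

end Env

/-! ### Semi-free bimodules and their K-projectivity -/

namespace DGBimod

variable {k : Type u} [Field k] {A : DGAlgebra k}

/-- The bilinear map `(a, b) ↦ ± a m b`, with the sign of moving a map of degree `n` past `a`. -/
noncomputable def sandwich {P : DGBimod A} (n : ℤ) (m : P.carrier) :
    A.carrier →ₗ[k] A.carrier →ₗ[k] P.carrier :=
  LinearMap.mk₂ k (fun a b => A.sgn n a • MulOpposite.op b • m)
    (fun a a' b => by simp [add_smul]) (fun c a b => by simp)
    (fun a b b' => by simp [add_smul]) (fun c a b => by
      rw [MulOpposite.op_smul, smul_assoc, smul_comm])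

@[simp] theorem sandwich_apply {P : DGBimod A} (n : ℤ) (m : P.carrier) (a b : A.carrier) :
    sandwich n m a b = A.sgn n a • MulOpposite.op b • m := rfl

section SemiFree

variable {S : Type u} {P : DGBimod A}

/-- The map `⨁ₛ A ⊗ A → P` given by a family of elements of `P`. -/
noncomputable def genMap (n : ℤ) (e : S → P.carrier) : (S →₀ Env A) →ₗ[k] P.carrier :=
  Finsupp.lsum k fun s => Env.lift (sandwich n (e s))

theorem genMap_single (n : ℤ) (e : S → P.carrier) (s : S) (a b : A.carrier) :
    genMap n e (Finsupp.single s (Env.mk a b)) = A.sgn n a • MulOpposite.op b • e s := by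
  simp [genMap]

/-- The sub-bimodule generated by a set of elements of a family. -/
def bispan (e : S → P.carrier) (T : Set S) : Submodule k P.carrier :=
  Submodule.span k {x | ∃ t ∈ T, ∃ a b : A.carrier, x = a • MulOpposite.op b • e t}

theorem mem_bispan {e : S → P.carrier} {T : Set S} {t : S} (ht : t ∈ T) (a b : A.carrier) :
    a • MulOpposite.op b • e t ∈ bispan e T := Submodule.subset_span ⟨t, ht, a, b, rfl⟩

theorem bispan_mono (e : S → P.carrier) {T T' : Set S} (h : T ⊆ T') : bispan e T ≤ bispan e T' :=
  Submodule.span_mono fun _ ⟨t, ht, a, b, e⟩ => ⟨t, h ht, a, b, e⟩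

theorem smul_mem_bispan {e : S → P.carrier} {T : Set S} (a : A.carrier) {x : P.carrier}
    (hx : x ∈ bispan e T) : a • x ∈ bispan e T := by
  induction hx using Submodule.span_induction with
  | zero => simp
  | add x y _ _ hx hy => rw [smul_add]; exact add_mem hx hy
  | smul c x _ hx => rw [smul_comm]; exact Submodule.smul_mem _ _ hx
  | mem x hx =>
    obtain ⟨t, ht, b, c, rfl⟩ := hx
    rw [smul_smul]
    exact mem_bispan ht _ _

theorem op_smul_mem_bispan {e : S → P.carrier} {T : Set S} (a : A.carrier) {x : P.carrier}
    (hx : x ∈ bispan e T) : MulOpposite.op a • x ∈ bispan e T := by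
  induction hx using Submodule.span_induction with
  | zero => simp
  | add x y _ _ hx hy => rw [smul_add]; exact add_mem hx hy
  | smul c x _ hx => rw [smul_comm]; exact Submodule.smul_mem _ _ hx
  | mem x hx =>
    obtain ⟨t, ht, b, c, rfl⟩ := hx
    rw [← smul_comm b, smul_smul, ← MulOpposite.op_mul]
    exact mem_bispan ht _ _

theorem bispan_le {e : S → P.carrier} {T : Set S} {N : Submodule k P.carrier}
    (h : ∀ t ∈ T, ∀ a b : A.carrier, a • MulOpposite.op b • e t ∈ N) : bispan e T ≤ N :=
  Submodule.span_le.mpr fun _ ⟨t, ht, a, b, e⟩ => e ▸ h t ht a b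

variable (S P) in
/-- A semi-free bimodule: free as a graded bimodule, with generators filtered by `ℕ` such that the
differential of a generator is generated by earlier ones. -/
structure SemiFree where
  deg : S → ℤ
  filt : S → ℕ
  gen : S → P.carrier
  gen_mem : ∀ s, gen s ∈ P.gr (deg s)
  d_gen : ∀ s, P.d (gen s) ∈ bispan gen {t | filt t < filt s}
  bij : Function.Bijective (genMap 0 gen)

namespace SemiFree

variable (F : SemiFree S P) {Y : DGBimod A}

theorem bispan_univ : bispan F.gen Set.univ = ⊤ := by
  rw [eq_top_iff]
  rintro x -
  obtain ⟨x, rfl⟩ := F.bij.2 x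
  induction x using Finsupp.induction_linear with
  | zero => simp
  | add x y hx hy => rw [map_add]; exact add_mem hx hy
  | single s x =>
    induction x using Env.induction with
    | h0 => simp
    | ha x y hx hy => rw [Finsupp.single_add, map_add]; exact add_mem hx hy
    | hm a b => rw [genMap_single]; exact mem_bispan (Set.mem_univ s) _ _

/-- The bimodule map of degree `n` with given values on the generators. -/
noncomputable def extend (n : ℤ) (y : S → Y.carrier) : P.carrier →ₗ[k] Y.carrier :=
  genMap n y ∘ₗ (LinearEquiv.ofBijective (genMap 0 F.gen) F.bij).symm.toLinearMap

theorem extend_apply (n : ℤ) (y : S → Y.carrier) (a b : A.carrier) (s : S) :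
    F.extend n y (a • MulOpposite.op b • F.gen s) = A.sgn n a • MulOpposite.op b • y s := by
  have : (LinearEquiv.ofBijective (genMap 0 F.gen) F.bij).symm (a • MulOpposite.op b • F.gen s) =
      Finsupp.single s (Env.mk a b) := by
    rw [LinearEquiv.symm_apply_eq, LinearEquiv.ofBijective_apply, genMap_single, DGAlgebra.sgn_zero]
  rw [extend, LinearMap.comp_apply, LinearEquiv.coe_coe, this, genMap_single]

theorem extend_gen (n : ℤ) (y : S → Y.carrier) (s : S) : F.extend n y (F.gen s) = y s := by
  have := F.extend_apply n y 1 1 s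
  simpa using this

theorem induction {p : P.carrier → Prop} (x : P.carrier) (h0 : p 0)
    (ha : ∀ x y, p x → p y → p (x + y))
    (hm : ∀ i j a b, a ∈ A.gr i → b ∈ A.gr j → ∀ s, p (a • MulOpposite.op b • F.gen s)) : p x := by
  have hx : x ∈ bispan F.gen Set.univ := F.bispan_univ ▸ Submodule.mem_top
  have key : ∀ (a b : A.carrier) (s : S), p (a • MulOpposite.op b • F.gen s) := by
    intro a b s
    induction a using graded_induction A.isInternal with
    | h0 => simpa using h0
    | ha x y hx hy => rw [add_smul]; exact ha _ _ hx hy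
    | hm i a hi =>
      induction b using graded_induction A.isInternal with
      | h0 => simpa using h0
      | ha x y hx hy => rw [MulOpposite.op_add, add_smul, smul_add]; exact ha _ _ hx hy
      | hm j b hj => exact hm i j a b hi hj s
  -- Quantified over all multiples because `p` is not assumed stable under scalars; on a product of
  -- a generator with algebra elements the scalar is absorbed into the left factor.
  have h : ∀ c : k, p (c • x) := by
    induction hx using Submodule.span_induction with
    | zero => simpa using h0
    | add x y _ _ hx hy => intro c; rw [smul_add]; exact ha _ _ (hx c) (hy c)
    | smul c x _ hx => intro c'; rw [smul_smul]; exact hx _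
    | mem x hx =>
      obtain ⟨t, ht, b, c, rfl⟩ := hx
      intro r
      rw [← smul_assoc]
      exact key _ _ _
  simpa using h 1

theorem isKHom_extend (n : ℤ) {y : S → Y.carrier} (hy : ∀ s, y s ∈ Y.gr (F.deg s + n)) :
    IsKHom n (F.extend n y) where
  map_smul a m := by
    induction m using F.induction with
    | h0 => simp
    | ha x y hx hy => simp only [smul_add, map_add, hx, hy]
    | hm i j b c hb hc s => rw [smul_smul, extend_apply, extend_apply, map_mul, mul_smul]
  map_op_smul a m := by
    induction m using F.induction with
    | h0 => simp
    | ha x y hx hy => simp only [smul_add, map_add, hx, hy]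
    | hm i j b c hb hc s =>
      rw [← smul_comm b, smul_smul, ← MulOpposite.op_mul, extend_apply, extend_apply,
        MulOpposite.op_mul, mul_smul, smul_comm]
  map_gr i x hx := by
    refine map_gr_of_span (n := n) P.isInternal Y.isInternal
      (X := {x | ∃ i j a b, a ∈ A.gr i ∧ b ∈ A.gr j ∧ ∃ s,
        x = a • MulOpposite.op b • F.gen s}) ?_ ?_ i x hx
    · rw [eq_top_iff]
      rintro x -
      induction x using F.induction with
      | h0 => exact zero_mem _
      | ha x y hx hy => exact add_mem hx hy
      | hm i j a b ha hb s => exact Submodule.subset_span ⟨i, j, a, b, ha, hb, s, rfl⟩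
    · rintro _ ⟨i, j, a, b, ha, hb, s, rfl⟩
      refine ⟨_, smul_op_smul_mem ha (F.gen_mem s) hb, ?_⟩
      rw [extend_apply]
      have := smul_op_smul_mem (DGAlgebra.sgn_mem n ha) (hy s) hb
      rwa [show i + (F.deg s + n) + j = i + F.deg s + j + n by ring] at this

/-- Two bimodule maps which agree on some generators agree on the sub-bimodule they generate. -/
theorem eq_on_bispan {n : ℤ} {φ ψ : P.carrier →ₗ[k] Y.carrier} (hφ : IsKHom n φ)
    (hψ : IsKHom n ψ) {T : Set S} (h : ∀ s ∈ T, φ (F.gen s) = ψ (F.gen s)) {x : P.carrier}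
    (hx : x ∈ bispan F.gen T) : φ x = ψ x := by
  have : bispan F.gen T ≤ LinearMap.eqLocus φ ψ := bispan_le fun t ht a b => by
    change φ _ = ψ _
    rw [hφ.map_smul, hψ.map_smul, hφ.map_op_smul, hψ.map_op_smul, h t ht]
  exact this hx

theorem hom_ext {n : ℤ} {φ ψ : P.carrier →ₗ[k] Y.carrier} (hφ : IsKHom n φ)
    (hψ : IsKHom n ψ) (h : ∀ s, φ (F.gen s) = ψ (F.gen s)) : φ = ψ :=
  LinearMap.ext fun _ => F.eq_on_bispan hφ hψ (T := Set.univ) (fun s _ => h s)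
    (F.bispan_univ ▸ Submodule.mem_top)

/-- A bimodule map is closed if it is so on the generators. -/
theorem d_comm_on_bispan {φ : P.carrier →ₗ[k] Y.carrier} (hφ : IsKHom 0 φ) {T : Set S}
    (h : ∀ s ∈ T, φ (P.d (F.gen s)) = Y.d (φ (F.gen s))) {x : P.carrier}
    (hx : x ∈ bispan F.gen T) : φ (P.d x) = Y.d (φ x) := by
  have := F.eq_on_bispan hφ.commutator' IsKHom.zero (T := T) (fun s hs => by
    simp [h s hs]) hx
  simp only [Int.negOnePow_zero, one_smul, LinearMap.sub_apply, LinearMap.comp_apply,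
    LinearMap.zero_apply, sub_eq_zero] at this
  exact this.symm

theorem d_comm {φ : P.carrier →ₗ[k] Y.carrier} (hφ : IsKHom 0 φ)
    (h : ∀ s, φ (P.d (F.gen s)) = Y.d (φ (F.gen s))) (x : P.carrier) : φ (P.d x) = Y.d (φ x) :=
  F.d_comm_on_bispan hφ (T := Set.univ) (fun s _ => h s) (F.bispan_univ ▸ Submodule.mem_top)

/-- Semi-free bimodules are K-projective. -/
theorem kProj (F : SemiFree S P) : KProj P := by
  classical
  intro Y hY n φ hφ hd
  -- The contraction is built on generators by well-founded recursion on the filtration. Given the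
  -- values below `s`, `z` extends them by 0, `w` is the element that has to be a boundary, and `G`
  -- picks a primitive of the right degree. The default 0 in `G` turns out never to be taken.
  let z (s : S) (y : ∀ t, F.filt t < F.filt s → Y.carrier) (t : S) : Y.carrier :=
    if h : F.filt t < F.filt s then y t h else 0
  let w (s : S) (y : ∀ t, F.filt t < F.filt s → Y.carrier) : Y.carrier :=
    φ (F.gen s) - n.negOnePow • F.extend (n - 1) (z s y) (P.d (F.gen s))
  let G (s : S) (y : ∀ t, F.filt t < F.filt s → Y.carrier) : Y.carrier :=
    if h : ∃ x ∈ Y.gr (F.deg s + (n - 1)), Y.d x = w s y then h.choose else 0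
  let wf : WellFounded fun s t : S => F.filt s < F.filt t := (measure F.filt).wf
  let y : S → Y.carrier := wf.fix G
  have key : ∀ s, y s ∈ Y.gr (F.deg s + (n - 1)) ∧
      Y.d (y s) + n.negOnePow • F.extend (n - 1) y (P.d (F.gen s)) = φ (F.gen s) := by
    intro s
    induction s using wf.induction with
    | _ s ih =>
    have hy : y s = G s fun t _ => y t := wf.fix_eq G s
    set y' : S → Y.carrier := z s fun t _ => y t with hy'
    have hy'1 : ∀ t, F.filt t < F.filt s → y' t = y t := fun t ht => dif_pos ht
    have hy'm : ∀ t, y' t ∈ Y.gr (F.deg t + (n - 1)) := fun t => by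
      by_cases ht : F.filt t < F.filt s
      · rw [hy'1 t ht]; exact (ih t ht).1
      · rw [hy', show z s (fun t _ => y t) t = 0 from dif_neg ht]; exact zero_mem _
    -- The differential of a generator involves only generators of strictly smaller filtration,
    -- where the truncated family has the same values as the full one.
    have hext : ∀ (s' : S), F.filt s' ≤ F.filt s →
        F.extend (n - 1) y (P.d (F.gen s')) = F.extend (n - 1) y' (P.d (F.gen s')) := by
      intro s' hs'
      have : bispan F.gen {t | F.filt t < F.filt s'} ≤
          LinearMap.eqLocus (F.extend (n - 1) y) (F.extend (n - 1) y') :=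
        bispan_le fun t ht a b => by
          change F.extend (n - 1) y _ = F.extend (n - 1) y' _
          rw [extend_apply, extend_apply, hy'1 t (lt_of_lt_of_le ht hs')]
      exact this (F.d_gen s')
    have hK : IsKHom (n - 1) (F.extend (n - 1) y') := F.isKHom_extend _ hy'm
    have hcomm : ∀ x ∈ bispan F.gen {t | F.filt t < F.filt s},
        Y.d (F.extend (n - 1) y' x) + n.negOnePow • F.extend (n - 1) y' (P.d x) = φ x := by
      intro x hx
      have h1 := hK.commutator'
      rw [sub_add_cancel] at h1
      have := F.eq_on_bispan h1 hφ (T := {t | F.filt t < F.filt s}) (fun t ht => by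
        have := (ih t ht).2
        rw [hext t (le_of_lt ht)] at this
        rw [← this]
        simp [extend_gen, hy'1 t ht, Int.negOnePow_sub]) hx
      rw [← this]
      simp [Int.negOnePow_sub]
    -- As `P.d (F.gen s)` lies in the sub-bimodule generated earlier, `hcomm` applies to it and
    -- shows that the obstruction is a cocycle; `Y` is acyclic.
    have hex : ∃ x ∈ Y.gr (F.deg s + (n - 1)), Y.d x = w s fun t _ => y t := by
      have hm : (w s fun t _ => y t) ∈ Y.gr (F.deg s + n) := by
        refine sub_mem (hφ.map_gr _ _ (F.gen_mem s)) (units_smul_mem _ ?_)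
        have := hK.map_gr _ _ (P.d_mem (F.gen_mem s))
        rwa [show F.deg s + 1 + (n - 1) = F.deg s + n by ring] at this
      obtain ⟨x, hx, e⟩ := hY _ _ hm (by
        change Y.d (φ (F.gen s) - n.negOnePow • F.extend (n - 1) y' (P.d (F.gen s))) = 0
        have := hcomm _ (F.d_gen s)
        rw [P.d_d, map_zero, smul_zero, add_zero] at this
        rw [map_sub, map_units_smul, this, hd, sub_self])
      rw [show F.deg s + n - 1 = F.deg s + (n - 1) by ring] at hx
      exact ⟨x, hx, e⟩
    have hy2 : y s = hex.choose := hy.trans (dif_pos hex)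
    rw [hext s le_rfl, hy2]
    refine ⟨hex.choose_spec.1, ?_⟩
    rw [hex.choose_spec.2]
    exact sub_add_cancel _ _
  have hK : IsKHom (n - 1) (F.extend (n - 1) y) := F.isKHom_extend _ fun s => (key s).1
  refine ⟨F.extend (n - 1) y, hK, fun p => ?_⟩
  have h1 := hK.commutator'
  rw [sub_add_cancel] at h1
  have := F.hom_ext hφ h1 (fun s => by
    rw [← (key s).2]
    simp [extend_gen, Int.negOnePow_sub])
  rw [this]
  simp [Int.negOnePow_sub]

end SemiFree

end SemiFree

end DGBimod

end NCWeil

namespace NCWeil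

open DGBimod

/-! ### Construction of semi-free bimodules from generators and boundaries -/

section Free

variable {k : Type u} [Field k] (A : DGAlgebra k) {S : Type u}

theorem smul_units_comm {R M : Type*} [Monoid R] [AddCommGroup M] [DistribMulAction R M] (r : R)
    (c : ℤˣ) (x : M) : r • c • x = c • r • x := by
  rcases Int.units_eq_one_or c with rfl | rfl <;> simp

/-- The elements of degree `n` of the free bimodule on generators of given degrees. -/
noncomputable def freeGr (deg : S → ℤ) (n : ℤ) : Submodule k (S →₀ Env A) :=
  Submodule.span k {x | ∃ (s : S) (i j : ℤ) (a b : A.carrier), a ∈ A.gr i ∧ b ∈ A.gr j ∧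
    i + deg s + j = n ∧ x = Finsupp.single s (Env.mk a b)}

variable {A}

theorem single_mem_freeGr {deg : S → ℤ} {s : S} {i j n : ℤ} {a b : A.carrier} (ha : a ∈ A.gr i)
    (hb : b ∈ A.gr j) (h : i + deg s + j = n) :
    Finsupp.single s (Env.mk a b) ∈ freeGr A deg n :=
  Submodule.subset_span ⟨s, i, j, a, b, ha, hb, h, rfl⟩

theorem free_induction {p : (S →₀ Env A) → Prop} (x : S →₀ Env A) (h0 : p 0)
    (ha : ∀ x y, p x → p y → p (x + y))
    (hm : ∀ s i j (a b : A.carrier), a ∈ A.gr i → b ∈ A.gr j → p (Finsupp.single s (Env.mk a b))) :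
    p x := by
  induction x using Finsupp.induction_linear with
  | zero => exact h0
  | add x y hx hy => exact ha _ _ hx hy
  | single s x =>
    induction x using Env.induction with
    | h0 => rw [Finsupp.single_zero]; exact h0
    | ha x y hx hy => rw [Finsupp.single_add]; exact ha _ _ hx hy
    | hm a b =>
      induction a using graded_induction A.isInternal with
      | h0 =>
        rw [show Env.mk 0 b = (0 : Env A) from TensorProduct.zero_tmul _ _, Finsupp.single_zero]
        exact h0
      | ha x y hx hy => rw [Env.mk_add_left, Finsupp.single_add]; exact ha _ _ hx hy
      | hm i a hi =>
        induction b using graded_induction A.isInternal with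
        | h0 =>
          rw [show Env.mk a 0 = (0 : Env A) from TensorProduct.tmul_zero _ _, Finsupp.single_zero]
          exact h0
        | ha x y hx hy => rw [Env.mk_add_right, Finsupp.single_add]; exact ha _ _ hx hy
        | hm j b hj => exact hm s i j a b hi hj

/-- Scalars are absorbed into the left factors, which leaves a plain finite list of homogeneous
terms. Such a list is precisely the boundary datum of a cell, and this is how the resolution kills a
given cycle. -/
theorem exists_sum_of_mem_freeGr {deg : S → ℤ} {n : ℤ} {x : S →₀ Env A}
    (hx : x ∈ freeGr A deg n) : ∃ (N : ℕ) (c : Fin N → S) (q r : Fin N → ℤ)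
      (a b : Fin N → A.carrier), (∀ i, a i ∈ A.gr (q i)) ∧ (∀ i, b i ∈ A.gr (r i)) ∧
      (∀ i, q i + deg (c i) + r i = n) ∧ x = ∑ i, Finsupp.single (c i) (Env.mk (a i) (b i)) := by
  obtain ⟨N, f, g, rfl⟩ := Submodule.mem_span_set'.mp hx
  choose c q r a b ha hb hd hgi using fun i => (g i).2
  refine ⟨N, c, q, r, fun i => f i • a i, b, fun i => Submodule.smul_mem _ _ (ha i), hb, hd,
    Finset.sum_congr rfl fun i _ => ?_⟩
  rw [hgi i, Finsupp.smul_single]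
  rfl

/-- The projection of `A ⊗ A` to a bigraded piece. -/
noncomputable def Env.proj (i j : ℤ) : Env A →ₗ[k] Env A :=
  TensorProduct.map (gproj A.isInternal i) (gproj A.isInternal j)

theorem Env.proj_mk (i j : ℤ) (a b : A.carrier) :
    Env.proj i j (Env.mk a b) = Env.mk (gproj A.isInternal i a) (gproj A.isInternal j b) := rfl

/-- The pieces indexed by a generator, a left degree and a right degree are separated by explicit
projections. Collecting those of equal total degree coarsens this to the grading by ℤ. -/
theorem isInternal_freeGr (deg : S → ℤ) : DirectSum.IsInternal (freeGr A deg) := by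
  classical
  let g : S × ℤ × ℤ → Submodule k (S →₀ Env A) := fun t =>
    Submodule.span k {x | ∃ a b : A.carrier, a ∈ A.gr t.2.1 ∧ b ∈ A.gr t.2.2 ∧
      x = Finsupp.single t.1 (Env.mk a b)}
  have hg : DirectSum.IsInternal g := by
    refine isInternal_of_proj g
      (fun t => Finsupp.lsingle t.1 ∘ₗ Env.proj t.2.1 t.2.2 ∘ₗ Finsupp.lapply t.1) ?_ ?_ ?_
    · rintro ⟨s, i, j⟩ x hx
      induction hx using Submodule.span_induction with
      | zero => simp
      | add x y _ _ hx hy => rw [map_add, hx, hy]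
      | smul c x _ hx => rw [map_smul, hx]
      | mem x hx =>
        obtain ⟨a, b, ha, hb, rfl⟩ := hx
        simp only [LinearMap.comp_apply, Finsupp.lapply_apply, Finsupp.single_eq_same,
          Finsupp.lsingle_apply, Env.proj_mk, gproj_of_mem A.isInternal ha,
          gproj_of_mem A.isInternal hb]
    · rintro ⟨s, i, j⟩ ⟨s', i', j'⟩ hne x hx
      induction hx using Submodule.span_induction with
      | zero => simp
      | add x y _ _ hx hy => rw [map_add, hx, hy, add_zero]
      | smul c x _ hx => rw [map_smul, hx, smul_zero]
      | mem x hx =>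
        obtain ⟨a, b, ha, hb, rfl⟩ := hx
        simp only [LinearMap.comp_apply, Finsupp.lapply_apply, Finsupp.lsingle_apply]
        by_cases hs : s' = s
        · subst hs
          rw [Finsupp.single_eq_same, Env.proj_mk]
          by_cases hi : i' = i
          · subst hi
            have hj : j' ≠ j := by rintro rfl; exact hne rfl
            rw [gproj_of_mem_ne A.isInternal hb hj,
              show Env.mk _ 0 = (0 : Env A) from TensorProduct.tmul_zero _ _, Finsupp.single_zero]
          · rw [gproj_of_mem_ne A.isInternal ha hi,
              show Env.mk 0 _ = (0 : Env A) from TensorProduct.zero_tmul _ _, Finsupp.single_zero]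
        · rw [Finsupp.single_eq_of_ne (Ne.symm hs), map_zero, Finsupp.single_zero]
    · rw [eq_top_iff]
      rintro x -
      induction x using free_induction with
      | h0 => exact zero_mem _
      | ha x y hx hy => exact add_mem hx hy
      | hm s i j a b ha hb =>
        exact Submodule.mem_iSup_of_mem (s, i, j) (Submodule.subset_span ⟨a, b, ha, hb, rfl⟩)
  refine isInternal_coarsen hg (fun t => t.2.1 + deg t.1 + t.2.2) _ ?_ ?_
  · rintro ⟨s, i, j⟩
    refine Submodule.span_le.mpr ?_
    rintro _ ⟨a, b, ha, hb, rfl⟩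
    exact single_mem_freeGr ha hb rfl
  · intro n
    refine Submodule.span_le.mpr ?_
    rintro _ ⟨s, i, j, a, b, ha, hb, h, rfl⟩
    exact Submodule.mem_iSup_of_mem (s, i, j) (Submodule.mem_iSup_of_mem h
      (Submodule.subset_span ⟨a, b, ha, hb, rfl⟩))

/-- The derivation of the free bimodule with given values on the generators. -/
noncomputable def freeD (deg : S → ℤ) (D : S → S →₀ Env A) : (S →₀ Env A) →ₗ[k] (S →₀ Env A) :=
  Finsupp.lsum k fun s => Env.lift <| LinearMap.mk₂ k
    (fun a b => Finsupp.single s (Env.mk (A.d a) b) + A.sgn 1 a • MulOpposite.op b • D s +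
      (deg s).negOnePow • Finsupp.single s (Env.mk (A.sgn 1 a) (A.d b)))
    (fun a a' b => by
      simp only [map_add, Env.mk_add_left, Finsupp.single_add, add_smul, smul_add]; abel)
    (fun c a b => by
      have h1 : ∀ (c : k) (a b : A.carrier), Env.mk (c • a) b = c • Env.mk a b :=
        fun c a b => TensorProduct.smul_tmul' c a b
      simp only [map_smul, h1, ← Finsupp.smul_single, smul_add, smul_assoc]
      rw [smul_comm c (deg s).negOnePow])
    (fun a b b' => by
      simp only [map_add, Env.mk_add_right, Finsupp.single_add, MulOpposite.op_add, add_smul,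
        smul_add]
      abel)
    (fun c a b => by
      have h1 : ∀ (c : k) (a b : A.carrier), Env.mk a (c • b) = c • Env.mk a b :=
        fun c a b => TensorProduct.tmul_smul c a b
      simp only [map_smul, h1, ← Finsupp.smul_single, smul_add, MulOpposite.op_smul, smul_assoc]
      rw [smul_comm c (deg s).negOnePow, smul_comm c (A.sgn 1 a)])

theorem freeD_single (deg : S → ℤ) (D : S → S →₀ Env A) (s : S) (a b : A.carrier) :
    freeD deg D (Finsupp.single s (Env.mk a b)) =
      Finsupp.single s (Env.mk (A.d a) b) + A.sgn 1 a • MulOpposite.op b • D s +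
      (deg s).negOnePow • Finsupp.single s (Env.mk (A.sgn 1 a) (A.d b)) := by
  simp [freeD]

/-- No homogeneity of `x` is needed, as the sign depends on `a` alone. In the right-hand rule
`freeD_op_smul` the sign is that of `x`, which must be homogeneous there. -/
theorem freeD_smul (deg : S → ℤ) (D : S → S →₀ Env A) (a : A.carrier) (x : S →₀ Env A) :
    freeD deg D (a • x) = A.d a • x + A.sgn 1 a • freeD deg D x := by
  induction x using free_induction with
  | h0 => simp
  | ha x y hx hy => simp only [smul_add, map_add, hx, hy]; abel
  | hm s i j b c hb hc =>
    rw [freeD_single]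
    simp only [smul_add, smul_units_comm (A.sgn 1 a)]
    simp only [Finsupp.smul_single, Env.smul_mk, freeD_single, DGAlgebra.leibniz_sgn, map_mul,
      Env.mk_add_left, Finsupp.single_add, mul_smul]
    abel

theorem freeD_op_smul (deg : S → ℤ) (D : S → S →₀ Env A) {n : ℤ} (c : A.carrier)
    {x : S →₀ Env A} (hx : x ∈ freeGr A deg n) :
    freeD deg D (MulOpposite.op c • x) = MulOpposite.op c • freeD deg D x +
      n.negOnePow • (MulOpposite.op (A.d c) • x) := by
  induction hx using Submodule.span_induction with
  | zero => simp
  | add x y _ _ hx hy => simp only [smul_add, map_add, hx, hy]; abel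
  | smul r x _ hx =>
    simp only [smul_comm _ r, map_smul, hx, smul_add]
  | mem x hx =>
    obtain ⟨s, i, j, a, b, ha, hb, rfl, rfl⟩ := hx
    have h1 : ∀ (u : ℤˣ) (a b : A.carrier), Env.mk a (u • b) = u • Env.mk a b := fun u a b =>
      NCWeil.map_units_smul (TensorProduct.mk k A.carrier A.carrier a) u b
    have h2 : ∀ (u : ℤˣ) (a b : A.carrier), Env.mk (u • a) b = u • Env.mk a b := fun u a b =>
      NCWeil.map_units_smul ((TensorProduct.mk k A.carrier A.carrier).flip b) u a
    have h3 : A.sgn 1 a • MulOpposite.op (b * c) • D s =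
        MulOpposite.op c • A.sgn 1 a • MulOpposite.op b • D s := by
      rw [MulOpposite.op_mul, mul_smul, smul_comm]
    have h4 : (deg s).negOnePow • Finsupp.single s (Env.mk (A.sgn 1 a)
        (j.negOnePow • (b * A.d c))) =
        (i + deg s + j).negOnePow • Finsupp.single s (Env.mk a (b * A.d c)) := by
      have h5 : ∀ (u : ℤˣ) (x : Env A),
          Finsupp.single s (u • x) = u • (Finsupp.single s x : S →₀ Env A) :=
        fun u x => NCWeil.map_units_smul (Finsupp.lsingle (R := k) s) u x
      rw [DGAlgebra.sgn_of_mem _ ha, h1, h2, h5, h5, smul_smul, smul_smul, one_mul,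
        Int.negOnePow_add, Int.negOnePow_add]
      congr 1
      ac_rfl
    rw [Finsupp.smul_single, Env.op_smul_mk, freeD_single, A.leibniz c hb, Env.mk_add_right,
      Finsupp.single_add, smul_add, h3, h4, freeD_single,
      smul_add, smul_add, smul_units_comm (MulOpposite.op c),
      Finsupp.smul_single (MulOpposite.op c), Finsupp.smul_single (MulOpposite.op c),
      Finsupp.smul_single (MulOpposite.op (A.d c)), Env.op_smul_mk, Env.op_smul_mk, Env.op_smul_mk]
    abel

variable (A S) in
/-- Generators of a semi-free bimodule with their differentials. -/
structure FreeData where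
  deg : S → ℤ
  filt : S → ℕ
  D : S → S →₀ Env A
  D_mem : ∀ s, D s ∈ freeGr A deg (deg s + 1)
  D_low : ∀ s t, D s t ≠ 0 → filt t < filt s
  d_D : ∀ s, freeD deg D (D s) = 0

namespace FreeData

variable (F : FreeData A S)

theorem gr_smul_mem {deg : S → ℤ} {i j : ℤ} {a : A.carrier} {x : S →₀ Env A} (ha : a ∈ A.gr i)
    (hx : x ∈ freeGr A deg j) : a • x ∈ freeGr A deg (i + j) := by
  induction hx using Submodule.span_induction with
  | zero => simp
  | add x y _ _ hx hy => rw [smul_add]; exact add_mem hx hy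
  | smul c x _ hx => rw [smul_comm]; exact Submodule.smul_mem _ _ hx
  | mem x hx =>
    obtain ⟨s, p, q, b, c, hb, hc, rfl, rfl⟩ := hx
    rw [Finsupp.smul_single, Env.smul_mk]
    exact single_mem_freeGr (A.mul_mem ha hb) hc (by ring)

theorem gr_op_smul_mem {deg : S → ℤ} {i j : ℤ} {a : A.carrier} {x : S →₀ Env A}
    (hx : x ∈ freeGr A deg i) (ha : a ∈ A.gr j) :
    MulOpposite.op a • x ∈ freeGr A deg (i + j) := by
  induction hx using Submodule.span_induction with
  | zero => simp
  | add x y _ _ hx hy => rw [smul_add]; exact add_mem hx hy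
  | smul c x _ hx => rw [smul_comm]; exact Submodule.smul_mem _ _ hx
  | mem x hx =>
    obtain ⟨s, p, q, b, c, hb, hc, rfl, rfl⟩ := hx
    rw [Finsupp.smul_single, Env.op_smul_mk]
    exact single_mem_freeGr hb (A.mul_mem hc ha) (by ring)

/-- In d²(a x) the cross terms cancel because d anticommutes with `sgn 1`, so it suffices to treat 1
⊗ b. There the right Leibniz rule leaves d (D s) = 0 and two terms in d b whose signs, (-1)^(deg s)
and (-1)^(deg s + 1), are opposite. -/
theorem freeD_freeD (x : S →₀ Env A) : freeD F.deg F.D (freeD F.deg F.D x) = 0 := by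
  have h1 : ∀ (a : A.carrier) (x : S →₀ Env A), freeD F.deg F.D (freeD F.deg F.D x) = 0 →
      freeD F.deg F.D (freeD F.deg F.D (a • x)) = 0 := fun a x hx => by
    rw [freeD_smul, map_add, freeD_smul, freeD_smul, A.d_d, hx, DGAlgebra.d_sgn]
    simp
  induction x using free_induction with
  | h0 => simp
  | ha x y hx hy => rw [map_add, map_add, hx, hy, add_zero]
  | hm s i j a b ha hb =>
    have e : Finsupp.single s (Env.mk a b) = a • Finsupp.single s (Env.mk 1 b) := by
      rw [Finsupp.smul_single, Env.smul_mk, mul_one]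
    rw [e]
    refine h1 a _ ?_
    have hD := F.D_mem s
    have h0 : Env.mk 0 b = (0 : Env A) := TensorProduct.zero_tmul _ _
    rw [freeD_single, DGAlgebra.d_one, h0, Finsupp.single_zero, map_one, one_smul, zero_add,
      map_add, NCWeil.map_units_smul, freeD_op_smul _ _ _ hD, F.d_D, freeD_single,
      DGAlgebra.d_one, A.d_d, map_one, one_smul]
    have h0' : ∀ a, Env.mk 0 a = (0 : Env A) := fun a => TensorProduct.zero_tmul _ _
    have h0'' : ∀ a, Env.mk a 0 = (0 : Env A) := fun a => TensorProduct.tmul_zero _ _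
    rw [h0', h0'', Finsupp.single_zero, Int.negOnePow_add]
    simp

/-- The semi-free bimodule with given generators. -/
noncomputable def bimod : DGBimod A where
  carrier := S →₀ Env A
  gr := freeGr A F.deg
  isInternal := isInternal_freeGr F.deg
  smul_mem := gr_smul_mem
  op_smul_mem := gr_op_smul_mem
  d := freeD F.deg F.D
  d_mem {n x} hx := by
    induction hx using Submodule.span_induction with
    | zero => simp
    | add x y _ _ hx hy => rw [map_add]; exact add_mem hx hy
    | smul c x _ hx => rw [map_smul]; exact Submodule.smul_mem _ _ hx
    | mem x hx =>
      obtain ⟨s, i, j, a, b, ha, hb, rfl, rfl⟩ := hx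
      rw [freeD_single]
      refine add_mem (add_mem (single_mem_freeGr (A.d_mem ha) hb (by ring)) ?_)
        (units_smul_mem _ (single_mem_freeGr (DGAlgebra.sgn_mem 1 ha) (A.d_mem hb) (by ring)))
      have := gr_smul_mem (DGAlgebra.sgn_mem 1 ha) (gr_op_smul_mem (F.D_mem s) hb)
      rwa [show i + (F.deg s + 1 + j) = i + F.deg s + j + 1 by ring] at this
  d_d := F.freeD_freeD
  leibniz_left {i a} x ha := by
    refine (freeD_smul _ _ a x).trans ?_
    rw [DGAlgebra.sgn_of_mem _ ha, one_mul, Units.smul_def, Units.smul_def, smul_assoc]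
  leibniz_right a hm := freeD_op_smul _ _ a hm

/-- The generators. -/
noncomputable def gen (s : S) : F.bimod.carrier := Finsupp.single s (Env.mk 1 1)

theorem smul_gen (s : S) (a b : A.carrier) :
    a • MulOpposite.op b • F.gen s = (Finsupp.single s (Env.mk a b) : S →₀ Env A) := by
  change a • MulOpposite.op b • (Finsupp.single s (Env.mk 1 1) : S →₀ Env A) = _
  rw [Finsupp.smul_single, Finsupp.smul_single, Env.op_smul_mk, Env.smul_mk, one_mul, mul_one]

/-- The identity, from finitely supported functions to the semi-free bimodule. -/
noncomputable def ofFin : (S →₀ Env A) ≃ₗ[k] F.bimod.carrier := LinearEquiv.refl k _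

/-- The coordinates. -/
noncomputable def coord (t : S) : F.bimod.carrier →ₗ[k] Env A :=
  Finsupp.lapply t ∘ₗ F.ofFin.symm.toLinearMap

theorem coord_ofFin (t : S) (x : S →₀ Env A) : F.coord t (F.ofFin x) = x t := rfl

theorem smul_gen' (s : S) (a b : A.carrier) :
    a • MulOpposite.op b • F.gen s = F.ofFin (Finsupp.single s (Env.mk a b)) := F.smul_gen s a b

theorem d_gen (s : S) : F.bimod.d (F.gen s) = F.ofFin (F.D s) := by
  change freeD F.deg F.D (Finsupp.single s (Env.mk 1 1)) = F.D s
  have h0' : ∀ a, Env.mk 0 a = (0 : Env A) := fun a => TensorProduct.zero_tmul _ _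
  have h0'' : ∀ a, Env.mk a 0 = (0 : Env A) := fun a => TensorProduct.tmul_zero _ _
  rw [freeD_single, DGAlgebra.d_one, h0', h0'']
  simp

theorem mem_bispan_gen {T : Set S} {x : F.bimod.carrier} :
    x ∈ bispan F.gen T ↔ ∀ t ∉ T, F.coord t x = 0 := by
  classical
  constructor
  · intro hx t ht
    have : bispan F.gen T ≤ LinearMap.ker (F.coord t) :=
      bispan_le fun s hs a b => by
        rw [LinearMap.mem_ker, smul_gen', coord_ofFin]
        exact Finsupp.single_eq_of_ne (by rintro rfl; exact ht hs)
    exact this hx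
  · intro h
    obtain ⟨x, rfl⟩ := F.ofFin.surjective x
    have hx' : x = ∑ s ∈ x.support, Finsupp.single s (x s) := (Finsupp.sum_single x).symm
    rw [hx', map_sum]
    refine sum_mem fun s hs => ?_
    have hsT : s ∈ T := by
      by_contra hsT
      exact (Finsupp.mem_support_iff.mp hs) (h s hsT)
    generalize x s = y
    induction y using Env.induction with
    | h0 => rw [Finsupp.single_zero, map_zero]; exact zero_mem _
    | ha x y hx hy => rw [Finsupp.single_add, map_add]; exact add_mem hx hy
    | hm a b =>
      rw [← F.smul_gen']
      exact mem_bispan hsT a b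

/-- The bimodule `F.bimod` is semi-free. -/
noncomputable def semiFree : SemiFree S F.bimod where
  deg := F.deg
  filt := F.filt
  gen := F.gen
  gen_mem s := single_mem_freeGr A.one_mem A.one_mem (by ring)
  d_gen s := by
    rw [d_gen, mem_bispan_gen]
    intro t ht
    by_contra h
    exact ht (F.D_low s t h)
  bij := by
    have : genMap 0 F.gen = F.ofFin.toLinearMap := by
      refine LinearMap.ext fun x => ?_
      induction x using free_induction with
      | h0 => simp
      | ha x y hx hy => rw [map_add, hx, hy, map_add]
      | hm s i j a b ha hb => rw [genMap_single, DGAlgebra.sgn_zero, smul_gen']; rfl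
    rw [this]
    exact F.ofFin.bijective

end FreeData

end Free

/-! ### The resolution of a bimodule by cells -/

section Resolution

variable {k : Type u} [Field k] {A : DGAlgebra k} (M : DGBimod A)

/-- Formal cells: a cell has a degree, an image in `M` and a boundary, which is a formal
combination of earlier cells. -/
inductive Cell (A M : Type u) : Type u
  | node (deg : ℤ) (y : M) (n : ℕ) (a b : Fin n → A) (c : Fin n → Cell A M) : Cell A M

namespace Cell

/-- The degree of a cell. -/
def deg {A M : Type u} : Cell A M → ℤ
  | node p _ _ _ _ _ => p

/-- The image of a cell. -/
def val {A M : Type u} : Cell A M → M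
  | node _ y _ _ _ _ => y

/-- The depth of a cell. -/
def depth {A M : Type u} : Cell A M → ℕ
  | node _ _ _ _ _ c => (Finset.univ.sup fun i => (c i).depth) + 1

variable {M}

/-- The boundary of a cell. -/
noncomputable def bd : Cell A.carrier M.carrier → (Cell A.carrier M.carrier →₀ Env A)
  | node _ _ _ a b c => ∑ i, Finsupp.single (c i) (Env.mk (a i) (b i))

/-- The cells whose boundaries are cocycles with the correct image. -/
def Valid : Cell A.carrier M.carrier → Prop
  | node p y n a b c => (∀ i, (c i).Valid) ∧ y ∈ M.gr p ∧
      (∀ i, ∃ q r, a i ∈ A.gr q ∧ b i ∈ A.gr r ∧ q + (c i).deg + r = p + 1) ∧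
      freeD deg bd (bd (node p y n a b c)) = 0 ∧
      genMap (P := M) 0 val (bd (node p y n a b c)) = M.d y

/-- The boundary of a valid cell. -/
noncomputable def bd' : {t : Cell A.carrier M.carrier // t.Valid} →
    ({t : Cell A.carrier M.carrier // t.Valid} →₀ Env A)
  | ⟨node _ _ _ a b c, h⟩ => ∑ i, Finsupp.single ⟨c i, h.1 i⟩ (Env.mk (a i) (b i))

theorem bd'_eq_zero (p : ℤ) (y : M.carrier) (a b : Fin 0 → A.carrier)
    (c : Fin 0 → Cell A.carrier M.carrier) (h : (node p y 0 a b c).Valid) :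
    bd' ⟨node p y 0 a b c, h⟩ = 0 := by
  simp [bd']

theorem mapDomain_bd' (t : {t : Cell A.carrier M.carrier // t.Valid}) :
    Finsupp.lmapDomain (Env A) k Subtype.val (bd' t) = bd t.1 := by
  obtain ⟨⟨p, y, n, a, b, c⟩, h⟩ := t
  simp [bd', bd, map_sum, Finsupp.mapDomain_single]

/-- Validity is defined by recursion on raw cells, so its condition that the boundary be a cycle
lives over all cells. This compatibility with the inclusion of the valid cells transports it to the
bimodule built on them, and back again when a new cell is attached. -/
theorem freeD_mapDomain (x : {t : Cell A.carrier M.carrier // t.Valid} →₀ Env A) :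
    freeD deg bd (Finsupp.lmapDomain (Env A) k Subtype.val x) =
      Finsupp.lmapDomain (Env A) k Subtype.val (freeD (fun t => deg t.1) bd' x) := by
  induction x using free_induction with
  | h0 => simp
  | ha x y hx hy => simp only [map_add, hx, hy]
  | hm s i j a b ha hb =>
    have h1 : ∀ (a : A.carrier) (x : {t : Cell A.carrier M.carrier // t.Valid} →₀ Env A),
        Finsupp.lmapDomain (Env A) k Subtype.val (a • x) =
          a • Finsupp.lmapDomain (Env A) k Subtype.val x := fun a x => Finsupp.mapDomain_smul a x
    have h2 : ∀ (a : A.carrierᵐᵒᵖ) (x : {t : Cell A.carrier M.carrier // t.Valid} →₀ Env A),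
        Finsupp.lmapDomain (Env A) k Subtype.val (a • x) =
          a • Finsupp.lmapDomain (Env A) k Subtype.val x := fun a x => Finsupp.mapDomain_smul a x
    have h3 : ∀ (s : {t : Cell A.carrier M.carrier // t.Valid}) (x : Env A),
        Finsupp.lmapDomain (Env A) k Subtype.val (Finsupp.single s x) = Finsupp.single s.1 x :=
      fun s x => Finsupp.mapDomain_single
    rw [h3, freeD_single, freeD_single, map_add, map_add, NCWeil.map_units_smul, h1, h2, h3, h3,
      mapDomain_bd']

variable (M) in
/-- The semi-free bimodule on all the valid cells. -/
noncomputable def data : FreeData A {t : Cell A.carrier M.carrier // t.Valid} where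
  deg t := deg t.1
  filt t := depth t.1
  D := bd'
  D_mem := by
    rintro ⟨⟨p, y, n, a, b, c⟩, h⟩
    refine sum_mem fun i _ => ?_
    obtain ⟨q, r, hq, hr, e⟩ := h.2.2.1 i
    exact single_mem_freeGr hq hr e
  D_low := by
    classical
    rintro ⟨⟨p, y, n, a, b, c⟩, h⟩ t ht
    change (∑ i, Finsupp.single (⟨c i, h.1 i⟩ : {t : Cell A.carrier M.carrier // t.Valid})
      (Env.mk (a i) (b i))) t ≠ 0 at ht
    rw [Finsupp.finsetSum_apply] at ht
    obtain ⟨i, -, hi⟩ := Finset.exists_ne_zero_of_sum_ne_zero ht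
    have : t = ⟨c i, h.1 i⟩ := by
      by_contra hne
      exact hi (Finsupp.single_eq_of_ne hne)
    subst this
    exact Nat.lt_succ_of_le (Finset.le_sup (f := fun i => (c i).depth) (Finset.mem_univ i))
  d_D t := by
    have hinj : Function.Injective (Finsupp.lmapDomain (Env A) k
        (Subtype.val : {t : Cell A.carrier M.carrier // t.Valid} → _)) :=
      Finsupp.mapDomain_injective Subtype.val_injective
    apply hinj
    rw [← freeD_mapDomain, mapDomain_bd', map_zero]
    obtain ⟨⟨p, y, n, a, b, c⟩, h⟩ := t
    exact h.2.2.2.1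

theorem val_d (t : {t : Cell A.carrier M.carrier // t.Valid}) :
    genMap (P := M) 0 (fun t : {t : Cell A.carrier M.carrier // t.Valid} => val t.1) (bd' t) =
      M.d (val t.1) := by
  have : genMap (P := M) 0 (fun t : {t : Cell A.carrier M.carrier // t.Valid} => val t.1) (bd' t) =
      genMap (P := M) 0 val (bd t.1) := by
    obtain ⟨⟨p, y, n, a, b, c⟩, h⟩ := t
    simp [bd', bd, map_sum, genMap_single]
  rw [this]
  obtain ⟨⟨p, y, n, a, b, c⟩, h⟩ := t
  exact h.2.2.2.2

theorem val_mem (t : {t : Cell A.carrier M.carrier // t.Valid}) : val t.1 ∈ M.gr (deg t.1) := by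
  obtain ⟨⟨p, y, n, a, b, c⟩, h⟩ := t
  exact h.2.1

/-- The bimodule is literally a space of finitely supported functions, so the abstract extension
from generators is the concrete sum; boundaries of cells are then evaluated by direct computation.
-/
theorem extend_eq_genMap :
    (data M).semiFree.extend 0 (fun t : {t : Cell A.carrier M.carrier // t.Valid} => val t.1) =
      genMap (P := M) 0 (fun t : {t : Cell A.carrier M.carrier // t.Valid} => val t.1) := by
  ext1 x
  induction x using (data M).semiFree.induction with
  | h0 => exact (map_zero _).trans (map_zero (genMap (P := M) 0 _)).symm
  | ha x y hx hy =>
    rw [map_add, hx, hy]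
    exact (map_add (genMap (P := M) 0 _) _ _).symm
  | hm i j a b ha hb s =>
    rw [SemiFree.extend_apply]
    change _ = genMap (P := M) 0 _ (a • MulOpposite.op b • (data M).gen s)
    rw [FreeData.smul_gen, genMap_single]

variable (M) in
/-- The augmentation of the resolution by cells. -/
noncomputable def aug : (data M).bimod ⟶ M :=
  IsKHom.toHom (φ := (data M).semiFree.extend 0 fun t => val t.1)
    ((data M).semiFree.isKHom_extend 0 fun t => by
      rw [add_zero]; exact val_mem t)
    ((data M).semiFree.d_comm ((data M).semiFree.isKHom_extend 0 fun t => by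
      rw [add_zero]; exact val_mem t) fun t => by
        rw [SemiFree.extend_gen]
        change (data M).semiFree.extend 0 _ ((data M).bimod.d ((data M).gen t)) = _
        rw [FreeData.d_gen, extend_eq_genMap]
        exact val_d t)

theorem aug_gen (t : {t : Cell A.carrier M.carrier // t.Valid}) :
    (aug M).toLinearMap ((data M).gen t) = val t.1 :=
  SemiFree.extend_gen _ _ _ _

theorem aug_ofFin (x : {t : Cell A.carrier M.carrier // t.Valid} →₀ Env A) :
    (aug M).toLinearMap ((data M).ofFin x) =
      genMap (P := M) 0 (fun t : {t : Cell A.carrier M.carrier // t.Valid} => val t.1) x :=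
  LinearMap.congr_fun extend_eq_genMap x

theorem genMap_mapDomain (x : {t : Cell A.carrier M.carrier // t.Valid} →₀ Env A) :
    genMap (P := M) 0 val (Finsupp.lmapDomain (Env A) k Subtype.val x) =
      genMap (P := M) 0 (fun t : {t : Cell A.carrier M.carrier // t.Valid} => val t.1) x := by
  induction x using free_induction with
  | h0 => simp
  | ha x y hx hy => simp only [map_add, hx, hy]
  | hm s i j a b ha hb =>
    rw [Finsupp.lmapDomain_apply, Finsupp.mapDomain_single, genMap_single, genMap_single]

variable (M) in
/-- The resolution by cells is a quasi-isomorphism. -/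
theorem quasiIso_aug : quasiIso A (aug M) := by
  rw [DGBimod.quasiIso_iff]
  refine fun n => ⟨?_, ?_⟩
  · rintro x hx hdx ⟨y, hy, e⟩
    obtain ⟨x, rfl⟩ := (data M).ofFin.surjective x
    replace hdx : freeD (fun t : {t : Cell A.carrier M.carrier // t.Valid} => deg t.1) bd' x = 0 :=
      hdx
    obtain ⟨N, c, q, r, a, b, ha, hb, hd, hx'⟩ := exists_sum_of_mem_freeGr
      (show x ∈ freeGr A (fun t => deg t.1) n from hx)
    -- A cycle `x` whose image bounds `y` is a legitimate boundary: the cell with boundary `x` and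
    -- image `y` is valid, and the differential of its generator is `x`. Cells being closed under
    -- this construction, no iteration of bimodules is needed.
    let t : Cell A.carrier M.carrier := node (n - 1) y N a b fun i => (c i).1
    have hbd : bd t = Finsupp.lmapDomain (Env A) k Subtype.val x := by
      rw [hx', map_sum]
      exact Finset.sum_congr rfl fun i _ => (Finsupp.mapDomain_single).symm
    have ht : t.Valid := by
      refine ⟨fun i => (c i).2, hy, fun i => ⟨q i, r i, ha i, hb i, ?_⟩, ?_, ?_⟩
      · rw [sub_add_cancel]; exact hd i
      · change freeD deg bd (bd t) = 0
        rw [hbd, freeD_mapDomain, hdx, map_zero]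
      · change genMap (P := M) 0 val (bd t) = _
        rw [e, hbd, aug_ofFin, genMap_mapDomain]
    refine ⟨(data M).gen ⟨t, ht⟩, (data M).semiFree.gen_mem ⟨t, ht⟩, ?_⟩
    rw [FreeData.d_gen, hx']
    rfl
  · intro y hy hdy
    -- A cell with empty boundary is a cycle lying over the given cocycle.
    let t : Cell A.carrier M.carrier := node n y 0 Fin.elim0 Fin.elim0 Fin.elim0
    have ht : t.Valid := ⟨fun i => i.elim0, hy, fun i => i.elim0, by simp [bd], by
      simp [bd, hdy]⟩
    refine ⟨(data M).gen ⟨t, ht⟩, (data M).semiFree.gen_mem ⟨t, ht⟩, ?_, 0, zero_mem _, ?_⟩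
    · rw [FreeData.d_gen]
      exact bd'_eq_zero _ _ _ _ _ ht
    · rw [aug_gen, map_zero, add_zero]
      rfl

end Cell

end Resolution

end NCWeil

namespace NCWeil

namespace DGBimod

variable {k : Type u} [Field k] {A : DGAlgebra k}

/-! ### Morphisms from K-projectives in the derived category -/

section HomotopyClasses

/-- Homotopy classes of maps out of a dg bimodule. -/
def homotopyClasses (P : DGBimod A) : DGBimod A ⥤ Type u where
  obj X := Quot (Homotopic (M := P) (N := X))
  map f := TypeCat.ofHom (Quot.map (· ≫ f) fun _ _ H => H.comp_right f)
  map_id X := by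
    ext ⟨v⟩
    exact congrArg (Quot.mk _) (Category.comp_id v)
  map_comp f g := by
    ext ⟨v⟩
    exact congrArg (Quot.mk _) (Category.assoc v f g).symm

theorem homotopic_of_quot_eq {P X : DGBimod A} {f g : P ⟶ X}
    (h : Quot.mk (Homotopic (M := P) (N := X)) f = Quot.mk _ g) : Homotopic f g :=
  (Equivalence.quot_mk_eq_iff ⟨Homotopic.refl, Homotopic.symm, Homotopic.trans⟩ f g).mp h

/-- Surjectivity and injectivity of composition with a quasi-isomorphism are `KProj.lift` and
`KProj.homotopic_of_comp`. Consequently the functor of homotopy classes out of `P` factors through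
the derived category. -/
theorem KProj.isInvertedBy_homotopyClasses {P : DGBimod A} (hP : KProj P) :
    (quasiIso A).IsInvertedBy (homotopyClasses P) := by
  intro X Y s hs
  rw [isIso_iff_bijective]
  constructor
  · rintro ⟨f⟩ ⟨g⟩ h
    exact Quot.sound (hP.homotopic_of_comp hs (homotopic_of_quot_eq h))
  · rintro ⟨f⟩
    obtain ⟨g, hg⟩ := hP.lift hs f
    exact ⟨Quot.mk _ g, Quot.sound hg⟩

/-- The functor of homotopy classes out of `P` factors through `Q`, so `f` and `g` act equally on
it; evaluation at the class of the identity of `P` compares them. -/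
theorem KProj.homotopic_of_Q_map_eq {P Y : DGBimod A} (hP : KProj P) {f g : P ⟶ Y}
    (h : (quasiIso A).Q.map f = (quasiIso A).Q.map g) : Homotopic f g := by
  have e := Localization.Construction.fac _ hP.isInvertedBy_homotopyClasses
  have e' : (homotopyClasses P).map f = (homotopyClasses P).map g := by
    have hf := Functor.congr_hom e f
    have hg := Functor.congr_hom e g
    rw [Functor.comp_map] at hf hg
    rw [h, hg] at hf
    exact ((cancel_mono _).mp ((cancel_epi _).mp hf)).symm
  have := congrArg (fun φ => φ (Quot.mk _ (𝟙 P))) e'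
  refine homotopic_of_quot_eq ?_
  have h1 : Quot.mk (Homotopic (M := P) (N := Y)) (𝟙 P ≫ f) = Quot.mk _ (𝟙 P ≫ g) := this
  simpa using h1

/-- Consider the morphisms of the localization whose composite with every Q(v), for v out of `P`, is
again some Q(v'). They are stable under composition, and contain the images of `Q` and, by
`KProj.lift`, the formal inverses of quasi-isomorphisms, hence everything. The case of the identity
v is the claim. -/
theorem KProj.exists_Q_map_eq {P Y : DGBimod A} (hP : KProj P)
    (g : (quasiIso A).Q.obj P ⟶ (quasiIso A).Q.obj Y) :
    ∃ f : P ⟶ Y, (quasiIso A).Q.map f = g := by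
  let W : MorphismProperty (quasiIso A).Localization := fun X Y g =>
    ∀ v : P ⟶ X.as.obj, ∃ v' : P ⟶ Y.as.obj,
      (show (quasiIso A).Q.obj P ⟶ X from (quasiIso A).Q.map v) ≫ g = (quasiIso A).Q.map v'
  have : W.IsStableUnderComposition := ⟨fun f g hf hg v => by
    obtain ⟨v', hv'⟩ := hf v
    obtain ⟨v'', hv''⟩ := hg v'
    refine ⟨v'', ?_⟩
    rw [← Category.assoc, hv', ← hv'']⟩
  have hW : W = ⊤ := by
    refine Localization.Construction.morphismProperty_eq_top W ?_ ?_
    · intro X Y f v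
      exact ⟨v ≫ f, ((quasiIso A).Q.map_comp v f).symm⟩
    · intro X Y s hs v
      obtain ⟨v', hv'⟩ := hP.lift hs v
      refine ⟨v', ?_⟩
      have h1 : (quasiIso A).Q.map v = (quasiIso A).Q.map v' ≫ (quasiIso A).Q.map s := by
        rw [← Functor.map_comp]
        exact (Q_map_eq_of_homotopic hv').symm
      have h2 : (quasiIso A).Q.map v' ≫ (quasiIso A).Q.map s ≫ Localization.Construction.wInv s hs
          = (quasiIso A).Q.map v' :=
        (congrArg (_ ≫ ·) (Localization.Construction.wIso s hs).hom_inv_id).trans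
          (Category.comp_id _)
      exact (congrArg (· ≫ Localization.Construction.wInv s hs) h1).trans
        ((Category.assoc _ _ _).trans h2)
  have hg : W g := by rw [hW]; trivial
  obtain ⟨f, hf⟩ := hg (𝟙 P)
  refine ⟨f, hf.symm.trans ?_⟩
  exact (congrArg (· ≫ g) ((quasiIso A).Q.map_id P)).trans (Category.id_comp g)

end HomotopyClasses

/-! ### Coproducts in the derived category -/

section Coproducts

variable {I : Type u}

/-- The direct sum of dg bimodules, as a cofan in the derived category. -/
noncomputable abbrev dsumCofan (Z : I → DGBimod A) : Cofan fun i => (quasiIso A).Q.obj (Z i) :=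
  Cofan.mk ((quasiIso A).Q.obj (dsum Z)) fun i => (quasiIso A).Q.map (dsumι i)

theorem isIso_Q_map {M N : DGBimod A} {f : M ⟶ N} (hf : quasiIso A f) :
    IsIso ((quasiIso A).Q.map f) := (quasiIso A).Q_inverts f hf

/-- Cell resolutions of the summands make the direct sum K-projective without changing it in the
derived category. Both morphisms are then represented by bimodule maps, and homotopies on the
summands assemble to a homotopy on the sum. -/
theorem dsum_Q_hom_ext {Z : I → DGBimod A} {Y : DGBimod A}
    {f g : (quasiIso A).Q.obj (dsum Z) ⟶ (quasiIso A).Q.obj Y}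
    (h : ∀ i, (quasiIso A).Q.map (dsumι i) ≫ f = (quasiIso A).Q.map (dsumι i) ≫ g) : f = g := by
  let P := fun i => (Cell.data (Z i)).bimod
  let s : ∀ i, P i ⟶ Z i := fun i => Cell.aug (Z i)
  have hs : ∀ i, quasiIso A (s i) := fun i => Cell.quasiIso_aug (Z i)
  have hP : ∀ i, KProj (P i) := fun i => (Cell.data (Z i)).semiFree.kProj
  let F : dsum P ⟶ dsum Z := dsumDesc fun i => s i ≫ dsumι i
  have hF : IsIso ((quasiIso A).Q.map F) := isIso_Q_map (quasiIso_dsumMap s hs)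
  rw [← cancel_epi ((quasiIso A).Q.map F)]
  obtain ⟨f', hf'⟩ := (KProj.dsum hP).exists_Q_map_eq ((quasiIso A).Q.map F ≫ f)
  obtain ⟨g', hg'⟩ := (KProj.dsum hP).exists_Q_map_eq ((quasiIso A).Q.map F ≫ g)
  rw [← hf', ← hg']
  refine Q_map_eq_of_homotopic (homotopic_of_dsumι fun i => (hP i).homotopic_of_Q_map_eq ?_)
  rw [Functor.map_comp, Functor.map_comp, hf', hg', ← Category.assoc, ← Category.assoc,
    ← Functor.map_comp, dsumι_desc, Functor.map_comp, Category.assoc, Category.assoc, h i]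

/-- On K-projective resolutions of the summands the given morphisms are honest bimodule maps, which
combine on the direct sum. The direct sum of the augmentations is invertible in the derived category
and carries the result back. -/
theorem exists_dsum_Q_desc {Z : I → DGBimod A} {Y : DGBimod A}
    (f : ∀ i, (quasiIso A).Q.obj (Z i) ⟶ (quasiIso A).Q.obj Y) :
    ∃ g : (quasiIso A).Q.obj (dsum Z) ⟶ (quasiIso A).Q.obj Y,
      ∀ i, (quasiIso A).Q.map (dsumι i) ≫ g = f i := by
  let P := fun i => (Cell.data (Z i)).bimod
  let s : ∀ i, P i ⟶ Z i := fun i => Cell.aug (Z i)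
  have hs : ∀ i, quasiIso A (s i) := fun i => Cell.quasiIso_aug (Z i)
  have hP : ∀ i, KProj (P i) := fun i => (Cell.data (Z i)).semiFree.kProj
  let F : dsum P ⟶ dsum Z := dsumDesc fun i => s i ≫ dsumι i
  have hF : IsIso ((quasiIso A).Q.map F) := isIso_Q_map (quasiIso_dsumMap s hs)
  choose f' hf' using fun i => (hP i).exists_Q_map_eq ((quasiIso A).Q.map (s i) ≫ f i)
  refine ⟨inv ((quasiIso A).Q.map F) ≫ (quasiIso A).Q.map (dsumDesc f'), fun i => ?_⟩
  have := isIso_Q_map (hs i)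
  rw [← cancel_epi ((quasiIso A).Q.map (s i)), ← hf' i, ← dsumι_desc f' i, Functor.map_comp,
    ← Category.assoc, ← Category.assoc, ← Functor.map_comp,
    show s i ≫ dsumι i = dsumι i ≫ F from (dsumι_desc (fun i => s i ≫ dsumι i) i).symm,
    Functor.map_comp, Category.assoc]
  exact (Category.assoc _ _ _).trans <| congrArg ((quasiIso A).Q.map (dsumι i) ≫ ·)
    (IsIso.hom_inv_id_assoc ((quasiIso A).Q.map F) ((quasiIso A).Q.map (dsumDesc f')))

/-- Direct sums of dg bimodules are coproducts in the derived category. -/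
noncomputable def isColimitDsumCofan (Z : I → DGBimod A) : IsColimit (dsumCofan Z) :=
  Cofan.IsColimit.mk _
    (fun t => (exists_dsum_Q_desc (Z := Z) (Y := t.pt.as.obj) t.inj).choose)
    (fun t i => (exists_dsum_Q_desc (Z := Z) (Y := t.pt.as.obj) t.inj).choose_spec i)
    (fun t _ hm => dsum_Q_hom_ext (Y := t.pt.as.obj) fun i =>
      (hm i).trans ((exists_dsum_Q_desc (Z := Z) (Y := t.pt.as.obj) t.inj).choose_spec i).symm)

end Coproducts

end DGBimod

/-! ### Compactness of K-projective bimodules in terms of homotopies -/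

section Compact

variable {C : Type*} [Category C]

/-- A morphism out of `X` is precomposed with the retraction, factored through a finite
subcoproduct, and restricted along the inclusion. -/
theorem IsCompactObject.of_retract {X X' : C} (h : IsCompactObject.{u} X') (i : X ⟶ X')
    (r : X' ⟶ X) (e : i ≫ r = 𝟙 X) : IsCompactObject.{u} X := by
  intro I Y c hc f
  obtain ⟨J, c', hc', g, hg⟩ := h Y c hc (r ≫ f)
  exact ⟨J, c', hc', i ≫ g, by rw [Category.assoc, hg, ← Category.assoc, e, Category.id_comp]⟩

end Compact

namespace DGBimod

variable {k : Type u} [Field k] {A : DGAlgebra k}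

theorem isCompactObject_iff_of_quasiIso {M N : DGBimod A} {f : M ⟶ N} (hf : quasiIso A f) :
    IsCompactObject.{u} ((quasiIso A).Q.obj M) ↔ IsCompactObject.{u} ((quasiIso A).Q.obj N) := by
  have := isIso_Q_map hf
  exact ⟨fun h => h.of_retract _ _ (IsIso.inv_hom_id ((quasiIso A).Q.map f)),
    fun h => h.of_retract _ _ (IsIso.hom_inv_id ((quasiIso A).Q.map f))⟩

/-- The projection to the summands in `J` is the identity on the finite subcoproduct through which
the image of `φ` factors. K-projectivity turns the resulting equality in the derived category into a
homotopy. -/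
theorem KProj.exists_finset_of_isCompactObject {P : DGBimod A} (hP : KProj P)
    (h : IsCompactObject.{u} ((quasiIso A).Q.obj P)) {I : Type u} (Z : I → DGBimod A)
    (φ : P ⟶ DGBimod.dsum Z) :
    ∃ J : Finset I, Homotopic (φ ≫ dsumProj Z J) φ := by
  obtain ⟨J, c', hc', g, hg⟩ := h _ (dsumCofan Z) (isColimitDsumCofan Z) ((quasiIso A).Q.map φ)
  refine ⟨J, hP.homotopic_of_Q_map_eq ?_⟩
  rw [Functor.map_comp, ← hg, Category.assoc]
  congr 1
  refine Cofan.IsColimit.hom_ext hc' _ _ fun j => ?_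
  rw [← Category.assoc, Cofan.IsColimit.fac]
  change (quasiIso A).Q.map (dsumι j.1) ≫ _ = (quasiIso A).Q.map (dsumι j.1)
  rw [← Functor.map_comp, dsumι_proj j.2]

/-- The projection from a direct sum to a finite subsum. -/
noncomputable def dsumRestrict {I : Type u} (Z : I → DGBimod A) (J : Finset I) :
    dsum Z ⟶ dsum fun j : J => Z j := by
  classical
  exact dsumDesc fun i => if hi : i ∈ J then dsumι (Z := fun j : J => Z j) ⟨i, hi⟩ else
    IsKHom.toHom (φ := 0) IsKHom.zero (fun m => by simp)

theorem dsumRestrict_comp {I : Type u} (Z : I → DGBimod A) (J : Finset I) :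
    dsumRestrict Z J ≫ dsumDesc (fun j : J => dsumι (Z := Z) j.1) = dsumProj Z J := by
  refine dsum_hom_ext fun i => ?_
  rw [dsumRestrict, dsumProj, ← Category.assoc, dsumι_desc, dsumι_desc]
  by_cases hi : i ∈ J
  · rw [dif_pos hi, if_pos hi, dsumι_desc]
  · rw [dif_neg hi, if_neg hi]
    apply hom_ext
    ext m
    exact map_zero (dsumDesc fun j : J => dsumι (Z := Z) j.1).toLinearMap

/-- Every coproduct in the derived category is isomorphic to a direct sum of bimodules, and every
morphism from `P` to that is represented by a bimodule map. A homotopy to its projection on a finite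
partial sum becomes the required factorization. -/
theorem KProj.isCompactObject {P : DGBimod A} (hP : KProj P)
    (h : ∀ {I : Type u} (Z : I → DGBimod A) (φ : P ⟶ DGBimod.dsum Z),
      ∃ J : Finset I, Homotopic (φ ≫ dsumProj Z J) φ) :
    IsCompactObject.{u} ((quasiIso A).Q.obj P) := by
  intro I Y c hc f
  obtain ⟨Z, rfl⟩ : ∃ Z : I → DGBimod A, Y = fun i => (quasiIso A).Q.obj (Z i) :=
    ⟨fun i => (Y i).as.obj, rfl⟩
  let e : c.pt ≅ (dsumCofan Z).pt := hc.coconePointUniqueUpToIso (isColimitDsumCofan Z)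
  have he : ∀ i, (quasiIso A).Q.map (dsumι i) ≫ e.inv = c.inj i := fun i =>
    hc.comp_coconePointUniqueUpToIso_inv (isColimitDsumCofan Z) ⟨i⟩
  obtain ⟨φ, hφ⟩ := hP.exists_Q_map_eq (Y := DGBimod.dsum Z) (f ≫ e.hom)
  obtain ⟨J, hJ⟩ := h Z φ
  refine ⟨J, dsumCofan fun j : J => Z j, isColimitDsumCofan _,
    (quasiIso A).Q.map (φ ≫ dsumRestrict Z J), ?_⟩
  rw [← cancel_mono e.hom, ← hφ, ← Q_map_eq_of_homotopic hJ, ← dsumRestrict_comp,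
    ← Category.assoc φ, Functor.map_comp _ (φ ≫ _), Category.assoc]
  congr 1
  refine dsum_Q_hom_ext fun j => ?_
  rw [← Category.assoc, ← Functor.map_comp, dsumι_desc]
  refine Eq.trans (congrArg (· ≫ e.hom) (Cofan.IsColimit.fac (isColimitDsumCofan _) _ j)) ?_
  rw [← he, Category.assoc, e.inv_hom_id]
  exact Category.comp_id _

end DGBimod

end NCWeil

namespace NCWeil

open DGBimod

/-! ### Compactness bounds the filtration -/

section Truncation

variable {k : Type u} [Field k] {A : DGAlgebra k} {S : Type u}

open scoped Classical in
/-- The projection which kills the generators in `X`. -/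
noncomputable def killGen (A : DGAlgebra k) (X : Set S) : (S →₀ Env A) →ₗ[k] (S →₀ Env A) :=
  Finsupp.lsum k fun s => if s ∈ X then 0 else Finsupp.lsingle s

theorem killGen_single {X : Set S} {s : S} (hs : s ∉ X) (x : Env A) :
    killGen A X (Finsupp.single s x) = Finsupp.single s x := by
  simp [killGen, hs]

theorem killGen_single_mem {X : Set S} {s : S} (hs : s ∈ X) (x : Env A) :
    killGen A X (Finsupp.single s x) = 0 := by
  simp [killGen, hs]

theorem killGen_apply {X : Set S} {t : S} (ht : t ∉ X) (x : S →₀ Env A) :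
    killGen A X x t = x t := by
  induction x using Finsupp.induction_linear with
  | zero => simp
  | add x y hx hy => rw [map_add, Finsupp.add_apply, hx, hy, Finsupp.add_apply]
  | single s x =>
    by_cases hs : s ∈ X
    · rw [killGen_single_mem hs, Finsupp.single_eq_of_ne (by rintro rfl; exact ht hs)]
      rfl
    · rw [killGen_single hs]

theorem killGen_apply_mem {X : Set S} {t : S} (ht : t ∈ X) (x : S →₀ Env A) :
    killGen A X x t = 0 := by
  induction x using Finsupp.induction_linear with
  | zero => simp
  | add x y hx hy => rw [map_add, Finsupp.add_apply, hx, hy, add_zero]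
  | single s x =>
    by_cases hs : s ∈ X
    · rw [killGen_single_mem hs]; rfl
    · rw [killGen_single hs, Finsupp.single_eq_of_ne (by rintro rfl; exact hs ht)]

theorem killGen_eq_zero {X : Set S} {x : S →₀ Env A} (h : ∀ t ∉ X, x t = 0) :
    killGen A X x = 0 := by
  ext t
  by_cases ht : t ∈ X
  · rw [killGen_apply_mem ht]; rfl
  · rw [killGen_apply ht, h t ht]; rfl

theorem killGen_killGen (X : Set S) (x : S →₀ Env A) :
    killGen A X (killGen A X x) = killGen A X x := by
  ext t
  by_cases ht : t ∈ X
  · rw [killGen_apply_mem ht, killGen_apply_mem ht]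
  · rw [killGen_apply ht]

theorem killGen_smul (X : Set S) (a : A.carrier) (x : S →₀ Env A) :
    killGen A X (a • x) = a • killGen A X x := by
  ext t
  by_cases ht : t ∈ X
  · rw [killGen_apply_mem ht, Finsupp.smul_apply, killGen_apply_mem ht, smul_zero]
  · rw [killGen_apply ht, Finsupp.smul_apply, Finsupp.smul_apply, killGen_apply ht]

theorem killGen_op_smul (X : Set S) (a : A.carrierᵐᵒᵖ) (x : S →₀ Env A) :
    killGen A X (a • x) = a • killGen A X x := by
  ext t
  by_cases ht : t ∈ X
  · rw [killGen_apply_mem ht, Finsupp.smul_apply, killGen_apply_mem ht, smul_zero]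
  · rw [killGen_apply ht, Finsupp.smul_apply, Finsupp.smul_apply, killGen_apply ht]

theorem killGen_mem {deg : S → ℤ} {n : ℤ} (X : Set S) {x : S →₀ Env A}
    (hx : x ∈ freeGr A deg n) : killGen A X x ∈ freeGr A deg n := by
  induction hx using Submodule.span_induction with
  | zero => simp
  | add x y _ _ hx hy => rw [map_add]; exact add_mem hx hy
  | smul c x _ hx => rw [map_smul]; exact Submodule.smul_mem _ _ hx
  | mem x hx =>
    obtain ⟨s, i, j, a, b, ha, hb, h, rfl⟩ := hx
    by_cases hs : s ∈ X
    · rw [killGen_single_mem hs]; exact zero_mem _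
    · rw [killGen_single hs]; exact single_mem_freeGr ha hb h

namespace FreeData

variable (F : FreeData A S)

/-- Sets of generators which generate a dg sub-bimodule. -/
def Closed (X : Set S) : Prop := ∀ s ∈ X, ∀ t, F.D s t ≠ 0 → t ∈ X

-- Since `X` is closed, its generators span a dg sub-bimodule on which both sides vanish. On a
-- generator outside `X` the two sides agree by construction.
variable {F} in
theorem killGen_freeD {X : Set S} (hX : F.Closed X) (x : S →₀ Env A) :
    killGen A X (freeD F.deg F.D x) = freeD F.deg (fun s => killGen A X (F.D s))
      (killGen A X x) := by
  induction x using free_induction with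
  | h0 => simp
  | ha x y hx hy => simp only [map_add, hx, hy]
  | hm s i j a b ha hb =>
    by_cases hs : s ∈ X
    · rw [killGen_single_mem hs, map_zero]
      have hD : killGen A X (F.D s) = 0 := killGen_eq_zero fun t ht => by
        by_contra h
        exact ht (hX s hs t h)
      rw [freeD_single, map_add, map_add, NCWeil.map_units_smul, killGen_single_mem hs,
        killGen_single_mem hs, killGen_smul, killGen_op_smul, hD]
      simp
    · rw [killGen_single hs, freeD_single, freeD_single, map_add, map_add, NCWeil.map_units_smul,
        killGen_single hs, killGen_single hs, killGen_smul, killGen_op_smul]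

/-- The generators outside of `X`, with the differential modulo the generators in `X`. -/
noncomputable def quot {X : Set S} (hX : F.Closed X) : FreeData A S where
  -- The index set is not cut down to the complement of `X`. The generators in `X` survive as a
  -- direct summand with zero differential, which the projection from the original bimodule does not
  -- meet.
  deg := F.deg
  filt := F.filt
  D s := killGen A X (F.D s)
  D_mem s := killGen_mem X (F.D_mem s)
  D_low s t h := F.D_low s t fun h' => h <| by
    by_cases ht : t ∈ X
    · exact killGen_apply_mem ht _
    · rw [killGen_apply ht, h']
  d_D s := by rw [← killGen_freeD hX, F.d_D, map_zero]

/-- The projection modulo a dg sub-bimodule. -/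
noncomputable def toQuot {X : Set S} (hX : F.Closed X) : F.bimod ⟶ (F.quot hX).bimod where
  toLinearMap := killGen A X
  map_smul := killGen_smul X
  map_op_smul a := killGen_op_smul X (MulOpposite.op a)
  map_gr _ _ hx := killGen_mem X hx
  map_d := killGen_freeD hX

variable {F} in
theorem mem_bispan_of_toQuot {X : Set S} (hX : F.Closed X) {x : F.bimod.carrier}
    (h : (F.toQuot hX).toLinearMap x = 0) : x ∈ bispan F.gen X := by
  rw [mem_bispan_gen]
  intro t ht
  have : killGen A X (F.ofFin.symm x) = 0 := h
  rw [coord, LinearMap.comp_apply, Finsupp.lapply_apply, ← killGen_apply ht, LinearEquiv.coe_coe,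
    this]
  rfl

theorem toQuot_of_mem_bispan {X : Set S} (hX : F.Closed X) {x : F.bimod.carrier}
    (h : x ∈ bispan F.gen X) : (F.toQuot hX).toLinearMap x = 0 := by
  rw [mem_bispan_gen] at h
  exact killGen_eq_zero h

/-- The projection of the quotient, as a map of degree `0` to the original bimodule. -/
noncomputable def ofQuot {X : Set S} (hX : F.Closed X) :
    (F.quot hX).bimod.carrier →ₗ[k] F.bimod.carrier := killGen A X

theorem isKHom_ofQuot {X : Set S} (hX : F.Closed X) :
    IsKHom 0 (M := (F.quot hX).bimod) (N := F.bimod) (F.ofQuot hX) where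
  map_smul a x := by
    rw [DGAlgebra.sgn_zero]
    exact killGen_smul X a _
  map_op_smul a := killGen_op_smul X (MulOpposite.op a)
  map_gr n x hx := by
    rw [add_zero]
    exact killGen_mem X hx

/-- The graded splitting `ofQuot` need not commute with the differentials, but its defect dies under
the projection. That suffices to carry a nullhomotopy on the quotient back to the original bimodule.
-/
theorem toQuot_d_ofQuot {X : Set S} (hX : F.Closed X) (x : (F.quot hX).bimod.carrier) :
    (F.toQuot hX).toLinearMap (F.bimod.d (F.ofQuot hX x)) =
      (F.toQuot hX).toLinearMap (F.ofQuot hX ((F.quot hX).bimod.d x)) := by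
  have hX' : (F.quot hX).Closed X := fun s hs t h => hX s hs t fun h' => h <| by
    by_cases ht : t ∈ X
    · exact killGen_apply_mem ht _
    · exact (killGen_apply ht _).trans h'
  have h1 : freeD F.deg (fun s => killGen A X (F.D s)) (killGen A X (killGen A X x)) =
      freeD F.deg (fun s => killGen A X (F.D s)) (killGen A X x) :=
    congrArg _ (killGen_killGen X x)
  have h2 : killGen A X (freeD F.deg (fun s => killGen A X (F.D s)) x) =
      freeD F.deg (fun s => killGen A X (killGen A X (F.D s))) (killGen A X x) :=
    killGen_freeD hX' (F := F.quot hX) x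
  have h3 : (fun s => killGen A X (killGen A X (F.D s))) = fun s => killGen A X (F.D s) :=
    funext fun s => killGen_killGen X _
  rw [h3] at h2
  exact ((F.toQuot hX).map_d _).trans (h1.trans (h2.symm.trans (killGen_killGen X _).symm))

theorem toQuot_ofQuot_toQuot {X : Set S} (hX : F.Closed X) (x : F.bimod.carrier) :
    (F.toQuot hX).toLinearMap (F.ofQuot hX ((F.toQuot hX).toLinearMap x)) =
      (F.toQuot hX).toLinearMap x :=
  (killGen_killGen X _).trans (killGen_killGen X _)

theorem closed_filt (n : ℕ) : F.Closed {s | F.filt s < n} := fun s hs t h =>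
  (F.D_low s t h).trans hs

/-- A finite set of generators is contained in a finite set which generates a dg sub-bimodule. -/
theorem exists_finset_closed (X : Finset S) :
    ∃ Y : Finset S, X ⊆ Y ∧ F.Closed (Y : Set S) := by
  classical
  -- Induction on the filtration: the boundary of `s` has finite support consisting of earlier
  -- generators, each of which already lies in a finite closed set.
  have h1 : ∀ n s, F.filt s < n → ∃ Y : Finset S, s ∈ Y ∧ F.Closed (Y : Set S) := by
    intro n
    induction n with
    | zero => intro s hs; omega
    | succ n ih =>
      intro s hs
      choose! Y hY hY' using ih
      refine ⟨insert s ((F.D s).support.biUnion Y), by simp, ?_⟩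
      intro t ht r hr
      have hlow : ∀ t ∈ (F.D s).support, F.filt t < n := fun t ht => by
        have := F.D_low s t (Finsupp.mem_support_iff.mp ht)
        omega
      rw [Finset.coe_insert, Set.mem_insert_iff] at ht ⊢
      right
      rw [Finset.mem_coe, Finset.mem_biUnion]
      rcases ht with rfl | ht
      · have hr' := Finsupp.mem_support_iff.mpr hr
        exact ⟨r, hr', hY r (hlow r hr')⟩
      · rw [Finset.mem_coe, Finset.mem_biUnion] at ht
        obtain ⟨q, hq, hq'⟩ := ht
        exact ⟨q, hq, hY' q (hlow q hq) t hq' r hr⟩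
  choose Y hY hY' using fun s => h1 _ s (Nat.lt_succ_self _)
  refine ⟨X.biUnion Y, fun s hs => Finset.mem_biUnion.mpr ⟨s, hs, hY s⟩, fun s hs t ht => ?_⟩
  rw [Finset.mem_coe, Finset.mem_biUnion] at hs ⊢
  obtain ⟨q, hq, hq'⟩ := hs
  exact ⟨q, hq, hY' q s hq' t ht⟩

/-- The identity plus a boundary. -/
theorem exists_homotopic_add {M N : DGBimod A} (u : M ⟶ N)
    {h : M.carrier →ₗ[k] N.carrier} (hh : IsKHom (-1) h) :
    ∃ u' : M ⟶ N, Homotopic u' u ∧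
      ∀ m, u'.toLinearMap m = u.toLinearMap m + (N.d (h m) + h (M.d m)) := by
  refine ⟨IsKHom.toHom ((IsKHom.of_hom u).add hh.commutator) fun m => ?_, ⟨h, hh, ?_⟩,
    fun m => rfl⟩
  · simp [u.map_d, M.d_d, N.d_d]
  · rw [IsKHom.toHom_toLinearMap, add_sub_cancel_left]

/-- The projections to the quotients by the generators of filtration < n, for all n, form a map to
the direct sum, because each generator survives in finitely many of them. By compactness this map is
homotopic to one that misses almost all n, so for some n the projection is nullhomotopic. Correcting
the identity by the boundary of a lift of that nullhomotopy moves its image into filtration < n. -/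
theorem exists_filt_lt_of_isCompactObject
    (hF : IsCompactObject.{u} ((quasiIso A).Q.obj F.bimod)) :
    ∃ (n : ℕ) (v : F.bimod ⟶ F.bimod), Homotopic v (𝟙 _) ∧
      ∀ p, v.toLinearMap p ∈ bispan F.gen {s | F.filt s < n} := by
  let Z : ULift.{u} ℕ → DGBimod A := fun n => (F.quot (F.closed_filt n.down)).bimod
  let π : ∀ n, F.bimod ⟶ Z n := fun n => F.toQuot (F.closed_filt n.down)
  -- These are the indices n ≤ `F.filt s`; for all larger n the generator `s` is killed.
  let N : S → Finset (ULift.{u} ℕ) := fun s =>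
    (Finset.range (F.filt s + 1)).map Equiv.ulift.symm.toEmbedding
  have hN : ∀ s n, n ∉ N s → F.filt s < n.down := by
    intro s n hn
    by_contra h
    exact hn (Finset.mem_map.mpr ⟨n.down, Finset.mem_range.mpr (by omega), rfl⟩)
  let y : S → (dsum Z).carrier := fun s => dsumMk (N s) fun n => (π n).toLinearMap (F.gen s)
  have hφ : IsKHom 0 (F.semiFree.extend 0 y) := F.semiFree.isKHom_extend 0 fun s => by
    rw [add_zero]
    exact dsumMk_mem fun n => (π n).map_gr _ _ (F.semiFree.gen_mem s)
  have hπ : ∀ n x, (dsumπ n).toLinearMap (F.semiFree.extend 0 y x) = (π n).toLinearMap x := by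
    intro n x
    refine LinearMap.congr_fun (F.semiFree.hom_ext
      ((IsKHom.of_hom (dsumπ (Z := Z) n)).comp hφ (add_zero 0)) (IsKHom.of_hom (π n))
      fun s => ?_) x
    rw [LinearMap.comp_apply, SemiFree.extend_gen]
    by_cases hn : n ∈ N s
    · exact dsumπ_mk _ hn
    · refine (dsumπ_mk_of_notMem _ hn).trans (F.toQuot_of_mem_bispan _ ?_).symm
      change F.gen s ∈ _
      simpa using mem_bispan (e := F.gen) (T := {s | F.filt s < n.down}) (hN s n hn) 1 1
  let φ : F.bimod ⟶ dsum Z := hφ.toHom fun x => dsum_ext fun n => by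
    rw [hπ, (dsumπ n).map_d, hπ, (π n).map_d]
  obtain ⟨J, h, hh, e⟩ := F.semiFree.kProj.exists_finset_of_isCompactObject hF Z φ
  -- At an index outside `J` the projected map is zero, so `h` exhibits the projection to that
  -- quotient as nullhomotopic.
  obtain ⟨n, hn⟩ := Infinite.exists_notMem_finset J
  have hh' := ((IsKHom.of_hom (dsumπ (Z := Z) n)).comp hh (zero_add (-1)))
  obtain ⟨v, hv, hv'⟩ := exists_homotopic_add (𝟙 F.bimod)
    ((F.isKHom_ofQuot (F.closed_filt n.down)).comp hh' (zero_add (-1)))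
  refine ⟨n.down, v, hv, fun p => F.mem_bispan_of_toQuot (F.closed_filt n.down) ?_⟩
  have e' := congrArg (dsumπ n).toLinearMap (LinearMap.congr_fun e p)
  simp only [comp_toLinearMap, LinearMap.sub_apply, LinearMap.add_apply,
    LinearMap.comp_apply, map_sub, map_add, dsumπ_proj_of_notMem hn, (dsumπ n).map_d] at e'
  have e1 : ∀ z : (Z n).carrier, (π n).toLinearMap (F.bimod.d
      (F.ofQuot (F.closed_filt n.down) z)) = (π n).toLinearMap
        (F.ofQuot (F.closed_filt n.down) ((Z n).d z)) := F.toQuot_d_ofQuot _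
  have e2 : (dsumπ n).toLinearMap (φ.toLinearMap p) = (π n).toLinearMap p := hπ n p
  have e3 := congrArg (fun z => (π n).toLinearMap (F.ofQuot (F.closed_filt n.down) z)) e'
  have e4 : (π n).toLinearMap (F.ofQuot (F.closed_filt n.down) ((π n).toLinearMap p)) =
    (π n).toLinearMap p := F.toQuot_ofQuot_toQuot _ _
  simp only [e2, zero_sub, map_neg, map_add, e4] at e3
  change (π n).toLinearMap (v.toLinearMap p) = 0
  rw [hv', map_add, map_add]
  simp only [LinearMap.comp_apply, e1]
  rw [← e3]
  exact add_neg_cancel _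

end FreeData

end Truncation

end NCWeil

namespace NCWeil

open DGBimod

/-! ### Compactness and finite generation up to homotopy -/

section FiniteGeneration

variable {k : Type u} [Field k] {A : DGAlgebra k} {S : Type u}

theorem DGBimod.SemiFree.map_mem_bispan {P Y : DGBimod A} (F : SemiFree S P) {n : ℤ}
    {φ : P.carrier →ₗ[k] Y.carrier} (hφ : IsKHom n φ) {S' : Type u} {e : S' → Y.carrier}
    {X : Set S'} {T : Set S} (h : ∀ s ∈ T, φ (F.gen s) ∈ bispan e X) {x : P.carrier}
    (hx : x ∈ bispan F.gen T) : φ x ∈ bispan e X := by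
  have : bispan F.gen T ≤ (bispan e X).comap φ := bispan_le fun t ht a b => by
    rw [Submodule.mem_comap, hφ.map_smul, hφ.map_op_smul]
    exact smul_mem_bispan _ (op_smul_mem_bispan _ (h t ht))
  exact this hx

namespace FreeData

variable (F : FreeData A S)

/-- Modulo `X` the generators in `T` are cycles, so `u` followed by the coordinates in `T \ X` is a
closed map to a direct sum of free bimodules. By compactness only a finite set `J` of coordinates
survives up to homotopy. Pushing that homotopy back changes `u` so that only generators in `X` and
`J` remain. -/
theorem exists_finset_of_layer (hF : IsCompactObject.{u} ((quasiIso A).Q.obj F.bimod))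
    {X T : Set S} (hX : ∀ s ∈ T, F.bimod.d (F.gen s) ∈ bispan F.gen X)
    (u : F.bimod ⟶ F.bimod) (hu : Homotopic u (𝟙 _))
    (huT : ∀ p, u.toLinearMap p ∈ bispan F.gen T) :
    ∃ (J : Finset S) (u' : F.bimod ⟶ F.bimod), Homotopic u' (𝟙 _) ∧
      ∀ p, u'.toLinearMap p ∈ bispan F.gen (X ∪ J) := by
  classical
  -- All generators get zero differential. Each summand is a copy of the whole of `E.bimod`, but the
  -- summand of index `s` is used only through its generator `s`.
  let E : FreeData A S :=
    { deg := F.deg, filt := 0, D := 0, D_mem := fun s => zero_mem _,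
      D_low := fun s t h => absurd rfl h, d_D := fun s => map_zero _ }
  have hE : ∀ s, E.bimod.d (E.gen s) = 0 := fun s => (E.d_gen s).trans (map_zero _)
  let Z : S → DGBimod A := fun _ => E.bimod
  let y : S → (dsum Z).carrier := fun s =>
    if s ∈ X then 0 else (dsumι (Z := Z) s).toLinearMap (E.gen s)
  let co := F.semiFree.extend 0 y
  have hco : IsKHom 0 co := F.semiFree.isKHom_extend 0 fun s => by
    by_cases hs : s ∈ X
    · rw [show y s = 0 from if_pos hs]; exact zero_mem _
    · rw [show y s = _ from if_neg hs, add_zero]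
      exact (dsumι (Z := Z) s).map_gr _ _ (E.semiFree.gen_mem s)
  have hcoX : ∀ x ∈ bispan F.gen X, co x = 0 := fun x hx =>
    F.semiFree.eq_on_bispan hco IsKHom.zero
      (fun s hs => (F.semiFree.extend_gen 0 y s).trans (if_pos hs)) hx
  have hcod : ∀ x ∈ bispan F.gen T, co (F.bimod.d x) = (dsum Z).d (co x) := fun x hx =>
    F.semiFree.d_comm_on_bispan hco (fun s hs => by
      refine (hcoX _ (hX s hs)).trans (Eq.symm ?_)
      refine (congrArg (dsum Z).d (F.semiFree.extend_gen 0 y s)).trans ?_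
      by_cases hs : s ∈ X
      · rw [show y s = 0 from if_pos hs, map_zero]
      · rw [show y s = _ from if_neg hs, ← (dsumι (Z := Z) s).map_d]
        exact (congrArg _ (hE s)).trans (map_zero _)) hx
  let φ : F.bimod ⟶ dsum Z := (hco.comp (IsKHom.of_hom u) (add_zero 0)).toHom fun p => by
    rw [LinearMap.comp_apply, LinearMap.comp_apply, u.map_d, hcod _ (huT p)]
  -- These values send the generator `s` of the summand `s` back to `F.gen s`, for `s` in `T`
  -- outside `X`, and all other generators to zero.
  let w : S → S → F.bimod.carrier := fun s t => if t = s ∧ s ∈ T ∧ s ∉ X then F.gen s else 0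
  let σ' : ∀ s, (Z s).carrier →ₗ[k] F.bimod.carrier := fun s => E.semiFree.extend 0 (w s)
  have hσ' : ∀ s, IsKHom 0 (σ' s) := fun s => E.semiFree.isKHom_extend 0 fun t => by
    by_cases ht : t = s ∧ s ∈ T ∧ s ∉ X
    · rw [show w s t = F.gen s from if_pos ht, add_zero, ht.1]
      exact F.semiFree.gen_mem s
    · rw [show w s t = 0 from if_neg ht]; exact zero_mem _
  let σ : (dsum Z).carrier →ₗ[k] F.bimod.carrier := dsumLift σ'
  have hσ : IsKHom 0 σ := isKHom_dsumLift hσ'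
  have hσι : ∀ s (z : (Z s).carrier), σ ((dsumι (Z := Z) s).toLinearMap z) = σ' s z :=
    dsumLift_ι σ'
  have h1 : ∀ z, F.bimod.d (σ z) - σ ((dsum Z).d z) ∈ bispan F.gen X := by
    intro z
    induction z using dsum_induction with
    | h0 => simp
    | ha x y hx hy =>
      simp only [map_add]
      rw [add_sub_add_comm]
      exact add_mem hx hy
    | hs s z =>
      rw [← (dsumι (Z := Z) s).map_d, hσι, hσι]
      have := E.semiFree.map_mem_bispan (hσ' s).commutator' (e := F.gen) (X := X)
        (T := Set.univ) (fun t _ => by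
          have e1 : σ' s (E.gen t) = w s t := E.semiFree.extend_gen 0 (w s) t
          have e2 : σ' s ((Z s).d (E.gen t)) = 0 := (congrArg _ (hE t)).trans (map_zero _)
          change F.bimod.d (σ' s (E.gen t)) - (0 : ℤ).negOnePow • σ' s ((Z s).d (E.gen t)) ∈
            bispan F.gen X
          rw [e1, e2, smul_zero, sub_zero]
          by_cases ht : t = s ∧ s ∈ T ∧ s ∉ X
          · rw [show w s t = F.gen s from if_pos ht]
            exact hX s ht.2.1
          · rw [show w s t = 0 from if_neg ht, map_zero]; exact zero_mem (bispan F.gen X))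
        (x := z) (E.semiFree.bispan_univ ▸ Submodule.mem_top)
      simpa using this
  have h2 : ∀ x ∈ bispan F.gen T, x - σ (co x) ∈ bispan F.gen X := by
    intro x hx
    refine F.semiFree.map_mem_bispan (n := 0) (φ := LinearMap.id - σ ∘ₗ co)
      ((IsKHom.of_hom (𝟙 F.bimod)).sub (hσ.comp hco (add_zero 0))) (T := T) (fun s hs => ?_) hx
    change F.gen s - σ (co (F.gen s)) ∈ _
    rw [show co (F.gen s) = y s from F.semiFree.extend_gen 0 y s]
    by_cases hs' : s ∈ X
    · rw [show y s = 0 from if_pos hs', map_zero, sub_zero]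
      simpa using mem_bispan (e := F.gen) hs' 1 1
    · rw [show y s = _ from if_neg hs', hσι,
        show σ' s (E.gen s) = w s s from E.semiFree.extend_gen 0 (w s) s,
        show w s s = F.gen s from if_pos ⟨rfl, hs, hs'⟩, sub_self]
      exact zero_mem _
  have h3 : ∀ (J : Finset S) (z : (dsum Z).carrier),
      σ ((dsumProj Z J).toLinearMap z) ∈ bispan F.gen (J : Set S) := by
    intro J z
    induction z using dsum_induction with
    | h0 => simp
    | ha x y hx hy => rw [map_add, map_add]; exact add_mem hx hy
    | hs s z =>
      by_cases hs : s ∈ J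
      · have e : (dsumProj Z J).toLinearMap ((dsumι (Z := Z) s).toLinearMap z) =
            (dsumι (Z := Z) s).toLinearMap z :=
          LinearMap.congr_fun (congrArg Hom.toLinearMap (dsumι_proj (Z := Z) hs)) z
        rw [e, hσι]
        refine E.semiFree.map_mem_bispan (hσ' s) (T := Set.univ) (fun t _ => ?_)
          (E.semiFree.bispan_univ ▸ Submodule.mem_top)
        rw [show σ' s (E.semiFree.gen t) = w s t from E.semiFree.extend_gen 0 (w s) t]
        by_cases ht : t = s ∧ s ∈ T ∧ s ∉ X
        · rw [show w s t = F.gen s from if_pos ht]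
          simpa using mem_bispan (e := F.gen) (T := (J : Set S)) (Finset.mem_coe.mpr hs) 1 1
        · rw [show w s t = 0 from if_neg ht]; exact zero_mem _
      · have e : (dsumProj Z J).toLinearMap ((dsumι (Z := Z) s).toLinearMap z) = 0 := by
          refine dsum_ext fun t => ?_
          rw [map_zero]
          by_cases ht : t ∈ J
          · have : (dsumProj Z J).toLinearMap ((dsumι s).toLinearMap z) = _ := dsumLift_ι _ s z
            rw [this]
            simp only [if_neg hs]
            exact map_zero _
          · exact dsumπ_proj_of_notMem ht _
        rw [e, map_zero]; exact zero_mem _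
  obtain ⟨J, h, hh, e⟩ := F.semiFree.kProj.exists_finset_of_isCompactObject hF Z φ
  obtain ⟨u', hu', hu''⟩ := exists_homotopic_add u (hσ.comp hh (zero_add (-1)))
  refine ⟨J, u', hu'.trans hu, fun p => ?_⟩
  have e' := congrArg σ (LinearMap.congr_fun e p)
  simp only [comp_toLinearMap, LinearMap.sub_apply, LinearMap.add_apply,
    LinearMap.comp_apply, map_sub, map_add] at e'
  have e3 : φ.toLinearMap p = co (u.toLinearMap p) := rfl
  -- The first summand lies over `X` because `σ` inverts `co` modulo `X` on the part generated by
  -- `T`, the second because `σ` is closed modulo `X`; the third involves only `J`.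
  have : u'.toLinearMap p = (u.toLinearMap p - σ (co (u.toLinearMap p))) +
      (F.bimod.d (σ (h p)) - σ ((dsum Z).d (h p))) +
      σ ((dsumProj Z J).toLinearMap (φ.toLinearMap p)) := by
    rw [hu'', LinearMap.comp_apply, LinearMap.comp_apply]
    rw [sub_eq_iff_eq_add] at e'
    rw [e', e3]
    abel
  rw [this]
  exact add_mem (bispan_mono _ Set.subset_union_left (add_mem (h2 _ (huT p)) (h1 _)))
    (bispan_mono _ Set.subset_union_right (h3 J _))

theorem d_gen_mem_of_closed {X : Set S} (hX : F.Closed X) {s : S} (hs : s ∈ X) :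
    F.bimod.d (F.gen s) ∈ bispan F.gen X := by
  rw [F.d_gen, mem_bispan_gen]
  intro t ht
  by_contra h
  exact ht (hX s hs t h)

/-- The identity of a compact semi-free bimodule is homotopic to an endomorphism whose image is
contained in a finitely generated sub-bimodule. -/
theorem exists_finset_of_isCompactObject
    (hF : IsCompactObject.{u} ((quasiIso A).Q.obj F.bimod)) :
    ∃ (X : Finset S) (u : F.bimod ⟶ F.bimod), Homotopic u (𝟙 _) ∧
      ∀ p, u.toLinearMap p ∈ bispan F.gen (X : Set S) := by
  obtain ⟨n, v, hv, hv'⟩ := F.exists_filt_lt_of_isCompactObject hF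
  -- Descending induction on the filtration bound, one layer at a time. The finite set carried along
  -- is kept closed, so that together with the generators of filtration < n it supports the
  -- differentials of the layer being removed.
  have key : ∀ (n : ℕ) (X : Finset S), F.Closed (X : Set S) → ∀ u : F.bimod ⟶ F.bimod,
      Homotopic u (𝟙 _) → (∀ p, u.toLinearMap p ∈ bispan F.gen ({s | F.filt s < n} ∪ X)) →
      ∃ (X : Finset S) (u : F.bimod ⟶ F.bimod), Homotopic u (𝟙 _) ∧
        ∀ p, u.toLinearMap p ∈ bispan F.gen (X : Set S) := by
    classical
    intro n
    induction n with
    | zero => exact fun X _ u hu h => ⟨X, u, hu, fun p => by simpa using h p⟩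
    | succ n ih =>
      intro X hX u hu h
      obtain ⟨J, u', hu', h'⟩ := F.exists_finset_of_layer hF (X := {s | F.filt s < n} ∪ X)
        (T := {s | F.filt s < n + 1} ∪ X) (by
          rintro s (hs | hs)
          · refine bispan_mono _ (Set.subset_union_of_subset_left ?_ _) (F.semiFree.d_gen s)
            intro t ht
            have h1 : F.filt t < F.filt s := ht
            have h2 : F.filt s < n + 1 := hs
            exact (by omega : F.filt t < n)
          · exact bispan_mono _ Set.subset_union_right (F.d_gen_mem_of_closed hX hs)) u hu h
      obtain ⟨X', hXX', hX'⟩ := F.exists_finset_closed (X ∪ J)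
      refine ih X' hX' u' hu' fun p => bispan_mono _ ?_ (h' p)
      rw [Set.union_assoc]
      refine Set.union_subset_union_right _ ?_
      rw [← Finset.coe_union]
      exact_mod_cast hXX'
  exact key n ∅ (by simp [Closed]) v hv (by simpa using hv')

end FreeData

/-- A K-projective bimodule is compact if its identity is homotopic to an endomorphism whose
image is contained in a finitely generated sub-bimodule. -/
theorem DGBimod.KProj.isCompactObject_of_finset {P : DGBimod A} (hP : KProj P) {S : Type u}
    (e : S → P.carrier) (X : Finset S) (u : P ⟶ P) (hu : Homotopic u (𝟙 _))
    (h : ∀ p, u.toLinearMap p ∈ bispan e (X : Set S)) :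
    IsCompactObject.{u} ((quasiIso A).Q.obj P) := by
  classical
  refine hP.isCompactObject fun Z φ => ?_
  -- The images of the finitely many generators in `X` have a finite joint support, and projecting
  -- to it changes nothing on the image of `u`.
  choose N hN using fun s => exists_dsum_support (φ.toLinearMap (e s))
  refine ⟨X.biUnion N, ?_⟩
  have key : ∀ x ∈ bispan e (X : Set S),
      (dsumProj Z (X.biUnion N)).toLinearMap (φ.toLinearMap x) = φ.toLinearMap x := by
    have : bispan e (X : Set S) ≤
        LinearMap.eqLocus (φ ≫ dsumProj Z (X.biUnion N)).toLinearMap φ.toLinearMap :=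
      bispan_le fun s hs a b => by
        change (φ ≫ dsumProj Z (X.biUnion N)).toLinearMap _ = φ.toLinearMap _
        rw [Hom.map_smul, Hom.map_op_smul, Hom.map_smul, Hom.map_op_smul]
        congr 2
        exact dsumProj_of_support fun i hi => hN s i fun h => hi
          (Finset.mem_biUnion.mpr ⟨s, hs, h⟩)
    exact fun x hx => this hx
  have e1 : u ≫ φ ≫ dsumProj Z (X.biUnion N) = u ≫ φ :=
    hom_ext (LinearMap.ext fun p => key _ (h p))
  have h1 := hu.comp_right φ
  have h2 := hu.comp_right (φ ≫ dsumProj Z (X.biUnion N))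
  rw [Category.id_comp] at h1 h2
  rw [e1] at h2
  exact h2.symm.trans h1

end FiniteGeneration

end NCWeil

namespace NCWeil

open DGBimod

/-! ### Generalized inverses and contractions over a field -/

section Splitting

variable {k V : Type*} [Field k] [AddCommGroup V] [Module k V] {gr : ℤ → Submodule k V}

/-- Every endomorphism of a vector space has a generalized inverse; this is a graded version. -/
theorem exists_graded_split (h : DirectSum.IsInternal gr) {d : V →ₗ[k] V}
    (d_mem : ∀ n, ∀ x ∈ gr n, d x ∈ gr (n + 1)) :
    ∃ s : V →ₗ[k] V, (∀ n, ∀ x ∈ gr n, s x ∈ gr (n - 1)) ∧ ∀ x, d (s (d x)) = d x := by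
  obtain ⟨r, hr⟩ := d.rangeRestrict.exists_rightInverse_of_surjective d.range_rangeRestrict
  obtain ⟨t, ht⟩ := LinearMap.exists_extend r
  have htd : ∀ x, d (t (d x)) = d x := fun x => by
    have h1 : t (d x) = r (d.rangeRestrict x) := LinearMap.congr_fun ht (d.rangeRestrict x)
    rw [h1]
    exact congrArg Subtype.val (LinearMap.congr_fun hr (d.rangeRestrict x))
  -- `t` need not respect degrees. Keeping only its component of degree n - 1 on the piece of degree
  -- n preserves the relation d t d = d, because `d` is homogeneous.
  refine ⟨gradedLift h fun n => gproj h (n - 1) ∘ₗ t ∘ₗ (gr n).subtype, ?_, ?_⟩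
  · intro n x hx
    rw [gradedLift_of_mem h _ hx]
    exact gproj_mem h _ _
  · intro x
    induction x using graded_induction h with
    | h0 => simp
    | ha x y hx hy => simp only [map_add, hx, hy]
    | hm n x hx =>
      have hdx := d_mem n x hx
      rw [gradedLift_of_mem h _ hdx]
      change d (gproj h _ (t (d x))) = _
      have := gproj_comm h h d_mem (n + 1 - 1) (t (d x))
      rw [this, htd, show n + 1 - 1 + 1 = n + 1 by ring, gproj_of_mem h hdx]

/-- An acyclic complex of vector spaces is contractible. -/
theorem exists_contraction (h : DirectSum.IsInternal gr) {d : V →ₗ[k] V}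
    (d_mem : ∀ n, ∀ x ∈ gr n, d x ∈ gr (n + 1)) (d_d : ∀ x, d (d x) = 0)
    (hac : ∀ n, ∀ m ∈ gr n, d m = 0 → ∃ u ∈ gr (n - 1), d u = m) :
    ∃ s : V →ₗ[k] V, (∀ n, ∀ x ∈ gr n, s x ∈ gr (n - 1)) ∧ ∀ x, d (s x) + s (d x) = x := by
  obtain ⟨s, hs, hsd⟩ := exists_graded_split h d_mem
  -- `φ` measures how far `s` is from a contraction. It is annihilated by `d` from both sides, and
  -- acyclicity makes its values boundaries, so φ² = 0. Hence φ s d = φ, and s + φ s is a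
  -- contraction.
  let φ : V →ₗ[k] V := LinearMap.id - d ∘ₗ s - s ∘ₗ d
  have hφ : ∀ x, φ x = x - d (s x) - s (d x) := fun x => rfl
  have hφd : ∀ x, φ (d x) = 0 := fun x => by rw [hφ, hsd, d_d, map_zero]; simp
  have hdφ : ∀ x, d (φ x) = 0 := fun x => by rw [hφ, map_sub, map_sub, hsd, d_d]; simp
  have hφgr : ∀ n, ∀ x ∈ gr n, φ x ∈ gr n := fun n x hx => by
    refine sub_mem (sub_mem hx ?_) ?_
    · have := d_mem _ _ (hs _ _ hx)
      rwa [sub_add_cancel] at this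
    · have := hs _ _ (d_mem _ _ hx)
      rwa [add_sub_cancel_right] at this
  have hφφ : ∀ x, φ (φ x) = 0 := fun x => by
    induction x using graded_induction h with
    | h0 => simp
    | ha x y hx hy => simp only [map_add, hx, hy, add_zero]
    | hm n x hx =>
      obtain ⟨u, -, hu⟩ := hac n _ (hφgr n x hx) (hdφ x)
      rw [← hu, hφd]
  refine ⟨s + φ ∘ₗ s, fun n x hx => add_mem (hs n x hx) (hφgr _ _ (hs n x hx)), fun x => ?_⟩
  have h1 := hφφ x
  rw [hφ x, map_sub, map_sub, hφd, sub_zero, sub_eq_zero] at h1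
  simp only [LinearMap.add_apply, LinearMap.comp_apply, map_add, hdφ, ← h1, add_zero]
  rw [hφ]
  abel

end Splitting

/-! ### Linear homotopy inverses of quasi-isomorphisms -/

section HomotopyInverse

variable {k : Type u} [Field k] {A : DGAlgebra k}

/-- A quasi-isomorphism has a linear homotopy inverse. -/
theorem DGBimod.exists_homotopyInverse {M N : DGBimod A} {f : M ⟶ N} (hf : quasiIso A f) :
    ∃ (g : N.carrier →ₗ[k] M.carrier) (h : M.carrier →ₗ[k] M.carrier)
      (h' : N.carrier →ₗ[k] N.carrier), (∀ n, ∀ x ∈ N.gr n, g x ∈ M.gr n) ∧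
      (∀ n, ∀ x ∈ M.gr n, h x ∈ M.gr (n - 1)) ∧ (∀ n, ∀ x ∈ N.gr n, h' x ∈ N.gr (n - 1)) ∧
      (∀ x, g (N.d x) = M.d (g x)) ∧
      (∀ x, g (f.toLinearMap x) - x = M.d (h x) + h (M.d x)) ∧
      (∀ x, f.toLinearMap (g x) - x = N.d (h' x) + h' (N.d x)) := by
  -- A contraction of the fibre of `f` is a two by two matrix. Its entry from N to M is the homotopy
  -- inverse, and its diagonal entries are, up to sign, the two homotopies.
  obtain ⟨σ, hσ, e⟩ := exists_contraction (cocone f).isInternal (d := (cocone f).d)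
    (fun n x hx => (cocone f).d_mem hx) (cocone f).d_d (acyclic_cocone hf)
  let i₁ : M.carrier →ₗ[k] (cocone f).carrier := LinearMap.inl k _ _
  let i₂ : N.carrier →ₗ[k] (cocone f).carrier := LinearMap.inr k M.carrier (Tw N) ∘ₗ
    N.toTw.toLinearMap
  let p₁ : (cocone f).carrier →ₗ[k] M.carrier := LinearMap.fst k _ _
  let p₂ : (cocone f).carrier →ₗ[k] N.carrier := N.toTw.symm.toLinearMap ∘ₗ
    LinearMap.snd k M.carrier (Tw N)
  have hi₁ : ∀ n, ∀ x ∈ M.gr n, i₁ x ∈ (cocone f).gr n := fun n x hx => ⟨hx, zero_mem _⟩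
  have hi₂ : ∀ n, ∀ x ∈ N.gr n, i₂ x ∈ (cocone f).gr (n + 1) := fun n x hx =>
    ⟨zero_mem _, x, by rwa [add_neg_cancel_right], rfl⟩
  have hp₁ : ∀ n, ∀ x ∈ (cocone f).gr n, p₁ x ∈ M.gr n := fun n x hx => hx.1
  have hp₂ : ∀ n, ∀ x ∈ (cocone f).gr n, p₂ x ∈ N.gr (n - 1) := by
    rintro n ⟨y, y'⟩ ⟨hy, y', hy', rfl⟩
    exact hy'
  have hdi₁ : ∀ x, (cocone f).d (i₁ x) = i₁ (M.d x) + i₂ (f.toLinearMap x) := fun x => by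
    refine Prod.ext ?_ ?_
    · exact (add_zero (M.d x)).symm
    · change f.toLinearMap x - N.d 0 = 0 + f.toLinearMap x
      rw [map_zero, sub_zero, zero_add]
  have hdi₂ : ∀ x, (cocone f).d (i₂ x) = -i₂ (N.d x) := fun x => by
    refine Prod.ext ?_ ?_
    · exact (map_zero M.d).trans neg_zero.symm
    · change f.toLinearMap 0 - N.d x = -N.d x
      rw [map_zero, zero_sub]
  have hp₁d : ∀ x, p₁ ((cocone f).d x) = M.d (p₁ x) := fun x => rfl
  have hp₂d : ∀ x, p₂ ((cocone f).d x) = f.toLinearMap (p₁ x) - N.d (p₂ x) := fun x => rfl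
  refine ⟨p₁ ∘ₗ σ ∘ₗ i₂, -(p₁ ∘ₗ σ ∘ₗ i₁), p₂ ∘ₗ σ ∘ₗ i₂, ?_, ?_, ?_, ?_, ?_, ?_⟩
  · intro n x hx
    have := hp₁ _ _ (hσ _ _ (hi₂ _ _ hx))
    rwa [add_sub_cancel_right] at this
  · intro n x hx
    exact neg_mem (hp₁ _ _ (hσ _ _ (hi₁ _ _ hx)))
  · intro n x hx
    have := hp₂ _ _ (hσ _ _ (hi₂ _ _ hx))
    rwa [add_sub_cancel_right] at this
  · intro x
    have := congrArg p₁ (e (i₂ x))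
    rw [map_add, hp₁d, hdi₂, map_neg, map_neg] at this
    have h0 : p₁ (i₂ x) = 0 := rfl
    rw [h0, add_neg_eq_zero] at this
    exact this.symm
  · intro x
    have := congrArg p₁ (e (i₁ x))
    rw [map_add, hp₁d, hdi₁, map_add, map_add] at this
    have h0 : p₁ (i₁ x) = x := rfl
    rw [h0] at this
    simp only [LinearMap.neg_apply, LinearMap.comp_apply, map_neg]
    rw [← sub_eq_zero] at this ⊢
    rw [← this]
    abel
  · intro x
    have := congrArg p₂ (e (i₂ x))
    rw [map_add, hp₂d, hdi₂, map_neg, map_neg] at this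
    have h0 : p₂ (i₂ x) = x := rfl
    rw [h0] at this
    simp only [LinearMap.comp_apply]
    rw [← sub_eq_zero] at this ⊢
    rw [← this]
    abel

end HomotopyInverse

end NCWeil

namespace NCWeil

/-! ### Resolutions with a compactness datum -/

section ChainMaps

variable {K : Type u} [Field K] {A B C : DGAlgebra K}

/-- Linear maps of degree `0` which commute with the differentials. -/
structure IsChain (φ : A.carrier →ₗ[K] B.carrier) : Prop where
  gr : ∀ n, ∀ x ∈ A.gr n, φ x ∈ B.gr n
  d : ∀ x, φ (A.d x) = B.d (φ x)

/-- Linear homotopies. -/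
structure IsHtpy (h f g : A.carrier →ₗ[K] B.carrier) : Prop where
  gr : ∀ n, ∀ x ∈ A.gr n, h x ∈ B.gr (n - 1)
  eq : ∀ x, f x - g x = B.d (h x) + h (A.d x)

variable {T T' : DGAlgebra K}

/-- Bilinear maps of degree `n`, with the Koszul sign. -/
structure IsBilin (n : ℤ) (j : DGAlgebra.Hom B T) (j' : DGAlgebra.Hom B T')
    (φ : T.carrier →ₗ[K] T'.carrier) : Prop where
  left : ∀ m, ∀ b ∈ B.gr m, ∀ t,
    φ (j.toRingHom b * t) = (n * m).negOnePow • (j'.toRingHom b * φ t)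
  right : ∀ b t, φ (t * j.toRingHom b) = φ t * j'.toRingHom b

/-- The identity morphism. -/
def DGAlgebra.Hom.id (B : DGAlgebra K) : DGAlgebra.Hom B B where
  toRingHom := RingHom.id _
  map_smul _ _ := rfl
  map_gr h := h
  map_d _ := rfl

/-- The span of the elements `a e b`, where `e` belongs to a family of generators. -/
def jspan (j : DGAlgebra.Hom B T) {S : Type u} (e : S → T.carrier) (X : Set S) :
    Submodule K T.carrier :=
  Submodule.span K {x | ∃ s ∈ X, ∃ m n a b, a ∈ B.gr m ∧ b ∈ B.gr n ∧
    x = j.toRingHom a * e s * j.toRingHom b}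

/-- A semi-free resolution `P → B` of the diagonal bimodule, together with a compactness datum, all
of which is expressed by linear maps of a dg algebra `T` which contains `B` and `P`. -/
structure Res (B : DGAlgebra K) where
  T : DGAlgebra K
  j : DGAlgebra.Hom B T
  /-- the projection to `P` -/
  π : T.carrier →ₗ[K] T.carrier
  π_chain : IsChain π
  π_bilin : IsBilin 0 j j π
  π_π : ∀ t, π (π t) = π t
  /-- the augmentation -/
  ε : T.carrier →ₗ[K] B.carrier
  ε_chain : IsChain ε
  ε_bilin : IsBilin 0 j (DGAlgebra.Hom.id B) ε
  /-- a linear homotopy inverse of the augmentation -/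
  g : B.carrier →ₗ[K] T.carrier
  g_chain : IsChain g
  π_g : ∀ b, π (g b) = g b
  hB : B.carrier →ₗ[K] B.carrier
  hB_htpy : IsHtpy hB (ε ∘ₗ g) LinearMap.id
  hT : T.carrier →ₗ[K] T.carrier
  hT_htpy : IsHtpy hT (g ∘ₗ ε) π
  π_hT : ∀ t, π (hT t) = hT t
  /-- an endomorphism of `P` which is homotopic to the identity and has a small image -/
  u : T.carrier →ₗ[K] T.carrier
  u_chain : IsChain u
  u_bilin : IsBilin 0 j j u
  π_u : ∀ t, π (u t) = u t
  hu : T.carrier →ₗ[K] T.carrier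
  hu_htpy : IsHtpy hu u π
  hu_bilin : IsBilin (-1) j j hu
  π_hu : ∀ t, π (hu t) = hu t
  /-- the generators -/
  S : Type u
  deg : S → ℤ
  filt : S → ℕ
  e : S → T.carrier
  e_mem : ∀ s, e s ∈ T.gr (deg s)
  d_e : ∀ s, T.d (e s) ∈ jspan j e {t | filt t < filt s}
  X : Finset S
  u_mem : ∀ t, u t ∈ jspan j e (X : Set S)
  κ : Type u
  b : Module.Basis κ K B.carrier
  bdeg : κ → ℤ
  b_mem : ∀ i, b i ∈ B.gr (bdeg i)
  bas : Module.Basis (κ × S × κ) K (LinearMap.range π)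
  bas_apply : ∀ x, (bas x).1 = j.toRingHom (b x.1) * e x.2.1 * j.toRingHom (b x.2.2)

/-- Since i p = π and p i = 1, the map `i` identifies `W` with the image of `π`. Images of
idempotents are computed in this way after extension of scalars and for tensor products. -/
theorem exists_basis_range {V W : Type*} [AddCommGroup V] [Module K V] [AddCommGroup W]
    [Module K W] {i : W →ₗ[K] V} {p : V →ₗ[K] W} {π : V →ₗ[K] V} (hip : ∀ v, i (p v) = π v)
    (hpi : ∀ w, p (i w) = w) {κ : Type*} (B : Module.Basis κ K W) :
    ∃ B' : Module.Basis κ K (LinearMap.range π), ∀ x, (B' x).1 = i (B x) :=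
  ⟨B.map (LinearEquiv.ofBijective (i.codRestrict (LinearMap.range π)
    fun w => ⟨i w, by rw [← hip, hpi]⟩)
    ⟨fun x y h => by rw [← hpi x, ← hpi y]; exact congrArg p (congrArg Subtype.val h),
      fun ⟨_, v, hv⟩ => ⟨p v, Subtype.ext ((hip v).trans hv)⟩⟩), fun _ => rfl⟩

theorem exists_homogeneous_basis (B : DGAlgebra K) :
    ∃ (κ : Type u) (b : Module.Basis κ K B.carrier) (bdeg : κ → ℤ), ∀ i, b i ∈ B.gr (bdeg i) :=
  ⟨_, B.isInternal.collectedBasis fun n => Module.Basis.ofVectorSpace K (B.gr n), fun i => i.1,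
    fun i => B.isInternal.collectedBasis_mem _ i⟩

end ChainMaps

/-! ### The resolution inside a square-zero extension -/

section TrivialExtension

open DGBimod

variable {K : Type u} [Field K] {A : DGAlgebra K} (P : DGBimod A)

/-- The trivial square-zero extension of a dg algebra by a dg bimodule. -/
noncomputable def trivExt : DGAlgebra K where
  carrier := TrivSqZeroExt A.carrier P.carrier
  gr n := (A.gr n).prod (P.gr n)
  isInternal := isInternal_prod A.isInternal P.isInternal
  one_mem := ⟨A.one_mem, zero_mem _⟩
  mul_mem ha hb := ⟨A.mul_mem ha.1 hb.1,
    add_mem (P.smul_mem ha.1 hb.2) (P.op_smul_mem ha.2 hb.1)⟩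
  d := A.d.prodMap P.d
  d_mem ha := ⟨A.d_mem ha.1, P.d_mem ha.2⟩
  d_d a := Prod.ext (A.d_d a.1) (P.d_d a.2)
  leibniz {m a} b ha := by
    refine Prod.ext (A.leibniz b.1 ha.1) ?_
    change P.d (a.1 • b.2 + MulOpposite.op b.1 • a.2) =
      (A.d a.1 • b.2 + MulOpposite.op b.1 • P.d a.2) +
      m.negOnePow • (a.1 • P.d b.2 + MulOpposite.op (A.d b.1) • a.2)
    rw [map_add, P.leibniz_left _ ha.1, P.leibniz_right _ ha.2, smul_add]
    abel

/-- The inclusion of the algebra. -/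
noncomputable def trivInl : DGAlgebra.Hom A (trivExt P) where
  toRingHom := TrivSqZeroExt.inlHom A.carrier P.carrier
  map_smul c a := TrivSqZeroExt.inl_smul (M := P.carrier) c a
  map_gr h := ⟨h, zero_mem _⟩
  map_d _ := Prod.ext rfl (map_zero P.d).symm

/-- The inclusion of the bimodule. -/
noncomputable def trivInr : P.carrier →ₗ[K] (trivExt P).carrier :=
  LinearMap.inr K A.carrier P.carrier

/-- The projection to the bimodule. -/
noncomputable def trivSnd : (trivExt P).carrier →ₗ[K] P.carrier :=
  LinearMap.snd K A.carrier P.carrier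

variable {P}

theorem trivInr_mem {n : ℤ} {p : P.carrier} (hp : p ∈ P.gr n) : trivInr P p ∈ (trivExt P).gr n :=
  ⟨zero_mem _, hp⟩

theorem trivSnd_mem {n : ℤ} {t : (trivExt P).carrier} (ht : t ∈ (trivExt P).gr n) :
    trivSnd P t ∈ P.gr n := ht.2

theorem trivInr_d (p : P.carrier) : trivInr P (P.d p) = (trivExt P).d (trivInr P p) :=
  Prod.ext (map_zero A.d).symm rfl

theorem trivSnd_d (t : (trivExt P).carrier) : trivSnd P ((trivExt P).d t) = P.d (trivSnd P t) :=
  rfl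

theorem trivInl_mul_inr (a : A.carrier) (p : P.carrier) :
    (trivInl P).toRingHom a * trivInr P p = trivInr P (a • p) :=
  TrivSqZeroExt.inl_mul_inr a p

theorem trivInr_mul_inl (a : A.carrier) (p : P.carrier) :
    trivInr P p * (trivInl P).toRingHom a = trivInr P (MulOpposite.op a • p) :=
  TrivSqZeroExt.inr_mul_inl a p

theorem trivSnd_inl_mul (a : A.carrier) (t : (trivExt P).carrier) :
    trivSnd P ((trivInl P).toRingHom a * t) = a • trivSnd P t := by
  change a • t.2 + MulOpposite.op t.1 • (0 : P.carrier) = a • t.2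
  rw [smul_zero, add_zero]

theorem trivSnd_mul_inl (a : A.carrier) (t : (trivExt P).carrier) :
    trivSnd P (t * (trivInl P).toRingHom a) = MulOpposite.op a • trivSnd P t := by
  change t.1 • (0 : P.carrier) + MulOpposite.op a • t.2 = MulOpposite.op a • t.2
  rw [smul_zero, zero_add]

theorem trivInr_bispan {S : Type u} {e : S → P.carrier} {X : Set S} {p : P.carrier}
    (hp : p ∈ bispan e X) : trivInr P p ∈ jspan (trivInl P) (fun s => trivInr P (e s)) X := by
  have key : ∀ s ∈ X, ∀ a b : A.carrier, trivInr P (a • MulOpposite.op b • e s) ∈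
      jspan (trivInl P) (fun s => trivInr P (e s)) X := by
    intro s hs a b
    induction a using graded_induction A.isInternal with
    | h0 => simp
    | ha x y hx hy => rw [add_smul, map_add]; exact add_mem hx hy
    | hm m a ha =>
      induction b using graded_induction A.isInternal with
      | h0 => simp
      | ha x y hx hy =>
        rw [MulOpposite.op_add, add_smul, smul_add, map_add]; exact add_mem hx hy
      | hm n b hb =>
        refine Submodule.subset_span ⟨s, hs, m, n, a, b, ha, hb, ?_⟩
        rw [trivInl_mul_inr, trivInr_mul_inl, smul_comm]
  have : bispan e X ≤ (jspan (trivInl P) (fun s => trivInr P (e s)) X).comap (trivInr P) :=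
    bispan_le key
  exact this hp

theorem isBilin_triv {n : ℤ} {φ : P.carrier →ₗ[K] P.carrier} (hφ : IsKHom n φ) :
    IsBilin n (trivInl P) (trivInl P) (trivInr P ∘ₗ φ ∘ₗ trivSnd P) where
  left m b hb t := by
    simp only [LinearMap.comp_apply]
    rw [trivSnd_inl_mul, hφ.map_smul, DGAlgebra.sgn_of_mem _ hb, units_smul_smul,
      NCWeil.map_units_smul, trivInl_mul_inr]
  right b t := by
    simp only [LinearMap.comp_apply]
    rw [trivSnd_mul_inl, hφ.map_op_smul, trivInr_mul_inl]

theorem isChain_triv (f : P ⟶ P) : IsChain (trivInr P ∘ₗ f.toLinearMap ∘ₗ trivSnd P) where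
  gr _ _ hx := trivInr_mem (f.map_gr _ _ (trivSnd_mem hx))
  d x := by
    simp only [LinearMap.comp_apply]
    rw [trivSnd_d, f.map_d, trivInr_d]

theorem FreeData.exists_basis {S κ : Type u} (F : FreeData A S) (b : Module.Basis κ K A.carrier) :
    ∃ B : Module.Basis (κ × S × κ) K F.bimod.carrier,
      ∀ x, B x = b x.1 • MulOpposite.op (b x.2.2) • F.gen x.2.1 := by
  let eq : κ × S × κ ≃ Σ _ : S, κ × κ :=
    { toFun := fun x => ⟨x.2.1, x.1, x.2.2⟩
      invFun := fun y => (y.2.1, y.1, y.2.2)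
      left_inv := fun _ => rfl
      right_inv := fun _ => rfl }
  let bb : Module.Basis (κ × κ) K (Env A) := b.tensorProduct b
  refine ⟨((Finsupp.basis fun _ : S => bb).reindex eq.symm).map F.ofFin, fun x => ?_⟩
  rw [F.smul_gen', Module.Basis.map_apply, Module.Basis.reindex_apply, Finsupp.coe_basis]
  change F.ofFin (Finsupp.single x.2.1 (bb (x.1, x.2.2))) = _
  rw [show bb (x.1, x.2.2) = Env.mk (b x.1) (b x.2.2) from b.tensorProduct_apply b _ _]

/-- A smooth dg algebra has a resolution with a compactness datum. -/
theorem DGAlgebra.IsSmooth.nonempty_res (hA : A.IsSmooth) : Nonempty (Res A) := by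
  let F := Cell.data (diagonal A)
  let P := F.bimod
  let aug : P ⟶ diagonal A := Cell.aug (diagonal A)
  have haug : quasiIso A aug := Cell.quasiIso_aug _
  obtain ⟨g, h, h', g_gr, h_gr, h'_gr, g_d, h_eq, h'_eq⟩ := exists_homotopyInverse haug
  -- Compactness of the diagonal bimodule passes along the augmentation to the semi-free bimodule
  -- `P`, to which the finiteness criterion applies.
  obtain ⟨X, u, ⟨w, hw, hw'⟩, huX⟩ := F.exists_finset_of_isCompactObject
    ((isCompactObject_iff_of_quasiIso haug).mpr hA)
  obtain ⟨κ, b, bdeg, hb⟩ := exists_homogeneous_basis A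
  obtain ⟨B, hB⟩ := F.exists_basis b
  obtain ⟨B', hB'⟩ := exists_basis_range (i := trivInr P) (p := trivSnd P)
    (π := trivInr P ∘ₗ (Hom.toLinearMap (𝟙 P)) ∘ₗ trivSnd P) (fun _ => rfl) (fun _ => rfl) B
  exact ⟨{
    T := trivExt P
    j := trivInl P
    π := trivInr P ∘ₗ (Hom.toLinearMap (𝟙 P)) ∘ₗ trivSnd P
    π_chain := isChain_triv (𝟙 P)
    π_bilin := isBilin_triv (IsKHom.of_hom (𝟙 P))
    π_π := fun _ => rfl
    ε := aug.toLinearMap ∘ₗ trivSnd P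
    ε_chain := ⟨fun n x hx => aug.map_gr _ _ (trivSnd_mem hx), fun x => aug.map_d _⟩
    ε_bilin := ⟨fun m b hb t => by
      rw [zero_mul, Int.negOnePow_zero, one_smul]
      exact (congrArg aug.toLinearMap (trivSnd_inl_mul b t)).trans (aug.map_smul _ _),
      fun b t => (congrArg aug.toLinearMap (trivSnd_mul_inl b t)).trans (aug.map_op_smul _ _)⟩
    g := trivInr P ∘ₗ g
    g_chain := ⟨fun n x hx => trivInr_mem (g_gr _ _ hx), fun x =>
      (congrArg (trivInr P) (g_d x)).trans (trivInr_d _)⟩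
    π_g := fun _ => rfl
    hB := h'
    hB_htpy := ⟨h'_gr, h'_eq⟩
    hT := trivInr P ∘ₗ h ∘ₗ trivSnd P
    hT_htpy := ⟨fun n x hx => trivInr_mem (h_gr _ _ (trivSnd_mem hx)), fun x => by
      have := congrArg (trivInr P) (h_eq (trivSnd P x))
      rw [map_sub, map_add, trivInr_d] at this
      exact this⟩
    π_hT := fun _ => rfl
    u := trivInr P ∘ₗ u.toLinearMap ∘ₗ trivSnd P
    u_chain := isChain_triv u
    u_bilin := isBilin_triv (IsKHom.of_hom u)
    π_u := fun _ => rfl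
    hu := trivInr P ∘ₗ w ∘ₗ trivSnd P
    hu_htpy := ⟨fun n x hx => trivInr_mem (hw.map_gr _ _ (trivSnd_mem hx)), fun x => by
      have := congrArg (trivInr P) (LinearMap.congr_fun hw' (trivSnd P x))
      rw [LinearMap.sub_apply, LinearMap.add_apply, map_sub, map_add] at this
      exact this.trans (congrArg (· + _) (trivInr_d (w (trivSnd P x))))⟩
    hu_bilin := isBilin_triv hw
    π_hu := fun _ => rfl
    S := _
    deg := F.deg
    filt := F.filt
    e := fun s => trivInr P (F.gen s)
    e_mem := fun s => trivInr_mem (F.semiFree.gen_mem s)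
    d_e := fun s => by
      rw [← trivInr_d]
      exact trivInr_bispan (F.semiFree.d_gen s)
    X := X
    u_mem := fun t => trivInr_bispan (huX _)
    κ := κ
    b := b
    bdeg := bdeg
    b_mem := hb
    bas := B'
    bas_apply := fun x => by
      rw [hB', hB, trivInl_mul_inr, trivInr_mul_inl, ← smul_comm (b x.1)] }⟩

end TrivialExtension

end NCWeil

namespace NCWeil

/-! ### Extension of scalars of a resolution -/

section BaseChange

variable {l : Type u} [Field l] (L : Type u) [Field L] [Algebra l L] {A B : DGAlgebra l}

variable {L} in
/-- The element `c ⊗ a`. -/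
noncomputable def tm (c : L) (a : A.carrier) : (A.baseChange L).carrier :=
  (c ⊗ₜ[l] a : L ⊗[l] A.carrier)

section Tm

variable {L}

theorem tm_add (c : L) (a a' : A.carrier) : tm c (a + a') = tm c a + tm c a' :=
  TensorProduct.tmul_add c a a'

theorem tm_sub (c : L) (a a' : A.carrier) : tm c (a - a') = tm c a - tm c a' :=
  TensorProduct.tmul_sub c a a'

theorem tm_zero (c : L) : tm c (0 : A.carrier) = 0 := TensorProduct.tmul_zero _ c

theorem tm_smul (c : L) (r : l) (a : A.carrier) : tm c (r • a) = algebraMap l L r • tm c a := by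
  change c ⊗ₜ[l] (r • a) = (algebraMap l L r * c) ⊗ₜ[l] a
  rw [← Algebra.smul_def, TensorProduct.tmul_smul, TensorProduct.smul_tmul']

theorem smul_tm (r c : L) (a : A.carrier) : r • tm c a = tm (r * c) a := rfl

theorem tm_units_smul (c : L) (r : ℤˣ) (a : A.carrier) : tm c (r • a) = r • tm c a := by
  rcases Int.units_eq_one_or r with rfl | rfl
  · simp
  · simp only [Units.neg_smul, one_smul]
    exact TensorProduct.tmul_neg c a

theorem tm_mul (c c' : L) (a a' : A.carrier) : tm c a * tm c' a' = tm (c * c') (a * a') :=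
  Algebra.TensorProduct.tmul_mul_tmul c c' a a'

theorem d_tm (c : L) (a : A.carrier) : (A.baseChange L).d (tm c a) = tm c (A.d a) := rfl

theorem tm_mem {n : ℤ} (c : L) {a : A.carrier} (ha : a ∈ A.gr n) :
    tm c a ∈ (A.baseChange L).gr n :=
  Submodule.tmul_mem_baseChange_of_mem c ha

theorem bc_induction {p : (A.baseChange L).carrier → Prop} (x : (A.baseChange L).carrier)
    (ha : ∀ x y, p x → p y → p (x + y)) (ht : ∀ c a, p (tm c a)) : p x := by
  have h0 : p 0 := by
    have := ht 0 0
    rwa [tm_zero] at this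
  exact TensorProduct.induction_on (R := l) (motive := p) x h0 ht ha

theorem bc_gr_induction {n : ℤ} {p : (A.baseChange L).carrier → Prop}
    {x : (A.baseChange L).carrier} (hx : x ∈ (A.baseChange L).gr n)
    (ha : ∀ x y, p x → p y → p (x + y)) (ht : ∀ c, ∀ a ∈ A.gr n, p (tm c a)) : p x := by
  have h0 : p 0 := by
    have := ht 0 0 (zero_mem _)
    rwa [tm_zero] at this
  have hx' : x ∈ Submodule.span L {y : (A.baseChange L).carrier | ∃ a ∈ A.gr n, y = tm 1 a} := by
    have e : x ∈ Submodule.span L (((A.gr n).map (TensorProduct.mk l L A.carrier 1) :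
      Submodule l (L ⊗[l] A.carrier)) : Set (L ⊗[l] A.carrier)) := by
      rw [← Submodule.baseChange_eq_span]; exact hx
    refine Submodule.span_mono ?_ e
    rintro _ ⟨a, ha, rfl⟩
    exact ⟨a, ha, rfl⟩
  -- Quantified over scalars because `p` is not assumed `L`-linear; a multiple of a pure tensor is
  -- again a pure tensor.
  have key : ∀ c : L, p (c • x) := by
    refine Submodule.span_induction (p := fun x _ => ∀ c : L, p (c • x)) ?_ ?_ ?_ ?_ hx'
    · rintro _ ⟨a, ha, rfl⟩ c
      exact ht _ a ha
    · intro c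
      rw [smul_zero]
      exact h0
    · intro x y _ _ hx hy c
      rw [smul_add]
      exact ha _ _ (hx c) (hy c)
    · intro r x _ hx c
      rw [smul_smul]
      exact hx _
  have := key 1
  rwa [one_smul] at this

end Tm

/-- The extension of scalars of a linear map. -/
noncomputable def bc (φ : A.carrier →ₗ[l] B.carrier) :
    (A.baseChange L).carrier →ₗ[L] (B.baseChange L).carrier :=
  LinearMap.baseChange L φ

variable {L}

theorem bc_tm (φ : A.carrier →ₗ[l] B.carrier) (c : L) (a : A.carrier) :
    bc L φ (tm c a) = tm c (φ a) := rfl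

theorem IsChain.baseChange {φ : A.carrier →ₗ[l] B.carrier} (h : IsChain φ) : IsChain (bc L φ) where
  gr n x hx := bc_gr_induction (p := fun x => bc L φ x ∈ (B.baseChange L).gr n) hx
    (fun x y hx hy => by rw [map_add]; exact add_mem hx hy) fun c a ha => tm_mem c (h.gr n a ha)
  d x := by
    induction x using bc_induction with
    | ha x y hx hy => simp only [map_add, hx, hy]
    | ht c a => rw [d_tm, bc_tm, h.d, bc_tm, d_tm]

theorem IsHtpy.baseChange {h f g : A.carrier →ₗ[l] B.carrier} (H : IsHtpy h f g) :
    IsHtpy (bc L h) (bc L f) (bc L g) where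
  gr n x hx := bc_gr_induction (p := fun x => bc L h x ∈ (B.baseChange L).gr (n - 1)) hx
    (fun x y hx hy => by rw [map_add]; exact add_mem hx hy) fun c a ha => tm_mem c (H.gr n a ha)
  eq x := by
    induction x using bc_induction with
    | ha x y hx hy =>
      simp only [map_add]
      rw [add_sub_add_comm, hx, hy]
      abel
    | ht c a => simp only [d_tm, bc_tm, ← tm_add, ← tm_sub, H.eq]

/-- The extension of scalars of a morphism. -/
noncomputable def bcHom (j : DGAlgebra.Hom A B) :
    DGAlgebra.Hom (A.baseChange L) (B.baseChange L) :=
  let F : (A.baseChange L).carrier →ₗ[L] (B.baseChange L).carrier := bc L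
    { toFun := j.toRingHom, map_add' := map_add _, map_smul' := j.map_smul }
  have hF : ∀ (c : L) (a : A.carrier), F (tm c a) = tm c (j.toRingHom a) := fun _ _ => rfl
  { toRingHom :=
    { toFun := F
      map_zero' := map_zero F
      map_add' := map_add F
      map_one' := (hF 1 1).trans (congrArg (tm 1) (map_one j.toRingHom))
      map_mul' := fun x y => by
        induction x using bc_induction with
        | ha x x' hx hx' => rw [add_mul, map_add, hx, hx', map_add, add_mul]
        | ht c a =>
          induction y using bc_induction with
          | ha x y hx hy => rw [mul_add, map_add, hx, hy, map_add, mul_add]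
          | ht c' a' => rw [tm_mul, hF, hF, hF, tm_mul, map_mul] }
    map_smul := map_smul F
    map_gr := fun {n x} hx => by
      change F x ∈ _
      refine bc_gr_induction hx (p := fun x => F x ∈ (B.baseChange L).gr n)
        (fun x y hx hy => ?_) fun c a ha => tm_mem c (j.map_gr ha)
      rw [map_add]
      exact add_mem hx hy
    map_d := fun x => by
      change F ((A.baseChange L).d x) = (B.baseChange L).d (F x)
      induction x using bc_induction with
      | ha x y hx hy => simp only [map_add, hx, hy]
      | ht c a => rw [d_tm, hF, hF, d_tm, j.map_d] }

theorem bcHom_tm (j : DGAlgebra.Hom A B) (c : L) (a : A.carrier) :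
    (bcHom (L := L) j).toRingHom (tm c a) = tm c (j.toRingHom a) := rfl

theorem bcHom_id : bcHom (L := L) (DGAlgebra.Hom.id A) = DGAlgebra.Hom.id (A.baseChange L) := by
  have : (bcHom (L := L) (DGAlgebra.Hom.id A)).toRingHom = RingHom.id _ := by
    ext x
    induction x using bc_induction with
    | ha x y hx hy => rw [map_add, map_add, hx, hy]
    | ht c a => rfl
  rw [DGAlgebra.SemiHom.mk.injEq]
  exact this

theorem IsBilin.baseChange {T T' : DGAlgebra l} {n : ℤ} {j : DGAlgebra.Hom B T} {j' : DGAlgebra.Hom B T'}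
    {φ : T.carrier →ₗ[l] T'.carrier} (h : IsBilin n j j' φ) :
    IsBilin n (bcHom (L := L) j) (bcHom j') (bc L φ) where
  left m b hb t := by
    refine bc_gr_induction (p := fun b => bc L φ ((bcHom (L := L) j).toRingHom b * t) =
      (n * m).negOnePow • ((bcHom (L := L) j').toRingHom b * bc L φ t)) hb
      (fun x y hx hy => ?_) fun c a ha => ?_
    · simp only [map_add, add_mul, hx, hy, smul_add]
    · induction t using bc_induction with
      | ha x y hx hy => simp only [map_add, mul_add, hx, hy, smul_add]
      | ht c' t =>
        rw [bcHom_tm, bcHom_tm, tm_mul, bc_tm, bc_tm, tm_mul, h.left m a ha, tm_units_smul]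
  right b t := by
    induction b using bc_induction with
    | ha x y hx hy => simp only [map_add, mul_add, hx, hy]
    | ht c b =>
      induction t using bc_induction with
      | ha x y hx hy => simp only [map_add, add_mul, hx, hy]
      | ht c' t => rw [bcHom_tm, bcHom_tm, tm_mul, bc_tm, bc_tm, tm_mul, h.right]

theorem tm_mem_jspan {T : DGAlgebra l} {j : DGAlgebra.Hom B T} {S : Type u} {e : S → T.carrier}
    {X : Set S} {t : T.carrier} (ht : t ∈ jspan j e X) (c : L) :
    tm c t ∈ jspan (bcHom (L := L) j) (fun s => tm 1 (e s)) X := by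
  induction ht using Submodule.span_induction generalizing c with
  | zero => rw [tm_zero]; exact zero_mem _
  | add x y _ _ hx hy => rw [tm_add]; exact add_mem (hx c) (hy c)
  | smul r x _ hx => rw [tm_smul]; exact Submodule.smul_mem _ _ (hx c)
  | mem x hx =>
    obtain ⟨s, hs, m, n, a, b, ha, hb, rfl⟩ := hx
    refine Submodule.subset_span ⟨s, hs, m, n, tm c a, tm 1 b, tm_mem _ ha, tm_mem _ hb, ?_⟩
    rw [bcHom_tm, bcHom_tm, tm_mul, tm_mul, mul_one, mul_one]

/-- The extension of scalars of a resolution. -/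
theorem Res.nonempty_baseChange (R : Res B) : Nonempty (Res (B.baseChange L)) := by
  have hcomp : ∀ {A B C : DGAlgebra l} (φ : A.carrier →ₗ[l] B.carrier)
      (ψ : B.carrier →ₗ[l] C.carrier), bc L (ψ ∘ₗ φ) = bc L ψ ∘ₗ bc L φ :=
    fun φ ψ => LinearMap.baseChange_comp φ ψ
  have hid : bc L (LinearMap.id : B.carrier →ₗ[l] B.carrier) = LinearMap.id :=
    LinearMap.baseChange_id
  let bb : Module.Basis R.κ L (B.baseChange L).carrier := Algebra.TensorProduct.basis L R.b
  have hbb : ∀ i, bb i = tm 1 (R.b i) := fun i => Algebra.TensorProduct.basis_apply R.b i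
  -- The image of the extended idempotent is L ⊗ range π, from which its basis is transported.
  let N := LinearMap.range R.π
  let i : L ⊗[l] N →ₗ[L] (R.T.baseChange L).carrier := N.subtype.baseChange L
  let p : (R.T.baseChange L).carrier →ₗ[L] L ⊗[l] N := R.π.rangeRestrict.baseChange L
  obtain ⟨B', hB'⟩ := exists_basis_range (i := i) (p := p) (π := bc L R.π)
    (fun v => LinearMap.congr_fun (LinearMap.baseChange_comp _ _).symm v)
    (fun w => by
      have : R.π.rangeRestrict ∘ₗ N.subtype = LinearMap.id := by
        refine LinearMap.ext ?_
        rintro ⟨_, t, rfl⟩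
        exact Subtype.ext (R.π_π t)
      have h2 := LinearMap.congr_fun (LinearMap.baseChange_comp (A := L) N.subtype
        R.π.rangeRestrict) w
      rw [this, LinearMap.baseChange_id] at h2
      exact h2.symm) (Algebra.TensorProduct.basis L R.bas)
  have hi : ∀ x, i (Algebra.TensorProduct.basis L R.bas x) = tm 1 (R.bas x).1 := fun x =>
    congrArg i (Algebra.TensorProduct.basis_apply R.bas x)
  refine ⟨{
    T := R.T.baseChange L
    j := bcHom R.j
    π := bc L R.π
    π_chain := R.π_chain.baseChange
    π_bilin := R.π_bilin.baseChange
    π_π := fun t => by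
      induction t using bc_induction with
      | ha x y hx hy => simp only [map_add, hx, hy]
      | ht c a => simp only [bc_tm, R.π_π]
    ε := bc L R.ε
    ε_chain := R.ε_chain.baseChange
    ε_bilin := by
      have := R.ε_bilin.baseChange (L := L)
      rwa [bcHom_id] at this
    g := bc L R.g
    g_chain := R.g_chain.baseChange
    π_g := fun t => by
      induction t using bc_induction with
      | ha x y hx hy => simp only [map_add, hx, hy]
      | ht c a => simp only [bc_tm, R.π_g]
    hB := bc L R.hB
    hB_htpy := by
      have := R.hB_htpy.baseChange (L := L)
      rwa [hcomp, hid] at this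
    hT := bc L R.hT
    hT_htpy := by
      have := R.hT_htpy.baseChange (L := L)
      rwa [hcomp] at this
    π_hT := fun t => by
      induction t using bc_induction with
      | ha x y hx hy => simp only [map_add, hx, hy]
      | ht c a => simp only [bc_tm, R.π_hT]
    u := bc L R.u
    u_chain := R.u_chain.baseChange
    u_bilin := R.u_bilin.baseChange
    π_u := fun t => by
      induction t using bc_induction with
      | ha x y hx hy => simp only [map_add, hx, hy]
      | ht c a => simp only [bc_tm, R.π_u]
    hu := bc L R.hu
    hu_htpy := R.hu_htpy.baseChange
    hu_bilin := R.hu_bilin.baseChange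
    π_hu := fun t => by
      induction t using bc_induction with
      | ha x y hx hy => simp only [map_add, hx, hy]
      | ht c a => simp only [bc_tm, R.π_hu]
    S := R.S
    deg := R.deg
    filt := R.filt
    e := fun s => tm 1 (R.e s)
    e_mem := fun s => tm_mem 1 (R.e_mem s)
    d_e := fun s => by
      rw [d_tm]
      exact tm_mem_jspan (R.d_e s) 1
    X := R.X
    u_mem := fun t => by
      induction t using bc_induction with
      | ha x y hx hy => rw [map_add]; exact add_mem hx hy
      | ht c a => rw [bc_tm]; exact tm_mem_jspan (R.u_mem a) c
    κ := R.κ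
    b := bb
    bdeg := R.bdeg
    b_mem := fun i => by
      rw [hbb]
      exact tm_mem 1 (R.b_mem i)
    bas := B'
    bas_apply := fun x => by
      rw [hB', hi, hbb, hbb, bcHom_tm, bcHom_tm, tm_mul, tm_mul, one_mul, one_mul, R.bas_apply] }⟩

end BaseChange

/-! ### Restriction of scalars along an isomorphism of fields -/

section Restrict

variable {K K' : Type u} [Field K] [Field K']

theorem exists_basis_compHom {M κ : Type*} [AddCommGroup M] [Module K M] [Module K' M]
    (f : K ≃+* K') (h : ∀ (c : K) (x : M), c • x = f c • x) (b : Module.Basis κ K' M) :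
    ∃ b' : Module.Basis κ K M, ∀ i, b' i = b i :=
  ⟨b.mapCoeffs f.symm fun c x => by rw [h, f.apply_symm_apply],
    fun _ => Module.Basis.mapCoeffs_apply _ _ _ _⟩

/-- Restriction of scalars of a linear map. -/
def rsMap (f : K →+* K') {A B : DGAlgebra K'} (φ : A.carrier →ₗ[K'] B.carrier) :
    (A.restrictScalars f).carrier →ₗ[K] (B.restrictScalars f).carrier where
  toFun := φ
  map_add' := φ.map_add
  map_smul' c := φ.map_smul (f c)

/-- Restriction of scalars of a morphism. -/
def rsHom (f : K →+* K') {A B : DGAlgebra K'} (j : DGAlgebra.Hom A B) :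
    DGAlgebra.Hom (A.restrictScalars f) (B.restrictScalars f) where
  toRingHom := j.toRingHom
  map_smul c x := j.map_smul (f c) x
  map_gr h := j.map_gr h
  map_d x := j.map_d x

theorem IsChain.restrictScalars (f : K →+* K') {A B : DGAlgebra K'}
    {φ : A.carrier →ₗ[K'] B.carrier} (h : IsChain φ) : IsChain (rsMap f φ) := ⟨h.gr, h.d⟩

theorem IsHtpy.restrictScalars (f : K →+* K') {A B : DGAlgebra K'}
    {φ ψ χ : A.carrier →ₗ[K'] B.carrier} (h : IsHtpy φ ψ χ) :
    IsHtpy (rsMap f φ) (rsMap f ψ) (rsMap f χ) := ⟨h.gr, h.eq⟩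

theorem IsBilin.restrictScalars (f : K →+* K') {B T T' : DGAlgebra K'} {n : ℤ}
    {j : DGAlgebra.Hom B T} {j' : DGAlgebra.Hom B T'} {φ : T.carrier →ₗ[K'] T'.carrier}
    (h : IsBilin n j j' φ) : IsBilin n (rsHom f j) (rsHom f j') (rsMap f φ) := ⟨h.left, h.right⟩

/-- A scalar r of `K'` acts as f⁻¹(r) in `K`, so surjectivity of `f` is what keeps the span from
shrinking. -/
theorem jspan_restrictScalars (f : K ≃+* K') {B T : DGAlgebra K'} {j : DGAlgebra.Hom B T}
    {S : Type u} {e : S → T.carrier} {X : Set S} {t : T.carrier} (ht : t ∈ jspan j e X) :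
    (show (T.restrictScalars (f : K →+* K')).carrier from t) ∈
      jspan (rsHom (f : K →+* K') j) e X := by
  induction ht using Submodule.span_induction with
  | zero => exact zero_mem _
  | add x y _ _ hx hy => exact add_mem hx hy
  | smul r x _ hx =>
    have := Submodule.smul_mem (jspan (rsHom (f : K →+* K') j) e X) (f.symm r) hx
    have e : f.symm r • (show (T.restrictScalars (f : K →+* K')).carrier from x) =
      (show (T.restrictScalars (f : K →+* K')).carrier from f (f.symm r) • x) := rfl
    rw [e, f.apply_symm_apply] at this
    exact this
  | mem x hx => exact Submodule.subset_span hx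

/-- Restriction of scalars of a resolution along an isomorphism of fields. -/
theorem Res.nonempty_restrictScalars (f : K ≃+* K') {B : DGAlgebra K'} (R : Res B) :
    Nonempty (Res (B.restrictScalars (f : K →+* K'))) := by
  obtain ⟨bas', hbas⟩ : ∃ b : Module.Basis (R.κ × R.S × R.κ) K
      (LinearMap.range (rsMap (f : K →+* K') R.π)), ∀ i, b i = R.bas i :=
    @exists_basis_compHom K K' _ _ (LinearMap.range R.π) _ _
      (LinearMap.range (rsMap (f : K →+* K') R.π)).module _ f (fun _ _ => rfl) R.bas
  obtain ⟨b', hb⟩ : ∃ b : Module.Basis R.κ K (B.restrictScalars (f : K →+* K')).carrier,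
      ∀ i, b i = R.b i :=
    @exists_basis_compHom K K' _ _ B.carrier _ _
      (B.restrictScalars (f : K →+* K')).algebra.toModule _ f (fun _ _ => rfl) R.b
  exact ⟨
    { T := R.T.restrictScalars (f : K →+* K')
      j := rsHom _ R.j
      π := rsMap _ R.π
      π_chain := R.π_chain.restrictScalars _
      π_bilin := R.π_bilin.restrictScalars _
      π_π := fun t => R.π_π t
      ε := rsMap _ R.ε
      ε_chain := R.ε_chain.restrictScalars _
      ε_bilin := R.ε_bilin.restrictScalars _
      g := rsMap _ R.g
      g_chain := R.g_chain.restrictScalars _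
      π_g := fun t => R.π_g t
      hB := rsMap _ R.hB
      hB_htpy := R.hB_htpy.restrictScalars _
      hT := rsMap _ R.hT
      hT_htpy := R.hT_htpy.restrictScalars _
      π_hT := fun t => R.π_hT t
      u := rsMap _ R.u
      u_chain := R.u_chain.restrictScalars _
      u_bilin := R.u_bilin.restrictScalars _
      π_u := fun t => R.π_u t
      hu := rsMap _ R.hu
      hu_htpy := R.hu_htpy.restrictScalars _
      hu_bilin := R.hu_bilin.restrictScalars _
      π_hu := fun t => R.π_hu t
      S := R.S
      deg := R.deg
      filt := R.filt
      e := R.e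
      e_mem := R.e_mem
      d_e := fun s => jspan_restrictScalars f (R.d_e s)
      X := R.X
      u_mem := fun t => jspan_restrictScalars f (R.u_mem t)
      κ := R.κ
      b := b'
      bdeg := R.bdeg
      b_mem := fun i => by
        rw [hb]
        exact R.b_mem i
      bas := bas'
      bas_apply := fun x => by
        rw [hbas, hb, hb]
        exact R.bas_apply x }⟩

end Restrict

end NCWeil

namespace NCWeil

/-! ### Tensor products of maps, homotopies and bilinear maps -/

section PiMap

open KTensor DGAlgebra

variable {K : Type u} [Field K] {ι : Type u} [Fintype ι] [LinearOrder ι]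
  {B C D : ι → DGAlgebra K}

/-- The pure tensor `⊗ᵢ xᵢ`. -/
noncomputable def ptm (x : ∀ i, (B i).carrier) : (piTensor B).carrier := KTensor.pure B x

section Ptm

theorem ptm_update_add (x : ∀ i, (B i).carrier) (i : ι) (a b : (B i).carrier) :
    ptm (Function.update x i (a + b)) =
      ptm (Function.update x i a) + ptm (Function.update x i b) :=
  pure_update_add x i a b

theorem ptm_update_zero (x : ∀ i, (B i).carrier) (i : ι) :
    ptm (Function.update x i 0) = 0 :=
  (PiTensorProduct.tprod K).map_update_zero x i

theorem ptm_update_smul (x : ∀ i, (B i).carrier) (i : ι) (c : K) (a : (B i).carrier) :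
    ptm (Function.update x i (c • a)) = c • ptm (Function.update x i a) :=
  (PiTensorProduct.tprod K).map_update_smul x i c a

theorem ptm_mul {f g : ι → ℤ} {x y : ∀ i, (B i).carrier} (hx : ∀ i, x i ∈ (B i).gr (f i))
    (hy : ∀ i, y i ∈ (B i).gr (g i)) : ptm x * ptm y = mulSign f g • ptm (x * y) :=
  pure_mul_pure hx hy

theorem ptm_mem {f : ι → ℤ} {x : ∀ i, (B i).carrier} (hx : ∀ i, x i ∈ (B i).gr (f i)) :
    ptm x ∈ (piTensor B).gr (∑ i, f i) := pure_mem_gr hx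

theorem d_ptm {f : ι → ℤ} {x : ∀ i, (B i).carrier} (hx : ∀ i, x i ∈ (B i).gr (f i)) :
    (piTensor B).d (ptm x) = ∑ i, dSign i f • ptm (Function.update x i ((B i).d (x i))) :=
  (dₗ_apply _).trans (Finset.sum_congr rfl fun i _ => dAt_pure i hx)

theorem ptm_induction {P : (piTensor B).carrier → Prop} (t : (piTensor B).carrier)
    (hp : ∀ (f : ι → ℤ) (x : ∀ i, (B i).carrier), (∀ i, x i ∈ (B i).gr (f i)) → P (ptm x))
    (ha : ∀ x y, P x → P y → P (x + y)) (hs : ∀ (c : K) x, P x → P (c • x)) : P t :=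
  hom_induction (P := P) t hp ha hs

theorem ptm_gr_induction {n : ℤ} {P : (piTensor B).carrier → Prop} {t : (piTensor B).carrier}
    (ht : t ∈ (piTensor B).gr n) (h0 : P 0)
    (hp : ∀ (f : ι → ℤ) (x : ∀ i, (B i).carrier), (∀ i, x i ∈ (B i).gr (f i)) →
      ∑ i, f i = n → P (ptm x))
    (ha : ∀ x y, P x → P y → P (x + y)) (hs : ∀ (c : K) x, P x → P (c • x)) : P t := by
  refine Submodule.span_induction (p := fun x _ => P x) ?_ h0 (fun x y _ _ => ha x y)
    (fun c x _ => hs c x) ht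
  rintro _ ⟨f, x, hx, hf, rfl⟩
  exact hp f x hx hf

end Ptm

/-- The tensor product of linear maps of degree `0`. -/
noncomputable def piMap (φ : ∀ i, (B i).carrier →ₗ[K] (C i).carrier) :
    (piTensor B).carrier →ₗ[K] (piTensor C).carrier :=
  PiTensorProduct.map φ

/-- The tensor product of linear maps of which only the one at `m` has an odd degree. -/
noncomputable def piMapAt (m : ι) (θ : ∀ i, (B i).carrier →ₗ[K] (C i).carrier) :
    (piTensor B).carrier →ₗ[K] (piTensor C).carrier :=
  piMap θ ∘ₗ (sOp (dSign m) : KTensor B →ₗ[K] KTensor B)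

theorem piMap_ptm (φ : ∀ i, (B i).carrier →ₗ[K] (C i).carrier) (x : ∀ i, (B i).carrier) :
    piMap φ (ptm x) = ptm fun i => φ i (x i) :=
  PiTensorProduct.map_tprod _ _

theorem piMapAt_ptm (m : ι) (θ : ∀ i, (B i).carrier →ₗ[K] (C i).carrier) {f : ι → ℤ}
    {x : ∀ i, (B i).carrier} (hx : ∀ i, x i ∈ (B i).gr (f i)) :
    piMapAt m θ (ptm x) = dSign m f • ptm fun i => θ i (x i) := by
  have : piMapAt m θ (ptm x) = piMap θ (dSign m f • ptm x) := congrArg (piMap θ) (sOp_pure _ hx)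
  rw [this, NCWeil.map_units_smul, piMap_ptm]

theorem piMap_comp (ψ : ∀ i, (C i).carrier →ₗ[K] (D i).carrier)
    (φ : ∀ i, (B i).carrier →ₗ[K] (C i).carrier) :
    piMap (fun i => ψ i ∘ₗ φ i) = piMap ψ ∘ₗ piMap φ := PiTensorProduct.map_comp _ _

theorem piMap_id : piMap (fun i => (LinearMap.id : (B i).carrier →ₗ[K] (B i).carrier)) =
    LinearMap.id := PiTensorProduct.map_id

theorem piMap_update_sub (φ : ∀ i, (B i).carrier →ₗ[K] (C i).carrier) (m : ι)
    (a b : (B m).carrier →ₗ[K] (C m).carrier) : piMap (Function.update φ m (a - b)) =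
      piMap (Function.update φ m a) - piMap (Function.update φ m b) := by
  have h : piMap (Function.update φ m (a - b + b)) =
      piMap (Function.update φ m (a - b)) + piMap (Function.update φ m b) :=
    PiTensorProduct.map_update_add φ m (a - b) b
  rw [sub_add_cancel] at h
  rw [h, add_sub_cancel_right]

theorem update_apply_apply (φ : ∀ i, (B i).carrier →ₗ[K] (C i).carrier) (x : ∀ i, (B i).carrier)
    (m : ι) (a : (B m).carrier) : (fun i => φ i (Function.update x m a i)) =
      Function.update (fun i => φ i (x i)) m (φ m a) := by
  funext i
  exact Function.apply_update (fun i => φ i) x m a i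

theorem update_d_mem' {f : ι → ℤ} {x : ∀ i, (B i).carrier} (hx : ∀ i, x i ∈ (B i).gr (f i))
    (m : ι) (i : ι) : Function.update x m ((B m).d (x m)) i ∈
      (B i).gr ((f + Pi.single m 1 : ι → ℤ) i) := update_d_mem m hx i

theorem IsChain.piMap {φ : ∀ i, (B i).carrier →ₗ[K] (C i).carrier} (h : ∀ i, IsChain (φ i)) :
    IsChain (piMap φ) where
  gr n x hx := by
    refine ptm_gr_induction (P := fun x => NCWeil.piMap φ x ∈ (piTensor C).gr n) hx (by simp)
      (fun f x hx hf => ?_) (fun x y hx hy => ?_) fun c x hx => ?_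
    · rw [piMap_ptm, ← hf]
      exact ptm_mem fun i => (h i).gr _ _ (hx i)
    · rw [map_add]; exact add_mem hx hy
    · rw [map_smul]; exact Submodule.smul_mem _ _ hx
  d x := by
    induction x using ptm_induction with
    | ha x y hx hy => simp only [map_add, hx, hy]
    | hs c x hx => simp only [map_smul, hx]
    | hp f x hx =>
      rw [d_ptm hx, piMap_ptm, d_ptm fun i => (h i).gr _ _ (hx i), map_sum]
      refine Finset.sum_congr rfl fun i _ => ?_
      rw [NCWeil.map_units_smul, piMap_ptm, update_apply_apply, (h i).d]

theorem dSign_sub_single (i m : ι) (f : ι → ℤ) :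
    dSign i (f - Pi.single m 1) = dSign i f * dSign i (Pi.single m 1) := by
  have h := dSign_add i (f - Pi.single m 1) (Pi.single m 1)
  rw [sub_add_cancel] at h
  rw [h, mul_assoc, Int.units_mul_self, mul_one]

theorem apply_mem_sub_single {θ : ∀ i, (B i).carrier →ₗ[K] (C i).carrier} {m : ι}
    (hm : ∀ n, ∀ x ∈ (B m).gr n, θ m x ∈ (C m).gr (n - 1))
    (hθ : ∀ i, i ≠ m → ∀ n, ∀ x ∈ (B i).gr n, θ i x ∈ (C i).gr n) {f : ι → ℤ}
    {x : ∀ i, (B i).carrier} (hx : ∀ i, x i ∈ (B i).gr (f i)) (i : ι) :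
    θ i (x i) ∈ (C i).gr ((f - Pi.single m 1 : ι → ℤ) i) := by
  by_cases e : i = m
  · subst e
    simpa using hm _ _ (hx i)
  · simpa [e] using hθ i e _ _ (hx i)

theorem piMapAt_mem {θ : ∀ i, (B i).carrier →ₗ[K] (C i).carrier} {m : ι}
    (hm : ∀ n, ∀ x ∈ (B m).gr n, θ m x ∈ (C m).gr (n - 1))
    (hθ : ∀ i, i ≠ m → ∀ n, ∀ x ∈ (B i).gr n, θ i x ∈ (C i).gr n) (n : ℤ)
    (x : (piTensor B).carrier) (hx : x ∈ (piTensor B).gr n) :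
    piMapAt m θ x ∈ (piTensor C).gr (n - 1) := by
  refine ptm_gr_induction (P := fun x => piMapAt m θ x ∈ (piTensor C).gr (n - 1)) hx (by simp)
    (fun f x hx hf => ?_) (fun x y hx hy => ?_) fun c x hx => ?_
  · rw [piMapAt_ptm m θ hx]
    have := ptm_mem (apply_mem_sub_single hm hθ hx)
    simp only [Pi.sub_apply, Finset.sum_sub_distrib, hf, Finset.sum_pi_single', Finset.mem_univ,
      if_true] at this
    exact units_smul_mem _ this
  · rw [map_add]; exact add_mem hx hy
  · rw [map_smul]; exact Submodule.smul_mem _ _ hx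

/-- For i ≠ m the terms in which the i-th factor is differentiated cancel: passing a map of odd
degree at m and a differential at i in the two orders gives opposite Koszul signs. Only the term at
m remains, and there the given homotopy applies. -/
theorem IsHtpy.piMapAt {θ : ∀ i, (B i).carrier →ₗ[K] (C i).carrier} {m : ι}
    {φ ψ : (B m).carrier →ₗ[K] (C m).carrier} (hm : IsHtpy (θ m) φ ψ)
    (hθ : ∀ i, i ≠ m → IsChain (θ i)) :
    IsHtpy (piMapAt m θ) (piMap (Function.update θ m φ)) (piMap (Function.update θ m ψ)) where
  gr := piMapAt_mem hm.gr fun i hi => (hθ i hi).gr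
  eq x := by
    rw [← LinearMap.sub_apply, ← piMap_update_sub]
    induction x using ptm_induction with
    | ha x y hx hy => simp only [map_add, hx, hy]; abel
    | hs c x hx => simp only [map_smul, hx, smul_add]
    | hp f x hx =>
      have hx' := apply_mem_sub_single hm.gr (fun i hi => (hθ i hi).gr) hx
      rw [piMap_ptm, piMapAt_ptm m θ hx, NCWeil.map_units_smul, d_ptm hx', d_ptm hx, map_sum,
        Finset.smul_sum, ← Finset.sum_add_distrib]
      have key : ∀ i, dSign m f • dSign i (f - Pi.single m 1) •
            ptm (Function.update (fun i => θ i (x i)) i ((C i).d (θ i (x i)))) +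
          NCWeil.piMapAt m θ (dSign i f • ptm (Function.update x i ((B i).d (x i)))) =
          (dSign m f * dSign i f) • (dSign i (Pi.single m 1) •
            ptm (Function.update (fun i => θ i (x i)) i ((C i).d (θ i (x i)))) +
          dSign m (Pi.single i 1) •
            ptm (Function.update (fun i => θ i (x i)) i (θ i ((B i).d (x i))))) := by
        intro i
        rw [NCWeil.map_units_smul, piMapAt_ptm m θ (update_d_mem' hx i), update_apply_apply,
          dSign_sub_single, dSign_add, smul_add]
        simp only [smul_smul]
        congr 2
        · ac_rfl
        · ac_rfl
      rw [Finset.sum_congr rfl fun i _ => key i, Finset.sum_eq_single m]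
      · rw [dSign_single_of_not_lt (lt_irrefl m), one_smul, one_smul, Int.units_mul_self, one_smul,
          ← ptm_update_add, ← hm.eq]
        congr 1
        funext i
        by_cases e : i = m
        · subst e; simp
        · simp [e]
      · intro i _ hi
        rw [(hθ i hi).d]
        rcases lt_or_gt_of_ne hi with h | h
        · rw [dSign_single_of_lt h, dSign_single_of_not_lt h.not_gt]; simp
        · rw [dSign_single_of_lt h, dSign_single_of_not_lt h.not_gt]; simp
      · simp

/-- A family of homotopies gives rise to a homotopy between the tensor products. -/
theorem exists_isHtpy_piMap {h φ ψ : ∀ i, (B i).carrier →ₗ[K] (C i).carrier}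
    (hφ : ∀ i, IsChain (φ i)) (hψ : ∀ i, IsChain (ψ i)) (H : ∀ i, IsHtpy (h i) (φ i) (ψ i))
    (p : ((piTensor B).carrier →ₗ[K] (piTensor C).carrier) → Prop) (h0 : p 0)
    (hadd : ∀ a b, p a → p b → p (a + b))
    (hp : ∀ m θ, θ m = h m → (∀ i, i ≠ m → θ i = φ i ∨ θ i = ψ i) → p (piMapAt m θ)) :
    ∃ w, IsHtpy w (piMap φ) (piMap ψ) ∧ p w := by
  -- The factors `ψ i` are exchanged for `φ i` one at a time and the homotopies are added up. The
  -- predicate `p` is carried along so that further properties of the resulting homotopy can be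
  -- verified term by term.
  have key : ∀ s : Finset ι, ∃ w, IsHtpy w (piMap (s.piecewise φ ψ)) (piMap ψ) ∧ p w := by
    intro s
    induction s using Finset.induction_on with
    | empty =>
      refine ⟨0, ⟨fun n x _ => zero_mem _, fun x => ?_⟩, h0⟩
      simp
    | insert m s hm ih =>
      obtain ⟨w, hw, hpw⟩ := ih
      have hd : ∀ i, (s.piecewise φ ψ) i = φ i ∨ (s.piecewise φ ψ) i = ψ i := fun i => by
        by_cases hi : i ∈ s
        · left; simp [hi]
        · right; simp [hi]
      let θ := Function.update (s.piecewise φ ψ) m (h m)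
      have hθm : θ m = h m := Function.update_self ..
      have hθ : ∀ i, i ≠ m → θ i = (s.piecewise φ ψ) i := fun i hi => Function.update_of_ne hi _ _
      have h1 : IsHtpy (piMapAt m θ) (piMap (Function.update θ m (φ m)))
          (piMap (Function.update θ m (ψ m))) := by
        refine IsHtpy.piMapAt (by rw [hθm]; exact H m) fun i hi => ?_
        rw [hθ i hi]
        rcases hd i with e | e <;> rw [e]
        exacts [hφ i, hψ i]
      rw [Function.update_idem, Function.update_idem] at h1
      have e1 : Function.update (s.piecewise φ ψ) m (φ m) = (insert m s).piecewise φ ψ :=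
        (Finset.piecewise_insert _ _ _ _).symm
      have e2 : Function.update (s.piecewise φ ψ) m (ψ m) = s.piecewise φ ψ := by
        rw [Function.update_eq_self_iff]
        simp [hm]
      rw [e1, e2] at h1
      refine ⟨piMapAt m θ + w, ⟨fun n x hx => add_mem (h1.gr n x hx) (hw.gr n x hx),
        fun x => ?_⟩, hadd _ _ (hp m θ hθm fun i hi => by rw [hθ i hi]; exact hd i) hpw⟩
      rw [LinearMap.add_apply, LinearMap.add_apply, map_add, add_add_add_comm, ← h1.eq, ← hw.eq]
      abel
  have := key Finset.univ
  rwa [Finset.piecewise_univ] at this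

/-- The tensor product of morphisms. -/
noncomputable def piHom (j : ∀ i, DGAlgebra.Hom (B i) (C i)) :
    DGAlgebra.Hom (piTensor B) (piTensor C) :=
  let F : (piTensor B).carrier →ₗ[K] (piTensor C).carrier := piMap fun i =>
    { toFun := (j i).toRingHom, map_add' := map_add _, map_smul' := (j i).map_smul }
  have hF : ∀ x : ∀ i, (B i).carrier, F (ptm x) = ptm fun i => (j i).toRingHom (x i) :=
    fun x => piMap_ptm _ x
  have hc : IsChain F := IsChain.piMap fun i => ⟨fun _ _ hx => (j i).map_gr hx, (j i).map_d⟩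
  { toRingHom :=
    { toFun := F
      map_zero' := map_zero F
      map_add' := map_add F
      map_one' := (hF 1).trans (congrArg ptm (funext fun i => map_one (j i).toRingHom))
      map_mul' := fun x y => by
        induction x using ptm_induction with
        | ha x x' hx hx' => rw [add_mul, map_add, hx, hx', map_add, add_mul]
        | hs c x hx => rw [smul_mul_assoc, map_smul, hx, map_smul, smul_mul_assoc]
        | hp f x hx =>
          induction y using ptm_induction with
          | ha x y hx hy => rw [mul_add, map_add, hx, hy, map_add, mul_add]
          | hs c x hx => rw [mul_smul_comm, map_smul, hx, map_smul, mul_smul_comm]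
          | hp g y hy =>
            rw [ptm_mul hx hy, NCWeil.map_units_smul, hF, hF, hF,
              ptm_mul (fun i => (j i).map_gr (hx i)) fun i => (j i).map_gr (hy i)]
            congr 2
            funext i
            exact map_mul (j i).toRingHom _ _ }
    map_smul := map_smul F
    map_gr := fun {n x} hx => hc.gr n x hx
    map_d := hc.d }

theorem piHom_ptm (j : ∀ i, DGAlgebra.Hom (B i) (C i)) (x : ∀ i, (B i).carrier) :
    (piHom j).toRingHom (ptm x) = ptm fun i => (j i).toRingHom (x i) := piMap_ptm _ x

theorem DGAlgebra.Hom.ringHom_smul {A B : DGAlgebra K} (j : DGAlgebra.Hom A B) (c : K)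
    (a : A.carrier) : j.toRingHom (c • a) = c • j.toRingHom a := j.map_smul c a

theorem piHom_id : piHom (fun i => DGAlgebra.Hom.id (B i)) = DGAlgebra.Hom.id (piTensor B) := by
  have : (piHom (fun i => DGAlgebra.Hom.id (B i))).toRingHom = RingHom.id _ := by
    ext x
    induction x using ptm_induction with
    | ha x y hx hy => rw [map_add, map_add, hx, hy]
    | hs c x hx => rw [DGAlgebra.Hom.ringHom_smul, hx]; rfl
    | hp f x hx => exact piHom_ptm _ x
  rw [DGAlgebra.SemiHom.mk.injEq]
  exact this

variable {T T' : ι → DGAlgebra K} {j : ∀ i, DGAlgebra.Hom (B i) (T i)}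
  {j' : ∀ i, DGAlgebra.Hom (B i) (T' i)}

theorem ptm_units_smul (c : ι → ℤˣ) (x : ∀ i, (B i).carrier) :
    ptm (fun i => c i • x i) = (∏ i, c i) • ptm x := by
  have h := (PiTensorProduct.tprod K (s := fun i => (B i).carrier)).map_smul_univ
    (fun i => ((c i : ℤ) : K)) x
  have e : ∀ {M : Type u} [AddCommGroup M] [Module K M] (c : ℤˣ) (x : M),
      ((c : ℤ) : K) • x = c • x := fun c x => by rw [Int.cast_smul_eq_zsmul, Units.smul_def]
  simp only [e] at h
  refine h.trans ?_
  rw [← e, Units.coe_prod, Int.cast_prod]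
  rfl

theorem sum_neg_single_mul (m : ι) (f : ι → ℤ) :
    ∏ i, ((-(Pi.single m 1 : ι → ℤ) i) * f i).negOnePow = (f m).negOnePow := by
  rw [Finset.prod_eq_single m]
  · rw [Pi.single_eq_same, neg_one_mul, Int.negOnePow_neg]
  · intro i _ hi
    simp [hi]
  · simp

/-- Maps of degree 0 change no degrees, so the Koszul signs on both sides are the same and
bilinearity is checked factor by factor. -/
theorem IsBilin.piMap {φ : ∀ i, (T i).carrier →ₗ[K] (T' i).carrier}
    (hg : ∀ i n, ∀ x ∈ (T i).gr n, φ i x ∈ (T' i).gr n)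
    (h : ∀ i, IsBilin 0 (j i) (j' i) (φ i)) : IsBilin 0 (piHom j) (piHom j') (piMap φ) where
  left m b hb t := by
    clear hb
    rw [zero_mul, Int.negOnePow_zero, one_smul]
    induction b using ptm_induction with
    | ha x y hx hy => simp only [map_add, add_mul, hx, hy]
    | hs c x hx =>
      simp only [DGAlgebra.Hom.ringHom_smul, smul_mul_assoc, map_smul, hx]
    | hp f b hb =>
      induction t using ptm_induction with
      | ha x y hx hy => simp only [map_add, mul_add, hx, hy]
      | hs c x hx => simp only [mul_smul_comm, map_smul, hx]
      | hp g t ht =>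
        rw [piHom_ptm, piHom_ptm, piMap_ptm, ptm_mul (fun i => (j i).map_gr (hb i)) ht,
          ptm_mul (fun i => (j' i).map_gr (hb i)) (fun i => hg i _ _ (ht i)),
          NCWeil.map_units_smul, piMap_ptm]
        congr 2
        funext i
        have := (h i).left _ _ (hb i) (t i)
        rwa [zero_mul, Int.negOnePow_zero, one_smul] at this
  right b t := by
    induction b using ptm_induction with
    | ha x y hx hy => simp only [map_add, mul_add, hx, hy]
    | hs c x hx =>
      simp only [DGAlgebra.Hom.ringHom_smul, mul_smul_comm, map_smul, hx]
    | hp f b hb =>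
      induction t using ptm_induction with
      | ha x y hx hy => simp only [map_add, add_mul, hx, hy]
      | hs c x hx => simp only [smul_mul_assoc, map_smul, hx]
      | hp g t ht =>
        rw [piHom_ptm, piHom_ptm, piMap_ptm, ptm_mul ht (fun i => (j i).map_gr (hb i)),
          ptm_mul (fun i => hg i _ _ (ht i)) (fun i => (j' i).map_gr (hb i)),
          NCWeil.map_units_smul, piMap_ptm]
        congr 2
        funext i
        exact (h i).right _ _

theorem mulSign_sub_single_right (f g : ι → ℤ) (m : ι) :
    mulSign f (g - Pi.single m 1) = mulSign f g * mulSign f (Pi.single m 1) := by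
  have h := mulSign_add_right f (g - Pi.single m 1) (Pi.single m 1)
  rw [sub_add_cancel] at h
  rw [h, mul_assoc, Int.units_mul_self, mul_one]

theorem mulSign_sub_single_left (f g : ι → ℤ) (m : ι) :
    mulSign (f - Pi.single m 1) g = mulSign f g * dSign m g := by
  have h := mulSign_add_left (f - Pi.single m 1) (Pi.single m 1) g
  rw [sub_add_cancel, mulSign_single_left] at h
  rw [h, mul_assoc, Int.units_mul_self, mul_one]

theorem IsBilin.piMapAt {θ : ∀ i, (T i).carrier →ₗ[K] (T' i).carrier} {m : ι}
    (hgm : ∀ n, ∀ x ∈ (T m).gr n, θ m x ∈ (T' m).gr (n - 1))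
    (hg : ∀ i, i ≠ m → ∀ n, ∀ x ∈ (T i).gr n, θ i x ∈ (T' i).gr n)
    (hm : IsBilin (-1) (j m) (j' m) (θ m))
    (h : ∀ i, i ≠ m → IsBilin 0 (j i) (j' i) (θ i)) :
    IsBilin (-1) (piHom j) (piHom j') (piMapAt m θ) where
  left n b hb t := by
    refine ptm_gr_induction (P := fun b => NCWeil.piMapAt m θ ((piHom j).toRingHom b * t) =
      (-1 * n).negOnePow • ((piHom j').toRingHom b * NCWeil.piMapAt m θ t)) hb (by simp)
      (fun f b hb hf => ?_) (fun x y hx hy => ?_) fun c x hx => ?_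
    · induction t using ptm_induction with
      | ha x y hx hy => simp only [map_add, mul_add, hx, hy, smul_add]
      | hs c x hx => simp only [mul_smul_comm, map_smul, hx]; rw [smul_comm]
      | hp g t ht =>
        have hj : ∀ i, (j i).toRingHom (b i) ∈ (T i).gr (f i) := fun i => (j i).map_gr (hb i)
        have e : (fun i => θ i (((fun i => (j i).toRingHom (b i)) * t) i)) = fun i =>
            ((-(Pi.single m 1 : ι → ℤ) i) * f i).negOnePow •
              ((fun i => (j' i).toRingHom (b i)) * fun i => θ i (t i)) i := by
          funext i
          by_cases hi : i = m
          · subst hi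
            rw [Pi.single_eq_same]
            exact hm.left _ _ (hb i) (t i)
          · rw [Pi.single_eq_of_ne hi, neg_zero]
            exact (h i hi).left _ _ (hb i) (t i)
        rw [piHom_ptm, piHom_ptm, ptm_mul hj ht, NCWeil.map_units_smul,
          piMapAt_ptm m θ (mul_mem_gr' hj ht), e, ptm_units_smul,
          piMapAt_ptm m θ ht, sum_neg_single_mul, mul_smul_comm,
          ptm_mul (fun i => (j' i).map_gr (hb i)) (apply_mem_sub_single hgm hg ht),
          mulSign_sub_single_right]
        simp only [smul_smul]
        congr 1
        -- This combines the sign (-1)^(f m) of the factor at `m` and the sign from the factors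
        -- before `m` into the total sign (-1)^|b|, up to the correction in `mulSign` caused by the
        -- shifted degree.
        have h1 := mulSign_single_right m f
        rw [dSign_add, neg_one_mul, Int.negOnePow_neg, ← hf]
        calc _ = mulSign f g * dSign m g * (dSign m f * (f m).negOnePow) := by ac_rfl
          _ = _ := by rw [← h1]; ac_rfl
    · simp only [map_add, add_mul, hx, hy, smul_add]
    · simp only [DGAlgebra.Hom.ringHom_smul, smul_mul_assoc, map_smul, hx]
      rw [smul_comm]
  right b t := by
    induction b using ptm_induction with
    | ha x y hx hy => simp only [map_add, mul_add, hx, hy]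
    | hs c x hx =>
      simp only [DGAlgebra.Hom.ringHom_smul, mul_smul_comm, map_smul, hx]
    | hp f b hb =>
      induction t using ptm_induction with
      | ha x y hx hy => simp only [map_add, add_mul, hx, hy]
      | hs c x hx => simp only [smul_mul_assoc, map_smul, hx]
      | hp g t ht =>
        have hj : ∀ i, (j i).toRingHom (b i) ∈ (T i).gr (f i) := fun i => (j i).map_gr (hb i)
        have e : (fun i => θ i ((t * fun i => (j i).toRingHom (b i)) i)) =
            (fun i => θ i (t i)) * fun i => (j' i).toRingHom (b i) := by
          funext i
          by_cases hi : i = m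
          · subst hi
            exact hm.right _ _
          · exact (h i hi).right _ _
        rw [piHom_ptm, piHom_ptm, ptm_mul ht hj, NCWeil.map_units_smul,
          piMapAt_ptm m θ (mul_mem_gr' ht hj), e,
          piMapAt_ptm m θ ht, smul_mul_assoc,
          ptm_mul (apply_mem_sub_single hgm hg ht) (fun i => (j' i).map_gr (hb i)),
          mulSign_sub_single_left]
        simp only [smul_smul]
        congr 1
        rw [dSign_add]
        ac_rfl

/-- By multilinearity the factors may be replaced by elements of the generating sets one at a time.
-/
theorem ptm_mem_of_span {M : Submodule K (piTensor B).carrier} {G : ∀ i, Set (B i).carrier}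
    (hG : ∀ x : ∀ i, (B i).carrier, (∀ i, x i ∈ G i) → ptm x ∈ M) {x : ∀ i, (B i).carrier}
    (hx : ∀ i, x i ∈ Submodule.span K (G i)) : ptm x ∈ M := by
  have key : ∀ s : Finset ι, ∀ x : ∀ i, (B i).carrier, (∀ i ∈ s, x i ∈ Submodule.span K (G i)) →
      (∀ i ∉ s, x i ∈ G i) → ptm x ∈ M := by
    intro s
    induction s using Finset.induction_on with
    | empty => exact fun x _ hx => hG x fun i => hx i (Finset.notMem_empty i)
    | insert m s hm ih =>
      intro x hx hx'
      rw [← Function.update_eq_self m x]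
      refine Submodule.span_induction (p := fun y _ => ptm (Function.update x m y) ∈ M)
        (fun y hy => ih _ (fun i hi => ?_) fun i hi => ?_) ?_ (fun y z _ _ hy hz => ?_)
        (fun c y _ hy => ?_) (hx m (Finset.mem_insert_self m s))
      · rw [Function.update_of_ne (ne_of_mem_of_not_mem hi hm)]
        exact hx i (Finset.mem_insert_of_mem hi)
      · by_cases e : i = m
        · subst e
          rwa [Function.update_self]
        · rw [Function.update_of_ne e]
          exact hx' i fun h => (Finset.mem_insert.mp h).elim e hi
      · rw [ptm_update_zero]; exact zero_mem _
      · rw [ptm_update_add]; exact add_mem hy hz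
      · rw [ptm_update_smul]; exact Submodule.smul_mem _ _ hy
  exact key Finset.univ x (fun i _ => hx i) fun i hi => absurd (Finset.mem_univ i) hi

/-- Interchanging factors costs a Koszul sign. Its value does not matter for spans or, after
rescaling, for bases, so it is left unspecified. -/
theorem exists_mul_ptm_mul {f g e : ι → ℤ} {a b : ∀ i, (B i).carrier} {t : ∀ i, (T i).carrier}
    (ha : ∀ i, a i ∈ (B i).gr (f i)) (ht : ∀ i, t i ∈ (T i).gr (e i))
    (hb : ∀ i, b i ∈ (B i).gr (g i)) : ∃ c : ℤˣ,
      ptm (fun i => (j i).toRingHom (a i) * t i * (j i).toRingHom (b i)) =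
        c • ((piHom j).toRingHom (ptm a) * ptm t * (piHom j).toRingHom (ptm b)) := by
  have ha' : ∀ i, (j i).toRingHom (a i) ∈ (T i).gr (f i) := fun i => (j i).map_gr (ha i)
  have hb' : ∀ i, (j i).toRingHom (b i) ∈ (T i).gr (g i) := fun i => (j i).map_gr (hb i)
  refine ⟨mulSign (f + e) g * mulSign f e, ?_⟩
  rw [piHom_ptm, piHom_ptm, ptm_mul ha' ht, smul_mul_assoc,
    ptm_mul (mul_mem_gr' ha' ht) hb', mul_smul, smul_smul (mulSign f e) (mulSign f e),
    Int.units_mul_self, one_smul, smul_smul, Int.units_mul_self, one_smul]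
  rfl

theorem ptm_mem_jspan {S : ι → Type u} {e : ∀ i, S i → (T i).carrier} {deg : ∀ i, S i → ℤ}
    (he : ∀ i s, e i s ∈ (T i).gr (deg i s)) {X : ∀ i, Set (S i)} {x : ∀ i, (T i).carrier}
    (hx : ∀ i, x i ∈ jspan (j i) (e i) (X i)) :
    ptm x ∈ jspan (piHom j) (fun s : ∀ i, S i => ptm fun i => e i (s i)) {s | ∀ i, s i ∈ X i} := by
  refine ptm_mem_of_span (fun x hx => ?_) hx
  choose s hs m n a b ha hb hx using hx
  obtain rfl : x = _ := funext hx
  obtain ⟨c, hc⟩ := exists_mul_ptm_mul (j := j) ha (fun i => he i (s i)) hb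
  rw [hc]
  exact units_smul_mem _ (Submodule.subset_span
    ⟨s, hs, _, _, ptm a, ptm b, ptm_mem ha, ptm_mem hb, rfl⟩)

end PiMap

end NCWeil

namespace NCWeil

/-! ### Tensor products of resolutions -/

section PiRes

open KTensor DGAlgebra

variable {K : Type u} [Field K] {ι : Type u} [Fintype ι] [LinearOrder ι] {B : ι → DGAlgebra K}

theorem exists_basis_piTensor {κ : ι → Type*} (b : ∀ i, Module.Basis (κ i) K (B i).carrier) :
    ∃ b' : Module.Basis (∀ i, κ i) K (piTensor B).carrier,
      ∀ x, b' x = ptm fun i => b i (x i) :=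
  ⟨Basis.piTensorProduct b, fun x => Basis.piTensorProduct_apply b x⟩

/-- The tensor products of the projections to the images and of their inclusions split `piMap π`, so
its image is the tensor product of the images. -/
theorem exists_basis_range_piMap {π : ∀ i, (B i).carrier →ₗ[K] (B i).carrier}
    (hπ : ∀ i t, π i (π i t) = π i t) {κ : ι → Type*}
    (b : ∀ i, Module.Basis (κ i) K (LinearMap.range (π i))) :
    ∃ b' : Module.Basis (∀ i, κ i) K (LinearMap.range (piMap π)),
      ∀ x, (b' x).1 = ptm fun i => (b i (x i)).1 := by
  let i : (PiTensorProduct K fun i => LinearMap.range (π i)) →ₗ[K] (piTensor B).carrier :=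
    PiTensorProduct.map fun i => (LinearMap.range (π i)).subtype
  let p : (piTensor B).carrier →ₗ[K] PiTensorProduct K fun i => LinearMap.range (π i) :=
    PiTensorProduct.map fun i => (π i).rangeRestrict
  have hip : ∀ v, i (p v) = piMap π v := fun v =>
    LinearMap.congr_fun (PiTensorProduct.map_comp (R := K)
      (fun i => (LinearMap.range (π i)).subtype) (fun i => (π i).rangeRestrict)).symm v
  have hpi : ∀ w, p (i w) = w := fun w => by
    have h1 : ∀ i, (π i).rangeRestrict ∘ₗ (LinearMap.range (π i)).subtype = LinearMap.id := by
      refine fun i => LinearMap.ext ?_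
      rintro ⟨_, t, rfl⟩
      exact Subtype.ext (hπ i t)
    have h2 := LinearMap.congr_fun (PiTensorProduct.map_comp (R := K)
      (fun i => (π i).rangeRestrict) (fun i => (LinearMap.range (π i)).subtype)) w
    simp only [h1, PiTensorProduct.map_id] at h2
    exact h2.symm
  obtain ⟨b', hb'⟩ := exists_basis_range (W := ⨂[K] i, LinearMap.range (π i)) hip hpi
    (Basis.piTensorProduct b)
  refine ⟨b', fun x => (hb' x).trans ?_⟩
  refine (congrArg i (Basis.piTensorProduct_apply b x)).trans ?_
  exact PiTensorProduct.map_tprod _ _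

/-- This absorbs the Koszul signs into a basis of pure tensors. -/
theorem exists_basis_units_smul {M κ : Type*} [AddCommGroup M] [Module K M]
    (b : Module.Basis κ K M) (c : κ → ℤˣ) : ∃ b' : Module.Basis κ K M, ∀ x, b' x = c x • b x :=
  ⟨b.unitsSMul fun x => Units.map (Int.castRingHom K).toMonoidHom (c x), fun x => by
    rw [Module.Basis.unitsSMul_apply, Units.smul_def, Units.smul_def]
    exact Int.cast_smul_eq_zsmul K _ _⟩

/-- The tensor product of resolutions. -/
theorem Res.nonempty_piTensor (R : ∀ i, Res (B i)) : Nonempty (Res (piTensor B)) := by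
  -- Maps into the images of the individual projections tensor to a map into the image of the tensor
  -- product of the projections, so every stability condition in `Res` passes to the tensor product.
  have absorb : ∀ {C : ι → DGAlgebra K} {φ : ∀ i, (C i).carrier →ₗ[K] (R i).T.carrier},
      (∀ i t, (R i).π (φ i t) = φ i t) → ∀ t, piMap (fun i => (R i).π) (piMap φ t) = piMap φ t := by
    intro C φ h t
    have e : (fun i => (R i).π ∘ₗ φ i) = φ := funext fun i => LinearMap.ext (h i)
    have := LinearMap.congr_fun (piMap_comp (fun i => (R i).π) φ) t
    rw [e] at this
    exact this.symm
  have absorbAt : ∀ {C : ι → DGAlgebra K} (m : ι)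
      {φ : ∀ i, (C i).carrier →ₗ[K] (R i).T.carrier}, (∀ i t, (R i).π (φ i t) = φ i t) →
      ∀ t, piMap (fun i => (R i).π) (piMapAt m φ t) = piMapAt m φ t :=
    fun m φ h t => absorb h _
  obtain ⟨hB, hB_htpy, -⟩ := exists_isHtpy_piMap (h := fun i => (R i).hB)
    (φ := fun i => (R i).ε ∘ₗ (R i).g) (ψ := fun i => LinearMap.id)
    (fun i => ⟨fun n x hx => (R i).ε_chain.gr n _ ((R i).g_chain.gr n x hx), fun x => by
      rw [LinearMap.comp_apply, (R i).g_chain.d, (R i).ε_chain.d]; rfl⟩)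
    (fun i => ⟨fun n x hx => hx, fun x => rfl⟩) (fun i => (R i).hB_htpy) (fun _ => True) trivial
    (fun _ _ _ _ => trivial) fun _ _ _ _ => trivial
  rw [piMap_comp, piMap_id] at hB_htpy
  obtain ⟨hT, hT_htpy, hT_π⟩ := exists_isHtpy_piMap (h := fun i => (R i).hT)
    (φ := fun i => (R i).g ∘ₗ (R i).ε) (ψ := fun i => (R i).π)
    (fun i => ⟨fun n x hx => (R i).g_chain.gr n _ ((R i).ε_chain.gr n x hx), fun x => by
      rw [LinearMap.comp_apply, (R i).ε_chain.d, (R i).g_chain.d]; rfl⟩)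
    (fun i => (R i).π_chain) (fun i => (R i).hT_htpy)
    (fun w => ∀ t, piMap (fun i => (R i).π) (w t) = w t) (fun _ => map_zero _)
    (fun a b ha hb t => by rw [LinearMap.add_apply, map_add, ha, hb])
    (fun m θ hm hθ => absorbAt m fun i t => by
      by_cases e : i = m
      · subst e; rw [hm, (R i).π_hT]
      · rcases hθ i e with e | e <;> rw [e]
        exacts [(R i).π_g _, (R i).π_π _])
  rw [piMap_comp] at hT_htpy
  obtain ⟨hu, hu_htpy, hu_bilin, hu_π⟩ := exists_isHtpy_piMap (h := fun i => (R i).hu)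
    (φ := fun i => (R i).u) (ψ := fun i => (R i).π)
    (fun i => (R i).u_chain) (fun i => (R i).π_chain) (fun i => (R i).hu_htpy)
    (fun w => IsBilin (-1) (piHom fun i => (R i).j) (piHom fun i => (R i).j) w ∧
      ∀ t, piMap (fun i => (R i).π) (w t) = w t)
    ⟨⟨fun _ _ _ _ => by simp, fun _ _ => by simp⟩, fun _ => map_zero _⟩
    (fun a b ha hb => ⟨⟨fun m x hx t => by
        simp only [LinearMap.add_apply, ha.1.left m x hx, hb.1.left m x hx, mul_add, smul_add],
      fun x t => by simp only [LinearMap.add_apply, ha.1.right, hb.1.right, add_mul]⟩,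
      fun t => by rw [LinearMap.add_apply, map_add, ha.2, hb.2]⟩)
    (fun m θ hm hθ => ⟨IsBilin.piMapAt (by rw [hm]; exact (R m).hu_htpy.gr)
        (fun i hi => by
          rcases hθ i hi with e | e <;> rw [e]
          exacts [(R i).u_chain.gr, (R i).π_chain.gr])
        (by rw [hm]; exact (R m).hu_bilin)
        (fun i hi => by
          rcases hθ i hi with e | e <;> rw [e]
          exacts [(R i).u_bilin, (R i).π_bilin]),
      absorbAt m fun i t => by
        by_cases e : i = m
        · subst e; rw [hm, (R i).π_hu]
        · rcases hθ i e with e | e <;> rw [e]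
          exacts [(R i).π_u _, (R i).π_π _]⟩)
  obtain ⟨b, hb⟩ := exists_basis_piTensor fun i => (R i).b
  obtain ⟨bas₀, hbas₀⟩ := exists_basis_range_piMap (fun i => (R i).π_π) fun i => (R i).bas
  -- A tensor product of basis elements a e b is of the required form only up to a Koszul sign.
  choose c hc using fun x : ∀ i, (R i).κ × (R i).S × (R i).κ =>
    exists_mul_ptm_mul (j := fun i => (R i).j) (fun i => (R i).b_mem (x i).1)
      (fun i => (R i).e_mem (x i).2.1) fun i => (R i).b_mem (x i).2.2
  obtain ⟨bas₁, hbas₁⟩ := exists_basis_units_smul bas₀ c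
  let eq : (∀ i, (R i).κ × (R i).S × (R i).κ) ≃
      (∀ i, (R i).κ) × (∀ i, (R i).S) × (∀ i, (R i).κ) :=
    { toFun := fun x => (fun i => (x i).1, fun i => (x i).2.1, fun i => (x i).2.2)
      invFun := fun y i => (y.1 i, y.2.1 i, y.2.2 i)
      left_inv := fun _ => rfl
      right_inv := fun _ => rfl }
  have hε := IsBilin.piMap (fun i => (R i).ε_chain.gr) fun i => (R i).ε_bilin
  rw [piHom_id] at hε
  exact ⟨
    { T := piTensor fun i => (R i).T
      j := piHom fun i => (R i).j
      π := piMap fun i => (R i).π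
      π_chain := IsChain.piMap fun i => (R i).π_chain
      π_bilin := IsBilin.piMap (fun i => (R i).π_chain.gr) fun i => (R i).π_bilin
      π_π := absorb fun i => (R i).π_π
      ε := piMap fun i => (R i).ε
      ε_chain := IsChain.piMap fun i => (R i).ε_chain
      ε_bilin := hε
      g := piMap fun i => (R i).g
      g_chain := IsChain.piMap fun i => (R i).g_chain
      π_g := absorb fun i => (R i).π_g
      hB := hB
      hB_htpy := hB_htpy
      hT := hT
      hT_htpy := hT_htpy
      π_hT := hT_π
      u := piMap fun i => (R i).u
      u_chain := IsChain.piMap fun i => (R i).u_chain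
      u_bilin := IsBilin.piMap (fun i => (R i).u_chain.gr) fun i => (R i).u_bilin
      π_u := absorb fun i => (R i).π_u
      hu := hu
      hu_htpy := hu_htpy
      hu_bilin := hu_bilin
      π_hu := hu_π
      S := ∀ i, (R i).S
      deg := fun s => ∑ i, (R i).deg (s i)
      filt := fun s => ∑ i, (R i).filt (s i)
      e := fun s => ptm fun i => (R i).e (s i)
      e_mem := fun s => ptm_mem fun i => (R i).e_mem (s i)
      d_e := fun s => by
        rw [d_ptm fun i => (R i).e_mem (s i)]
        -- Differentiating the m-th factor lowers its filtration and leaves the generators of the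
        -- other factors fixed, so the sum of the filtrations strictly decreases.
        refine sum_mem fun m _ => units_smul_mem _ ?_
        have := ptm_mem_jspan (j := fun i => (R i).j) (fun i => (R i).e_mem)
          (X := Function.update (fun i => {s i}) m {t | (R m).filt t < (R m).filt (s m)})
          (x := Function.update (fun i => (R i).e (s i)) m ((R m).T.d ((R m).e (s m))))
          fun i => by
            by_cases h : i = m
            · subst h
              rw [Function.update_self, Function.update_self]
              exact (R i).d_e _
            · rw [Function.update_of_ne h, Function.update_of_ne h]
              exact Submodule.subset_span ⟨s i, rfl, 0, 0, 1, 1, (B i).one_mem, (B i).one_mem,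
                by rw [map_one, one_mul, mul_one]⟩
        refine Submodule.span_mono ?_ this
        rintro _ ⟨t, ht, h⟩
        refine ⟨t, ?_, h⟩
        have hm : (R m).filt (t m) < (R m).filt (s m) := by
          have := ht m
          rwa [Function.update_self] at this
        change ∑ i, (R i).filt (t i) < ∑ i, (R i).filt (s i)
        refine Finset.sum_lt_sum (fun i _ => ?_) ⟨m, Finset.mem_univ m, hm⟩
        by_cases h : i = m
        · subst h; exact hm.le
        · have := ht i
          rw [Function.update_of_ne h] at this
          rw [Set.mem_singleton_iff.mp this]
      X := Fintype.piFinset fun i => (R i).X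
      u_mem := fun t => by
        induction t using ptm_induction with
        | ha x y hx hy => rw [map_add]; exact add_mem hx hy
        | hs c x hx => rw [map_smul]; exact Submodule.smul_mem _ _ hx
        | hp f x hx =>
          rw [piMap_ptm]
          have := ptm_mem_jspan (j := fun i => (R i).j) (fun i => (R i).e_mem)
            (X := fun i => ((R i).X : Set (R i).S)) fun i => (R i).u_mem (x i)
          refine Submodule.span_mono ?_ this
          rintro _ ⟨t, ht, h⟩
          exact ⟨t, by rw [Finset.mem_coe, Fintype.mem_piFinset]; exact ht, h⟩
      κ := ∀ i, (R i).κ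
      b := b
      bdeg := fun x => ∑ i, (R i).bdeg (x i)
      b_mem := fun x => by
        rw [hb]
        exact ptm_mem fun i => (R i).b_mem (x i)
      bas := bas₁.reindex eq
      bas_apply := fun x => by
        rw [Module.Basis.reindex_apply, hbas₁, hb, hb]
        have h1 := hc (eq.symm x)
        simp only [← (R _).bas_apply] at h1
        rw [← hbas₀] at h1
        have h2 : ∀ (c : ℤˣ) (v : LinearMap.range (piMap fun i => (R i).π)),
            (c • v).1 = c • v.1 := fun _ _ => rfl
        rw [h2, h1, smul_smul, Int.units_mul_self, one_smul]
        rfl }⟩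

end PiRes

end NCWeil

namespace NCWeil

/-! ### A dg algebra as a bimodule over another one -/

section AlgBimod

variable {K : Type u} [Field K] {A B T T' : DGAlgebra K}

/-- The composition of morphisms of dg algebras. -/
def DGAlgebra.Hom.comp (j : DGAlgebra.Hom B T) (i : DGAlgebra.Hom A B) : DGAlgebra.Hom A T where
  toRingHom := j.toRingHom.comp i.toRingHom
  map_smul c a := (congrArg j.toRingHom (i.map_smul c a)).trans (j.map_smul c _)
  map_gr h := j.map_gr (i.map_gr h)
  map_d a := (congrArg j.toRingHom (i.map_d a)).trans (j.map_d _)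

theorem IsBilin.comp_hom {n : ℤ} {j : DGAlgebra.Hom B T} {j' : DGAlgebra.Hom B T'}
    {φ : T.carrier →ₗ[K] T'.carrier} (h : IsBilin n j j' φ) (i : DGAlgebra.Hom A B) :
    IsBilin n (j.comp i) (j'.comp i) φ where
  left m _ hb t := h.left m _ (i.map_gr hb) t
  right _ t := h.right _ t

/-- A dg algebra `T` as a bimodule over a dg algebra which maps to it. -/
def algBimod (j : DGAlgebra.Hom B T) : DGBimod B :=
  letI : Module B.carrier T.carrier := Module.compHom T.carrier j.toRingHom
  letI : Module B.carrierᵐᵒᵖ T.carrier := Module.compHom T.carrier j.toRingHom.op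
  { carrier := T.carrier
    comm := ⟨fun a b t => (mul_assoc (j.toRingHom a) t (j.toRingHom b.unop)).symm⟩
    towerLeft := ⟨fun c a t => by
      change j.toRingHom (c • a) * t = c • (j.toRingHom a * t)
      rw [j.map_smul, RingHom.id_apply, smul_mul_assoc]⟩
    towerRight := ⟨fun c a t => by
      change t * j.toRingHom (c • a.unop) = c • (t * j.toRingHom a.unop)
      rw [j.map_smul, RingHom.id_apply, mul_smul_comm]⟩
    gr := T.gr
    isInternal := T.isInternal
    smul_mem := fun ha hm => T.mul_mem (j.map_gr ha) hm
    op_smul_mem := fun hm ha => T.mul_mem hm (j.map_gr ha)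
    d := T.d
    d_mem := T.d_mem
    d_d := T.d_d
    leibniz_left := fun {i a} m ha => by
      change T.d (j.toRingHom a * m) = j.toRingHom (B.d a) * m +
        i.negOnePow • (j.toRingHom a * T.d m)
      rw [T.leibniz m (j.map_gr ha), j.map_d]
    leibniz_right := fun {i m} a hm => by
      change T.d (m * j.toRingHom a) = T.d m * j.toRingHom a +
        i.negOnePow • (m * j.toRingHom (B.d a))
      rw [T.leibniz _ hm, j.map_d] }

/-- `IsBilin` records signs only for homogeneous elements and says nothing about degrees. Additivity
extends the sign rule to all elements, and the degree condition is supplied separately. -/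
theorem IsBilin.isKHom {n : ℤ} {j : DGAlgebra.Hom B T} {j' : DGAlgebra.Hom B T'}
    {φ : T.carrier →ₗ[K] T'.carrier} (h : IsBilin n j j' φ)
    (hgr : ∀ i, ∀ x ∈ T.gr i, φ x ∈ T'.gr (i + n)) :
    DGBimod.IsKHom (M := algBimod j) (N := algBimod j') n φ where
  map_smul a (t : T.carrier) := by
    change φ (j.toRingHom a * t) = j'.toRingHom (B.sgn n a) * φ t
    induction a using graded_induction B.isInternal with
    | h0 => simp
    | ha x y hx hy => simp only [map_add, add_mul, hx, hy]
    | hm i a ha =>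
      rw [h.left i a ha, DGAlgebra.sgn_of_mem n ha, Units.smul_def, Units.smul_def, map_zsmul,
        smul_mul_assoc]
  map_op_smul a t := h.right a t
  map_gr := hgr

theorem IsChain.gr_add_zero {φ : T.carrier →ₗ[K] T'.carrier} (h : IsChain φ) (i : ℤ)
    (x : T.carrier) (hx : x ∈ T.gr i) : φ x ∈ T'.gr (i + 0) := by
  rw [add_zero]; exact h.gr i x hx

end AlgBimod

/-! ### Images of idempotent endomorphisms -/

namespace DGBimod

variable {k : Type u} [Field k] {A : DGAlgebra k} {M : DGBimod A}

/-- The image of an idempotent endomorphism of a dg bimodule. -/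
noncomputable def image (p : M ⟶ M) (hp : ∀ m, p.toLinearMap (p.toLinearMap m) = p.toLinearMap m) :
    DGBimod A :=
  let V := LinearMap.range p.toLinearMap
  have hV : ∀ v ∈ V, p.toLinearMap v = v := by
    rintro _ ⟨m, rfl⟩
    exact hp m
  have hl : ∀ (a : A.carrier), ∀ v ∈ V, a • v ∈ V := by
    rintro a _ ⟨m, rfl⟩
    exact ⟨a • m, p.map_smul a m⟩
  have hr : ∀ (a : A.carrierᵐᵒᵖ), ∀ v ∈ V, a • v ∈ V := by
    rintro a _ ⟨m, rfl⟩
    exact ⟨a • m, p.map_op_smul a.unop m⟩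
  have hd : ∀ v ∈ V, M.d v ∈ V := by
    rintro _ ⟨m, rfl⟩
    exact ⟨M.d m, p.map_d m⟩
  have hgr : ∀ v ∈ V, ∀ n, gproj M.isInternal n v ∈ V := by
    rintro _ ⟨m, rfl⟩ n
    refine ⟨gproj M.isInternal n m, ?_⟩
    have := gproj_comm M.isInternal M.isInternal (f := p.toLinearMap) (n := 0)
      (fun i x hx => by rw [add_zero]; exact p.map_gr i x hx) n m
    rwa [add_zero] at this
  letI : Module A.carrier V :=
      { smul := fun a v => ⟨a • v.1, hl a v.1 v.2⟩
        one_smul := fun v => Subtype.ext (one_smul _ v.1)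
        mul_smul := fun a b v => Subtype.ext (mul_smul a b v.1)
        smul_zero := fun a => Subtype.ext (smul_zero a)
        smul_add := fun a v w => Subtype.ext (smul_add a v.1 w.1)
        add_smul := fun a b v => Subtype.ext (add_smul a b v.1)
        zero_smul := fun v => Subtype.ext (zero_smul _ v.1) }
  letI : Module A.carrierᵐᵒᵖ V :=
      { smul := fun a v => ⟨a • v.1, hr a v.1 v.2⟩
        one_smul := fun v => Subtype.ext (one_smul _ v.1)
        mul_smul := fun a b v => Subtype.ext (mul_smul a b v.1)
        smul_zero := fun a => Subtype.ext (smul_zero a)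
        smul_add := fun a v w => Subtype.ext (smul_add a v.1 w.1)
        add_smul := fun a b v => Subtype.ext (add_smul a b v.1)
        zero_smul := fun v => Subtype.ext (zero_smul _ v.1) }
  { carrier := V
    comm := ⟨fun a b v => Subtype.ext (smul_comm a b v.1)⟩
    towerLeft := ⟨fun c a v => Subtype.ext (smul_assoc c a v.1)⟩
    towerRight := ⟨fun c a v => Subtype.ext (smul_assoc c a v.1)⟩
    gr := fun n => (M.gr n).comap V.subtype
    isInternal := by
      refine isInternal_of_proj _ (fun n => (gproj M.isInternal n ∘ₗ V.subtype).codRestrict V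
        fun v => hgr v.1 v.2 n) ?_ ?_ ?_
      · intro n x hx
        exact Subtype.ext (gproj_of_mem M.isInternal hx)
      · intro n m hm x hx
        exact Subtype.ext (gproj_of_mem_ne M.isInternal hx hm)
      · rw [eq_top_iff]
        rintro x -
        obtain ⟨s, hs⟩ := mem_iSup_gproj M.isInternal x.1
        have : x = ∑ n ∈ s, (⟨gproj M.isInternal n x.1, hgr _ x.2 n⟩ : V) := by
          apply Subtype.ext
          rw [AddSubmonoidClass.coe_finsetSum]
          exact hs
        rw [this]
        refine sum_mem fun n _ => Submodule.mem_iSup_of_mem n ?_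
        exact gproj_mem M.isInternal n x.1
    smul_mem := fun ha hm => M.smul_mem ha hm
    op_smul_mem := fun hm ha => M.op_smul_mem hm ha
    d := (M.d ∘ₗ V.subtype).codRestrict V fun v => hd v.1 v.2
    d_mem := fun hm => M.d_mem hm
    d_d := fun m => Subtype.ext (M.d_d m.1)
    leibniz_left := fun {i a} m ha => Subtype.ext (by
      have := M.leibniz_left m.1 ha
      rw [Units.smul_def] at this ⊢
      exact this)
    leibniz_right := fun {i m} a hm => Subtype.ext (by
      have := M.leibniz_right (m := m.1) a hm
      rw [Units.smul_def] at this ⊢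
      exact this) }

variable (p : M ⟶ M) (hp : ∀ m, p.toLinearMap (p.toLinearMap m) = p.toLinearMap m)

/-- The inclusion of the image. -/
noncomputable def imageι : image p hp ⟶ M where
  toLinearMap := (LinearMap.range p.toLinearMap).subtype
  map_smul _ _ := rfl
  map_op_smul _ _ := rfl
  map_gr _ _ h := h
  map_d _ := rfl

/-- The projection to the image. -/
noncomputable def imageπ : M ⟶ image p hp where
  toLinearMap := p.toLinearMap.rangeRestrict
  map_smul a m := Subtype.ext (p.map_smul a m)
  map_op_smul a m := Subtype.ext (p.map_op_smul a m)
  map_gr n m h := p.map_gr n m h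
  map_d m := Subtype.ext (p.map_d m)

theorem imageπ_imageι (v : (image p hp).carrier) :
    (imageπ p hp).toLinearMap ((imageι p hp).toLinearMap v) = v := by
  obtain ⟨_, m, rfl⟩ := v
  exact Subtype.ext (hp m)

theorem imageι_injective : Function.Injective (imageι p hp).toLinearMap := Subtype.val_injective

end DGBimod

/-! ### Change of basis in a resolution -/

section Bases

variable {k L : Type u} [Field k] [Field L] [Algebra k L]

theorem exists_basis_smulTower {M I κ : Type*} [AddCommGroup M] [Module k M] [Module L M]
    (h : ∀ (c : k) (m : M), c • m = algebraMap k L c • m) (x : Module.Basis I k L)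
    (b : Module.Basis κ L M) :
    ∃ b' : Module.Basis (I × κ) k M, ∀ y, b' y = x y.1 • b y.2 := by
  have : IsScalarTower k L M := ⟨fun c a m => by rw [h, smul_smul, Algebra.smul_def]⟩
  exact ⟨x.smulTower b, fun y => Module.Basis.smulTower_apply x b y⟩

theorem bijective_of_basis {V V' κ : Type*} [AddCommGroup V] [Module k V] [AddCommGroup V']
    [Module k V'] (b : Module.Basis κ k V) (b' : Module.Basis κ k V') (φ : V →ₗ[k] V')
    (h : ∀ i, φ (b i) = b' i) : Function.Bijective φ := by
  have : φ = (b.equiv b' (Equiv.refl κ)).toLinearMap := b.ext fun i => by simp [h]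
  rw [this]
  exact (b.equiv b' (Equiv.refl κ)).bijective

/-- The basis condition in the definition of a resolution does not depend on the basis. -/
theorem Res.exists_basis {B : DGAlgebra L} (R : Res B) {κ : Type u}
    (b : Module.Basis κ L B.carrier) :
    ∃ bas : Module.Basis (κ × R.S × κ) L (LinearMap.range R.π),
      ∀ x, (bas x).1 = R.j.toRingHom (b x.1) * R.e x.2.1 * R.j.toRingHom (b x.2.2) := by
  let eqv : ∀ κ : Type u, κ × R.S × κ ≃ Σ _ : R.S, κ × κ := fun κ =>
    { toFun := fun x => ⟨x.2.1, x.1, x.2.2⟩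
      invFun := fun y => (y.2.1, y.1, y.2.2)
      left_inv := fun _ => rfl
      right_inv := fun _ => rfl }
  let bb : ∀ {κ : Type u}, Module.Basis κ L B.carrier →
      Module.Basis (κ × R.S × κ) L (R.S →₀ B.carrier ⊗[L] B.carrier) := fun {κ} b =>
    (Finsupp.basis fun _ : R.S => b.tensorProduct b).reindex (eqv κ).symm
  have hbb : ∀ {κ : Type u} (b : Module.Basis κ L B.carrier) x,
      bb b x = Finsupp.single x.2.1 (b x.1 ⊗ₜ b x.2.2) := by
    intro κ b x
    rw [Module.Basis.reindex_apply, Finsupp.coe_basis]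
    exact congrArg _ (b.tensorProduct_apply b _ _)
  -- The basis-free content of the condition is that Θ, sending a ⊗ b in the summand s to a eₛ b, is
  -- an isomorphism from the direct sum of copies of B ⊗ B to the image of `π`. Any basis of B can
  -- then be transported.
  let Θ := (bb R.b).equiv R.bas (Equiv.refl _)
  let m (s : R.S) : B.carrier →ₗ[L] B.carrier →ₗ[L] R.T.carrier :=
    LinearMap.mk₂ L (fun a b => R.j.toRingHom a * R.e s * R.j.toRingHom b)
      (fun a a' b => by simp only [map_add, add_mul])
      (fun c a b => by simp only [DGAlgebra.Hom.ringHom_smul, smul_mul_assoc])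
      (fun a b b' => by simp only [map_add, mul_add])
      (fun c a b => by simp only [DGAlgebra.Hom.ringHom_smul, mul_smul_comm])
  have hΘ : ∀ s a b, (Θ (Finsupp.single s (a ⊗ₜ b))).1 =
      R.j.toRingHom a * R.e s * R.j.toRingHom b := by
    intro s a b
    have : TensorProduct.lift (m s) = (LinearMap.range R.π).subtype ∘ₗ Θ.toLinearMap ∘ₗ
        Finsupp.lsingle s := by
      refine (R.b.tensorProduct R.b).ext fun i => ?_
      obtain ⟨i, i'⟩ := i
      rw [Module.Basis.tensorProduct_apply, TensorProduct.lift.tmul]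
      have h2 : Θ (bb R.b (i, s, i')) = R.bas (i, s, i') := Module.Basis.equiv_apply ..
      rw [hbb] at h2
      change _ = (Θ (Finsupp.single s (R.b i ⊗ₜ R.b i'))).1
      rw [h2, R.bas_apply]
      rfl
    exact (LinearMap.congr_fun this (a ⊗ₜ b)).symm
  refine ⟨(bb b).map Θ, fun x => ?_⟩
  rw [Module.Basis.map_apply, hbb, hΘ]

end Bases

end NCWeil

namespace NCWeil

/-! ### Compactness over a form of the algebra -/

section Compactness

open DGBimod

variable {k L : Type u} [Field k] [Field L] [Algebra k L] [FiniteDimensional k L]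

/-- If a basis of `B₀` over `k` is a basis of `B` over `L`, then a resolution of `B` with a
compactness datum shows that `B` is a compact bimodule over `B₀`. -/
theorem Res.isCompactObject_algBimod {B : DGAlgebra L} (R : Res B) {B₀ : DGAlgebra k}
    (i : DGAlgebra.Hom B₀ (B.restrictScalars (algebraMap k L))) {κ : Type u}
    (r : Module.Basis κ k B₀.carrier) (r' : Module.Basis κ L B.carrier)
    (hr : ∀ a, r' a = i.toRingHom (r a)) :
    IsCompactObject.{u} ((quasiIso B₀).Q.obj (algBimod i)) := by
  let F := algebraMap k L
  let j := (rsHom F R.j).comp i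
  let J : B₀.carrier → R.T.carrier := fun a => R.j.toRingHom (i.toRingHom a)
  have hπ := R.π_bilin.restrictScalars F |>.comp_hom i |>.isKHom
    (R.π_chain.restrictScalars F).gr_add_zero
  let p : algBimod j ⟶ algBimod j := hπ.toHom (R.π_chain.restrictScalars F).d
  have hp : ∀ m, p.toLinearMap (p.toLinearMap m) = p.toLinearMap m := R.π_π
  let N := image p hp
  let q : R.T.carrier → N.carrier := (imageπ p hp).toLinearMap
  let v : N.carrier → R.T.carrier := (imageι p hp).toLinearMap
  have hv : Function.Injective v := imageι_injective p hp
  have hvq : ∀ t, v (q t) = R.π t := fun t => rfl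
  have hqv : ∀ t, q (v t) = t := imageπ_imageι p hp
  have hπv : ∀ t, R.π (v t) = v t := fun t => by rw [← hvq, hqv]
  have q_add : ∀ s t, q (s + t) = q s + q t := (imageπ p hp).toLinearMap.map_add
  have q_zero : q 0 = 0 := (imageπ p hp).toLinearMap.map_zero
  have q_smul : ∀ (c : k) t, q (F c • t) = c • q t := (imageπ p hp).toLinearMap.map_smul
  let I := Module.Basis.ofVectorSpaceIndex k L
  let x : Module.Basis I k L := Module.Basis.ofVectorSpace k L
  -- Scalars in `L` do not come from `B₀` and have to be expanded over `k`. Hence there is one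
  -- generator for each pair of a basis element of L/k and an old generator.
  let gen : I × R.S → N.carrier := fun y => q (x y.1 • R.e y.2)
  have hJ : ∀ (a b : B₀.carrier) (c : L) s,
      a • MulOpposite.op b • q (c • R.e s) = q (c • (J a * R.e s * J b)) := by
    intro a b c s
    have h1 := (imageπ p hp).map_op_smul b (c • R.e s : R.T.carrier)
    have h2 := (imageπ p hp).map_smul a ((c • R.e s) * J b : R.T.carrier)
    refine (congrArg (a • ·) h1.symm).trans (h2.symm.trans (congrArg q ?_))
    change J a * ((c • R.e s) * J b) = _
    rw [smul_mul_assoc, mul_smul_comm, mul_assoc]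
  -- The outer factors are expanded in the basis `r'`, whose members come from `B₀`. The
  -- coefficients in `L` are central and are collected in `c`, which is finally expanded over `k`.
  have hspan : ∀ (X : Set R.S) t, t ∈ jspan R.j R.e X → ∀ c : L,
      q (c • t) ∈ bispan gen {y | y.2 ∈ X} := by
    intro X t ht
    have key : ∀ s ∈ X, ∀ (b a : B.carrier) (c : L),
        q (c • (R.j.toRingHom a * R.e s * R.j.toRingHom b)) ∈ bispan gen {y | y.2 ∈ X} := by
      intro s hs b
      induction r'.mem_span b using Submodule.span_induction with
      | zero => intro a c; rw [map_zero, mul_zero, smul_zero, q_zero]; exact zero_mem _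
      | add b b' _ _ h h' =>
        intro a c
        rw [map_add, mul_add, smul_add, q_add]
        exact add_mem (h a c) (h' a c)
      | smul c' b _ h =>
        intro a c
        rw [DGAlgebra.Hom.ringHom_smul, mul_smul_comm, smul_smul]
        exact h a _
      | mem b hb =>
        obtain ⟨β, rfl⟩ := hb
        intro a
        induction r'.mem_span a using Submodule.span_induction with
        | zero => intro c; rw [map_zero, zero_mul, zero_mul, smul_zero, q_zero]; exact zero_mem _
        | add a a' _ _ h h' =>
          intro c
          rw [map_add, add_mul, add_mul, smul_add, q_add]
          exact add_mem (h c) (h' c)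
        | smul c' a _ h =>
          intro c
          rw [DGAlgebra.Hom.ringHom_smul, smul_mul_assoc, smul_mul_assoc, smul_smul]
          exact h _
        | mem a ha =>
          obtain ⟨α, rfl⟩ := ha
          intro c
          induction x.mem_span c using Submodule.span_induction with
          | zero => rw [zero_smul, q_zero]; exact zero_mem _
          | add c c' _ _ h h' => rw [add_smul, q_add]; exact add_mem h h'
          | smul c' c _ h =>
            rw [show c' • c = F c' * c from Algebra.smul_def c' c, mul_smul, q_smul]
            exact Submodule.smul_mem _ _ h
          | mem c hc =>
            obtain ⟨y, rfl⟩ := hc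
            rw [hr, hr, ← hJ]
            exact mem_bispan (e := gen) (t := (y, s)) hs _ _
    induction ht using Submodule.span_induction with
    | zero => intro c; rw [smul_zero, q_zero]; exact zero_mem _
    | add t t' _ _ h h' => intro c; rw [smul_add, q_add]; exact add_mem (h c) (h' c)
    | smul c' t _ h => intro c; rw [smul_smul]; exact h _
    | mem t ht =>
      obtain ⟨s, hs, m, n, a, b, -, -, rfl⟩ := ht
      exact key s hs b a
  obtain ⟨bas, hbas⟩ := R.exists_basis r'
  obtain ⟨bas', hbas'⟩ : ∃ b' : Module.Basis (I × κ × R.S × κ) k N.carrier,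
      ∀ y, v (b' y) = x y.1 • (bas y.2).1 := by
    obtain ⟨b', hb'⟩ := @exists_basis_smulTower k L _ _ _ (LinearMap.range R.π) I _ _
      N.module _ (fun _ _ => rfl) x bas
    exact ⟨b', fun y => congrArg v (hb' y)⟩
  let eqv : I × κ × R.S × κ ≃ Σ _ : I × R.S, κ × κ :=
    { toFun := fun y => ⟨(y.1, y.2.2.1), y.2.1, y.2.2.2⟩
      invFun := fun z => (z.1.1, z.2.1, z.1.2, z.2.2)
      left_inv := fun _ => rfl
      right_inv := fun _ => rfl }
  let rr : Module.Basis (κ × κ) k (Env B₀) := r.tensorProduct r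
  have hrr : ∀ α β, rr (α, β) = Env.mk (r α) (r β) := fun α β => r.tensorProduct_apply r α β
  -- The basis of the free bimodule over `B₀` built from `r` goes to the products x r' e r'. These
  -- form a `k`-basis of `N`, obtained by multiplying an `L`-basis by a basis of L/k.
  have hbij : Function.Bijective (genMap 0 gen) := by
    refine bijective_of_basis ((Finsupp.basis fun _ : I × R.S => rr).reindex eqv.symm) bas' _
      fun y => hv ?_
    rw [Module.Basis.reindex_apply, Finsupp.coe_basis]
    change v (genMap 0 gen (Finsupp.single (y.1, y.2.2.1) (rr (y.2.1, y.2.2.2)))) = _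
    rw [hrr, genMap_single, DGAlgebra.sgn_zero, hJ, hvq, hbas', map_smul, hbas, hr, hr]
    congr 1
    have : R.π (bas y.2).1 = (bas y.2).1 := by
      obtain ⟨t, ht⟩ := (bas y.2).2
      rw [← ht, R.π_π]
    rw [hbas, hr, hr] at this
    exact this
  let SF : SemiFree (I × R.S) N :=
    { deg := fun y => R.deg y.2
      filt := fun y => R.filt y.2
      gen := gen
      gen_mem := fun y => (imageπ p hp).map_gr _ _
        (Submodule.smul_mem (R.T.gr _) (x y.1) (R.e_mem y.2))
      d_gen := fun y => by
        have h1 : N.d (gen y) = q (x y.1 • R.T.d (R.e y.2)) :=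
          ((imageπ p hp).map_d _).symm.trans (congrArg q (map_smul R.T.d _ _))
        rw [h1]
        exact hspan _ _ (R.d_e y.2) _
      bij := hbij }
  have hε := R.ε_bilin.restrictScalars F |>.comp_hom i |>.isKHom
    (R.ε_chain.restrictScalars F).gr_add_zero
  let ε : N ⟶ algBimod i := imageι p hp ≫ hε.toHom (R.ε_chain.restrictScalars F).d
  -- The inverse `R.g` and the homotopies `R.hT`, `R.hB` are only linear, which is enough for a
  -- statement about cohomology.
  have hεq : quasiIso B₀ ε := by
    rw [DGBimod.quasiIso_iff]
    refine fun n => ⟨fun t ht hdt hex => ?_, fun (w : B.carrier) hw hdw => ?_⟩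
    · have hdt' : R.T.d (v t) = 0 := congrArg v hdt
      obtain ⟨w, hw, hw'⟩ : ∃ w : B.carrier, w ∈ B.gr (n - 1) ∧ B.d w = R.ε (v t) := hex
      refine ⟨q (R.g w - R.hT (v t)), (imageπ p hp).map_gr _ _
        (sub_mem (R.g_chain.gr _ _ hw) (R.hT_htpy.gr n _ ht)), ?_⟩
      have h1 : N.d (q (R.g w - R.hT (v t))) = q (R.T.d (R.g w - R.hT (v t))) :=
        ((imageπ p hp).map_d _).symm
      have h2 := R.hT_htpy.eq (v t)
      rw [hdt', map_zero, add_zero, LinearMap.comp_apply, ← hw', R.g_chain.d, hπv] at h2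
      rw [h1, map_sub, ← h2, sub_sub_cancel, hqv]
    · refine ⟨q (R.g w), (imageπ p hp).map_gr _ _ (R.g_chain.gr _ _ hw), ?_, R.hB w,
        R.hB_htpy.gr _ _ hw, ?_⟩
      · have h1 : N.d (q (R.g w)) = q (R.T.d (R.g w)) := ((imageπ p hp).map_d _).symm
        have h2 : B.d w = 0 := hdw
        rw [h1, ← R.g_chain.d, h2, map_zero, q_zero]
      · have h2 := R.hB_htpy.eq w
        have h3 : B.d w = 0 := hdw
        rw [h3, map_zero, add_zero, LinearMap.comp_apply, LinearMap.id_apply, sub_eq_iff_eq_add,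
          add_comm] at h2
        change R.ε (v (q (R.g w))) = w + B.d (R.hB w)
        rw [hvq, R.π_g, h2]
  have hu := R.u_bilin.restrictScalars F |>.comp_hom i |>.isKHom
    (R.u_chain.restrictScalars F).gr_add_zero
  let u : N ⟶ N := imageι p hp ≫ hu.toHom (R.u_chain.restrictScalars F).d ≫ imageπ p hp
  have hhu := (R.hu_bilin.restrictScalars F |>.comp_hom i |>.isKHom
    (R.hu_htpy.restrictScalars F).gr)
  rw [← isCompactObject_iff_of_quasiIso hεq]
  -- Finiteness of L/k enters here: every generator in the finite set `R.X` is replaced by the [L :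
  -- k] generators lying over it.
  refine DGBimod.KProj.isCompactObject_of_finset SF.kProj gen (Finset.univ ×ˢ R.X) u
    ⟨(imageπ p hp).toLinearMap ∘ₗ rsMap F R.hu ∘ₗ (imageι p hp).toLinearMap,
      (IsKHom.of_hom _).comp (hhu.comp (IsKHom.of_hom _) (zero_add _)) (add_zero _), ?_⟩ ?_
  · refine LinearMap.ext fun t => hv ?_
    have h1 := R.hu_htpy.eq (v t)
    have h2 : v (N.d (q (R.hu (v t)))) = R.T.d (R.hu (v t)) := by
      change R.T.d (v (q _)) = _
      rw [hvq, R.π_hu]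
    change v (q (R.u (v t))) - v t = v (N.d (q (R.hu (v t)))) + v (q (R.hu (R.T.d (v t))))
    rw [h2, hvq, hvq, R.π_hu, R.π_u, ← h1, hπv]
  · intro t
    have := hspan R.X _ (R.u_mem (v t)) 1
    rw [one_smul] at this
    refine bispan_mono gen ?_ this
    intro y hy
    simpa using hy

end Compactness

end NCWeil

namespace NCWeil

/-! ### Galois descent for bases -/

section Descent

variable {k L : Type*} [Field k] [Field L] [Algebra k L] [FiniteDimensional k L] [IsGalois k L]

/-- Galois descent: a basis of the space of invariants of a semilinear action is a basis. -/
theorem exists_basis_of_semilinear {V U κ : Type*} [AddCommGroup V] [Module L V] [AddCommGroup U]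
    [Module k U] (f : (L ≃ₐ[k] L) → V →+ V) (hf : ∀ ρ (c : L) v, f ρ (c • v) = ρ c • f ρ v)
    (h1 : ∀ v, f 1 v = v) (hm : ∀ ρ' ρ v, f (ρ' * ρ) v = f ρ' (f ρ v))
    (i : U →+ V) (hi : Function.Injective i) (hik : ∀ (c : k) u, i (c • u) = algebraMap k L c • i u)
    (hU : ∀ v, (∀ ρ, f ρ v = v) ↔ v ∈ Set.range i) (b : Module.Basis κ k U) :
    ∃ b' : Module.Basis κ L V, ∀ x, b' x = i (b x) := by
  classical
  have hfix : ∀ ρ u, f ρ (i u) = i u := fun ρ u => (hU (i u)).mpr ⟨u, rfl⟩ ρ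
  have hli : LinearIndependent L fun x => i (b x) := by
    rw [linearIndependent_iff']
    intro s c hc x hx
    -- Multiplying the relation by `y` and summing over the Galois group gives a relation over `k`
    -- whose coefficients are the traces of c(x) y. They vanish by independence over `k`, and the
    -- trace form is nondegenerate.
    have htr : ∀ y : L, Algebra.trace k L (c x * y) = 0 := by
      intro y
      have h2 : ∑ ρ : L ≃ₐ[k] L, f ρ (y • ∑ x ∈ s, c x • i (b x)) = 0 := by
        rw [hc, smul_zero]
        simp
      have h3 : i (∑ x ∈ s, Algebra.trace k L (c x * y) • b x) = 0 := by
        rw [map_sum, ← h2]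
        simp only [Finset.smul_sum, map_sum, hik, trace_eq_sum_automorphisms, smul_smul, hf, hfix]
        rw [Finset.sum_comm]
        refine Finset.sum_congr rfl fun x _ => ?_
        rw [Finset.sum_smul]
        refine Finset.sum_congr rfl fun ρ _ => ?_
        rw [mul_comm]
      exact linearIndependent_iff'.mp b.linearIndependent s _
        (hi (h3.trans (map_zero i).symm)) x hx
    exact (traceForm_nondegenerate k L).1 (c x) htr
  refine ⟨Module.Basis.mk hli ?_, fun x => Module.Basis.mk_apply hli _ x⟩
  rintro v -
  by_contra hv
  -- A functional that kills the span also kills every invariant vector ∑ ρ(y v). Thus the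
  -- combination of the automorphisms ρ with coefficients φ(ρ v) is zero, and their linear
  -- independence gives φ(v) = 0.
  obtain ⟨φ, hφv, hφ⟩ := Submodule.exists_le_ker_of_notMem hv
  have hφi : ∀ u, φ (i u) = 0 := by
    intro u
    induction b.mem_span u using Submodule.span_induction with
    | zero => rw [map_zero, map_zero]
    | add x y _ _ hx hy => rw [map_add, map_add, hx, hy, add_zero]
    | smul c x _ hx => rw [hik, map_smul, hx, smul_zero]
    | mem x hx =>
      obtain ⟨x, rfl⟩ := hx
      exact hφ (Submodule.subset_span ⟨x, rfl⟩)
  have hsum : ∀ y : L, ∑ ρ : L ≃ₐ[k] L, φ (f ρ v) * ρ y = 0 := by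
    intro y
    obtain ⟨u, hu⟩ := (hU (∑ ρ : L ≃ₐ[k] L, f ρ (y • v))).mp fun ρ => by
      rw [map_sum]
      exact Fintype.sum_equiv (Equiv.mulLeft ρ) _ _ fun ρ' => (hm ρ ρ' _).symm
    rw [← hφi u, hu, map_sum]
    refine Finset.sum_congr rfl fun ρ _ => ?_
    rw [hf, map_smul, smul_eq_mul, mul_comm]
  have hind := (linearIndependent_toLinearMap k L L).comp
    (fun ρ : L ≃ₐ[k] L => (ρ : L →ₐ[k] L)) fun ρ ρ' h => by
      ext y
      exact DFunLike.congr_fun h y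
  have := Fintype.linearIndependent_iff.mp hind (fun ρ => φ (f ρ v))
    (LinearMap.ext fun y => by
      rw [LinearMap.sum_apply]
      exact hsum y) 1
  rw [h1] at this
  exact hφv this

end Descent

/-! ### Smoothness of the invariants -/

section Invariants

open DGBimod

variable {k L : Type u} [Field k] [Field L] [Algebra k L] {W : DGAlgebra L}

/-- A semilinear morphism, as a morphism of dg `k`-algebras. -/
def DGAlgebra.SemiHom.toHom {ρ : L ≃ₐ[k] L} (f : DGAlgebra.SemiHom (ρ : L →+* L) W W) :
    DGAlgebra.Hom (W.restrictScalars (algebraMap k L)) (W.restrictScalars (algebraMap k L)) where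
  toRingHom := f.toRingHom
  map_smul c a := by
    have := f.map_smul (algebraMap k L c) a
    rw [RingHom.coe_coe, AlgEquiv.commutes] at this
    exact this
  map_gr ha := f.map_gr ha
  map_d a := f.map_d a

variable (act : ∀ ρ : L ≃ₐ[k] L, DGAlgebra.SemiHom (ρ : L →+* L) W W)

/-- The dg `k`-algebra of invariants of a semilinear action on a dg `L`-algebra. -/
def invariants : DGAlgebra k :=
  (W.restrictScalars (algebraMap k L)).fixed fun ρ => (act ρ).toHom

/-- The inclusion of the invariants. -/
def invariantsHom : DGAlgebra.Hom (invariants act) (W.restrictScalars (algebraMap k L)) where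
  toRingHom :=
    { toFun := Subtype.val
      map_zero' := rfl
      map_one' := rfl
      map_add' := fun _ _ => rfl
      map_mul' := fun _ _ => rfl }
  map_smul _ _ := rfl
  map_gr h := h
  map_d _ := rfl

theorem invariantsHom_injective : Function.Injective (invariantsHom act).toRingHom :=
  Subtype.val_injective

variable {act}

theorem mem_range_invariantsHom {w : W.carrier} (h : ∀ ρ, (act ρ).toRingHom w = w) :
    ∃ a, (invariantsHom act).toRingHom a = w := ⟨⟨w, h⟩, rfl⟩

theorem act_invariantsHom (ρ : L ≃ₐ[k] L) (a : (invariants act).carrier) :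
    (act ρ).toRingHom ((invariantsHom act).toRingHom a) = (invariantsHom act).toRingHom a :=
  a.2 ρ

variable [FiniteDimensional k L] [IsGalois k L]

theorem exists_basis_invariants (h1 : ∀ t, (act 1).toRingHom t = t)
    (hm : ∀ ρ' ρ t, (act (ρ' * ρ)).toRingHom t = (act ρ').toRingHom ((act ρ).toRingHom t))
    {κ : Type*} (b : Module.Basis κ k (invariants act).carrier) :
    ∃ b' : Module.Basis κ L W.carrier, ∀ x, b' x = (invariantsHom act).toRingHom (b x) :=
  exists_basis_of_semilinear (fun ρ => (act ρ).toRingHom.toAddMonoidHom)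
    (fun ρ => (act ρ).map_smul) h1 hm (invariantsHom act).toRingHom.toAddMonoidHom
    (invariantsHom_injective act) (fun _ _ => rfl)
    (fun _ => ⟨fun h => mem_range_invariantsHom h, fun ⟨a, ha⟩ ρ => ha ▸ act_invariantsHom ρ a⟩) b

/-- The map is w ↦ ∑ ρ(c w) with c of trace 1, which exists by surjectivity of the trace. Every ρ
fixes invariant factors, preserves degrees and commutes with the differential. On an invariant
element the sum gives back Tr(c) = 1 times that element. -/
theorem exists_trace
    (hm : ∀ ρ' ρ t, (act (ρ' * ρ)).toRingHom t = (act ρ').toRingHom ((act ρ).toRingHom t)) :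
    ∃ s : W.carrier → W.carrier, (∀ w ρ, (act ρ).toRingHom (s w) = s w) ∧
      (∀ x y, s (x + y) = s x + s y) ∧
      (∀ (r : k) x, s (algebraMap k L r • x) = algebraMap k L r • s x) ∧
      (∀ n, ∀ x ∈ W.gr n, s x ∈ W.gr n) ∧ (∀ x, s (W.d x) = W.d (s x)) ∧
      (∀ a, (∀ ρ, (act ρ).toRingHom a = a) → ∀ t, s (a * t) = a * s t) ∧
      (∀ a, (∀ ρ, (act ρ).toRingHom a = a) → ∀ t, s (t * a) = s t * a) ∧
      ∀ a, (∀ ρ, (act ρ).toRingHom a = a) → s a = a := by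
  obtain ⟨c, hc⟩ := Algebra.trace_surjective k L 1
  refine ⟨fun w => ∑ ρ : L ≃ₐ[k] L, (act ρ).toRingHom (c • w), fun w ρ => ?_, fun x y => ?_,
    fun r x => ?_, fun n x hx => ?_, fun x => ?_, fun a ha t => ?_, fun a ha t => ?_,
    fun a ha => ?_⟩
  · rw [map_sum]
    exact Fintype.sum_equiv (Equiv.mulLeft ρ) _ _ fun ρ' => (hm ρ ρ' _).symm
  · simp only [smul_add, map_add, Finset.sum_add_distrib]
  · rw [Finset.smul_sum]
    refine Finset.sum_congr rfl fun ρ _ => ?_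
    rw [smul_comm, (act ρ).map_smul, RingHom.coe_coe, AlgEquiv.commutes]
  · exact sum_mem fun ρ _ => (act ρ).map_gr (Submodule.smul_mem _ c hx)
  · rw [map_sum]
    refine Finset.sum_congr rfl fun ρ _ => ?_
    rw [← (act ρ).map_d, map_smul W.d]
  · rw [Finset.mul_sum]
    refine Finset.sum_congr rfl fun ρ _ => ?_
    rw [← mul_smul_comm, map_mul, ha]
  · rw [Finset.sum_mul]
    refine Finset.sum_congr rfl fun ρ _ => ?_
    rw [← smul_mul_assoc, map_mul, ha]
  · simp only [(act _).map_smul, ha, RingHom.coe_coe]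
    have h1 := Finset.sum_smul (s := Finset.univ) (f := fun ρ : L ≃ₐ[k] L => ρ c) (x := a)
    rw [← trace_eq_sum_automorphisms, hc, map_one, one_smul] at h1
    exact h1.symm

/-- The retraction of the inclusion of the invariants given by the trace. -/
theorem exists_transfer
    (hm : ∀ ρ' ρ t, (act (ρ' * ρ)).toRingHom t = (act ρ').toRingHom ((act ρ).toRingHom t)) :
    ∃ τ : (W.restrictScalars (algebraMap k L)).carrier →ₗ[k] (invariants act).carrier,
      IsChain τ ∧ IsBilin 0 (invariantsHom act) (DGAlgebra.Hom.id (invariants act)) τ ∧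
        ∀ a, τ ((invariantsHom act).toRingHom a) = a := by
  obtain ⟨s, hs, s_add, s_smul, s_gr, s_d, s_left, s_right, s_fix⟩ := exists_trace hm
  let τ : (W.restrictScalars (algebraMap k L)).carrier →ₗ[k] (invariants act).carrier :=
    { toFun := fun w => ⟨s w, hs w⟩
      map_add' := fun x y => Subtype.ext (s_add x y)
      map_smul' := fun r x => Subtype.ext (s_smul r x) }
  refine ⟨τ, ⟨s_gr, fun w => Subtype.ext (s_d w)⟩, ⟨fun m b hb t => ?_, fun b t => ?_⟩,
    fun a => Subtype.ext (s_fix a.1 a.2)⟩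
  · rw [zero_mul, Int.negOnePow_zero, one_smul]
    exact Subtype.ext (s_left b.1 b.2 t)
  · exact Subtype.ext (s_right b.1 b.2 t)

/-- The invariants of a dg algebra which has a resolution with a compactness datum are smooth. -/
theorem Res.isSmooth_invariants (R : Res W) (h1 : ∀ t, (act 1).toRingHom t = t)
    (hm : ∀ ρ' ρ t, (act (ρ' * ρ)).toRingHom t = (act ρ').toRingHom ((act ρ).toRingHom t)) :
    (invariants act).IsSmooth := by
  obtain ⟨b', hb'⟩ := exists_basis_invariants h1 hm
    (Module.Basis.ofVectorSpace k (invariants act).carrier)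
  have hc := R.isCompactObject_algBimod (invariantsHom act) _ b' hb'
  obtain ⟨τ, hτ, hτb, hτi⟩ := exists_transfer hm
  let i : diagonal (invariants act) ⟶ algBimod (invariantsHom act) :=
    { toLinearMap :=
        { toFun := (invariantsHom act).toRingHom
          map_add' := map_add _
          map_smul' := (invariantsHom act).map_smul }
      map_smul := fun a (x : (invariants act).carrier) => map_mul (invariantsHom act).toRingHom a x
      map_op_smul := fun a (x : (invariants act).carrier) =>
        map_mul (invariantsHom act).toRingHom x a
      map_gr := fun n x hx => (invariantsHom act).map_gr hx
      map_d := (invariantsHom act).map_d }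
  let r : algBimod (invariantsHom act) ⟶ diagonal (invariants act) :=
    { toLinearMap := τ
      map_smul := ((hτb.isKHom hτ.gr_add_zero).toHom hτ.d).map_smul
      map_op_smul := hτb.right
      map_gr := hτ.gr
      map_d := hτ.d }
  -- The inclusion followed by the trace map is the identity, so the diagonal bimodule is a retract
  -- of the compact bimodule given by `W`.
  refine hc.of_retract ((quasiIso _).Q.map i) ((quasiIso _).Q.map r) ?_
  have : i ≫ r = 𝟙 _ := hom_ext (LinearMap.ext hτi)
  rw [← Functor.map_comp, this, CategoryTheory.Functor.map_id]

end Invariants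

/-- The noncommutative Weil restriction preserves smoothness. -/
theorem DGAlgebra.IsSmooth.weilRestriction {k l L : Type u} [Field k] [Field l] [Field L]
    [Algebra k l] [Algebra k L] [Algebra l L] [IsScalarTower k l L] [FiniteDimensional k L]
    [IsGalois k L] {A : DGAlgebra l} (hA : A.IsSmooth) : (weilRestriction k l L A).IsSmooth := by
  obtain ⟨R⟩ := hA.nonempty_res
  obtain ⟨R'⟩ := R.nonempty_baseChange (L := L)
  -- A conjugate is a restriction of scalars along an automorphism of `L`, so it inherits a
  -- resolution.
  obtain ⟨R''⟩ := Res.nonempty_piTensor fun s : Cosets k l L =>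
    (R'.nonempty_restrictScalars ((s.out⁻¹ : L ≃ₐ[k] L) : L ≃+* L)).some
  exact Res.isSmooth_invariants (W := weilTensor k l L A) (act := weilAct A) R'' (weilAct_one A)
    (weilAct_mul A)

end NCWeil

namespace NCWeil

/-! ### Properness through finite-rank homotopy idempotence -/

section Proper

open DGAlgebra

variable {K : Type u} [Field K]

/-- A dg algebra is homotopically finite if its identity is homotopic to a chain map with a
finite-dimensional image. -/
def IsHtpyFinite (B : DGAlgebra K) : Prop :=
  ∃ (φ h : B.carrier →ₗ[K] B.carrier) (X : Finset B.carrier), IsChain φ ∧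
    IsHtpy h φ LinearMap.id ∧ ∀ x, φ x ∈ Submodule.span K (X : Set B.carrier)

/-- With a graded generalized inverse s of d, the map φ = 1 - d s - s d kills boundaries and takes
values in cocycles. Its square therefore factors through the cohomology, which is
finite-dimensional, and the square is still homotopic to the identity. -/
theorem DGAlgebra.IsProper.isHtpyFinite {A : DGAlgebra K} (hA : A.IsProper) : IsHtpyFinite A := by
  obtain ⟨s, hs, hsd⟩ := exists_graded_split A.isInternal (d := A.d) fun n x hx => A.d_mem hx
  let φ : A.carrier →ₗ[K] A.carrier := LinearMap.id - A.d ∘ₗ s - s ∘ₗ A.d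
  have hφ : ∀ x, φ x = x - A.d (s x) - s (A.d x) := fun x => rfl
  have hφd : ∀ x, φ (A.d x) = 0 := fun x => by rw [hφ, hsd, A.d_d, map_zero]; simp
  have hdφ : ∀ x, A.d (φ x) = 0 := fun x => by rw [hφ, map_sub, map_sub, hsd, A.d_d]; simp
  have hφgr : ∀ n, ∀ x ∈ A.gr n, φ x ∈ A.gr n := fun n x hx => by
    refine sub_mem (sub_mem hx ?_) ?_
    · have := A.d_mem (hs _ _ hx)
      rwa [sub_add_cancel] at this
    · have := hs _ _ (A.d_mem hx)
      rwa [add_sub_cancel_right] at this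
  let ψ (n : ℤ) : Cohomology A.gr A.d n →ₗ[K] A.carrier :=
    Submodule.liftQ _ (φ ∘ₗ (cocycles A.gr A.d n).subtype) (by
      rintro ⟨_, hv⟩ ⟨w, -, rfl⟩
      exact hφd w)
  let Ψ : DirectSum ℤ (fun n => Cohomology A.gr A.d n) →ₗ[K] A.carrier :=
    DirectSum.toModule K ℤ A.carrier ψ
  have hfin : Module.Finite K (DirectSum ℤ fun n => Cohomology A.gr A.d n) := by
    rw [← Module.rank_lt_aleph0_iff, rank_directSum]
    exact hA
  have hfg : (LinearMap.range Ψ).FG := Module.Finite.iff_fg.mp inferInstance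
  obtain ⟨X, hX⟩ := hfg
  refine ⟨φ ∘ₗ φ, -(φ ∘ₗ s) - s, X, ⟨fun n x hx => hφgr _ _ (hφgr _ _ hx), fun x => ?_⟩,
    ⟨fun n x hx => sub_mem (neg_mem (hφgr _ _ (hs _ _ hx))) (hs _ _ hx), fun x => ?_⟩, fun x => ?_⟩
  · rw [LinearMap.comp_apply, hφd, map_zero, LinearMap.comp_apply, hdφ]
  · simp only [LinearMap.comp_apply, LinearMap.sub_apply, LinearMap.neg_apply, LinearMap.id_apply,
      map_sub, map_neg, hdφ]
    rw [hφ x, map_sub, map_sub, hφd, hφ x]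
    abel
  · rw [hX]
    induction x using graded_induction A.isInternal with
    | h0 => rw [map_zero]; exact zero_mem _
    | ha x y hx hy => rw [map_add]; exact add_mem hx hy
    | hm n x hx =>
      refine ⟨DirectSum.lof K ℤ (fun n => Cohomology A.gr A.d n) n
        (Submodule.Quotient.mk ⟨φ x, hφgr _ _ hx, hdφ x⟩), ?_⟩
      exact DirectSum.toModule_lof ..

theorem IsHtpyFinite.baseChange {K' : Type u} [Field K'] [Algebra K K'] {B : DGAlgebra K}
    (hB : IsHtpyFinite B) : IsHtpyFinite (B.baseChange K') := by
  classical
  obtain ⟨φ, h, X, hφ, hh, hX⟩ := hB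
  have hh' := hh.baseChange (L := K')
  rw [show bc K' (LinearMap.id : B.carrier →ₗ[K] B.carrier) = LinearMap.id from
    LinearMap.baseChange_id] at hh'
  refine ⟨bc K' φ, bc K' h, X.image (tm 1), hφ.baseChange, hh', fun x => ?_⟩
  induction x using bc_induction with
  | ha x y hx hy => rw [map_add]; exact add_mem hx hy
  | ht c a =>
    rw [bc_tm]
    obtain ⟨y, hy⟩ : ∃ y, y = φ a := ⟨_, rfl⟩
    have hyX := hX a
    rw [← hy] at hyX ⊢
    clear hy
    induction hyX using Submodule.span_induction generalizing c with
    | zero => rw [tm_zero]; exact zero_mem _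
    | add x y _ _ hx hy => rw [tm_add]; exact add_mem (hx c) (hy c)
    | smul r x _ hx => rw [tm_smul]; exact Submodule.smul_mem _ _ (hx c)
    | mem x hx =>
      rw [show tm c x = c • tm 1 x by rw [smul_tm, mul_one]]
      refine Submodule.smul_mem _ _ (Submodule.subset_span ?_)
      rw [Finset.coe_image]
      exact ⟨x, hx, rfl⟩

theorem IsHtpyFinite.restrictScalars {K' : Type u} [Field K'] (f : K ≃+* K') {B : DGAlgebra K'}
    (hB : IsHtpyFinite B) : IsHtpyFinite (B.restrictScalars (f : K →+* K')) := by
  obtain ⟨φ, h, X, hφ, hh, hX⟩ := hB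
  refine ⟨rsMap _ φ, rsMap _ h, X, hφ.restrictScalars _, hh.restrictScalars _, fun x => ?_⟩
  have key : ∀ y ∈ Submodule.span K' (X : Set B.carrier),
      (show (B.restrictScalars (f : K →+* K')).carrier from y) ∈
        Submodule.span K ((show Finset (B.restrictScalars (f : K →+* K')).carrier from X) :
          Set (B.restrictScalars (f : K →+* K')).carrier) := by
    intro y hy
    induction hy using Submodule.span_induction with
    | zero => exact zero_mem _
    | add x y _ _ hx hy => exact add_mem hx hy
    | smul r x _ hx =>
      have := Submodule.smul_mem _ (f.symm r) hx
      have e : f.symm r • (show (B.restrictScalars (f : K →+* K')).carrier from x) =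
        (show (B.restrictScalars (f : K →+* K')).carrier from f (f.symm r) • x) := rfl
      rw [e, f.apply_symm_apply] at this
      exact this
    | mem x hx => exact Submodule.subset_span hx
  exact key _ (hX x)

theorem IsHtpyFinite.piTensor {ι : Type u} [Fintype ι] [LinearOrder ι] {B : ι → DGAlgebra K}
    (hB : ∀ i, IsHtpyFinite (B i)) : IsHtpyFinite (piTensor B) := by
  classical
  choose φ h X hφ hh hX using hB
  obtain ⟨w, hw, -⟩ := exists_isHtpy_piMap (ψ := fun i => LinearMap.id) hφ
    (fun i => ⟨fun n x hx => hx, fun x => rfl⟩) hh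
    (fun _ => True) trivial (fun _ _ _ _ => trivial) fun _ _ _ _ => trivial
  rw [piMap_id] at hw
  refine ⟨piMap φ, w, (Fintype.piFinset X).image ptm, IsChain.piMap hφ, hw, fun x => ?_⟩
  induction x using ptm_induction with
  | ha x y hx hy => rw [map_add]; exact add_mem hx hy
  | hs c x hx => rw [map_smul]; exact Submodule.smul_mem _ _ hx
  | hp f x hx =>
    rw [piMap_ptm]
    refine ptm_mem_of_span (G := fun i => (X i : Set (B i).carrier)) (fun x hx => ?_)
      fun i => hX i (x i)
    refine Submodule.subset_span ?_
    rw [Finset.coe_image]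
    exact ⟨x, by rw [Finset.mem_coe, Fintype.mem_piFinset]; exact hx, rfl⟩

/-- A criterion for properness. -/
theorem DGAlgebra.isProper_of_finite {B : DGAlgebra K} {θ : B.carrier →ₗ[K] B.carrier}
    (hθ : IsChain θ) (hfin : Module.Finite K (LinearMap.range θ))
    (h : ∀ n, ∀ x ∈ B.gr n, B.d x = 0 → ∃ y ∈ B.gr (n - 1), B.d y = x - θ x) : B.IsProper := by
  -- The images under `θ` of the cocycles map onto the cohomology. In different degrees they are
  -- independent subspaces of the range of `θ`, so their dimensions have a finite sum.
  let Z (n : ℤ) : Submodule K B.carrier := (cocycles B.gr B.d n).map θ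
  have hZ : ∀ n, Z n ≤ cocycles B.gr B.d n := by
    rintro n _ ⟨x, ⟨hx, hdx⟩, rfl⟩
    refine ⟨hθ.gr n x hx, ?_⟩
    have hdx : B.d x = 0 := hdx
    change B.d (θ x) = 0
    rw [← hθ.d, hdx, map_zero]
  have h1 : ∀ n, Module.rank K (Cohomology B.gr B.d n) ≤ Module.rank K (Z n) := by
    intro n
    refine LinearMap.rank_le_of_surjective
      ((coboundaries B.gr B.d n).mkQ ∘ₗ Submodule.inclusion (hZ n)) ?_
    intro x
    obtain ⟨⟨x, hx⟩, rfl⟩ := Submodule.Quotient.mk_surjective _ x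
    refine ⟨⟨θ x, x, hx, rfl⟩, ?_⟩
    obtain ⟨y, hy, e⟩ := h n x hx.1 hx.2
    refine (Submodule.Quotient.eq _).mpr ⟨-y, neg_mem hy, ?_⟩
    rw [map_neg, e, neg_sub]
    rfl
  have hind : iSupIndep Z :=
    (B.isInternal.submodule_iSupIndep).mono fun n => (hZ n).trans inf_le_left
  have h2 : Module.rank K (DirectSum ℤ fun n => Z n) < Cardinal.aleph0 := by
    let Ψ : DirectSum ℤ (fun n => Z n) →ₗ[K] LinearMap.range θ :=
      DirectSum.toModule K ℤ _ fun n => Submodule.inclusion (by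
        rintro _ ⟨x, -, rfl⟩
        exact ⟨x, rfl⟩)
    refine (LinearMap.rank_le_of_injective Ψ ?_).trans_lt (Module.rank_lt_aleph0 K (LinearMap.range θ))
    have e : (LinearMap.range θ).subtype ∘ₗ Ψ = DFinsupp.lsum ℕ fun n => (Z n).subtype := by
      refine DirectSum.linearMap_ext K fun n => LinearMap.ext fun x => ?_
      change ((Ψ (DirectSum.lof K ℤ (fun n => Z n) n x)).1 : B.carrier) =
        DFinsupp.lsum ℕ (fun n => (Z n).subtype) (DFinsupp.single n x)
      rw [DirectSum.toModule_lof, DFinsupp.lsum_single]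
      rfl
    have hinj := hind.dfinsupp_lsum_injective
    rw [← e, LinearMap.coe_comp] at hinj
    exact Function.Injective.of_comp hinj
  rw [rank_directSum] at h2
  exact (Cardinal.sum_le_sum _ _ h1).trans_lt h2

end Proper

/-! ### Properness of the invariants -/

section Invariants

theorem finite_span_restrictScalars {k L : Type*} [Field k] [Field L] [Algebra k L]
    [FiniteDimensional k L] {M : Type*} [AddCommGroup M] [Module k M] [Module L M]
    (h : ∀ (c : k) (m : M), c • m = algebraMap k L c • m) (X : Finset M) :
    ∃ V : Submodule k M, Module.Finite k V ∧ ∀ x ∈ Submodule.span L (X : Set M), x ∈ V := by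
  have : IsScalarTower k L M := ⟨fun c a m => by rw [h, smul_smul, Algebra.smul_def]⟩
  have : Module.Finite k (Submodule.span L (X : Set M)) := Module.Finite.trans L _
  exact ⟨(Submodule.span L (X : Set M)).restrictScalars k, this, fun _ h => h⟩

variable {k L : Type u} [Field k] [Field L] [Algebra k L] [FiniteDimensional k L] [IsGalois k L]
  {W : DGAlgebra L} {act : ∀ ρ : L ≃ₐ[k] L, DGAlgebra.SemiHom (ρ : L →+* L) W W}

/-- Placing the finite-rank map of `W` between the inclusion i of the invariants and the trace
retraction τ gives a chain map τ φ i of finite rank over `k`, since L/k is finite. As τ i = 1, the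
map τ h i is a homotopy from it to the identity. -/
theorem IsHtpyFinite.isProper_invariants (hW : IsHtpyFinite W)
    (hm : ∀ ρ' ρ t, (act (ρ' * ρ)).toRingHom t = (act ρ').toRingHom ((act ρ).toRingHom t)) :
    (invariants act).IsProper := by
  obtain ⟨φ, h, X, hφ, hh, hX⟩ := hW
  obtain ⟨τ, hτ, -, hτi⟩ := exists_transfer hm
  let i : (invariants act).carrier →ₗ[k] (W.restrictScalars (algebraMap k L)).carrier :=
    { toFun := (invariantsHom act).toRingHom
      map_add' := map_add _
      map_smul' := (invariantsHom act).map_smul }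
  have hi : IsChain i := ⟨fun n x hx => hx, fun x => rfl⟩
  have hφ' := hφ.restrictScalars (algebraMap k L)
  have hh' := hh.restrictScalars (algebraMap k L)
  obtain ⟨V, hV, hXV⟩ : ∃ V : Submodule k (W.restrictScalars (algebraMap k L)).carrier,
      Module.Finite k V ∧ ∀ x ∈ Submodule.span L (X : Set W.carrier), x ∈ V := @finite_span_restrictScalars k L _ _ _ _ W.carrier _
    (W.restrictScalars (algebraMap k L)).algebra.toModule _ (fun _ _ => rfl) X
  refine DGAlgebra.isProper_of_finite (θ := τ ∘ₗ rsMap _ φ ∘ₗ i)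
    ⟨fun n x hx => hτ.gr _ _ (hφ'.gr _ _ (hi.gr _ _ hx)), fun x => ?_⟩ ?_ fun n x hx hdx =>
      ⟨-τ (rsMap _ h (i x)), neg_mem (hτ.gr _ _ (hh'.gr _ _ (hi.gr _ _ hx))), ?_⟩
  · simp only [LinearMap.comp_apply]
    rw [hi.d, hφ'.d, hτ.d]
  · have : LinearMap.range (τ ∘ₗ rsMap (algebraMap k L) φ ∘ₗ i) ≤ V.map τ := by
      rintro _ ⟨x, rfl⟩
      exact ⟨_, hXV _ (hX _), rfl⟩
    have hfin : Module.Finite k (V.map τ) :=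
      Module.Finite.iff_fg.mpr ((Module.Finite.iff_fg.mp hV).map τ)
    exact Submodule.finiteDimensional_of_le this
  · have h1 := hh'.eq (i x)
    rw [← hi.d, hdx, map_zero, map_zero, add_zero] at h1
    have h2 : τ (rsMap (algebraMap k L) φ (i x)) - x =
        (invariants act).d (τ (rsMap (algebraMap k L) h (i x))) := by
      rw [← hτ.d, ← h1, map_sub]
      congr 1
      exact (hτi x).symm
    rw [map_neg, ← h2, neg_sub]
    rfl

end Invariants

/-- The noncommutative Weil restriction preserves properness. -/
theorem DGAlgebra.IsProper.weilRestriction {k l L : Type u} [Field k] [Field l] [Field L]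
    [Algebra k l] [Algebra k L] [Algebra l L] [IsScalarTower k l L] [FiniteDimensional k L]
    [IsGalois k L] {A : DGAlgebra l} (hA : A.IsProper) : (weilRestriction k l L A).IsProper :=
  (IsHtpyFinite.piTensor fun s : Cosets k l L =>
    (hA.isHtpyFinite.baseChange (K' := L)).restrictScalars
      ((s.out⁻¹ : L ≃ₐ[k] L) : L ≃+* L)).isProper_invariants (W := weilTensor k l L A)
        (act := weilAct A) (weilAct_mul A)

end NCWeil

theorem mainTheorem2 (k l L : Type u) [Field k] [Field l] [Field L]
    [Algebra k l] [Algebra k L] [Algebra l L] [IsScalarTower k l L]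
    [FiniteDimensional k l] [Algebra.IsSeparable k l]
    [FiniteDimensional k L] [IsGalois k L] (A : NCWeil.DGAlgebra l) :
    (A.IsSmooth → (NCWeil.weilRestriction k l L A).IsSmooth) ∧
      (A.IsProper → (NCWeil.weilRestriction k l L A).IsProper) :=
  ⟨fun h => h.weilRestriction, fun h => h.weilRestriction⟩
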